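/- Let $E$ be a real Banach function space with finite cotype over a $\sigma$-finite measure space $(S,\Sigma,\mu)$; that is, $E$ is an order ideal of the space $L^0(\mu)$ of real measurable functions modulo a.e. equality, with a complete norm such that $|f|\le|g|$ a.e. implies $\|f\|_E\le\|g\|_E$, and $E$ has cotype $q$ for some $q\in[2,\infty)$. For a measurable $f:S\to[0,\infty]$ write $\|f\|_E<\infty$ if $f$ is a.e. finite and belongs to $E$, and $\|f\|_E=\infty$ otherwise. Then there is a constant $C>0$, depending only on $E$, such that the following holds. Let $T>0$, let $H$ be a separable real Hilbert space with inner product $[\cdot,\cdot]_H$, and let $(\Omega,\mathcal F,\mathbb P)$ be a probability space with a filtration $\mathbb F=(\mathcal F_t)_{t\in[0,T]}$. Let $W_H$ be an $H$-cylindrical $\mathbb F$-Brownian motion: bounded operators $W_H(t):H\to L^2(\Omega)$, $t\in[0,T]$, such that for each $h\in H$ the process $W_Hh$ is a Brownian motion relative to $\mathbb F$ (adapted to $\mathbb F$, with increments $W_H(t)h-W_H(s)h$, $s\le t$, independent of $\mathcal F_s$) and $\mathbb E(W_H(t_1)h_1\,W_H(t_2)h_2)=(t_1\wedge t_2)[h_1,h_2]_H$.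 Let $\Phi:[0,T]\to\mathcal L(H,E)$ be such that $t\mapsto\Phi(t)h$ is strongly measurable for every $h\in H$, and assume that there is a strongly measurable $\phi:[0,T]\times S\to H$ with $(\Phi(t)h)(\cdot)=[\phi(t,\cdot),h]_H$ in $E$ for all $h\in H$ and $t\in[0,T]$. Then $\Phi$ is stochastically integrable with respect to $W_H$ if and only if $$\Big\|\Big(\int_0^T\|\phi(t,\cdot)\|_H^2\,dt\Big)^{1/2}\Big\|_E<\infty,$$ and in this case $$C^{-1}\Big\|\Big(\int_0^T\|\phi(t,\cdot)\|_H^2\,dt\Big)^{1/2}\Big\|_E\le\Big(\mathbb E\Big\|\int_0^T\Phi\,dW_H\Big\|_E^2\Big)^{1/2}\le C\,\Big\|\Big(\int_0^T\|\phi(t,\cdot)\|_H^2\,dt\Big)^{1/2}\Big\|_E .$$ Here an elementary adapted process is a process of the form $\Psi=\sum_{n=1}^N\sum_{m=1}^M 1_{(t_{n-1},t_n]\times A_{mn}}\sum_{k=1}^K h_k\otimes x_{kmn}$ with $0\le t_0<\dots<t_N\le T$, sets $A_{1n},\dots,A_{Mn}\in\mathcal F_{t_{n-1}}$ disjoint for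 each $n$, $h_1,\dots,h_K\in H$ orthonormal and $x_{kmn}\in E$, where $(h\otimes x)h'=[h,h']_Hx$; its integral is $\int_0^t\Psi\,dW_H=\sum_{n,m}1_{A_{mn}}\sum_k\big(W_H(t_n\wedge t)h_k-W_H(t_{n-1}\wedge t)h_k\big)x_{kmn}$. A process $\Phi$ is stochastically integrable with respect to $W_H$ if there are elementary adapted processes $\Phi_n$ and a random variable $\zeta:\Omega\to C([0,T];E)$ such that $\langle\Phi_nh,x^*\rangle\to\langle\Phi h,x^*\rangle$ in measure on $[0,T]\times\Omega$ for all $h\in H$, $x^*\in E^*$, and $\int_0^\cdot\Phi_n\,dW_H\to\zeta$ in measure in $C([0,T];E)$; then $\int_0^\cdot\Phi\,dW_H:=\zeta$. A function $\Phi:[0,T]\to\mathcal L(H,E)$ is regarded as a process that does not depend on $\omega$. -/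

import Mathlib

open MeasureTheory ProbabilityTheory Filter Topology
open scoped NNReal ENNReal

/-- `ι` exhibits the normed space `E` as a function space over `(S, Σ, μ)`: it identifies `E`
(whose norm may be any norm) with an order ideal of the space `L⁰(μ)` of classes of measurable
functions modulo a.e. equality, in such a way that `|f| ≤ |g|` a.e. with `g ∈ E` implies `f ∈ E` and
`‖f‖ ≤ ‖g‖`. A complete such space is a Banach function space. -/
structure IsFunctionSpace {S : Type*} [MeasurableSpace S] (μ : Measure S)
    {E : Type*} [NormedAddCommGroup E] [NormedSpace ℝ E] (ι : E →ₗ[ℝ] (S →ₘ[μ] ℝ)) : Prop where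
  injective : Function.Injective ι
  solid : ∀ (g : E) (f : S →ₘ[μ] ℝ), |f| ≤ |ι g| → ∃ x : E, ι x = f ∧ ‖x‖ ≤ ‖g‖

/-- The extended norm `‖f‖_E` of a nonnegative function `f : S → [0, ∞]`: the norm of the element of
`E` represented by `f` (up to sign, which does not affect the norm) if there is one, and `∞`
otherwise. In particular `‖f‖_E < ∞` means that `f` is a.e. finite and belongs to `E`. -/
noncomputable def extNorm {S : Type*} [MeasurableSpace S] {μ : Measure S}
    {E : Type*} [NormedAddCommGroup E] [NormedSpace ℝ E] (ι : E →ₗ[ℝ] (S →ₘ[μ] ℝ))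
    (f : S → ℝ≥0∞) : ℝ≥0∞ :=
  ⨅ (x : E) (_ : ∀ᵐ s ∂μ, f s = ‖(ι x) s‖ₑ), ‖x‖ₑ

/-- `(𝔼 ‖∑ rₙ xₙ‖²)^{1/2}` for independent Rademacher variables `rₙ`, written as the average over
all choices of signs. -/
noncomputable def rademacherMean {E : Type*} [NormedAddCommGroup E] [NormedSpace ℝ E]
    {N : ℕ} (x : Fin N → E) : ℝ :=
  √((2 ^ N : ℝ)⁻¹ * ∑ ε : Fin N → ℤˣ, ‖∑ n, ((ε n : ℤ) : ℝ) • x n‖ ^ 2)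

/-- `E` has cotype `q`. -/
def HasCotype (E : Type*) [NormedAddCommGroup E] [NormedSpace ℝ E] (q : ℝ) : Prop :=
  ∃ C : ℝ, ∀ (N : ℕ) (x : Fin N → E),
    (∑ n, ‖x n‖ ^ q) ^ (1 / q) ≤ C * rademacherMean x

/-- `E` has finite cotype: it has cotype `q` for some `q ∈ [2, ∞)`. -/
def HasFiniteCotype (E : Type*) [NormedAddCommGroup E] [NormedSpace ℝ E] : Prop :=
  ∃ q : ℝ, 2 ≤ q ∧ HasCotype E q

/-- The time interval `[0, T]`. -/
abbrev TimeInterval (T : ℝ) : Type := Set.Icc (0 : ℝ) T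

/-- Lebesgue measure on `[0, T]`. -/
noncomputable def timeMeasure (T : ℝ) : Measure (TimeInterval T) :=
  Measure.comap Subtype.val volume

/-- `β` is a Brownian motion on `[0, T]` with variance parameter `v` (that is, `√v` times a standard
one) relative to the filtration `𝓕`. The random variables `β t` are only relevant up to null
sets, so that continuity of paths means the existence of a continuous version. -/
structure IsBrownianMotionOn {Ω : Type*} [mΩ : MeasurableSpace Ω] (P : Measure Ω) {T : ℝ}
    (𝓕 : Filtration (TimeInterval T) mΩ) (v : ℝ≥0) (β : TimeInterval T → Ω → ℝ) : Prop where
  adapted : ∀ t, AEStronglyMeasurable[𝓕 t] (β t) P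
  zero : ∀ t : TimeInterval T, (t : ℝ) = 0 → β t =ᵐ[P] 0
  gaussian : ∀ s t : TimeInterval T, s ≤ t →
    HasLaw (β t - β s) (gaussianReal 0 (v * Real.toNNReal ((t : ℝ) - (s : ℝ)))) P
  indep : ∀ s t : TimeInterval T, s ≤ t →
    Indep (MeasurableSpace.comap (β t - β s) inferInstance) (𝓕 s) P
  continuous : ∃ B : Ω → C(TimeInterval T, ℝ), ∀ t, (fun ω => B ω t) =ᵐ[P] β t

/-- `W` is an `H`-cylindrical Brownian motion relative to the filtration `𝓕`. -/
structure IsCylindricalBrownianMotion {Ω : Type*} [mΩ : MeasurableSpace Ω] (P : Measure Ω) {T : ℝ}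
    (𝓕 : Filtration (TimeInterval T) mΩ)
    {H : Type*} [NormedAddCommGroup H] [InnerProductSpace ℝ H]
    (W : TimeInterval T → H →L[ℝ] Lp ℝ 2 P) : Prop where
  brownian : ∀ h : H, IsBrownianMotionOn P 𝓕 (‖h‖₊ ^ 2) (fun t => W t h)
  covariance : ∀ (t₁ t₂ : TimeInterval T) (h₁ h₂ : H),
    ∫ ω, W t₁ h₁ ω * W t₂ h₂ ω ∂P = min (t₁ : ℝ) (t₂ : ℝ) * inner ℝ h₁ h₂

/-- The data of an elementary adapted process
`∑ₙ ∑ₘ 1_{(tₙ₋₁, tₙ] × Aₘₙ} ∑ₖ hₖ ⊗ xₖₘₙ` with values in `L(H, E)`. -/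
structure ElementaryAdapted {Ω : Type*} [mΩ : MeasurableSpace Ω] {T : ℝ}
    (𝓕 : Filtration (TimeInterval T) mΩ)
    (H : Type*) [NormedAddCommGroup H] [InnerProductSpace ℝ H]
    (E : Type*) where
  N : ℕ
  M : ℕ
  K : ℕ
  t : Fin (N + 1) → TimeInterval T
  strictMono_t : StrictMono t
  A : Fin M → Fin N → Set Ω
  measurableSet_A : ∀ m n, MeasurableSet[𝓕 (t n.castSucc)] (A m n)
  disjoint_A : ∀ n, Pairwise fun m m' => Disjoint (A m n) (A m' n)
  h : Fin K → H
  orthonormal_h : Orthonormal ℝ h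
  x : Fin K → Fin M → Fin N → E

namespace ElementaryAdapted

variable {Ω : Type*} [mΩ : MeasurableSpace Ω] {T : ℝ} {𝓕 : Filtration (TimeInterval T) mΩ}
  {H : Type*} [NormedAddCommGroup H] [InnerProductSpace ℝ H]
  {E : Type*} [NormedAddCommGroup E] [NormedSpace ℝ E]

/-- The process `[0, T] × Ω → L(H, E)`; here `h ⊗ x` is the operator `h' ↦ [h, h'] x`. -/
noncomputable def process (Ψ : ElementaryAdapted 𝓕 H E) (p : TimeInterval T × Ω) : H →L[ℝ] E :=
  ∑ n : Fin Ψ.N, ∑ m : Fin Ψ.M,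
    (Set.Ioc (Ψ.t n.castSucc) (Ψ.t n.succ) ×ˢ Ψ.A m n).indicator
      (fun _ => ∑ k : Fin Ψ.K, (innerSL ℝ (Ψ.h k)).smulRight (Ψ.x k m n)) p

/-- The stochastic integral `∫₀ᵗ Ψ dW` at time `t`. -/
noncomputable def integral {P : Measure Ω} (Ψ : ElementaryAdapted 𝓕 H E)
    (W : TimeInterval T → H →L[ℝ] Lp ℝ 2 P) (t : TimeInterval T) (ω : Ω) : E :=
  ∑ n : Fin Ψ.N, ∑ m : Fin Ψ.M,
    (Ψ.A m n).indicator
      (fun ω => ∑ k : Fin Ψ.K,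
        (W (min (Ψ.t n.succ) t) (Ψ.h k) ω - W (min (Ψ.t n.castSucc) t) (Ψ.h k) ω) • Ψ.x k m n) ω

end ElementaryAdapted

/-- `ζ` is the stochastic integral `∫₀^· Φ dW` of the process `Φ`: a `C([0, T]; E)`-valued random
variable such that for some sequence `Ψₙ` of elementary adapted processes, `⟨Ψₙ h, x*⟩ → ⟨Φ h, x*⟩`
in measure on `[0, T] × Ω` for all `h` and `x*`, and (the continuous versions `Zₙ` of)
`∫₀^· Ψₙ dW` converge to `ζ` in measure in `C([0, T]; E)`, which carries the supremum norm. -/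
def IsStochasticIntegral {Ω : Type*} [mΩ : MeasurableSpace Ω] (P : Measure Ω) {T : ℝ}
    (𝓕 : Filtration (TimeInterval T) mΩ)
    {H : Type*} [NormedAddCommGroup H] [InnerProductSpace ℝ H]
    {E : Type*} [NormedAddCommGroup E] [NormedSpace ℝ E]
    (W : TimeInterval T → H →L[ℝ] Lp ℝ 2 P)
    (Φ : TimeInterval T × Ω → H →L[ℝ] E) (ζ : Ω → C(TimeInterval T, E)) : Prop :=
  AEStronglyMeasurable ζ P ∧
  ∃ (Ψ : ℕ → ElementaryAdapted 𝓕 H E) (Z : ℕ → Ω → C(TimeInterval T, E)),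
    (∀ (h : H) (x' : E →L[ℝ] ℝ),
      TendstoInMeasure ((timeMeasure T).prod P)
        (fun n p => x' ((Ψ n).process p h)) atTop (fun p => x' (Φ p h))) ∧
    (∀ n t, (fun ω => Z n ω t) =ᵐ[P] (Ψ n).integral W t) ∧
    TendstoInMeasure P Z atTop ζ

/-- The process `Φ` is stochastically integrable with respect to `W`. -/
def IsStochasticallyIntegrable {Ω : Type*} [mΩ : MeasurableSpace Ω] (P : Measure Ω) {T : ℝ}
    (𝓕 : Filtration (TimeInterval T) mΩ)
    {H : Type*} [NormedAddCommGroup H] [InnerProductSpace ℝ H]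
    {E : Type*} [NormedAddCommGroup E] [NormedSpace ℝ E]
    (W : TimeInterval T → H →L[ℝ] Lp ℝ 2 P)
    (Φ : TimeInterval T × Ω → H →L[ℝ] E) : Prop :=
  ∃ ζ : Ω → C(TimeInterval T, E), IsStochasticIntegral P 𝓕 W Φ ζ

/-- The square function `s ↦ (∫₀ᵀ ‖φ(t, s)‖² dt)^{1/2}` with values in `[0, ∞]`. -/
noncomputable def squareFunction {S : Type*} {T : ℝ} {H : Type*} [NormedAddCommGroup H]
    (φ : TimeInterval T × S → H) (s : S) : ℝ≥0∞ :=
  (∫⁻ t, ‖φ (t, s)‖ₑ ^ 2 ∂timeMeasure T) ^ (1 / 2 : ℝ)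

/-! Everything rests on the Gaussian structure seen pointwise. The integral of a deterministic step
function is a finite sum `∑ γ_k x_k` with jointly Gaussian coefficients, and for almost every `s`
the real variable `∑ γ_k x_k(s)` is centred Gaussian with variance `g(s)²`, where `g` is the square
function. The theorem amounts to comparing the norm of the random sum with `‖g‖`, and to passing
from step functions to `Φ`.

Upper bound and existence. Finite cotype gives a lower estimate: if `∑ |x_i| ≤ |z|`, then `∑
‖x_i‖^(2R)` is at most a constant times `‖z‖^(2R)` (`exists_lowerEstimate`). If a random set
contains each point with probability at most `1 / (2n)`, then `n` independent copies of it are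
nearly disjoint, and the lower estimate bounds `n` times the mean of `‖1_A g‖^(2R)`
(`sum_mul_norm_pow_le`). Slicing the random sum along the levels `2^l g` and using Gaussian tails
yields a second moment at most a constant times `‖g‖²` (`sum_mul_norm_sq_le`,
`lintegral_gaussian_sum_le`). The lower estimate also makes the norm order continuous, so
projections of the kernel onto finitely many coordinates and time averages converge in the norm of
the square function. With Doob's maximal inequality, the corresponding integrals converge in `C([0,
T]; E)` (`exists_isStochasticIntegral`).

Law of an arbitrary integral. A stochastic integral is a limit in measure of integrals of processes
that may be random, and nothing is known of its moments. After applying a functional `x'`, a small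
integral forces a small quadratic variation (`CondGaussian.integral_one_sub_exp_le`), so the kernels
of the approximating processes converge to the kernel of `⟨Φ, x'⟩` in `L²`, in probability. A
stopped exponential martingale then identifies the characteristic function of the limit, jointly
with Wiener integrals (`ApproximatesIntegral.integral_exp_add`). Consequently all integrals of `Φ`
have the same law of the norm at time `T`, and the upper bound proved for one of them holds for all.

Lower bound. Reflecting in the span of finitely many step functions is an isometry of `L²`, so the
reflected integral has the law of the integral itself; the projected integral is the mean of the
two, and its quantiles are controlled (`norm_le_of_projection`). For a finite Gaussian sum a small
ball estimate at each `s` turns a quantile of the norm into a bound for the square function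
(`norm_le_of_gaussian_sum`). A Fatou lemma in `E`, again from the lower estimate, lets the
partition, the set of coordinates and the truncation exhaust everything
(`ApproximatesIntegral.extNorm_squareFunction_le`). Only a quantile is needed, so the same bound
shows that integrability forces the square function into `E`. -/

namespace IsFunctionSpace

/-! ### Pointwise calculus and order in a function space. -/

variable {S : Type*} [MeasurableSpace S] {μ : Measure S}
  {E : Type*} [NormedAddCommGroup E] [NormedSpace ℝ E] {ι : E →ₗ[ℝ] (S →ₘ[μ] ℝ)}

lemma coe_add (ι : E →ₗ[ℝ] (S →ₘ[μ] ℝ)) (x y : E) :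
    ∀ᵐ s ∂μ, ι (x + y) s = ι x s + ι y s := by
  rw [map_add]; exact AEEqFun.coeFn_add _ _

lemma coe_sub (ι : E →ₗ[ℝ] (S →ₘ[μ] ℝ)) (x y : E) :
    ∀ᵐ s ∂μ, ι (x - y) s = ι x s - ι y s := by
  rw [map_sub]; exact AEEqFun.coeFn_sub _ _

lemma coe_smul (ι : E →ₗ[ℝ] (S →ₘ[μ] ℝ)) (c : ℝ) (x : E) :
    ∀ᵐ s ∂μ, ι (c • x) s = c * ι x s := by
  rw [map_smul]; exact AEEqFun.coeFn_smul _ _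

lemma coe_zero (ι : E →ₗ[ℝ] (S →ₘ[μ] ℝ)) : ∀ᵐ s ∂μ, ι 0 s = 0 := by
  rw [map_zero]; exact AEEqFun.coeFn_zero

lemma coe_sum (ι : E →ₗ[ℝ] (S →ₘ[μ] ℝ)) {α : Type*} (F : Finset α) (x : α → E) :
    ∀ᵐ s ∂μ, ι (∑ i ∈ F, x i) s = ∑ i ∈ F, ι (x i) s := by
  classical
  induction F using Finset.induction_on with
  | empty => simpa using coe_zero ι
  | insert a F ha ih =>
    filter_upwards [ih, coe_add ι (x a) (∑ i ∈ F, x i)] with s h1 h2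
    rw [Finset.sum_insert ha, Finset.sum_insert ha, h2, h1]

lemma coe_sum_smul (ι : E →ₗ[ℝ] (S →ₘ[μ] ℝ)) {α : Type*} (F : Finset α) (c : α → ℝ) (x : α → E) :
    ∀ᵐ s ∂μ, ι (∑ i ∈ F, c i • x i) s = ∑ i ∈ F, c i * ι (x i) s := by
  have : ∀ᵐ s ∂μ, ∀ i ∈ F, ι (c i • x i) s = c i * ι (x i) s :=
    (F.finite_toSet.eventually_all (l := ae μ)).2 fun i _ => coe_smul ι (c i) (x i)
  filter_upwards [this, coe_sum ι F fun i => c i • x i] with s h1 h2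
  rw [h2, Finset.sum_congr rfl h1]

/-- Solidity produces some preimage of `ι x` with small norm; injectivity of `ι` identifies it with
`x`. -/
lemma norm_le (hι : IsFunctionSpace μ ι) {x y : E} (h : ∀ᵐ s ∂μ, |ι x s| ≤ |ι y s|) :
    ‖x‖ ≤ ‖y‖ := by
  have : |ι x| ≤ |ι y| := by
    rw [← AEEqFun.coeFn_le]
    filter_upwards [h, AEEqFun.coeFn_abs (ι x), AEEqFun.coeFn_abs (ι y)] with s h1 h2 h3
    rwa [h2, h3]
  obtain ⟨z, hz, hzn⟩ := hι.solid y (ι x) this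
  rwa [hι.injective hz] at hzn

lemma exists_of_abs_le (hι : IsFunctionSpace μ ι) {y : E} {f : S → ℝ}
    (hf : AEStronglyMeasurable f μ) (h : ∀ᵐ s ∂μ, |f s| ≤ |ι y s|) :
    ∃ x : E, (∀ᵐ s ∂μ, ι x s = f s) ∧ ‖x‖ ≤ ‖y‖ := by
  have : |AEEqFun.mk f hf| ≤ |ι y| := by
    rw [← AEEqFun.coeFn_le]
    filter_upwards [h, AEEqFun.coeFn_abs (ι y), AEEqFun.coeFn_abs (AEEqFun.mk f hf),
      AEEqFun.coeFn_mk f hf] with s h1 h2 h3 h4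
    rwa [h2, h3, h4]
  obtain ⟨z, hz, hzn⟩ := hι.solid y _ this
  refine ⟨z, ?_, hzn⟩
  rw [hz]; exact AEEqFun.coeFn_mk f hf

lemma aestronglyMeasurable_coe (ι : E →ₗ[ℝ] (S →ₘ[μ] ℝ)) (x : E) :
    AEStronglyMeasurable (fun s => ι x s) μ := (ι x).aestronglyMeasurable

lemma exists_abs (hι : IsFunctionSpace μ ι) (x : E) :
    ∃ z : E, (∀ᵐ s ∂μ, ι z s = |ι x s|) ∧ ‖z‖ = ‖x‖ := by
  obtain ⟨z, hz, hn⟩ := hι.exists_of_abs_le (y := x) (f := fun s => |ι x s|)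
    (aestronglyMeasurable_coe ι x).norm (by simp)
  refine ⟨z, hz, le_antisymm hn (hι.norm_le ?_)⟩
  filter_upwards [hz] with s hs
  simp [hs]

/-- The absolute value of an element of a function space. -/
noncomputable def absE (hι : IsFunctionSpace μ ι) (x : E) : E := (hι.exists_abs x).choose

lemma coe_absE (hι : IsFunctionSpace μ ι) (x : E) : ∀ᵐ s ∂μ, ι (hι.absE x) s = |ι x s| :=
  (hι.exists_abs x).choose_spec.1

@[simp] lemma norm_absE (hι : IsFunctionSpace μ ι) (x : E) : ‖hι.absE x‖ = ‖x‖ :=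
  (hι.exists_abs x).choose_spec.2

/-- The triangle inequality for an element that is only dominated pointwise: with the `y i` replaced
by their absolute values, the dominating function becomes an element of `E`. Means over finite
probability spaces are estimated in this form. -/
lemma norm_le_sum (hι : IsFunctionSpace μ ι) {α : Type*} (F : Finset α) {c : α → ℝ} (hc : ∀ i ∈ F, 0 ≤ c i)
    {x : E} {y : α → E} (h : ∀ᵐ s ∂μ, |ι x s| ≤ ∑ i ∈ F, c i * |ι (y i) s|) :
    ‖x‖ ≤ ∑ i ∈ F, c i * ‖y i‖ := by
  have h1 : ‖x‖ ≤ ‖∑ i ∈ F, c i • hι.absE (y i)‖ := by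
    apply hι.norm_le
    have : ∀ᵐ s ∂μ, ∀ i ∈ F, ι (hι.absE (y i)) s = |ι (y i) s| :=
      (F.finite_toSet.eventually_all (l := ae μ)).2 fun i _ => hι.coe_absE (y i)
    filter_upwards [h, this, coe_sum_smul ι F c fun i => hι.absE (y i)] with s h1 h2 h3
    rw [h3]
    refine h1.trans (le_trans (le_of_eq ?_) (le_abs_self _))
    exact Finset.sum_congr rfl fun i hi => by rw [h2 i hi]
  refine h1.trans ((norm_sum_le _ _).trans (le_of_eq ?_))
  refine Finset.sum_congr rfl fun i hi => ?_
  rw [norm_smul, norm_absE, Real.norm_of_nonneg (hc i hi)]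

lemma norm_le_const_mul (hι : IsFunctionSpace μ ι) {c : ℝ} (hc : 0 ≤ c) {x y : E}
    (h : ∀ᵐ s ∂μ, |ι x s| ≤ c * |ι y s|) : ‖x‖ ≤ c * ‖y‖ := by
  simpa using hι.norm_le_sum (Finset.univ : Finset Unit) (c := fun _ => c) (y := fun _ => y)
    (by simpa using hc) (by simpa using h)

/-- A measurable function dominated by a finite combination of elements of `E` belongs to `E`. -/
lemma exists_of_abs_le_sum (hι : IsFunctionSpace μ ι) {α : Type*} (F : Finset α) {c : α → ℝ}
    (hc : ∀ i ∈ F, 0 ≤ c i) {f : S → ℝ} (hf : AEStronglyMeasurable f μ) {y : α → E}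
    (h : ∀ᵐ s ∂μ, |f s| ≤ ∑ i ∈ F, c i * |ι (y i) s|) :
    ∃ x : E, (∀ᵐ s ∂μ, ι x s = f s) ∧ ‖x‖ ≤ ∑ i ∈ F, c i * ‖y i‖ := by
  have : ∀ᵐ s ∂μ, ∀ i ∈ F, ι (hι.absE (y i)) s = |ι (y i) s| :=
    (F.finite_toSet.eventually_all (l := ae μ)).2 fun i _ => hι.coe_absE (y i)
  obtain ⟨x, hx, -⟩ := hι.exists_of_abs_le (y := ∑ i ∈ F, c i • hι.absE (y i)) hf (by
    filter_upwards [h, this, coe_sum_smul ι F c fun i => hι.absE (y i)] with s h1 h2 h3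
    rw [h3]
    refine h1.trans (le_trans (le_of_eq ?_) (le_abs_self _))
    exact Finset.sum_congr rfl fun i hi => by rw [h2 i hi])
  refine ⟨x, hx, hι.norm_le_sum F hc ?_⟩
  filter_upwards [h, hx] with s h1 h2
  rwa [h2]

lemma exists_of_abs_le_const_mul (hι : IsFunctionSpace μ ι) {c : ℝ} (hc : 0 ≤ c) {f : S → ℝ}
    (hf : AEStronglyMeasurable f μ) {y : E} (h : ∀ᵐ s ∂μ, |f s| ≤ c * |ι y s|) :
    ∃ x : E, (∀ᵐ s ∂μ, ι x s = f s) ∧ ‖x‖ ≤ c * ‖y‖ := by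
  simpa using hι.exists_of_abs_le_sum (Finset.univ : Finset Unit) (c := fun _ => c)
    (y := fun _ => y) (by simpa using hc) hf (by simpa using h)

/-- The positive cone is closed because the negative part of `z` is dominated by `|y n - z|` as soon
as `y n ≥ 0`. Order relations thus survive norm limits without extracting subsequences that converge
almost everywhere. -/
lemma nonneg_of_tendsto (hι : IsFunctionSpace μ ι) {y : ℕ → E} {z : E}
    (h : ∀ᶠ n in atTop, ∀ᵐ s ∂μ, 0 ≤ ι (y n) s) (hy : Tendsto y atTop (𝓝 z)) :
    ∀ᵐ s ∂μ, 0 ≤ ι z s := by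
  obtain ⟨w, hw, -⟩ := hι.exists_of_abs_le (y := z) (f := fun s => min (ι z s) 0)
    ((aestronglyMeasurable_coe ι z).inf aestronglyMeasurable_const) (by
      refine ae_of_all _ fun s => ?_
      rcases le_total (ι z s) 0 with h | h <;> simp [h])
  have key : ∀ᶠ n in atTop, ‖w‖ ≤ ‖y n - z‖ := by
    filter_upwards [h] with n hn
    apply hι.norm_le
    filter_upwards [hn, hw, coe_sub ι (y n) z] with s h1 h2 h3
    rw [h2, h3]
    rcases le_total (ι z s) 0 with h | h
    · rw [min_eq_left h, abs_of_nonpos h, abs_of_nonneg (by linarith)]; linarith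
    · rw [min_eq_right h]; simp
  have hlim : Tendsto (fun n => ‖y n - z‖) atTop (𝓝 0) := by
    rwa [← tendsto_iff_norm_sub_tendsto_zero]
  have hw0 : w = 0 := by
    rw [← norm_le_zero_iff]
    exact ge_of_tendsto hlim key
  subst hw0
  filter_upwards [hw, coe_zero ι] with s h1 h2
  rw [h2] at h1
  exact min_eq_right_iff.1 h1.symm

lemma le_of_tendsto_of_le (hι : IsFunctionSpace μ ι) {y : ℕ → E} {x z : E}
    (h : ∀ᶠ n in atTop, ∀ᵐ s ∂μ, ι x s ≤ ι (y n) s) (hy : Tendsto y atTop (𝓝 z)) :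
    ∀ᵐ s ∂μ, ι x s ≤ ι z s := by
  have := hι.nonneg_of_tendsto (y := fun n => y n - x) (z := z - x) (by
    filter_upwards [h] with n hn
    filter_upwards [hn, coe_sub ι (y n) x] with s h1 h2
    rw [h2]; linarith) (hy.sub_const x)
  filter_upwards [this, coe_sub ι z x] with s h1 h2
  rw [h2] at h1; linarith

/-- The Riesz–Fischer property: an absolutely summable series is dominated. -/
lemma exists_dominating_of_summable [CompleteSpace E] (hι : IsFunctionSpace μ ι) {x : ℕ → E}
    (hx : Summable fun n => ‖x n‖) :
    ∃ v : E, ∀ᵐ s ∂μ, ∀ N, ∑ n ∈ Finset.range N, |ι (x n) s| ≤ ι v s := by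
  have hs : Summable fun n => hι.absE (x n) := Summable.of_norm (by simpa using hx)
  have hall : ∀ᵐ s ∂μ, ∀ n, ι (hι.absE (x n)) s = |ι (x n) s| :=
    ae_all_iff.2 fun n => hι.coe_absE (x n)
  refine ⟨∑' n, hι.absE (x n), ae_all_iff.2 fun N => ?_⟩
  -- The partial sums of the absolute values increase, so each of them stays below the norm limit.
  have := hι.le_of_tendsto_of_le (x := ∑ n ∈ Finset.range N, hι.absE (x n)) (by
    filter_upwards [eventually_ge_atTop N] with M hM
    filter_upwards [hall, coe_sum ι (Finset.range N) fun n => hι.absE (x n),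
      coe_sum ι (Finset.range M) fun n => hι.absE (x n)] with s h1 h2 h3
    rw [h2, h3]
    refine Finset.sum_le_sum_of_subset_of_nonneg (Finset.range_subset_range.2 hM) ?_
    intro i _ _
    rw [h1]; positivity) hs.hasSum.tendsto_sum_nat
  filter_upwards [this, hall, coe_sum ι (Finset.range N) fun n => hι.absE (x n)] with s h1 h2 h3
  rw [h3] at h1
  simpa [h2] using h1

lemma ae_summable_of_summable_norm [CompleteSpace E] (hι : IsFunctionSpace μ ι) {x : ℕ → E}
    (hx : Summable fun n => ‖x n‖) : ∀ᵐ s ∂μ, Summable fun n => |ι (x n) s| := by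
  obtain ⟨v, hv⟩ := hι.exists_dominating_of_summable hx
  filter_upwards [hv] with s hs
  exact summable_of_sum_range_le (fun n => abs_nonneg _) hs

lemma ae_tendsto_zero_of_summable_norm [CompleteSpace E] (hι : IsFunctionSpace μ ι) {x : ℕ → E}
    (hx : Summable fun n => ‖x n‖) : ∀ᵐ s ∂μ, Tendsto (fun n => ι (x n) s) atTop (𝓝 0) := by
  filter_upwards [hι.ae_summable_of_summable_norm hx] with s hs
  exact (tendsto_zero_iff_abs_tendsto_zero _).2 hs.tendsto_atTop_zero

end IsFunctionSpace

/-! ### From finite cotype to a lower estimate. -/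

section Cotype

variable {S : Type*} [MeasurableSpace S] {μ : Measure S}
  {E : Type*} [NormedAddCommGroup E] [NormedSpace ℝ E] {ι : E →ₗ[ℝ] (S →ₘ[μ] ℝ)}

/-- A lower `Q`-estimate with constant `C`: sums of absolute values. -/
def HasLowerEstimate (ι : E →ₗ[ℝ] (S →ₘ[μ] ℝ)) (Q : ℕ) (C : ℝ) : Prop :=
  ∀ (N : ℕ) (x : Fin N → E) (z : E), (∀ᵐ s ∂μ, ∑ i, |ι (x i) s| ≤ |ι z s|) →
    ∑ i, ‖x i‖ ^ Q ≤ (C * ‖z‖) ^ Q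

/-- Every choice of signs gives an element dominated by `z`, so the bound holds before averaging. -/
lemma IsFunctionSpace.rademacherMean_le (hι : IsFunctionSpace μ ι) {N : ℕ} {x : Fin N → E} {z : E}
    (h : ∀ᵐ s ∂μ, ∑ i, |ι (x i) s| ≤ |ι z s|) : rademacherMean x ≤ ‖z‖ := by
  have h1 : ∀ ε : Fin N → ℤˣ, ‖∑ n, ((ε n : ℤ) : ℝ) • x n‖ ≤ ‖z‖ := by
    intro ε
    apply hι.norm_le
    filter_upwards [h, coe_sum_smul ι Finset.univ (fun n => ((ε n : ℤ) : ℝ)) x] with s hs1 hs2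
    rw [hs2]
    refine (Finset.abs_sum_le_sum_abs _ _).trans (le_trans (le_of_eq ?_) hs1)
    refine Finset.sum_congr rfl fun i _ => ?_
    rcases Int.units_eq_one_or (ε i) with h | h <;> simp [h]
  rw [rademacherMean]
  refine Real.sqrt_le_iff.2 ⟨norm_nonneg _, ?_⟩
  rw [inv_mul_le_iff₀ (by positivity)]
  refine (Finset.sum_le_card_nsmul _ _ (‖z‖ ^ 2) fun ε _ => ?_).trans (le_of_eq ?_)
  · exact pow_le_pow_left₀ (norm_nonneg _) (h1 ε) 2
  · simp [Fintype.card_units_int]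

/-- Cotype gives the estimate with exponent `q`. Each `‖x i‖` is at most the `ℓ^q` norm of the
family, so the exponent may be raised to the even integer `2 * ⌈q⌉₊`. Evenness is wanted in order to
descend from moments of order `2R` to second moments by Jensen's inequality. -/
lemma IsFunctionSpace.exists_lowerEstimate (hι : IsFunctionSpace μ ι) (hE : HasFiniteCotype E) :
    ∃ (R : ℕ) (C : ℝ), 1 ≤ R ∧ 0 < C ∧ HasLowerEstimate ι (2 * R) C := by
  obtain ⟨q, hq, C, hC⟩ := hE
  refine ⟨⌈q⌉₊, max C 1, ?_, by positivity, fun N x z hxz => ?_⟩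
  · exact Nat.one_le_ceil_iff.2 (by linarith)
  have hq0 : 0 < q := by linarith
  set Q := 2 * ⌈q⌉₊ with hQdef
  have hQ : q ≤ Q := (Nat.le_ceil q).trans (by rw [hQdef]; push_cast; linarith [Nat.le_ceil q])
  set A := ∑ n, ‖x n‖ ^ q with hA
  have hA0 : 0 ≤ A := Finset.sum_nonneg fun i _ => by positivity
  have hB : A ^ (1 / q) ≤ max C 1 * ‖z‖ := by
    refine (hC N x).trans ?_
    refine (mul_le_mul_of_nonneg_right (le_max_left C 1) (Real.sqrt_nonneg _)).trans ?_
    exact mul_le_mul_of_nonneg_left (hι.rademacherMean_le hxz) (by positivity)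
  have hi : ∀ i, ‖x i‖ ≤ A ^ (1 / q) := fun i => by
    have : ‖x i‖ ^ q ≤ A := Finset.single_le_sum (f := fun n => ‖x n‖ ^ q)
      (fun i _ => by positivity) (Finset.mem_univ i)
    calc ‖x i‖ = (‖x i‖ ^ q) ^ (1 / q) := by
          rw [← Real.rpow_mul (norm_nonneg _), mul_one_div_cancel hq0.ne', Real.rpow_one]
      _ ≤ _ := Real.rpow_le_rpow (by positivity) this (by positivity)
  have hfin : ∑ i, ‖x i‖ ^ Q ≤ (A ^ (1 / q)) ^ Q := by
    calc ∑ i, ‖x i‖ ^ Q ≤ ∑ i, ‖x i‖ ^ q * (A ^ (1 / q)) ^ (Q - q : ℝ) := by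
          refine Finset.sum_le_sum fun i _ => ?_
          rcases (norm_nonneg (x i)).eq_or_lt with h0 | h0
          · rw [← h0, zero_pow (by have : (0:ℝ) < Q := hq0.trans_le hQ
                                   exact_mod_cast this.ne')]
            positivity
          · have e : ‖x i‖ ^ Q = ‖x i‖ ^ q * ‖x i‖ ^ (Q - q : ℝ) := by
              rw [← Real.rpow_add h0, add_sub_cancel, Real.rpow_natCast]
            rw [e]
            exact mul_le_mul_of_nonneg_left (Real.rpow_le_rpow h0.le (hi i) (by linarith))
              (by positivity)
      _ = A * (A ^ (1 / q)) ^ (Q - q : ℝ) := by rw [Finset.sum_mul]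
      _ = (A ^ (1 / q)) ^ Q := by
          rcases hA0.eq_or_lt with h0 | h0
          · rw [← h0, Real.zero_rpow (by positivity), zero_mul, zero_pow]
            have : (0:ℝ) < Q := hq0.trans_le hQ
            exact_mod_cast this.ne'
          · nth_rewrite 1 [show A = (A ^ (1/q)) ^ q by
              rw [← Real.rpow_mul hA0, one_div_mul_cancel hq0.ne', Real.rpow_one]]
            rw [← Real.rpow_add (by positivity), ← Real.rpow_natCast]
            congr 1; ring
  exact hfin.trans (pow_le_pow_left₀ (by positivity) hB Q)

end Cotype

/-! ### Extended norms and order continuity. -/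

namespace IsFunctionSpace

variable {S : Type*} [MeasurableSpace S] {μ : Measure S}
  {E : Type*} [NormedAddCommGroup E] [NormedSpace ℝ E] {ι : E →ₗ[ℝ] (S →ₘ[μ] ℝ)}

/-- Elements with the same absolute value have the same norm, so the infimum runs over equal values.
-/
lemma extNorm_eq (hι : IsFunctionSpace μ ι) {f : S → ℝ≥0∞} {x : E}
    (h : ∀ᵐ s ∂μ, f s = ‖ι x s‖ₑ) : extNorm ι f = ‖x‖ₑ := by
  refine le_antisymm (iInf₂_le x h) (le_iInf₂ fun y hy => ?_)
  rw [enorm_le_iff_norm_le]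
  apply hι.norm_le
  filter_upwards [h, hy] with s h1 h2
  rw [h1, enorm_eq_iff_norm_eq] at h2
  exact h2.le

lemma exists_of_extNorm_lt_top {f : S → ℝ≥0∞} (h : extNorm ι f < ∞) :
    ∃ x : E, ∀ᵐ s ∂μ, f s = ‖ι x s‖ₑ := by
  rw [extNorm, iInf_lt_iff] at h
  obtain ⟨x, hx⟩ := h
  rw [iInf_lt_iff] at hx
  exact ⟨x, hx.choose⟩

lemma extNorm_le (hι : IsFunctionSpace μ ι) {f : S → ℝ≥0∞} (hf : AEMeasurable f μ) {x : E}
    (h : ∀ᵐ s ∂μ, f s ≤ ‖ι x s‖ₑ) : extNorm ι f ≤ ‖x‖ₑ := by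
  obtain ⟨y, hy, hyn⟩ := hι.exists_of_abs_le (y := x) (f := fun s => (f s).toReal)
    hf.ennreal_toReal.aestronglyMeasurable (by
      filter_upwards [h] with s hs
      rw [abs_of_nonneg ENNReal.toReal_nonneg]
      exact ENNReal.toReal_le_of_le_ofReal (abs_nonneg _) (by rwa [← Real.norm_eq_abs, ofReal_norm]))
  have : ∀ᵐ s ∂μ, f s = ‖ι y s‖ₑ := by
    filter_upwards [h, hy] with s h1 h2
    rw [h2, Real.enorm_eq_ofReal ENNReal.toReal_nonneg, ENNReal.ofReal_toReal]
    exact (h1.trans_lt enorm_lt_top).ne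
  rw [hι.extNorm_eq this]
  exact enorm_le_iff_norm_le.2 hyn

lemma extNorm_congr {f g : S → ℝ≥0∞} (h : ∀ᵐ s ∂μ, f s = g s) : extNorm ι f = extNorm ι g := by
  have : ∀ x : E, (∀ᵐ s ∂μ, f s = ‖ι x s‖ₑ) ↔ ∀ᵐ s ∂μ, g s = ‖ι x s‖ₑ := fun x =>
    ⟨fun h' => by filter_upwards [h, h'] with s h1 h2; rw [← h1, h2],
     fun h' => by filter_upwards [h, h'] with s h1 h2; rw [h1, h2]⟩
  simp only [extNorm, this]

/-- Under a lower estimate, norm bounded increasing sequences of positive elements converge. -/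
lemma cauchySeq_of_monotone {Q : ℕ} {C : ℝ} (hQ : HasLowerEstimate ι Q C) {G : ℕ → E} {c : ℝ} (hc : ∀ n, ‖G n‖ ≤ c)
    (h0 : ∀ n, ∀ᵐ s ∂μ, 0 ≤ ι (G n) s)
    (hm : ∀ᵐ s ∂μ, Monotone fun n => ι (G n) s) : CauchySeq G := by
  by_contra hG
  rw [Metric.cauchySeq_iff'] at hG
  push Not at hG
  obtain ⟨δ, hδ, hG⟩ := hG
  choose ν hν1 hν2 using hG
  -- Without the Cauchy property there is a subsequence whose consecutive increments have norm at
  -- least `δ`. These increments are positive and add up to at most `G (k N)`, so the lower estimate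
  -- bounds `N * δ ^ Q` uniformly in `N`, which is absurd.
  let k : ℕ → ℕ := fun n => Nat.rec 0 (fun _ m => ν m) n
  have hk : ∀ n, k (n + 1) = ν (k n) := fun n => rfl
  have hN : ∀ N : ℕ, N * δ ^ Q ≤ (|C| * c) ^ Q := by
    intro N
    have := hQ N (fun i => G (k (i + 1)) - G (k i)) (G (k N)) (by
      have h2 : ∀ᵐ s ∂μ, ∀ i : Fin N, ι (G (k (i + 1)) - G (k i)) s
          = ι (G (k (i + 1))) s - ι (G (k i)) s := ae_all_iff.2 fun i => coe_sub ι _ _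
      filter_upwards [hm, h2, h0 (k N), h0 (k 0)] with s h1 h2 h3 h4
      have : ∀ i : Fin N, |ι (G (k (i + 1)) - G (k i)) s|
          = ι (G (k (i + 1))) s - ι (G (k i)) s := by
        intro i
        rw [h2, abs_of_nonneg]
        exact sub_nonneg.2 (h1 (by rw [hk]; exact hν1 _))
      rw [Finset.sum_congr rfl fun i _ => this i,
        Fin.sum_univ_eq_sum_range (fun i => ι (G (k (i + 1))) s - ι (G (k i)) s),
        Finset.sum_range_sub (fun i => ι (G (k i)) s), abs_of_nonneg h3]
      linarith)
    calc (N : ℝ) * δ ^ Q = ∑ i : Fin N, δ ^ Q := by simp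
      _ ≤ ∑ i : Fin N, ‖G (k (i + 1)) - G (k i)‖ ^ Q := by
          refine Finset.sum_le_sum fun i _ => ?_
          gcongr
          rw [← dist_eq_norm, hk]
          exact hν2 _
      _ ≤ _ := this
      _ ≤ |C * ‖G (k N)‖| ^ Q := by rw [← abs_pow]; exact le_abs_self _
      _ ≤ _ := by
          rw [abs_mul, abs_norm]
          gcongr
          exact hc _
  obtain ⟨N, hN'⟩ := exists_nat_gt ((|C| * c) ^ Q / δ ^ Q)
  rw [div_lt_iff₀ (by positivity)] at hN'
  exact absurd (hN N) (not_le.2 hN')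

/-- Fatou's lemma in a function space with a lower estimate. -/
lemma extNorm_le_of_le_liminf [CompleteSpace E] (hι : IsFunctionSpace μ ι) {Q : ℕ} {C : ℝ}
    (hQ : HasLowerEstimate ι Q C) {G : ℕ → E} {c : ℝ≥0∞} (hcG : ∀ n, ‖G n‖ₑ ≤ c)
    {f : S → ℝ≥0∞} (hf : AEMeasurable f μ)
    (h : ∀ᵐ s ∂μ, f s ≤ liminf (fun n => ‖ι (G n) s‖ₑ) atTop) : extNorm ι f ≤ c := by
  rcases eq_or_ne c ∞ with rfl | hctop
  · exact le_top
  lift c to ℝ≥0 using hctop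
  have hc : ∀ n, ‖G n‖ ≤ c := fun n => by
    have := hcG n
    rw [← ofReal_norm] at this
    exact (ENNReal.ofReal_le_iff_le_toReal ENNReal.coe_ne_top).1 this
  have hmeas : ∀ n, AEStronglyMeasurable (fun s => ⨅ k, |ι (G (n + k)) s|) μ := fun n =>
    (AEMeasurable.iInf fun k => (ι (G (n + k))).measurable.norm.aemeasurable).aestronglyMeasurable
  have hbdd : ∀ n s, BddBelow (Set.range fun k => |ι (G (n + k)) s|) := fun n s =>
    ⟨0, by rintro _ ⟨k, rfl⟩; exact abs_nonneg _⟩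
  have hnn : ∀ n s, 0 ≤ ⨅ k, |ι (G (n + k)) s| := fun n s => Real.iInf_nonneg fun k => abs_nonneg _
  -- The tail infima increase pointwise and are bounded in norm, hence converge in norm; their limit
  -- dominates the pointwise lower limit.
  have hex : ∀ n, ∃ y : E, (∀ᵐ s ∂μ, ι y s = ⨅ k, |ι (G (n + k)) s|) ∧ ‖y‖ ≤ ‖G n‖ := fun n =>
    hι.exists_of_abs_le (hmeas n) (ae_of_all _ fun s => by
      rw [abs_of_nonneg (hnn n s)]
      exact ciInf_le (hbdd n s) 0)
  choose y hy hyn using hex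
  have hy' : ∀ᵐ s ∂μ, ∀ n, ι (y n) s = ⨅ k, |ι (G (n + k)) s| := ae_all_iff.2 hy
  have hmono : ∀ᵐ s ∂μ, Monotone fun n => ι (y n) s := by
    filter_upwards [hy'] with s hs
    refine monotone_nat_of_le_succ fun n => ?_
    rw [hs, hs]
    refine le_ciInf fun k => ?_
    rw [show n + 1 + k = n + (k + 1) by ring]
    exact ciInf_le (hbdd n s) (k + 1)
  have hcau := cauchySeq_of_monotone hQ (fun n => (hyn n).trans (hc n)) (fun n => by
    filter_upwards [hy'] with s hs
    rw [hs]; exact hnn n s) hmono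
  obtain ⟨z, hz⟩ := cauchySeq_tendsto_of_complete hcau
  have hzc : ‖z‖ ≤ c := le_of_tendsto hz.norm (Eventually.of_forall fun n => (hyn n).trans (hc n))
  have hle : ∀ᵐ s ∂μ, ∀ n, ι (y n) s ≤ ι z s := ae_all_iff.2 fun n =>
    hι.le_of_tendsto_of_le (by
      filter_upwards [eventually_ge_atTop n] with m hnm
      filter_upwards [hmono] with s hs using hs hnm) hz
  have hfin : extNorm ι f ≤ ‖z‖ₑ := by
    refine hι.extNorm_le hf ?_
    filter_upwards [h, hle, hy'] with s h1 h2 h3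
    refine h1.trans ?_
    rw [liminf_eq_iSup_iInf_of_nat]
    refine iSup_le fun n => ?_
    calc ⨅ i ≥ n, ‖ι (G i) s‖ₑ ≤ ENNReal.ofReal (ι (y n) s) := by
          rw [h3]
          rw [ENNReal.ofReal_iInf]
          refine le_iInf fun k => (iInf₂_le (n + k) (by omega)).trans ?_
          rw [← Real.norm_eq_abs, ofReal_norm]
      _ ≤ ‖ι z s‖ₑ := by
          rw [← ofReal_norm]
          exact ENNReal.ofReal_le_ofReal ((h2 n).trans (le_abs_self _))
  refine hfin.trans ?_
  rw [← ofReal_norm]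
  exact ENNReal.ofReal_le_of_le_toReal hzc

/-- Dominated convergence (order continuity of the norm). -/
lemma tendsto_zero_of_dominated [CompleteSpace E] (hι : IsFunctionSpace μ ι) {Q : ℕ} {C : ℝ}
    (hQ : HasLowerEstimate ι Q C) {x : ℕ → E} {g : E}
    (hd : ∀ n, ∀ᵐ s ∂μ, |ι (x n) s| ≤ |ι g s|)
    (hx : ∀ᵐ s ∂μ, Tendsto (fun n => ι (x n) s) atTop (𝓝 0)) :
    Tendsto x atTop (𝓝 0) := by
  have hd' : ∀ᵐ s ∂μ, ∀ n, |ι (x n) s| ≤ |ι g s| := ae_all_iff.2 hd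
  -- The tail suprema `h n` decrease to zero, so `|g| - h n` increases, stays below `|g|` and
  -- converges in norm to some `z ≥ |g|`. The difference between `z` and `|g| - h n` then dominates
  -- `|x n|`.
  let h : ℕ → S → ℝ := fun n s => ⨆ k, |ι (x (n + k)) s|
  have hmeas : ∀ n, AEStronglyMeasurable (fun s => |ι g s| - h n s) μ := fun n =>
    (aestronglyMeasurable_coe ι g).norm.sub
    (AEMeasurable.iSup fun k => (ι (x (n + k))).measurable.norm.aemeasurable).aestronglyMeasurable
  have hbd : ∀ᵐ s ∂μ, (∀ n, BddAbove (Set.range fun k => |ι (x (n + k)) s|)) ∧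
      (∀ n, h n s ≤ |ι g s|) ∧ (∀ n k, |ι (x (n + k)) s| ≤ h n s) ∧ ∀ n, 0 ≤ h n s := by
    filter_upwards [hd'] with s hs
    have hb : ∀ n, BddAbove (Set.range fun k => |ι (x (n + k)) s|) := fun n =>
      ⟨|ι g s|, by rintro _ ⟨k, rfl⟩; exact hs _⟩
    exact ⟨hb, fun n => ciSup_le fun k => hs _, fun n k => le_ciSup (hb n) k,
      fun n => (abs_nonneg _).trans (le_ciSup (hb n) 0)⟩
  have hex : ∀ n, ∃ y : E, (∀ᵐ s ∂μ, ι y s = |ι g s| - h n s) ∧ ‖y‖ ≤ ‖g‖ := fun n =>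
    hι.exists_of_abs_le (hmeas n) (by
      filter_upwards [hbd] with s hs
      rw [abs_of_nonneg (sub_nonneg.2 (hs.2.1 n))]
      linarith [hs.2.2.2 n])
  choose y hy hyn using hex
  have hy' : ∀ᵐ s ∂μ, ∀ n, ι (y n) s = |ι g s| - h n s := ae_all_iff.2 hy
  have hmono : ∀ᵐ s ∂μ, Monotone fun n => ι (y n) s := by
    filter_upwards [hy', hbd] with s hs hb
    refine monotone_nat_of_le_succ fun n => ?_
    rw [hs, hs]
    refine sub_le_sub_left (ciSup_le fun k => ?_) _
    have := hb.2.2.1 n (k + 1)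
    rwa [show n + (k + 1) = n + 1 + k by ring] at this
  have hcau := cauchySeq_of_monotone hQ hyn (fun n => by
    filter_upwards [hy', hbd] with s hs hb
    rw [hs]; linarith [hb.2.1 n]) hmono
  obtain ⟨z, hz⟩ := cauchySeq_tendsto_of_complete hcau
  have hle : ∀ᵐ s ∂μ, ∀ n, ι (y n) s ≤ ι z s := ae_all_iff.2 fun n =>
    hι.le_of_tendsto_of_le (by
      filter_upwards [eventually_ge_atTop n] with m hnm
      filter_upwards [hmono] with s hs using hs hnm) hz
  have hgz : ∀ᵐ s ∂μ, |ι g s| ≤ ι z s := by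
    filter_upwards [hle, hy', hx, hbd] with s h1 h2 h3 h4
    refine le_of_forall_pos_le_add fun ε hε => ?_
    obtain ⟨n, hn⟩ := (Metric.tendsto_atTop.1 h3) ε hε
    have hhn : h n s ≤ ε := ciSup_le fun k => by
      have := hn (n + k) (by omega)
      rw [Real.dist_eq, sub_zero] at this
      exact this.le
    have := h1 n
    rw [h2] at this
    linarith
  rw [tendsto_zero_iff_norm_tendsto_zero]
  have hlim : Tendsto (fun n => ‖z - y n‖) atTop (𝓝 0) := by
    have := (tendsto_iff_norm_sub_tendsto_zero.1 hz)
    simpa [norm_sub_rev] using this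
  refine squeeze_zero (fun n => norm_nonneg _) (fun n => hι.norm_le ?_) hlim
  filter_upwards [hgz, hy', hbd, coe_sub ι z (y n)] with s h1 h2 h3 h4
  rw [h4, h2]
  have := h3.2.2.1 n 0
  rw [add_zero] at this
  refine this.trans (le_trans ?_ (le_abs_self _))
  linarith

end IsFunctionSpace

/-! ### Independent samples from a finite probability space. -/

lemma sum_prod_pi {n : ℕ} {J : Type*} [Fintype J] (ψ : Fin n → J → ℝ) :
    ∑ f : Fin n → J, ∏ k, ψ k (f k) = ∏ k, ∑ j, ψ k j := by
  classical
  rw [Finset.prod_univ_sum, Fintype.piFinset_univ]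

section PiWeights

variable {n : ℕ} {J : Type*} [Fintype J] [DecidableEq J] {w : J → ℝ}

/-- The `i`-th of `n` independent samples has law `w`: the sum over the fibre factors, and all
factors other than the `i`-th equal one. -/
lemma sum_pi_fiber (hw1 : ∑ j, w j = 1) (i : Fin n) (j : J) :
    ∑ f : Fin n → J with f i = j, ∏ k, w (f k) = w j := by
  have h := sum_prod_pi (fun (k : Fin n) l => if k = i then (if l = j then w l else 0) else w l)
  have hL : ∑ f : Fin n → J, ∏ k, (if k = i then (if f k = j then w (f k) else 0) else w (f k))
      = ∑ f : Fin n → J with f i = j, ∏ k, w (f k) := by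
    rw [Finset.sum_filter]
    refine Finset.sum_congr rfl fun f _ => ?_
    split_ifs with hf
    · refine Finset.prod_congr rfl fun k _ => ?_
      by_cases hk : k = i
      · subst hk; simp [hf]
      · simp [hk]
    · exact Finset.prod_eq_zero (Finset.mem_univ i) (by simp [hf])
  rw [hL] at h
  rw [h, Finset.prod_eq_single i]
  · simp
  · intro k _ hk
    simp [hk, hw1]
  · simp

/-- Independence of two different samples, by the same factorization: the factor at `k` becomes the
mean of `χ`. -/
lemma sum_pi_fiber_mul (hw1 : ∑ j, w j = 1) {i k : Fin n} (hik : k ≠ i) (j : J) (χ : J → ℝ) :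
    ∑ f : Fin n → J with f i = j, (∏ l, w (f l)) * χ (f k) = w j * ∑ l, w l * χ l := by
  have h := sum_prod_pi (fun (m : Fin n) l => if m = i then (if l = j then w l else 0) else
    if m = k then w l * χ l else w l)
  have hL : ∑ f : Fin n → J, ∏ m, (if m = i then (if f m = j then w (f m) else 0) else
      if m = k then w (f m) * χ (f m) else w (f m))
      = ∑ f : Fin n → J with f i = j, (∏ l, w (f l)) * χ (f k) := by
    rw [Finset.sum_filter]
    refine Finset.sum_congr rfl fun f _ => ?_
    split_ifs with hf
    · have : ∏ m, (if m = k then χ (f m) else 1) = χ (f k) := by simp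
      rw [← this, ← Finset.prod_mul_distrib]
      refine Finset.prod_congr rfl fun m _ => ?_
      by_cases hm : m = i
      · subst hm; simp [hf, hik.symm]
      · by_cases hmk : m = k <;> simp [hm, hmk, hik]
    · exact Finset.prod_eq_zero (Finset.mem_univ i) (by simp [hf])
  rw [hL] at h
  rw [h, ← Finset.mul_prod_erase Finset.univ _ (Finset.mem_univ i),
    ← Finset.mul_prod_erase (Finset.univ.erase i) _ (Finset.mem_erase.2 ⟨hik, Finset.mem_univ k⟩),
    Finset.prod_eq_one]
  · simp [hik]
  · intro m hm
    simp only [Finset.mem_erase, Finset.mem_univ, and_true] at hm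
    simp [hm.1, hm.2, hw1]

/-- A union bound: given that the `i`-th sample is `j`, each of the others hits `A` with probability
at most `1 / (2n)`, so they all avoid it with probability at least `1 / 2`. -/
lemma half_le_sum_pi (hw0 : ∀ j, 0 ≤ w j) (hw1 : ∑ j, w j = 1) (i : Fin n) (j : J)
    (A : J → Prop) [DecidablePred A] (hA : 2 * n * ∑ l with A l, w l ≤ 1) :
    w j / 2 ≤ ∑ f : Fin n → J with f i = j,
      (∏ l, w (f l)) * if ∀ k, k ≠ i → ¬ A (f k) then 1 else 0 := by
  have h1 : ∀ f : Fin n → J, (1 : ℝ) - ∑ k ∈ Finset.univ.erase i, (if A (f k) then 1 else 0)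
      ≤ if ∀ k, k ≠ i → ¬ A (f k) then 1 else 0 := by
    intro f
    split_ifs with h
    · have : 0 ≤ ∑ k ∈ Finset.univ.erase i, (if A (f k) then (1 : ℝ) else 0) :=
        Finset.sum_nonneg fun k _ => by split_ifs <;> simp
      linarith
    · push Not at h
      obtain ⟨k, hk, hAk⟩ := h
      have := Finset.single_le_sum (f := fun k => if A (f k) then (1 : ℝ) else 0)
        (s := Finset.univ.erase i) (fun k _ => by split_ifs <;> simp)
        (Finset.mem_erase.2 ⟨hk, Finset.mem_univ k⟩)
      simp only [hAk, if_true] at this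
      linarith
  have h2 : ∑ f : Fin n → J with f i = j, (∏ l, w (f l)) *
      ((1 : ℝ) - ∑ k ∈ Finset.univ.erase i, (if A (f k) then 1 else 0))
      = w j - ∑ k ∈ (Finset.univ : Finset (Fin n)).erase i, w j * ∑ l with A l, w l := by
    simp only [mul_sub, mul_one, Finset.sum_sub_distrib, Finset.mul_sum]
    rw [sum_pi_fiber hw1, Finset.sum_comm]
    congr 1
    refine Finset.sum_congr rfl fun k hk => ?_
    have := sum_pi_fiber_mul hw1 (Finset.ne_of_mem_erase hk) j fun l => if A l then 1 else 0
    rw [this, Finset.sum_filter, Finset.mul_sum]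
    simp
  calc w j / 2 ≤ w j - ∑ k ∈ (Finset.univ : Finset (Fin n)).erase i, w j * ∑ l with A l, w l := by
        have hp : 0 ≤ ∑ l with A l, w l := Finset.sum_nonneg fun l _ => hw0 l
        have hle : ∑ k ∈ (Finset.univ : Finset (Fin n)).erase i, w j * ∑ l with A l, w l
            ≤ ∑ k : Fin n, w j * ∑ l with A l, w l :=
          Finset.sum_le_sum_of_subset_of_nonneg (Finset.erase_subset _ _)
            fun _ _ _ => mul_nonneg (hw0 j) hp
        have hc : ∑ _k : Fin n, w j * ∑ l with A l, w l = n * (w j * ∑ l with A l, w l) := by simp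
        nlinarith [hw0 j]
    _ ≤ _ := by
        rw [← h2]
        exact Finset.sum_le_sum fun f _ =>
          mul_le_mul_of_nonneg_left (h1 f) (Finset.prod_nonneg fun l _ => hw0 _)

end PiWeights

/-! ### Second moments from pointwise tail bounds. -/

namespace IsFunctionSpace

variable {S : Type*} [MeasurableSpace S] {μ : Measure S}
  {E : Type*} [NormedAddCommGroup E] [NormedSpace ℝ E] {ι : E →ₗ[ℝ] (S →ₘ[μ] ℝ)}

/-- The average norm of the restriction of `g` to a random set which contains each point with
small probability is small. -/
lemma sum_mul_norm_pow_le (hι : IsFunctionSpace μ ι) {Q : ℕ} {C : ℝ} (hQ : HasLowerEstimate ι Q C)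
    {J : Type*} [Fintype J] {w : J → ℝ} (hw0 : ∀ j, 0 ≤ w j)
    (hw1 : ∑ j, w j = 1) {A : J → Set S} (hA : ∀ j, MeasurableSet (A j)) {g : E} {y : J → E}
    (hy : ∀ j, ∀ᵐ s ∂μ, ι (y j) s = (A j).indicator (fun s => |ι g s|) s) {n : ℕ}
    (hp : ∀ᵐ s ∂μ, 2 * n * (∑ j, (A j).indicator (fun _ => w j) s) ≤ 1) :
    n * ∑ j, w j * ‖y j‖ ^ Q ≤ (2 * C * ‖g‖) ^ Q := by
  classical
  -- For `n` independent samples `f`, the set `B f i` is the part of the `i`-th random set that is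
  -- not covered by the others. For fixed `f` these parts are disjoint, so the lower estimate
  -- applies to the restrictions of `g` to them.
  let B : (Fin n → J) → Fin n → Set S := fun f i => A (f i) \ ⋃ k ∈ Finset.univ.erase i, A (f k)
  have hB : ∀ f i, MeasurableSet (B f i) := fun f i =>
    (hA _).diff (Finset.measurableSet_biUnion _ fun k _ => hA _)
  have hBmem : ∀ f i s, s ∈ B f i ↔ s ∈ A (f i) ∧ ∀ k, k ≠ i → s ∉ A (f k) := by
    intro f i s; simp [B]
  have hex : ∀ f i, ∃ b : E, (∀ᵐ s ∂μ, ι b s = (B f i).indicator (fun s => |ι g s|) s) ∧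
      ‖b‖ ≤ ‖g‖ := fun f i =>
    hι.exists_of_abs_le ((aestronglyMeasurable_coe ι g).norm.indicator (hB f i))
      (ae_of_all _ fun s => by by_cases hs : s ∈ B f i <;> simp [hs])
  choose b hb hbn using hex
  have hb' : ∀ᵐ s ∂μ, ∀ f i, ι (b f i) s = (B f i).indicator (fun s => |ι g s|) s :=
    ae_all_iff.2 fun f => ae_all_iff.2 fun i => hb f i
  have hW0 : ∀ f : Fin n → J, 0 ≤ ∏ k, w (f k) := fun f => Finset.prod_nonneg fun k _ => hw0 _
  have h1 : ∀ f, ∑ i, ‖b f i‖ ^ Q ≤ (C * ‖g‖) ^ Q := fun f => hQ n (b f) g (by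
    filter_upwards [hb'] with s hs
    simp only [hs]
    by_cases h : ∃ i, s ∈ B f i
    · obtain ⟨i, hi⟩ := h
      rw [Finset.sum_eq_single i]
      · simp [hi]
      · intro k _ hk
        have : s ∉ B f k := fun hk' => ((hBmem f k s).1 hk').2 i hk.symm ((hBmem f i s).1 hi).1
        simp [this]
      · simp
    · push Not at h
      simp [h])
  have hWsum : ∑ f : Fin n → J, ∏ k, w (f k) = 1 := by
    rw [sum_prod_pi fun _ => w]; simp [hw1]
  have h2 : ∑ f : Fin n → J, (∏ k, w (f k)) * ∑ i, ‖b f i‖ ^ Q ≤ (C * ‖g‖) ^ Q := by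
    calc _ ≤ ∑ f : Fin n → J, (∏ k, w (f k)) * (C * ‖g‖) ^ Q :=
          Finset.sum_le_sum fun f _ => mul_le_mul_of_nonneg_left (h1 f) (hW0 f)
      _ = _ := by rw [← Finset.sum_mul, hWsum, one_mul]
  -- Conditionally on `f i = j`, half of `y j` lies below the mean of the pieces `b f i`. The
  -- triangle inequality and Jensen's inequality carry this over to the `Q`-th powers of the norms.
  have h3 : ∀ i : Fin n, ∀ j, w j * (‖y j‖ / 2) ^ Q ≤
      ∑ f : Fin n → J with f i = j, (∏ k, w (f k)) * ‖b f i‖ ^ Q := by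
    intro i j
    rcases (hw0 j).eq_or_lt with h0 | h0
    · rw [← h0, zero_mul]
      exact Finset.sum_nonneg fun f _ => mul_nonneg (hW0 f) (by positivity)
    have hy2 : ‖(w j / 2) • y j‖ ≤ ∑ f : Fin n → J with f i = j, (∏ k, w (f k)) * ‖b f i‖ := by
      refine hι.norm_le_sum _ (fun f _ => hW0 f) ?_
      filter_upwards [coe_smul ι (w j / 2) (y j), hy j, hb', hp] with s hs1 hs2 hs3 hs4
      rw [hs1, hs2]
      by_cases hs : s ∈ A j
      · rw [Set.indicator_of_mem hs, abs_mul, abs_abs, abs_of_nonneg (by positivity)]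
        have hhalf := half_le_sum_pi hw0 hw1 i j (fun l => s ∈ A l) (by
          rw [Finset.sum_filter]
          simpa [Set.indicator_apply] using hs4)
        refine (mul_le_mul_of_nonneg_right hhalf (abs_nonneg _)).trans (le_of_eq ?_)
        rw [Finset.sum_mul]
        refine Finset.sum_congr rfl fun f hf => ?_
        have hfi : f i = j := (Finset.mem_filter.1 hf).2
        have hiff : s ∈ B f i ↔ ∀ k, k ≠ i → ¬ s ∈ A (f k) := by
          rw [hBmem, hfi]; simp [hs]
        rw [hs3, mul_assoc]
        congr 1
        by_cases hsB : s ∈ B f i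
        · rw [if_pos (hiff.1 hsB)]; simp [hsB]
        · rw [if_neg fun h => hsB (hiff.2 h)]; simp [hsB]
      · rw [Set.indicator_of_notMem hs, mul_zero, abs_zero]
        exact Finset.sum_nonneg fun f _ => mul_nonneg (hW0 f) (abs_nonneg _)
    rw [norm_smul, Real.norm_of_nonneg (by positivity)] at hy2
    have hpm := Real.pow_arith_mean_le_arith_mean_pow
      (Finset.univ.filter fun f : Fin n → J => f i = j)
      (fun f => (∏ k, w (f k)) / w j) (fun f => ‖b f i‖)
      (fun f _ => div_nonneg (hW0 f) h0.le)
      (by rw [← Finset.sum_div, sum_pi_fiber hw1, div_self h0.ne'])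
      (fun f _ => norm_nonneg _) Q
    simp only [div_mul_eq_mul_div, ← Finset.sum_div] at hpm
    rw [le_div_iff₀ h0] at hpm
    refine le_trans ?_ hpm
    rw [mul_comm]
    refine mul_le_mul_of_nonneg_right (pow_le_pow_left₀ (by positivity) ?_ Q) h0.le
    rw [le_div_iff₀ h0]
    linarith
  have h4 : n * ∑ j, w j * (‖y j‖ / 2) ^ Q ≤ (C * ‖g‖) ^ Q := by
    calc n * ∑ j, w j * (‖y j‖ / 2) ^ Q = ∑ i : Fin n, ∑ j, w j * (‖y j‖ / 2) ^ Q := by simp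
      _ ≤ ∑ i : Fin n, ∑ j, ∑ f : Fin n → J with f i = j, (∏ k, w (f k)) * ‖b f i‖ ^ Q :=
          Finset.sum_le_sum fun i _ => Finset.sum_le_sum fun j _ => h3 i j
      _ = ∑ i : Fin n, ∑ f : Fin n → J, (∏ k, w (f k)) * ‖b f i‖ ^ Q :=
          Finset.sum_congr rfl fun i _ =>
            Finset.sum_fiberwise_of_maps_to (fun f _ => Finset.mem_univ (f i)) _
      _ = ∑ f : Fin n → J, (∏ k, w (f k)) * ∑ i, ‖b f i‖ ^ Q := by
          rw [Finset.sum_comm]; simp [Finset.mul_sum]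
      _ ≤ _ := h2
  calc n * ∑ j, w j * ‖y j‖ ^ Q = 2 ^ Q * (n * ∑ j, w j * (‖y j‖ / 2) ^ Q) := by
        simp only [Finset.mul_sum, div_pow]
        refine Finset.sum_congr rfl fun j _ => ?_
        field_simp
    _ ≤ 2 ^ Q * (C * ‖g‖) ^ Q := by gcongr
    _ = _ := by rw [← mul_pow]; ring

/-- Dyadic slicing: at the largest level `κ * 2 ^ l * γ` exceeded by `x`, the corresponding summand
is the next level, which `x` does not exceed. If no level is exceeded, the first term suffices. -/
lemma abs_le_sum_levels {κ x γ : ℝ} (hκ : 0 ≤ κ) (hγ : 0 ≤ γ) (m : ℕ) (h : x ≤ κ * 2 ^ m * γ) :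
    x ≤ κ * γ + ∑ l ∈ Finset.range m, κ * 2 ^ (l + 1) * (if κ * 2 ^ l * γ < x then γ else 0) := by
  induction m with
  | zero => simpa using h
  | succ m ih =>
    rw [Finset.sum_range_succ]
    by_cases hx : κ * 2 ^ m * γ < x
    · rw [if_pos hx]
      have : 0 ≤ ∑ l ∈ Finset.range m, κ * 2 ^ (l + 1) * (if κ * 2 ^ l * γ < x then γ else 0) :=
        Finset.sum_nonneg fun l _ => by split_ifs <;> positivity
      have : 0 ≤ κ * γ := by positivity
      linarith
    · rw [if_neg hx]
      have := ih (not_lt.1 hx)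
      linarith

/-- A family of elements whose values have, at each point, tails controlled by `g` has second
moment controlled by the norm of `g`. -/
lemma sum_mul_norm_sq_le (hι : IsFunctionSpace μ ι) {R : ℕ} {C : ℝ}
    (hC : 0 < C) (hQ : HasLowerEstimate ι (2 * R) C) (hR : 1 ≤ R)
    {J : Type*} [Fintype J] {w : J → ℝ} (hw0 : ∀ j, 0 ≤ w j)
    (hw1 : ∑ j, w j = 1) {X : J → E} {g : E} {κ : ℝ} (hκ : 0 ≤ κ) {L : ℕ}
    (hL : ∀ᵐ s ∂μ, ∀ j, |ι (X j) s| ≤ κ * 2 ^ L * |ι g s|)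
    (hp : ∀ᵐ s ∂μ, ∀ l < L, 2 * (8 ^ l) ^ (2 * R) *
      (∑ j, if κ * 2 ^ l * |ι g s| < |ι (X j) s| then w j else 0) ≤ 1) :
    ∑ j, w j * ‖X j‖ ^ 2 ≤ (κ * (2 + 12 * C) * ‖g‖) ^ 2 := by
  -- `A l j` is the set where `X j` exceeds the level `κ * 2 ^ l * |g|`, and `y l j` is the
  -- restriction of `|g|` to it. By `hp` a point lies in the random set at level `l` with
  -- probability at most `1 / (2n)` for `n = (8 ^ l) ^ (2 * R)`, which gains a factor `8 ^ l` in the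
  -- norm.
  let A : ℕ → J → Set S := fun l j => {s | κ * 2 ^ l * |ι g s| < |ι (X j) s|}
  have hA : ∀ l j, MeasurableSet (A l j) := fun l j =>
    measurableSet_lt ((ι g).measurable.abs.const_mul _) (ι (X j)).measurable.abs
  have hex : ∀ l j, ∃ b : E, (∀ᵐ s ∂μ, ι b s = (A l j).indicator (fun s => |ι g s|) s) ∧
      ‖b‖ ≤ ‖g‖ := fun l j =>
    hι.exists_of_abs_le ((aestronglyMeasurable_coe ι g).norm.indicator (hA l j))
      (ae_of_all _ fun s => by by_cases hs : s ∈ A l j <;> simp [hs])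
  choose y hy _ using hex
  have hy' : ∀ᵐ s ∂μ, ∀ l j, ι (y l j) s = (A l j).indicator (fun s => |ι g s|) s :=
    ae_all_iff.2 fun l => ae_all_iff.2 fun j => hy l j
  have h1 : ∀ l < L, ∑ j, w j * ‖y l j‖ ^ 2 ≤ (2 * C * ‖g‖ / 8 ^ l) ^ 2 := by
    intro l hl
    have h := hι.sum_mul_norm_pow_le hQ hw0 hw1 (hA l) (hy l) (n := (8 ^ l) ^ (2 * R)) (by
      filter_upwards [hp] with s hs
      have := hs l hl
      push_cast
      simpa [Set.indicator_apply, A] using this)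
    -- Jensen's inequality with exponent `R` descends from moments of order `2R` to second moments.
    have hpm := Real.pow_arith_mean_le_arith_mean_pow Finset.univ w (fun j => ‖y l j‖ ^ 2)
      (fun j _ => hw0 j) hw1 (fun j _ => by positivity) R
    simp only [← pow_mul] at hpm
    have h3 : (∑ j, w j * ‖y l j‖ ^ 2) ^ R ≤ ((2 * C * ‖g‖ / 8 ^ l) ^ 2) ^ R := by
      refine hpm.trans ?_
      rw [← pow_mul, div_pow, le_div_iff₀ (by positivity), mul_comm]
      exact_mod_cast h
    exact le_of_pow_le_pow_left₀ (by omega) (by positivity) h3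
  have h2 : ∀ j, ‖X j‖ ≤ κ * ‖g‖ + ∑ l ∈ Finset.range L, κ * 2 ^ (l + 1) * ‖y l j‖ := by
    intro j
    have := hι.norm_le_sum (Finset.insertNone (Finset.range L)) (x := X j)
      (c := fun o => o.elim κ fun l => κ * 2 ^ (l + 1)) (y := fun o => o.elim g fun l => y l j)
      (by rintro (_ | l) _ <;> simp <;> positivity) (by
        filter_upwards [hL, hy'] with s hs1 hs2
        rw [Finset.sum_insertNone]
        refine (abs_le_sum_levels hκ (abs_nonneg _) L (hs1 j)).trans (le_of_eq ?_)
        simp only [Option.elim, hs2]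
        congr 1
        refine Finset.sum_congr rfl fun l _ => ?_
        by_cases hs : s ∈ A l j
        · have hs' : κ * 2 ^ l * |ι g s| < |ι (X j) s| := hs
          rw [if_pos hs', Set.indicator_of_mem hs, abs_abs]
        · have hs' : ¬ κ * 2 ^ l * |ι g s| < |ι (X j) s| := hs
          rw [if_neg hs', Set.indicator_of_notMem hs, abs_zero])
    rwa [Finset.sum_insertNone] at this
  have hgeo : ∀ m, ∑ l ∈ Finset.range m, ((1 : ℝ) / 2) ^ l ≤ 2 := sum_geometric_two_le
  have h3 : ∀ j, ‖X j‖ ^ 2 ≤ 2 * (κ * ‖g‖) ^ 2 +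
      16 * κ ^ 2 * ∑ l ∈ Finset.range L, 8 ^ l * ‖y l j‖ ^ 2 := by
    intro j
    -- Cauchy–Schwarz with the splitting `4 ^ l = (1 / 2) ^ l * 8 ^ l`. The growth `8 ^ l` is
    -- absorbed by the decay `64 ^ (-l)` of the second moments in `h1`.
    have hcs := Finset.sum_sq_le_sum_mul_sum_of_sq_le_mul (Finset.range L)
      (r := fun l => 2 ^ l * ‖y l j‖) (f := fun l => ((1 : ℝ) / 2) ^ l)
      (g := fun l => 8 ^ l * ‖y l j‖ ^ 2) (fun l _ => by positivity) (fun l _ => by positivity)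
      (fun l _ => by
        refine le_of_eq ?_
        rw [← mul_assoc, ← mul_pow, mul_pow, ← pow_mul, mul_comm l 2, pow_mul]; norm_num)
    have hnn : 0 ≤ ∑ l ∈ Finset.range L, (8 : ℝ) ^ l * ‖y l j‖ ^ 2 :=
      Finset.sum_nonneg fun l _ => by positivity
    have e : ∑ l ∈ Finset.range L, κ * 2 ^ (l + 1) * ‖y l j‖
        = 2 * κ * ∑ l ∈ Finset.range L, 2 ^ l * ‖y l j‖ := by
      rw [Finset.mul_sum]; exact Finset.sum_congr rfl fun l _ => by ring
    have h2j := h2 j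
    rw [e] at h2j
    calc ‖X j‖ ^ 2 ≤ (κ * ‖g‖ + 2 * κ * ∑ l ∈ Finset.range L, 2 ^ l * ‖y l j‖) ^ 2 :=
          pow_le_pow_left₀ (norm_nonneg _) h2j 2
      _ ≤ 2 * ((κ * ‖g‖) ^ 2 + (2 * κ * ∑ l ∈ Finset.range L, 2 ^ l * ‖y l j‖) ^ 2) := add_sq_le
      _ ≤ 2 * ((κ * ‖g‖) ^ 2 + (2 * κ) ^ 2 *
          (2 * ∑ l ∈ Finset.range L, 8 ^ l * ‖y l j‖ ^ 2)) := by
          rw [mul_pow (2 * κ)]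
          gcongr
          exact hcs.trans (mul_le_mul_of_nonneg_right (hgeo L) hnn)
      _ = _ := by ring
  calc ∑ j, w j * ‖X j‖ ^ 2 ≤ ∑ j, w j * (2 * (κ * ‖g‖) ^ 2 +
        16 * κ ^ 2 * ∑ l ∈ Finset.range L, 8 ^ l * ‖y l j‖ ^ 2) :=
        Finset.sum_le_sum fun j _ => mul_le_mul_of_nonneg_left (h3 j) (hw0 j)
    _ = 2 * (κ * ‖g‖) ^ 2 + 16 * κ ^ 2 * ∑ l ∈ Finset.range L, 8 ^ l *
        ∑ j, w j * ‖y l j‖ ^ 2 := by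
        simp only [mul_add, Finset.sum_add_distrib, ← Finset.sum_mul, hw1, one_mul]
        congr 1
        simp only [Finset.mul_sum]
        rw [Finset.sum_comm]
        refine Finset.sum_congr rfl fun l _ => Finset.sum_congr rfl fun j _ => by ring
    _ ≤ 2 * (κ * ‖g‖) ^ 2 + 16 * κ ^ 2 * ∑ l ∈ Finset.range L,
        (2 * C * ‖g‖) ^ 2 * (1 / 2) ^ l := by
        refine add_le_add le_rfl (mul_le_mul_of_nonneg_left (Finset.sum_le_sum fun l hl => ?_)
          (by positivity))
        refine (mul_le_mul_of_nonneg_left (h1 l (Finset.mem_range.1 hl)) (by positivity)).trans ?_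
        rw [div_pow, mul_div_assoc', div_le_iff₀ (by positivity)]
        have : (8 : ℝ) ^ l ≤ (1 / 2) ^ l * (8 ^ l) ^ 2 := by
          rw [← pow_mul, mul_comm l 2, pow_mul, ← mul_pow]
          exact pow_le_pow_left₀ (by norm_num) (by norm_num) l
        calc (8 : ℝ) ^ l * (2 * C * ‖g‖) ^ 2 ≤ ((1 / 2) ^ l * (8 ^ l) ^ 2) * (2 * C * ‖g‖) ^ 2 := by
              gcongr
          _ = _ := by ring
    _ ≤ 2 * (κ * ‖g‖) ^ 2 + 16 * κ ^ 2 * ((2 * C * ‖g‖) ^ 2 * 2) := by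
        rw [← Finset.mul_sum]
        gcongr
        exact hgeo L
    _ ≤ _ := by
        have : 0 ≤ (κ * ‖g‖) ^ 2 * C := by positivity
        have : 0 ≤ (κ * ‖g‖) ^ 2 * C ^ 2 := by positivity
        nlinarith [sq_nonneg (κ * ‖g‖)]

end IsFunctionSpace

/-! ### Tails and small balls of real Gaussian variables. -/

lemma gaussianReal_eq_map_sqrt (v : ℝ≥0) :
    gaussianReal 0 v = (gaussianReal 0 1).map (fun x => √v * x) := by
  rw [gaussianReal_map_const_mul]
  congr 1
  · simp
  · ext; simp

/-- Uniform polynomial tail bounds for centred Gaussian variables. -/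
lemma exists_gaussianReal_tail (R : ℕ) (hR : 1 ≤ R) :
    ∃ κ : ℝ, 1 ≤ κ ∧ ∀ (v : ℝ≥0) (l : ℕ),
      2 * (8 ^ l) ^ (2 * R) * (gaussianReal 0 v).real {z | κ * 2 ^ l * √v < |z|} ≤ 1 := by
  -- Markov's inequality is applied to the moment of order `6R`, because `(8 ^ l) ^ (2 * R) = (2 ^
  -- l) ^ (6 * R)`. The choice `2 * M ≤ κ ≤ κ ^ (6 * R)` absorbs both the moment and the factor `2`.
  have hint : Integrable (fun x : ℝ => |x| ^ (6 * R)) (gaussianReal 0 1) := by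
    have := (memLp_id_gaussianReal (μ := 0) (v := 1) ((6 * R : ℕ) : ℝ≥0)).integrable_norm_rpow'
    refine this.congr (ae_of_all _ fun x => ?_)
    simp [← Real.rpow_natCast]
  set M := ∫ x : ℝ, |x| ^ (6 * R) ∂(gaussianReal 0 1) with hM
  have hM0 : 0 ≤ M := integral_nonneg fun x => by positivity
  refine ⟨max 1 (2 * M), le_max_left _ _, fun v l => ?_⟩
  set κ := max 1 (2 * M)
  have hκ1 : 1 ≤ κ := le_max_left _ _
  have hκM : 2 * M ≤ κ := le_max_right _ _
  have hms : MeasurableSet {z : ℝ | κ * 2 ^ l * √v < |z|} :=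
    measurableSet_lt measurable_const measurable_id.abs
  have h1 : (gaussianReal 0 v).real {z | κ * 2 ^ l * √v < |z|}
      ≤ (gaussianReal 0 1).real {z | (κ * 2 ^ l) ^ (6 * R) ≤ |z| ^ (6 * R)} := by
    rw [gaussianReal_eq_map_sqrt, map_measureReal_apply (by fun_prop) hms]
    refine measureReal_mono (fun z hz => ?_) (measure_ne_top _ _)
    simp only [Set.mem_preimage, Set.mem_ofPred_eq, abs_mul, abs_of_nonneg (Real.sqrt_nonneg _)] at hz
    have : κ * 2 ^ l < |z| := by
      rcases (Real.sqrt_nonneg (v : ℝ)).eq_or_lt with h | h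
      · rw [← h] at hz; simp at hz
      · rw [mul_comm] at hz
        exact lt_of_mul_lt_mul_left hz h.le
    exact pow_le_pow_left₀ (by positivity) this.le _
  have h2 := mul_meas_ge_le_integral_of_nonneg (μ := gaussianReal 0 1)
    (f := fun x : ℝ => |x| ^ (6 * R)) (ae_of_all _ fun x => by positivity) hint
    ((κ * 2 ^ l) ^ (6 * R))
  have h3 : ((8 : ℝ) ^ l) ^ (2 * R) = (2 ^ l) ^ (6 * R) := by
    rw [show (8 : ℝ) = 2 ^ 3 by norm_num, ← pow_mul, ← pow_mul, ← pow_mul]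
    congr 1; ring
  have h4 : κ ≤ κ ^ (6 * R) := le_self_pow₀ hκ1 (by omega)
  set p := (gaussianReal 0 1).real {z | (κ * 2 ^ l) ^ (6 * R) ≤ |z| ^ (6 * R)}
  have hp0 : 0 ≤ p := measureReal_nonneg
  have hq : 2 * (8 ^ l) ^ (2 * R) * p ≤ 1 := by
    have hκ0 : 0 < κ := by linarith
    have h5 : κ * ((2 ^ l) ^ (6 * R) * p) ≤ M := by
      refine le_trans ?_ h2
      rw [mul_pow, mul_assoc]
      exact mul_le_mul_of_nonneg_right h4 (by positivity)
    rw [h3]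
    have h6 : κ * (2 * (2 ^ l) ^ (6 * R) * p) ≤ κ * 1 := by linarith
    exact le_of_mul_le_mul_left h6 hκ0
  exact (mul_le_mul_of_nonneg_left h1 (by positivity)).trans hq

/-- Uniform small ball bound for centred Gaussian variables. -/
lemma exists_gaussianReal_smallBall :
    ∃ δ : ℝ, 0 < δ ∧ ∀ v : ℝ≥0, v ≠ 0 → (gaussianReal 0 v).real {z | |z| < δ * √v} ≤ 1 / 4 := by
  -- The balls shrink to the origin, a null set for the standard law, so one of them is small
  -- enough; scaling by `√v` then covers every nonzero variance.
  have hlim : Tendsto (fun n : ℕ => gaussianReal 0 1 (Metric.closedBall 0 (1 / (n + 1 : ℝ)))) atTop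
      (𝓝 (gaussianReal 0 1 (⋂ n : ℕ, Metric.closedBall 0 (1 / (n + 1 : ℝ))))) :=
    tendsto_measure_iInter_atTop (fun n => measurableSet_closedBall.nullMeasurableSet)
      (fun m n hmn => Metric.closedBall_subset_closedBall (one_div_le_one_div_of_le (by positivity)
        (by exact_mod_cast Nat.succ_le_succ hmn))) ⟨0, measure_ne_top _ _⟩
  have hinter : (⋂ n : ℕ, Metric.closedBall (0 : ℝ) (1 / (n + 1 : ℝ))) = {0} := by
    ext x
    simp only [Set.mem_iInter, Metric.mem_closedBall, dist_zero_right, Set.mem_singleton_iff]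
    refine ⟨fun h => ?_, fun h n => by subst h; simp; positivity⟩
    rw [← norm_le_zero_iff]
    exact ge_of_tendsto tendsto_one_div_add_atTop_nhds_zero_nat (Eventually.of_forall h)
  have h0 : gaussianReal 0 1 {(0 : ℝ)} = 0 := by
    have := nullSingletonClass_gaussianReal (μ := 0) (v := 1) one_ne_zero
    exact measure_singleton 0
  rw [hinter, h0] at hlim
  obtain ⟨n, hn⟩ := (hlim.eventually (gt_mem_nhds (show (0 : ℝ≥0∞) < ENNReal.ofReal (1 / 4) by
    simp))).exists
  refine ⟨1 / (n + 1 : ℝ), by positivity, fun v hv => ?_⟩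
  have hms : MeasurableSet {z : ℝ | |z| < 1 / (n + 1 : ℝ) * √v} :=
    measurableSet_lt measurable_id.abs measurable_const
  rw [gaussianReal_eq_map_sqrt, map_measureReal_apply (by fun_prop) hms]
  have hv' : 0 < √(v : ℝ) := Real.sqrt_pos.2 (by exact_mod_cast pos_iff_ne_zero.2 hv)
  refine le_trans (measureReal_mono (fun z hz => ?_) (measure_ne_top _ _))
    (ENNReal.toReal_le_of_le_ofReal (by norm_num) hn.le)
  simp only [Set.mem_preimage, Set.mem_ofPred_eq, abs_mul, abs_of_nonneg hv'.le] at hz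
  rw [mul_comm (1 / (n + 1 : ℝ))] at hz
  simpa using (lt_of_mul_lt_mul_left hz hv'.le).le

/-! ### Gaussian sums in a function space. -/

section Simple

variable {Ω : Type*} {mΩ : MeasurableSpace Ω} {P : Measure Ω} [IsProbabilityMeasure P]

/-- A simple random variable is turned into a finite family of weights, the masses of its fibres,
which is the setting of the moment estimates above. -/
lemma SimpleFunc.sum_measureReal_mul {V : Type*} (τ : SimpleFunc Ω V) (F : V → ℝ) :
    ∑ j : τ.range, P.real (τ ⁻¹' {(j : V)}) * F j = ∫ ω, F (τ ω) ∂P := by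
  classical
  have h : ∀ ω, F (τ ω) = ∑ j ∈ τ.range, (τ ⁻¹' {j}).indicator (fun _ => F j) ω := by
    intro ω
    rw [Finset.sum_eq_single (τ ω)]
    · simp
    · intro b _ hb
      simp [Ne.symm hb]
    · intro h
      exact absurd (τ.mem_range_self ω) h
  simp only [h]
  rw [integral_finsetSum _ fun j _ => (integrable_const _).indicator (τ.measurableSet_fiber j)]
  simp only [integral_indicator_const _ (τ.measurableSet_fiber _), smul_eq_mul]
  exact Finset.sum_coe_sort τ.range fun j => P.real (τ ⁻¹' {j}) * F j

end Simple

namespace IsFunctionSpace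

variable {S : Type*} [MeasurableSpace S] {μ : Measure S}
  {E : Type*} [NormedAddCommGroup E] [NormedSpace ℝ E] {ι : E →ₗ[ℝ] (S →ₘ[μ] ℝ)}
  {Ω : Type*} {mΩ : MeasurableSpace Ω} {P : Measure Ω} [IsProbabilityMeasure P]

lemma abs_sum_mul_le {α : Type*} [Fintype α] (a b : α → ℝ) : |∑ k, a k * b k| ≤ ‖a‖ * ∑ k, |b k| := by
  rw [Finset.mul_sum]
  refine (Finset.abs_sum_le_sum_abs _ _).trans (Finset.sum_le_sum fun k _ => ?_)
  rw [abs_mul]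
  exact mul_le_mul_of_nonneg_right (norm_le_pi_norm a k) (abs_nonneg _)

/-- Replacing the Gaussian coefficients by a simple `τ` makes the random sum take finitely many
values, so the finite estimate applies. The error is absorbed by enlarging `g` to `|g| + ε * ∑ |x
k|`, which keeps the tail events of the discretized sum inside the Gaussian ones. The alternative `τ
ω = 0` is harmless, since a vanishing sum lies in no tail event. -/
lemma sum_mul_norm_sq_le_of_gaussian_approx (hι : IsFunctionSpace μ ι) {R : ℕ} {C κ : ℝ}
    (hC : 0 < C) (hQ : HasLowerEstimate ι (2 * R) C) (hR : 1 ≤ R) (hκ : 1 ≤ κ)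
    (hκv : ∀ (v : ℝ≥0) (l : ℕ),
      2 * (8 ^ l) ^ (2 * R) * (gaussianReal 0 v).real {z | κ * 2 ^ l * √v < |z|} ≤ 1)
    {α : Type*} [Fintype α] {γ : Ω → α → ℝ} {v : (α → ℝ) → ℝ≥0}
    (hv : ∀ a : α → ℝ, HasLaw (fun ω => ∑ k, γ ω k * a k) (gaussianReal 0 (v a)) P)
    {x : α → E} {g : E} (hg : ∀ᵐ s ∂μ, ι g s ^ 2 = v fun k => ι (x k) s)
    {ε : ℝ} (hε : 0 < ε) (τ : SimpleFunc Ω (α → ℝ)) (hτ : ∀ ω, ‖τ ω - γ ω‖ ≤ ε ∨ τ ω = 0) :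
    ∫ ω, ‖∑ k, τ ω k • x k‖ ^ 2 ∂P ≤ (κ * (2 + 12 * C) * (‖g‖ + ε * ∑ k, ‖x k‖)) ^ 2 := by
  obtain ⟨G, hG, hGn⟩ := hι.exists_of_abs_le_sum (Finset.insertNone (Finset.univ : Finset α))
    (c := fun o => o.elim 1 fun _ => ε) (y := fun o => o.elim g x)
    (f := fun s => |ι g s| + ε * ∑ k, |ι (x k) s|)
    (by rintro (_ | l) _ <;> simp [hε.le])
    ((aestronglyMeasurable_coe ι g).norm.add ((Finset.aestronglyMeasurable_fun_sum _ fun k _ =>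
      (aestronglyMeasurable_coe ι (x k)).norm).const_mul ε)) (ae_of_all _ fun s => by
        rw [Finset.sum_insertNone, abs_of_nonneg (by positivity), Finset.mul_sum]
        simp)
  have hGn' : ‖G‖ ≤ ‖g‖ + ε * ∑ k, ‖x k‖ := by
    rw [Finset.sum_insertNone] at hGn
    simpa [Finset.mul_sum] using hGn
  have hX : ∀ᵐ s ∂μ, ∀ j : τ.range, ι (∑ k, (j : α → ℝ) k • x k) s
      = ∑ k, (j : α → ℝ) k * ι (x k) s := ae_all_iff.2 fun j => coe_sum_smul ι _ _ _
  obtain ⟨B, hB0, hB⟩ : ∃ B : ℝ, 0 ≤ B ∧ ∀ j : τ.range, ‖(j : α → ℝ)‖ ≤ B :=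
    ⟨∑ j : τ.range, ‖(j : α → ℝ)‖, Finset.sum_nonneg fun _ _ => norm_nonneg _, fun j =>
      Finset.single_le_sum (f := fun j : τ.range => ‖(j : α → ℝ)‖) (fun _ _ => norm_nonneg _)
        (Finset.mem_univ j)⟩
  -- Since `τ` is bounded by `B ≤ 2 ^ L * ε`, the term `ε * ∑ |x k|` in the enlarged function
  -- guarantees that finitely many levels suffice.
  obtain ⟨L, hL⟩ := pow_unbounded_of_one_lt (B / ε) (one_lt_two (α := ℝ))
  have key := hι.sum_mul_norm_sq_le hC hQ hR (J := τ.range)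
    (w := fun j => P.real (τ ⁻¹' {(j : α → ℝ)})) (fun j => measureReal_nonneg)
    (by simpa using SimpleFunc.sum_measureReal_mul (P := P) τ fun _ => 1)
    (X := fun j => ∑ k, (j : α → ℝ) k • x k) (g := G) (κ := κ) (by linarith) (L := L)
    (by
      filter_upwards [hX, hG] with s h1 h2 j
      have h0 : 0 ≤ ∑ k, |ι (x k) s| := Finset.sum_nonneg fun _ _ => abs_nonneg _
      rw [h1, h2, abs_of_nonneg (a := |ι g s| + _) (by positivity)]
      refine (abs_sum_mul_le _ _).trans ?_
      have h3 : B ≤ 2 ^ L * ε := by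
        rw [div_lt_iff₀ hε] at hL; exact hL.le
      calc ‖(j : α → ℝ)‖ * ∑ k, |ι (x k) s| ≤ (2 ^ L * ε) * ∑ k, |ι (x k) s| :=
            mul_le_mul_of_nonneg_right ((hB j).trans h3) h0
        _ = 1 * 2 ^ L * (ε * ∑ k, |ι (x k) s|) := by ring
        _ ≤ κ * 2 ^ L * (|ι g s| + ε * ∑ k, |ι (x k) s|) := by
            gcongr
            linarith [abs_nonneg (ι g s)])
    (by
      filter_upwards [hX, hG, hg] with s h1 h2 h3 l _
      have h0 : 0 ≤ ∑ k, |ι (x k) s| := Finset.sum_nonneg fun _ _ => abs_nonneg _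
      refine le_trans ?_ (hκv (v fun k => ι (x k) s) l)
      refine mul_le_mul_of_nonneg_left ?_ (by positivity)
      have hms : MeasurableSet {z : ℝ | κ * 2 ^ l * √(v fun k => ι (x k) s : ℝ≥0) < |z|} :=
        measurableSet_lt measurable_const measurable_id.abs
      have hlaw := (hv fun k => ι (x k) s)
      rw [← hlaw.map_eq, map_measureReal_apply_of_aemeasurable hlaw.aemeasurable hms]
      have h4 := SimpleFunc.sum_measureReal_mul (P := P) τ fun j =>
        if κ * 2 ^ l * |ι G s| < |∑ k, j k * ι (x k) s| then 1 else 0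
      have hms2 : MeasurableSet {ω | κ * 2 ^ l * |ι G s| < |∑ k, τ ω k * ι (x k) s|} :=
        (τ.measurableSet_preimage {j | κ * 2 ^ l * |ι G s| < |∑ k, j k * ι (x k) s|})
      have h5 : ∫ ω, (if κ * 2 ^ l * |ι G s| < |∑ k, τ ω k * ι (x k) s| then (1 : ℝ) else 0) ∂P
          = P.real {ω | κ * 2 ^ l * |ι G s| < |∑ k, τ ω k * ι (x k) s|} := by
        rw [← integral_indicator_one hms2]
        rfl
      rw [h5] at h4
      simp only [mul_ite, mul_one, mul_zero] at h4
      simp only [h1]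
      rw [h4]
      refine measureReal_mono (fun ω hω => ?_) (measure_ne_top _ _)
      simp only [Set.mem_ofPred_eq, Set.mem_preimage] at hω ⊢
      rw [← h3, Real.sqrt_sq_eq_abs]
      rw [h2, abs_of_nonneg (a := |ι g s| + _) (by positivity)] at hω
      rcases hτ ω with h | h
      · have h6 : |∑ k, τ ω k * ι (x k) s| ≤ |∑ k, γ ω k * ι (x k) s| + ε * ∑ k, |ι (x k) s| := by
          have e : ∑ k, τ ω k * ι (x k) s = ∑ k, γ ω k * ι (x k) s +
              ∑ k, (τ ω - γ ω) k * ι (x k) s := by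
            rw [← Finset.sum_add_distrib]
            exact Finset.sum_congr rfl fun k _ => by simp only [Pi.sub_apply]; ring
          rw [e]
          refine (abs_add_le _ _).trans (add_le_add le_rfl ((abs_sum_mul_le _ _).trans ?_))
          exact mul_le_mul_of_nonneg_right h h0
        have h7 : ε * ∑ k, |ι (x k) s| ≤ κ * 2 ^ l * (ε * ∑ k, |ι (x k) s|) :=
          le_mul_of_one_le_left (by positivity)
            (one_le_mul_of_one_le_of_one_le hκ (one_le_pow₀ one_le_two))
        linarith
      · rw [h] at hω
        simp only [Pi.zero_apply, zero_mul, Finset.sum_const_zero, abs_zero] at hω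
        have : 0 ≤ κ * 2 ^ l * (|ι g s| + ε * ∑ k, |ι (x k) s|) := by positivity
        linarith)
  rw [SimpleFunc.sum_measureReal_mul (P := P) τ fun j => ‖∑ k, j k • x k‖ ^ 2] at key
  refine key.trans (pow_le_pow_left₀ (by positivity) ?_ 2)
  exact mul_le_mul_of_nonneg_left hGn' (by positivity)

end IsFunctionSpace

lemma continuous_sum_smul {E : Type*} [NormedAddCommGroup E] [NormedSpace ℝ E] {α : Type*} [Fintype α]
    (x : α → E) : Continuous fun a : α → ℝ => ∑ k, a k • x k := by fun_prop

section Approx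

variable {Ω : Type*} {mΩ : MeasurableSpace Ω}

/-- The approximations are set to zero wherever they are not yet within `ε` of `γ`. Thus the
alternative holds at every index, and the limit at each `ω` is unaffected. -/
lemma exists_simpleFunc_approx {α : Type*} [Fintype α] {γ : Ω → α → ℝ} (hγ : Measurable γ) {ε : ℝ}
    (hε : 0 < ε) : ∃ τ : ℕ → SimpleFunc Ω (α → ℝ),
      (∀ m ω, ‖τ m ω - γ ω‖ ≤ ε ∨ τ m ω = 0) ∧
      ∀ ω, Tendsto (fun m => τ m ω) atTop (𝓝 (γ ω)) := by
  classical
  have hsm : StronglyMeasurable γ := hγ.stronglyMeasurable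
  have hmeas : ∀ m, MeasurableSet {ω | ‖hsm.approx m ω - γ ω‖ ≤ ε} := fun m =>
    measurableSet_le (((hsm.approx m).measurable.sub hγ).norm) measurable_const
  refine ⟨fun m => SimpleFunc.piecewise _ (hmeas m) (hsm.approx m) 0, fun m ω => ?_, fun ω => ?_⟩
  · by_cases h : ‖hsm.approx m ω - γ ω‖ ≤ ε
    · left; simp [h]
    · right; simp [h]
  · refine (hsm.tendsto_approx ω).congr' ?_
    have := (tendsto_iff_norm_sub_tendsto_zero.1 (hsm.tendsto_approx ω)).eventually (gt_mem_nhds hε)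
    filter_upwards [this] with m hm
    simp [hm.le]

end Approx

namespace IsFunctionSpace

variable {S : Type*} [MeasurableSpace S] {μ : Measure S}
  {E : Type*} [NormedAddCommGroup E] [NormedSpace ℝ E] {ι : E →ₗ[ℝ] (S →ₘ[μ] ℝ)}
  {Ω : Type*} {mΩ : MeasurableSpace Ω} {P : Measure Ω} [IsProbabilityMeasure P]

/-- The second moment of a Gaussian sum is controlled by its square function. -/
lemma lintegral_gaussian_sum_le (hι : IsFunctionSpace μ ι) {R : ℕ} {C κ : ℝ}
    (hC : 0 < C) (hQ : HasLowerEstimate ι (2 * R) C) (hR : 1 ≤ R) (hκ : 1 ≤ κ)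
    (hκv : ∀ (v : ℝ≥0) (l : ℕ),
      2 * (8 ^ l) ^ (2 * R) * (gaussianReal 0 v).real {z | κ * 2 ^ l * √v < |z|} ≤ 1)
    {α : Type*} [Fintype α] {γ : Ω → α → ℝ} (hγ : Measurable γ) {v : (α → ℝ) → ℝ≥0}
    (hv : ∀ a : α → ℝ, HasLaw (fun ω => ∑ k, γ ω k * a k) (gaussianReal 0 (v a)) P)
    {x : α → E} {g : E} (hg : ∀ᵐ s ∂μ, ι g s ^ 2 = v fun k => ι (x k) s) :
    ∫⁻ ω, ‖∑ k, γ ω k • x k‖ₑ ^ 2 ∂P ≤ (ENNReal.ofReal (κ * (2 + 12 * C)) * ‖g‖ₑ) ^ 2 := by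
  have hcont : Continuous fun a : α → ℝ => ‖∑ k, a k • x k‖ₑ ^ 2 :=
    (ENNReal.continuous_pow 2).comp (continuous_sum_smul x).enorm
  -- Fatou's lemma along the simple approximations for fixed `ε`; afterwards `ε` tends to zero.
  have step : ∀ ε : ℝ, 0 < ε → ∫⁻ ω, ‖∑ k, γ ω k • x k‖ₑ ^ 2 ∂P ≤
      ENNReal.ofReal ((κ * (2 + 12 * C) * (‖g‖ + ε * ∑ k, ‖x k‖)) ^ 2) := by
    intro ε hε
    obtain ⟨τ, hτ, hlim⟩ := exists_simpleFunc_approx hγ hε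
    have h1 : ∀ ω, ‖∑ k, γ ω k • x k‖ₑ ^ 2 =
        liminf (fun m => ‖∑ k, τ m ω k • x k‖ₑ ^ 2) atTop := fun ω =>
      (((hcont.tendsto _).comp (hlim ω)).liminf_eq).symm
    simp only [h1]
    refine (lintegral_liminf_le fun m => (hcont.measurable.comp (τ m).measurable)).trans ?_
    refine liminf_le_of_le (by isBoundedDefault) fun b hb => ?_
    obtain ⟨m, hm⟩ := hb.exists
    refine hm.trans ?_
    have h2 := hι.sum_mul_norm_sq_le_of_gaussian_approx hC hQ hR hκ hκv hv hg hε (τ m) (hτ m)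
    have h3 : ∫⁻ ω, ‖∑ k, τ m ω k • x k‖ₑ ^ 2 ∂P
        = ENNReal.ofReal (∫ ω, ‖∑ k, τ m ω k • x k‖ ^ 2 ∂P) := by
      rw [ofReal_integral_eq_lintegral_ofReal]
      · refine lintegral_congr fun ω => ?_
        rw [ENNReal.ofReal_pow (norm_nonneg _), ofReal_norm]
      · exact SimpleFunc.integrable_of_isFiniteMeasure (μ := P)
          ((τ m).map fun j : α → ℝ => ‖∑ k, j k • x k‖ ^ 2)
      · exact ae_of_all _ fun ω => by positivity
    exact h3.le.trans <| ENNReal.ofReal_le_ofReal h2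
  have hlim : Tendsto (fun ε : ℝ => ENNReal.ofReal
      ((κ * (2 + 12 * C) * (‖g‖ + ε * ∑ k, ‖x k‖)) ^ 2)) (𝓝[>] 0)
      (𝓝 (ENNReal.ofReal ((κ * (2 + 12 * C) * (‖g‖ + 0 * ∑ k, ‖x k‖)) ^ 2))) :=
    ((ENNReal.continuous_ofReal.comp (by fun_prop)).tendsto (0 : ℝ)).mono_left nhdsWithin_le_nhds
  refine (ge_of_tendsto hlim (by
    filter_upwards [self_mem_nhdsWithin] with ε hε using step ε hε)).trans (le_of_eq ?_)
  rw [zero_mul, add_zero, ENNReal.ofReal_pow (by positivity), ENNReal.ofReal_mul (by positivity),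
    ofReal_norm]

/-- The square function of a Gaussian sum is controlled by a quantile of its norm. -/
lemma norm_le_of_gaussian_sum (hι : IsFunctionSpace μ ι) {δ : ℝ} (hδ : 0 < δ)
    (hδv : ∀ v : ℝ≥0, v ≠ 0 → (gaussianReal 0 v).real {z | |z| < δ * √v} ≤ 1 / 4)
    {α : Type*} [Fintype α] {γ : Ω → α → ℝ} (hγ : Measurable γ) {v : (α → ℝ) → ℝ≥0}
    (hv : ∀ a : α → ℝ, HasLaw (fun ω => ∑ k, γ ω k * a k) (gaussianReal 0 (v a)) P)
    {x : α → E} {g : E} (hg : ∀ᵐ s ∂μ, ι g s ^ 2 = v fun k => ι (x k) s)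
    {r : ℝ} (hr : 0 < r) (hP : P.real {ω | r < ‖∑ k, γ ω k • x k‖} ≤ 1 / 8) :
    ‖g‖ ≤ 16 / (3 * δ) * r := by
  classical
  -- Four exceptional events are discarded at a given `s`: a small value of the Gaussian variable
  -- (at most `1 / 4`), a large norm of the sum (at most `1 / 8`), and two failures of the
  -- approximation (at most `1 / 8` each). On the rest, of probability at least `3 / 8`, the
  -- discretized sum has norm at most `2 * r`, while its value at `s` is at least `δ * |ι g s|` up
  -- to the error `ε * ∑ |ι (x k) s|`.
  have step : ∀ ε : ℝ, 0 < ε → 3 / 8 * δ * ‖g‖ ≤ 2 * r + ε * ∑ k, ‖x k‖ := by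
    intro ε hε
    obtain ⟨τ, -, hlim⟩ := exists_simpleFunc_approx hγ hε
    have hc := (continuous_sum_smul x)
    have ht1 : TendstoInMeasure P (fun m => (τ m : Ω → α → ℝ)) atTop γ :=
      tendstoInMeasure_of_tendsto_ae (fun m => (τ m).aestronglyMeasurable)
        (ae_of_all _ hlim)
    have ht2 : TendstoInMeasure P (fun m ω => ∑ k, τ m ω k • x k) atTop
        (fun ω => ∑ k, γ ω k • x k) :=
      tendstoInMeasure_of_tendsto_ae (fun m => ((τ m).map fun a : α → ℝ => ∑ k, a k • x k).aestronglyMeasurable)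
        (ae_of_all _ fun ω => (hc.tendsto _).comp (hlim ω))
    rw [tendstoInMeasure_iff_measureReal_norm] at ht1 ht2
    have e1 := (ht1 ε hε).eventually (gt_mem_nhds (show (0 : ℝ) < 1 / 8 by norm_num))
    have e2 := (ht2 r hr).eventually (gt_mem_nhds (show (0 : ℝ) < 1 / 8 by norm_num))
    obtain ⟨m, hm1, hm2⟩ := (e1.and e2).exists
    set σ := τ m
    have hX : ∀ᵐ s ∂μ, ∀ j : σ.range, ι (∑ k, (j : α → ℝ) k • x k) s
        = ∑ k, (j : α → ℝ) k * ι (x k) s := ae_all_iff.2 fun j => coe_sum_smul ι _ _ _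
    -- Discarding the values of norm above `2 * r` bounds the weighted sum of the norms without any
    -- moment assumption.
    let w : σ.range → ℝ := fun j => P.real (σ ⁻¹' {(j : α → ℝ)}) *
      if ‖∑ k, (j : α → ℝ) k • x k‖ ≤ 2 * r then 1 else 0
    have hw0 : ∀ j, 0 ≤ w j := fun j => mul_nonneg measureReal_nonneg (by split_ifs <;> simp)
    have hw1 : ∑ j, w j * ‖∑ k, (j : α → ℝ) k • x k‖ ≤ 2 * r := by
      calc ∑ j, w j * ‖∑ k, (j : α → ℝ) k • x k‖
          ≤ ∑ j : σ.range, P.real (σ ⁻¹' {(j : α → ℝ)}) * (2 * r) := by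
            refine Finset.sum_le_sum fun j _ => ?_
            simp only [w]
            split_ifs with h
            · rw [mul_one]; exact mul_le_mul_of_nonneg_left h measureReal_nonneg
            · rw [mul_zero, zero_mul]; positivity
        _ = 2 * r := by
            rw [SimpleFunc.sum_measureReal_mul (P := P) σ fun _ => 2 * r]; simp
    have key : ∀ᵐ s ∂μ, 3 / 8 * δ * |ι g s| ≤
        ∑ j, w j * |ι (∑ k, (j : α → ℝ) k • x k) s| + ε * ∑ k, |ι (x k) s| := by
      filter_upwards [hX, hg] with s h1 h2
      have h0 : 0 ≤ ∑ k, |ι (x k) s| := Finset.sum_nonneg fun _ _ => abs_nonneg _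
      by_cases hg0 : ι g s = 0
      · rw [hg0, abs_zero, mul_zero]
        exact add_nonneg (Finset.sum_nonneg fun j _ => mul_nonneg (hw0 j) (abs_nonneg _))
          (by positivity)
      have hv0 : v (fun k => ι (x k) s) ≠ 0 := by
        intro h
        rw [h] at h2
        exact hg0 (by simpa using h2)
      have hsq : √(v (fun k => ι (x k) s) : ℝ) = |ι g s| := by rw [← h2, Real.sqrt_sq_eq_abs]
      simp only [h1]
      have hsum : ∑ j, w j * |∑ k, (j : α → ℝ) k * ι (x k) s| = ∫ ω,
          (if ‖∑ k, σ ω k • x k‖ ≤ 2 * r then 1 else 0) * |∑ k, σ ω k * ι (x k) s| ∂P := by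
        rw [← SimpleFunc.sum_measureReal_mul (P := P) σ fun j =>
          (if ‖∑ k, j k • x k‖ ≤ 2 * r then 1 else 0) * |∑ k, j k * ι (x k) s|]
        simp only [w, mul_assoc]
      rw [hsum]
      have hlaw := hv fun k => ι (x k) s
      have hms : MeasurableSet {z : ℝ | |z| < δ * √(v fun k => ι (x k) s : ℝ≥0)} :=
        measurableSet_lt measurable_id.abs measurable_const
      have hsb := hδv _ hv0
      rw [← hlaw.map_eq, map_measureReal_apply_of_aemeasurable hlaw.aemeasurable hms] at hsb
      set A1 := (fun ω => ∑ k, γ ω k * ι (x k) s) ⁻¹'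
        {z : ℝ | |z| < δ * √(v fun k => ι (x k) s : ℝ≥0)} with hA1
      set A2 := {ω | r < ‖∑ k, γ ω k • x k‖} with hA2
      set A3 := {ω | ε ≤ ‖σ ω - γ ω‖} with hA3
      set A4 := {ω | r ≤ ‖∑ k, σ ω k • x k - ∑ k, γ ω k • x k‖} with hA4
      have hmA1 : MeasurableSet A1 := by
        have : Measurable fun ω => ∑ k, γ ω k * ι (x k) s :=
          Finset.measurable_fun_sum _ fun k _ => ((measurable_pi_apply k).comp hγ).mul_const _
        exact this hms
      have hmA2 : MeasurableSet A2 :=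
        measurableSet_lt measurable_const ((hc.norm.measurable).comp hγ)
      have hmA3 : MeasurableSet A3 := measurableSet_le measurable_const (σ.measurable.sub hγ).norm
      have hmA4 : MeasurableSet A4 := by
        have : Measurable fun ω => ‖∑ k, σ ω k • x k - ∑ k, γ ω k • x k‖ := by
          have hc2 : Continuous fun a : (α → ℝ) × (α → ℝ) =>
            ‖∑ k, a.1 k • x k - ∑ k, a.2 k • x k‖ := by fun_prop
          exact hc2.measurable.comp (σ.measurable.prodMk hγ)
        exact measurableSet_le measurable_const this
      set U := A1 ∪ A2 ∪ (A3 ∪ A4) with hU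
      have hmU : MeasurableSet U := (hmA1.union hmA2).union (hmA3.union hmA4)
      have hPU : P.real U ≤ 5 / 8 := by
        have u1 := measureReal_union_le (μ := P) (A1 ∪ A2) (A3 ∪ A4)
        have u2 := measureReal_union_le (μ := P) A1 A2
        have u3 := measureReal_union_le (μ := P) A3 A4
        linarith
      have hPUc : 3 / 8 ≤ P.real Uᶜ := by
        rw [probReal_compl_eq_one_sub hmU]; linarith
      have hint : Integrable (fun ω => (if ‖∑ k, σ ω k • x k‖ ≤ 2 * r then (1 : ℝ) else 0) *
          |∑ k, σ ω k * ι (x k) s|) P :=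
        SimpleFunc.integrable_of_isFiniteMeasure (μ := P) (σ.map fun j : α → ℝ =>
          (if ‖∑ k, j k • x k‖ ≤ 2 * r then (1 : ℝ) else 0) * |∑ k, j k * ι (x k) s|)
      have hfin : P.real Uᶜ * (δ * |ι g s|) ≤ ∫ ω,
          ((if ‖∑ k, σ ω k • x k‖ ≤ 2 * r then (1 : ℝ) else 0) * |∑ k, σ ω k * ι (x k) s|
            + ε * ∑ k, |ι (x k) s|) ∂P := by
        rw [← smul_eq_mul, ← integral_indicator_const _ hmU.compl]
        refine integral_mono ((integrable_const _).indicator hmU.compl)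
          (hint.add (integrable_const _)) fun ω => ?_
        by_cases hω : ω ∈ U
        · simp only [Set.mem_compl_iff, hω, not_true_eq_false, not_false_eq_true,
            Set.indicator_of_notMem]
          exact add_nonneg (mul_nonneg (by split_ifs <;> simp) (abs_nonneg _)) (by positivity)
        · have hω' := hω
          simp only [hU, hA1, hA2, hA3, hA4, Set.mem_union, Set.mem_ofPred_eq, Set.mem_preimage,
            not_or, not_lt, not_le, hsq] at hω'
          obtain ⟨⟨b1, b2⟩, b3, b4⟩ := hω'
          rw [Set.indicator_of_mem (by exact hω)]
          have b5 : ‖∑ k, σ ω k • x k‖ ≤ 2 * r := by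
            have := norm_sub_norm_le (∑ k, σ ω k • x k) (∑ k, γ ω k • x k)
            linarith
          simp only [b5, if_true, one_mul]
          have e : ∑ k, γ ω k * ι (x k) s = ∑ k, σ ω k * ι (x k) s -
              ∑ k, (σ ω - γ ω) k * ι (x k) s := by
            rw [← Finset.sum_sub_distrib]
            exact Finset.sum_congr rfl fun k _ => by simp only [Pi.sub_apply]; ring
          rw [e] at b1
          have b6 := abs_sum_mul_le (σ ω - γ ω) fun k => ι (x k) s
          have b7 : ‖σ ω - γ ω‖ * ∑ k, |ι (x k) s| ≤ ε * ∑ k, |ι (x k) s| :=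
            mul_le_mul_of_nonneg_right b3.le h0
          have b8 := abs_sub (∑ k, σ ω k * ι (x k) s) (∑ k, (σ ω - γ ω) k * ι (x k) s)
          linarith
      rw [integral_add hint (integrable_const _)] at hfin
      simp only [integral_const, probReal_univ, one_smul] at hfin
      refine le_trans ?_ hfin
      rw [mul_assoc]
      exact mul_le_mul_of_nonneg_right hPUc (by positivity)
    have hnorm : ‖(3 / 8 * δ) • g‖ ≤ ∑ o ∈ Finset.univ.disjSum (Finset.univ : Finset α),
        Sum.elim w (fun _ => ε) o * ‖Sum.elim (fun j : σ.range => ∑ k, (j : α → ℝ) k • x k) x o‖ := by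
      refine hι.norm_le_sum _ ?_ ?_
      · rintro (j | k) _
        · exact hw0 j
        · exact hε.le
      · filter_upwards [key, coe_smul ι (3 / 8 * δ) g] with s h1 h2
        rw [h2, abs_mul, abs_of_nonneg (by positivity : 0 ≤ 3 / 8 * δ), Finset.sum_disjSum]
        simpa [Finset.mul_sum] using h1
    rw [Finset.sum_disjSum, norm_smul, Real.norm_of_nonneg (by positivity)] at hnorm
    simp only [Sum.elim_inl, Sum.elim_inr] at hnorm
    rw [← Finset.mul_sum] at hnorm
    linarith
  have hlim : Tendsto (fun ε : ℝ => 2 * r + ε * ∑ k, ‖x k‖) (𝓝[>] 0)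
      (𝓝 (2 * r + 0 * ∑ k, ‖x k‖)) :=
    (Continuous.tendsto (by fun_prop) (0 : ℝ)).mono_left nhdsWithin_le_nhds
  have := ge_of_tendsto hlim (by filter_upwards [self_mem_nhdsWithin] with ε hε using step ε hε)
  rw [zero_mul, add_zero] at this
  rw [div_mul_eq_mul_div, le_div_iff₀ (by positivity)]
  linarith

end IsFunctionSpace

/-! ### The Bochner integral in a function space, computed pointwise. -/

namespace IsFunctionSpace

variable {S : Type*} [MeasurableSpace S] {μ : Measure S}
  {E : Type*} [NormedAddCommGroup E] [NormedSpace ℝ E] {ι : E →ₗ[ℝ] (S →ₘ[μ] ℝ)}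
  {𝕋 : Type*} [MeasurableSpace 𝕋] {ρ : Measure 𝕋}

/-- Geometric speed makes the telescoping series of the approximations absolutely summable, so no
further subsequences are needed. -/
lemma _root_.MeasureTheory.Integrable.exists_simpleFunc_fast {E : Type*} [NormedAddCommGroup E]
    {F : 𝕋 → E} (hF : Integrable F ρ) :
    ∃ G : ℕ → SimpleFunc 𝕋 E, (∀ n, Integrable (G n) ρ) ∧
      ∀ n, ∫ t, ‖F t - G n t‖ ∂ρ ≤ (1 / 2) ^ n := by
  have : ∀ n : ℕ, ∃ G : SimpleFunc 𝕋 E, Integrable G ρ ∧ ∫ t, ‖F t - G t‖ ∂ρ ≤ (1 / 2) ^ n := by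
    intro n
    have hpos : (0 : ℝ) < (1 / 2) ^ n := by positivity
    obtain ⟨G, hG1, hG2⟩ := (memLp_one_iff_integrable.2 hF).exists_simpleFunc_eLpNorm_sub_lt
      ENNReal.one_ne_top (ε := ENNReal.ofReal ((1 / 2) ^ n)) (by simp)
    refine ⟨G, memLp_one_iff_integrable.1 hG2, ?_⟩
    rw [eLpNorm_one_eq_lintegral_enorm] at hG1
    have hint : Integrable (F - ⇑G) ρ := hF.sub (memLp_one_iff_integrable.1 hG2)
    have := integral_norm_eq_lintegral_enorm hint.aestronglyMeasurable
    simp only [Pi.sub_apply] at this hG1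
    rw [this]
    exact ENNReal.toReal_le_of_le_ofReal hpos.le hG1.le
  choose G h1 h2 using this
  exact ⟨G, h1, h2⟩

/-- The Bochner integral of a simple function is computed pointwise. -/
lemma coe_integral_simpleFunc (ι : E →ₗ[ℝ] (S →ₘ[μ] ℝ)) [CompleteSpace E] {G : SimpleFunc 𝕋 E}
    (hG : Integrable G ρ) : ∀ᵐ s ∂μ, Integrable (fun t => ι (G t) s) ρ ∧
      ι (∫ t, G t ∂ρ) s = ∫ t, ι (G t) s ∂ρ := by
  filter_upwards [coe_zero ι, coe_sum_smul ι G.range (fun x => ρ.real (G ⁻¹' {x})) fun x => x] with s h0 h1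
  have h2 : (∫ t, G t ∂ρ) = ∑ x ∈ G.range, ρ.real (G ⁻¹' {x}) • x := by
    rw [← SimpleFunc.integral_eq_integral G hG, SimpleFunc.integral_eq]
  have hmap := SimpleFunc.map_integral G (fun x => ι x s) hG h0
  have hint : Integrable (G.map fun x => ι x s) ρ := by
    rw [SimpleFunc.integrable_iff_finMeasSupp] at hG ⊢
    exact hG.map h0
  refine ⟨hint, ?_⟩
  rw [h2, h1]
  have : ∫ t, ι (G t) s ∂ρ = (G.map fun x => ι x s).integral ρ := by
    rw [SimpleFunc.integral_eq_integral _ hint]; rfl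
  rw [this, hmap]
  simp

/-- The Bochner integral in a function space is computed pointwise. -/
lemma coe_integral [SigmaFinite μ] [SFinite ρ] [CompleteSpace E] (hι : IsFunctionSpace μ ι) {F : 𝕋 → E}
    (hF : Integrable F ρ) {f : 𝕋 × S → ℝ} (hf : StronglyMeasurable f)
    (hFf : ∀ᵐ t ∂ρ, ∀ᵐ s ∂μ, ι (F t) s = f (t, s)) :
    ∀ᵐ s ∂μ, Integrable (fun t => f (t, s)) ρ ∧ ι (∫ t, F t ∂ρ) s = ∫ t, f (t, s) ∂ρ := by
  obtain ⟨G, hGi, hGF⟩ := hF.exists_simpleFunc_fast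
  have hgm : ∀ n, Measurable fun p : 𝕋 × S => ι (G n p.1) p.2 := by
    intro n
    classical
    have : (fun p : 𝕋 × S => ι (G n p.1) p.2) = fun p => ∑ x ∈ (G n).range,
        ((G n) ⁻¹' {x}).indicator (fun _ => (1 : ℝ)) p.1 * ι x p.2 := by
      ext p
      rw [Finset.sum_eq_single (G n p.1)]
      · simp
      · intro b _ hb
        simp [Ne.symm hb]
      · intro h
        exact absurd ((G n).mem_range_self p.1) h
    rw [this]
    refine Finset.measurable_fun_sum _ fun x _ => Measurable.mul ?_ ?_
    · exact (measurable_const.indicator ((G n).measurableSet_fiber x)).comp measurable_fst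
    · exact (ι x).measurable.comp measurable_snd
  -- absolute convergence of the telescoping series
  let D : ℕ → SimpleFunc 𝕋 E := fun n => G (n + 1) - G n
  have hDi : ∀ n, Integrable (D n) ρ := fun n => (hGi (n + 1)).sub (hGi n)
  have hDn : ∀ n, ∫ t, ‖D n t‖ ∂ρ ≤ 2 * (1 / 2) ^ n := by
    intro n
    calc ∫ t, ‖D n t‖ ∂ρ ≤ ∫ t, (‖F t - G (n + 1) t‖ + ‖F t - G n t‖) ∂ρ := by
          refine integral_mono (hDi n).norm ((hF.sub (hGi (n + 1))).norm.add
            (hF.sub (hGi n)).norm) fun t => ?_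
          have : D n t = (F t - G n t) - (F t - G (n + 1) t) := by
            simp only [D, SimpleFunc.coe_sub, Pi.sub_apply]; abel
          simp only [this]
          exact (norm_sub_le _ _).trans (le_of_eq (add_comm _ _))
      _ ≤ (1 / 2) ^ (n + 1) + (1 / 2) ^ n := by
          refine (integral_add (hF.sub (hGi (n + 1))).norm (hF.sub (hGi n)).norm).trans_le ?_
          exact add_le_add (hGF _) (hGF _)
      _ ≤ _ := by
          rw [pow_succ]
          have : (0 : ℝ) < (1 / 2) ^ n := by positivity
          linarith
  have hDabs : ∀ n, Integrable ((D n).map hι.absE) ρ := by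
    intro n
    have := hDi n
    rw [SimpleFunc.integrable_iff_finMeasSupp] at this ⊢
    exact this.map (by rw [← norm_eq_zero, norm_absE, norm_zero])
  -- The `E`-valued integrals of `|G (n + 1) - G n|` are summable in norm, hence summable at almost
  -- every `s` by the Riesz–Fischer property. This is what provides a majorant integrable in `t` for
  -- the dominated convergence at fixed `s`.
  have hu : Summable fun n => ‖∫ t, (D n).map hι.absE t ∂ρ‖ := by
    refine Summable.of_nonneg_of_le (fun n => norm_nonneg _) (fun n => ?_)
      (summable_geometric_two.mul_left 2)
    refine (norm_integral_le_integral_norm _).trans (le_trans (le_of_eq ?_) (hDn n))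
    simp [SimpleFunc.map_apply]
  have hall : ∀ᵐ s ∂μ, ∀ n, Integrable (fun t => ι (G n t) s) ρ ∧
      ι (∫ t, G n t ∂ρ) s = ∫ t, ι (G n t) s ∂ρ := ae_all_iff.2 fun n => coe_integral_simpleFunc ι (hGi n)
  have hall2 : ∀ᵐ s ∂μ, ∀ n, Integrable (fun t => ι ((D n).map hι.absE t) s) ρ ∧
      ι (∫ t, (D n).map hι.absE t ∂ρ) s = ∫ t, ι ((D n).map hι.absE t) s ∂ρ :=
    ae_all_iff.2 fun n => coe_integral_simpleFunc ι (hDabs n)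
  have hpt : ∀ᵐ s ∂μ, ∀ n t, ι ((D n).map hι.absE t) s = |ι (G (n + 1) t) s - ι (G n t) s| := by
    refine ae_all_iff.2 fun n => ?_
    have : ∀ᵐ s ∂μ, ∀ x ∈ (D n).range, ι (hι.absE x) s = |ι x s| :=
      ((D n).range.finite_toSet.eventually_all (l := ae μ)).2 fun x _ => hι.coe_absE x
    have h2 : ∀ᵐ s ∂μ, ∀ p ∈ ((G (n + 1)).pair (G n)).range, ι (p.1 - p.2) s = ι p.1 s - ι p.2 s :=
      (((G (n + 1)).pair (G n)).range.finite_toSet.eventually_all (l := ae μ)).2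
        fun p _ => coe_sub ι _ _
    filter_upwards [this, h2] with s hs hs2 t
    rw [SimpleFunc.map_apply, hs _ ((D n).mem_range_self t)]
    have := hs2 _ (((G (n + 1)).pair (G n)).mem_range_self t)
    rw [SimpleFunc.pair_apply] at this
    rw [← this]
    rfl
  -- pointwise identification of the limit
  have hFsum : ∀ᵐ t ∂ρ, Summable fun n => ‖F t - G n t‖ := by
    have hmeas : ∀ n, AEMeasurable (fun t => ‖F t - G n t‖ₑ) ρ := fun n =>
      (hF.sub (hGi n)).aestronglyMeasurable.enorm
    have hfin : ∫⁻ t, ∑' n, ‖F t - G n t‖ₑ ∂ρ ≠ ∞ := by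
      rw [lintegral_tsum hmeas]
      have : ∀ n, ∫⁻ t, ‖F t - G n t‖ₑ ∂ρ ≤ ENNReal.ofReal ((1 / 2) ^ n) := fun n => by
        have := ofReal_integral_norm_eq_lintegral_enorm (hF.sub (hGi n))
        simp only [Pi.sub_apply] at this
        rw [← this]
        exact ENNReal.ofReal_le_ofReal (hGF n)
      refine ne_top_of_le_ne_top ?_ (ENNReal.tsum_le_tsum this)
      rw [← ENNReal.ofReal_tsum_of_nonneg (fun n => by positivity) summable_geometric_two]
      exact ENNReal.ofReal_ne_top
    filter_upwards [ae_lt_top' (AEMeasurable.tsum hmeas) hfin] with t ht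
    have := ENNReal.summable_toReal ht.ne
    simpa using this
  have hconv : ∀ᵐ s ∂μ, ∀ᵐ t ∂ρ, Tendsto (fun n => ι (G n t) s) atTop (𝓝 (f (t, s))) := by
    -- Joint measurability of the set of convergence permits exchanging the order of the two
    -- quantifiers "almost every `t`" and "almost every `s`".
    have hms : MeasurableSet {p : 𝕋 × S | Tendsto (fun n => ι (G n p.1) p.2) atTop (𝓝 (f p))} := by
      have e : {p : 𝕋 × S | Tendsto (fun n => ι (G n p.1) p.2) atTop (𝓝 (f p))} =
          {p | Tendsto (fun n => dist (ι (G n p.1) p.2) (f p)) atTop (𝓝 0)} := by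
        ext p
        exact tendsto_iff_dist_tendsto_zero
      rw [e]
      exact measurableSet_tendsto (𝓝 0) fun n => (hgm n).dist hf.measurable
    have h1 : ∀ᵐ t ∂ρ, ∀ᵐ s ∂μ, Tendsto (fun n => ι (G n t) s) atTop (𝓝 (f (t, s))) := by
      filter_upwards [hFsum, hFf] with t h1 h2
      have h3 : ∀ᵐ s ∂μ, ∀ n, ι (F t - G n t) s = ι (F t) s - ι (G n t) s :=
        ae_all_iff.2 fun n => coe_sub ι _ _
      filter_upwards [hι.ae_tendsto_zero_of_summable_norm h1, h2, h3] with s h4 h5 h6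
      simp only [h6] at h4
      have := (tendsto_const_nhds (x := ι (F t) s)).sub h4
      simpa [h5] using this
    exact (Measure.ae_ae_comm hms).1 h1
  have hGlim : ∀ᵐ s ∂μ, Tendsto (fun n => ι (∫ t, G n t ∂ρ) s) atTop (𝓝 (ι (∫ t, F t ∂ρ) s)) := by
    have hs : Summable fun n => ‖∫ t, F t ∂ρ - ∫ t, G n t ∂ρ‖ := by
      refine Summable.of_nonneg_of_le (fun n => norm_nonneg _) (fun n => ?_) summable_geometric_two
      rw [← integral_sub hF (hGi n)]
      exact (norm_integral_le_integral_norm _).trans (hGF n)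
    have h3 : ∀ᵐ s ∂μ, ∀ n, ι (∫ t, F t ∂ρ - ∫ t, G n t ∂ρ) s
        = ι (∫ t, F t ∂ρ) s - ι (∫ t, G n t ∂ρ) s := ae_all_iff.2 fun n => coe_sub ι _ _
    filter_upwards [hι.ae_tendsto_zero_of_summable_norm hs, h3] with s h4 h6
    simp only [h6] at h4
    have := (tendsto_const_nhds (x := ι (∫ t, F t ∂ρ) s)).sub h4
    simpa using this
  filter_upwards [hall, hall2, hpt, hconv, hGlim, hι.ae_summable_of_summable_norm hu]
    with s h1 h2 h3 h4 h5 h6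
  let d : ℕ → 𝕋 → ℝ := fun n t => |ι (G (n + 1) t) s - ι (G n t) s|
  have hd : ∀ n, Integrable (d n) ρ := fun n =>
    (h2 n).1.congr (ae_of_all _ fun t => h3 n t)
  have hdint : ∀ n, ∫ t, d n t ∂ρ = ι (∫ t, (D n).map hι.absE t ∂ρ) s := fun n => by
    rw [(h2 n).2]
    exact integral_congr_ae (ae_of_all _ fun t => (h3 n t).symm)
  have hsumd : Summable fun n => ∫ t, ‖d n t‖ ∂ρ := by
    refine h6.congr fun n => ?_
    rw [← hdint]
    simp only [d, Real.norm_eq_abs, abs_abs]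
    rw [abs_of_nonneg (integral_nonneg fun t => abs_nonneg _)]
  have hdm : ∀ n, AEMeasurable (fun t => ‖d n t‖ₑ) ρ := fun n => (hd n).aestronglyMeasurable.enorm
  have hfin : ∫⁻ t, ∑' n, ‖d n t‖ₑ ∂ρ ≠ ∞ := by
    rw [lintegral_tsum hdm]
    have : ∀ n, ∫⁻ t, ‖d n t‖ₑ ∂ρ = ENNReal.ofReal (∫ t, ‖d n t‖ ∂ρ) := fun n =>
      (ofReal_integral_norm_eq_lintegral_enorm (hd n)).symm
    simp only [this]
    rw [← ENNReal.ofReal_tsum_of_nonneg (fun n => integral_nonneg fun t => norm_nonneg _) hsumd]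
    exact ENNReal.ofReal_ne_top
  have haesum := ae_lt_top' (AEMeasurable.tsum hdm) hfin
  let b : 𝕋 → ℝ := fun t => |ι (G 0 t) s| + (∑' n, ‖d n t‖ₑ).toReal
  have hb : Integrable b ρ := (h1 0).1.norm.add
    (integrable_toReal_of_lintegral_ne_top (AEMeasurable.tsum hdm) hfin)
  have hbound : ∀ n, ∀ᵐ t ∂ρ, ‖ι (G n t) s‖ ≤ b t := by
    intro n
    filter_upwards [haesum] with t ht
    have e : ι (G n t) s = ι (G 0 t) s + ∑ k ∈ Finset.range n, (ι (G (k + 1) t) s - ι (G k t) s) := by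
      rw [Finset.sum_range_sub (fun k => ι (G k t) s)]; ring
    rw [e]
    refine (norm_add_le _ _).trans (add_le_add le_rfl ((norm_sum_le _ _).trans ?_))
    calc ∑ k ∈ Finset.range n, ‖ι (G (k + 1) t) s - ι (G k t) s‖
        = (∑ k ∈ Finset.range n, ‖d k t‖ₑ).toReal := by
          rw [ENNReal.toReal_sum fun k _ => enorm_ne_top]
          exact Finset.sum_congr rfl fun k _ => by simp [d]
      _ ≤ _ := ENNReal.toReal_mono ht.ne (ENNReal.sum_le_tsum _)
  have hfm : AEStronglyMeasurable (fun t => f (t, s)) ρ :=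
    (hf.comp_measurable measurable_prodMk_right).aestronglyMeasurable
  have hlim := tendsto_integral_of_dominated_convergence b (fun n => (h1 n).1.aestronglyMeasurable)
    hb hbound h4
  refine ⟨hb.mono' hfm ?_, ?_⟩
  · filter_upwards [h4, ae_all_iff.2 hbound] with t h7 h8
    exact le_of_tendsto h7.norm (Eventually.of_forall h8)
  · refine tendsto_nhds_unique h5 ?_
    simpa only [(h1 _).2] using hlim

end IsFunctionSpace

/-- A sequence of increments `D j` which, given the past `𝒢 j`, are centred Gaussian with
variance `v j`. -/
structure CondGaussian {Ω : Type*} [mΩ : MeasurableSpace Ω] (P : Measure Ω)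
    (𝒢 : ℕ → MeasurableSpace Ω) (D v : ℕ → Ω → ℝ) : Prop where
  mono : Monotone 𝒢
  le : ∀ j, 𝒢 j ≤ mΩ
  measurable_D : ∀ j, Measurable[𝒢 (j + 1)] (D j)
  measurable_v : ∀ j, Measurable[𝒢 j] (v j)
  nonneg : ∀ j ω, 0 ≤ v j ω
  charFun : ∀ j (Y : Ω → ℂ), Measurable[𝒢 j] Y → (∃ c : ℝ, ∀ ω, ‖Y ω‖ ≤ c) →
    ∫ ω, Y ω * Complex.exp (D j ω * Complex.I) ∂P = ∫ ω, Y ω * Real.exp (-(v j ω) / 2) ∂P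

/-! ### Sums of conditionally Gaussian increments. -/

namespace CondGaussian

variable {Ω : Type*} [mΩ : MeasurableSpace Ω] {P : Measure Ω}
  {𝒢 : ℕ → MeasurableSpace Ω} {D v : ℕ → Ω → ℝ}

lemma measurable_sum_D (h : CondGaussian P 𝒢 D v) (j : ℕ) :
    Measurable[𝒢 j] fun ω => ∑ i ∈ Finset.range j, D i ω :=
  Finset.measurable_fun_sum _ fun i hi =>
    (h.measurable_D i).mono (h.mono (Finset.mem_range.1 hi)) le_rfl

lemma measurable_sum_v (h : CondGaussian P 𝒢 D v) (j : ℕ) :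
    Measurable[𝒢 j] fun ω => ∑ i ∈ Finset.range (j + 1), v i ω :=
  Finset.measurable_fun_sum _ fun i hi =>
    (h.measurable_v i).mono (h.mono (Finset.mem_range_succ_iff.1 hi)) le_rfl

/-- Induction on `1 - p * q ≤ (1 - p) + (1 - q)` for `p, q ∈ [0, 1]`. -/
lemma one_sub_exp_sum_le (a : ℕ → ℝ) (ha : ∀ i, 0 ≤ a i) (m : ℕ) :
    1 - Real.exp (-(∑ i ∈ Finset.range m, a i) / 2)
      ≤ ∑ i ∈ Finset.range m, (1 - Real.exp (-(a i) / 2)) := by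
  induction m with
  | zero => simp
  | succ m ih =>
    rw [Finset.sum_range_succ, Finset.sum_range_succ, neg_add, add_div, Real.exp_add]
    have h1 : Real.exp (-(∑ i ∈ Finset.range m, a i) / 2) ≤ 1 := Real.exp_le_one_iff.2 (by
      have := Finset.sum_nonneg fun i (_ : i ∈ Finset.range m) => ha i
      linarith)
    have h2 : Real.exp (-(a m) / 2) ≤ 1 := Real.exp_le_one_iff.2 (by linarith [ha m])
    nlinarith

/-- The sum telescopes until `C` fails for the first time. If it has not failed, the value is `1 -
cos (M m)`; otherwise it is frozen at one minus the cosine at the exit, which is at most `2`. -/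
lemma sum_stopped_le (M : ℕ → ℝ) (hM : M 0 = 0) (C : ℕ → Prop) [DecidablePred C]
    (hC : ∀ j, C (j + 1) → C j) (m : ℕ) :
    (C m → ∑ j ∈ Finset.range m, (if C j then 1 else 0) * (Real.cos (M j) - Real.cos (M (j + 1)))
      = 1 - Real.cos (M m)) ∧
    ∑ j ∈ Finset.range m, (if C j then 1 else 0) * (Real.cos (M j) - Real.cos (M (j + 1))) ≤ 2 := by
  induction m with
  | zero => simp [hM]
  | succ m ih =>
    rw [Finset.sum_range_succ]
    by_cases h : C m
    · rw [ih.1 h, if_pos h]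
      refine ⟨fun _ => by ring, ?_⟩
      linarith [Real.neg_one_le_cos (M (m + 1))]
    · rw [if_neg h, zero_mul, add_zero]
      exact ⟨fun h' => absurd (hC m h') h, ih.2⟩

variable [IsProbabilityMeasure P]

lemma integrable_of_measurable_of_bound {F : Type*} [NormedAddCommGroup F] [MeasurableSpace F]
    [BorelSpace F] [SecondCountableTopology F] {f : Ω → F} (hf : Measurable f)
    {c : ℝ} (hc : ∀ ω, ‖f ω‖ ≤ c) : Integrable f P :=
  Integrable.of_bound hf.aestronglyMeasurable c (ae_of_all _ hc)

/-- If the partial sums stay small with large probability, then so does the total conditional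
variance. -/
lemma integral_one_sub_exp_le (h : CondGaussian P 𝒢 D v) {a : ℝ} (ha : a ≤ 1) (m : ℕ) :
    ∫ ω, (1 - Real.exp (-(∑ i ∈ Finset.range m, v i ω) / 2)) ∂P ≤
      a ^ 2 + 5 * P.real {ω | ∃ j ≤ m, a < |∑ i ∈ Finset.range j, D i ω|} := by
  classical
  let M : ℕ → Ω → ℝ := fun j ω => ∑ i ∈ Finset.range j, D i ω
  -- The sums are observed while they stay in `[-a, a]`. There `cos (M j) ≥ 1 / 2`, so the mean
  -- decrement of the cosine over a step is at least half the mean of `1 - exp (-v j / 2)`. The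
  -- decrements telescope to at most `a ^ 2 / 2` if the sums never leave the interval, and to at
  -- most `2` in any case.
  let C : ℕ → Set Ω := fun j => {ω | ∀ i ≤ j, |M i ω| ≤ a}
  have hMG : ∀ j, Measurable[𝒢 j] (M j) := h.measurable_sum_D
  have hM : ∀ j, Measurable (M j) := fun j => (hMG j).mono (h.le j) le_rfl
  have hCG : ∀ j, MeasurableSet[𝒢 j] (C j) := by
    intro j
    have : C j = ⋂ i ∈ Finset.range (j + 1), {ω | |M i ω| ≤ a} := by
      ext ω; simp [C]
    rw [this]
    refine Finset.measurableSet_biInter _ fun i hi => ?_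
    have hi' : Measurable[𝒢 j] (M i) :=
      (hMG i).mono (h.mono (Finset.mem_range_succ_iff.1 hi)) le_rfl
    exact (continuous_abs.measurable.comp hi') measurableSet_Iic
  have hCm : ∀ j, MeasurableSet (C j) := fun j => h.le j _ (hCG j)
  have hv : ∀ j, Measurable (v j) := fun j => (h.measurable_v j).mono (h.le j) le_rfl
  have hVm : Measurable fun ω => ∑ i ∈ Finset.range m, v i ω :=
    Finset.measurable_fun_sum _ fun i _ => hv i
  have he1 : ∀ j ω, Real.exp (-(v j ω) / 2) ≤ 1 := fun j ω =>
    Real.exp_le_one_iff.2 (by linarith [h.nonneg j ω])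
  have he0 : ∀ j ω, 0 ≤ Real.exp (-(v j ω) / 2) := fun j ω => (Real.exp_pos _).le
  let χ : ℕ → Ω → ℝ := fun j ω => if ω ∈ C j then 1 else 0
  have hχm : ∀ j, Measurable (χ j) := fun j =>
    Measurable.ite (hCm j) measurable_const measurable_const
  have hχ0 : ∀ j ω, 0 ≤ χ j ω := fun j ω => by simp only [χ]; split_ifs <;> simp
  have hχ1 : ∀ j ω, χ j ω ≤ 1 := fun j ω => by simp only [χ]; split_ifs <;> simp
  have hcosm : ∀ j, Measurable fun ω => Real.cos (M j ω) := fun j =>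
    Real.measurable_cos.comp (hM j)
  have hem : ∀ j, Measurable fun ω => Real.exp (-(v j ω) / 2) := fun j =>
    Real.measurable_exp.comp ((hv j).neg.div_const 2)
  -- integrability
  have i1 : ∀ j k, Integrable (fun ω => χ j ω * Real.cos (M k ω)) P := fun j k =>
    integrable_of_measurable_of_bound ((hχm j).mul (hcosm k)) (c := 1) fun ω => by
      rw [norm_mul, Real.norm_of_nonneg (hχ0 j ω)]
      exact mul_le_one₀ (hχ1 j ω) (norm_nonneg _) (Real.abs_cos_le_one _)
  have i2 : ∀ j, Integrable (fun ω => χ j ω * Real.cos (M j ω) * Real.exp (-(v j ω) / 2)) P :=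
    fun j => integrable_of_measurable_of_bound (((hχm j).mul (hcosm j)).mul (hem j)) (c := 1)
      fun ω => by
        rw [norm_mul, norm_mul, Real.norm_of_nonneg (hχ0 j ω), Real.norm_of_nonneg (he0 j ω)]
        exact mul_le_one₀ (mul_le_one₀ (hχ1 j ω) (norm_nonneg _) (Real.abs_cos_le_one _))
          (he0 j ω) (he1 j ω)
  have i3 : ∀ j, Integrable (fun ω => χ j ω * (1 - Real.exp (-(v j ω) / 2))) P := fun j =>
    integrable_of_measurable_of_bound ((hχm j).mul (measurable_const.sub (hem j))) (c := 1)
      fun ω => by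
        rw [norm_mul, Real.norm_of_nonneg (hχ0 j ω), Real.norm_of_nonneg (by linarith [he1 j ω])]
        exact mul_le_one₀ (hχ1 j ω) (by linarith [he1 j ω]) (by linarith [he0 j ω])
  -- the conditional characteristic function, real part
  have hstep : ∀ j, ∫ ω, χ j ω * Real.cos (M (j + 1) ω) ∂P
      = ∫ ω, χ j ω * Real.cos (M j ω) * Real.exp (-(v j ω) / 2) ∂P := by
    intro j
    have hYm : Measurable[𝒢 j] fun ω => (χ j ω : ℂ) * Complex.exp (M j ω * Complex.I) := by
      refine Measurable.mul ?_ ?_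
      · exact Complex.measurable_ofReal.comp
          (Measurable.ite (hCG j) measurable_const measurable_const)
      · exact Complex.measurable_exp.comp
          ((Complex.measurable_ofReal.comp (hMG j)).mul_const _)
    have hY1 : ∀ ω, ‖(χ j ω : ℂ) * Complex.exp (M j ω * Complex.I)‖ ≤ 1 := fun ω => by
      rw [norm_mul, Complex.norm_exp_ofReal_mul_I, mul_one, Complex.norm_real,
        Real.norm_of_nonneg (hχ0 j ω)]
      exact hχ1 j ω
    have hc := h.charFun j _ hYm ⟨1, hY1⟩
    have hYm' := hYm.mono (h.le j) le_rfl
    have hDm : Measurable (D j) := (h.measurable_D j).mono (h.le _) le_rfl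
    have I1 : Integrable (fun ω => (χ j ω : ℂ) * Complex.exp (M j ω * Complex.I) *
        Complex.exp (D j ω * Complex.I)) P :=
      integrable_of_measurable_of_bound (hYm'.mul (Complex.measurable_exp.comp
        ((Complex.measurable_ofReal.comp hDm).mul_const _))) (c := 1) fun ω => by
          rw [norm_mul, Complex.norm_exp_ofReal_mul_I, mul_one]; exact hY1 ω
    have I2 : Integrable (fun ω => (χ j ω : ℂ) * Complex.exp (M j ω * Complex.I) *
        (Real.exp (-(v j ω) / 2) : ℝ)) P :=
      integrable_of_measurable_of_bound (hYm'.mul (Complex.measurable_ofReal.comp (hem j)))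
        (c := 1) fun ω => by
          rw [norm_mul, Complex.norm_real, Real.norm_of_nonneg (he0 j ω)]
          exact mul_le_one₀ (hY1 ω) (he0 j ω) (he1 j ω)
    have hre := congrArg Complex.reCLM hc
    rw [← Complex.reCLM.integral_comp_comm I1, ← Complex.reCLM.integral_comp_comm I2] at hre
    simp only [Complex.reCLM_apply] at hre
    convert hre using 2
    · ext ω
      rw [mul_assoc, ← Complex.exp_add, ← add_mul, ← Complex.ofReal_add, Complex.re_ofReal_mul,
        Complex.exp_ofReal_mul_I_re]
      simp only [M, Finset.sum_range_succ]
    · ext ω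
      rw [Complex.re_mul_ofReal, Complex.re_ofReal_mul, Complex.exp_ofReal_mul_I_re]
  have hhalf : ∀ j, 1 / 2 * ∫ ω, χ j ω * (1 - Real.exp (-(v j ω) / 2)) ∂P ≤
      ∫ ω, χ j ω * (Real.cos (M j ω) - Real.cos (M (j + 1) ω)) ∂P := by
    intro j
    simp only [mul_sub, mul_one]
    rw [integral_sub (i1 j j) (i1 j (j + 1)), hstep, ← integral_sub (i1 j j) (i2 j),
      ← integral_const_mul]
    refine integral_mono ?_ ((i1 j j).sub (i2 j)) fun ω => ?_
    · have := (i3 j).const_mul (1 / 2)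
      simpa only [mul_sub, mul_one] using this
    · simp only
      by_cases hω : ω ∈ C j
      · have hMa : |M j ω| ≤ a := hω j le_rfl
        have hcos : 1 / 2 ≤ Real.cos (M j ω) := by
          have h1 := Real.one_sub_sq_div_two_le_cos (x := M j ω)
          have h2 : M j ω ^ 2 ≤ 1 := by
            rw [← sq_abs]; exact pow_le_one₀ (abs_nonneg _) (hMa.trans ha)
          linarith
        simp only [χ, if_pos hω, one_mul]
        nlinarith [he1 j ω]
      · simp [χ, if_neg hω]
  have hsum : 1 / 2 * ∫ ω, χ m ω * (1 - Real.exp (-(∑ i ∈ Finset.range m, v i ω) / 2)) ∂P ≤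
      a ^ 2 / 2 + 2 * P.real (C m)ᶜ := by
    have iV : Integrable (fun ω => χ m ω *
        (1 - Real.exp (-(∑ i ∈ Finset.range m, v i ω) / 2))) P := by
      refine integrable_of_measurable_of_bound ((hχm m).mul (measurable_const.sub
        (Real.measurable_exp.comp (hVm.neg.div_const 2)))) (c := 1) fun ω => ?_
      have h0 := Finset.sum_nonneg fun i (_ : i ∈ Finset.range m) => h.nonneg i ω
      have h1 : Real.exp (-(∑ i ∈ Finset.range m, v i ω) / 2) ≤ 1 :=
        Real.exp_le_one_iff.2 (by linarith)
      rw [norm_mul, Real.norm_of_nonneg (hχ0 m ω), Real.norm_of_nonneg (by linarith)]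
      exact mul_le_one₀ (hχ1 m ω) (by linarith)
        (by linarith [Real.exp_pos (-(∑ i ∈ Finset.range m, v i ω) / 2)])
    calc 1 / 2 * ∫ ω, χ m ω * (1 - Real.exp (-(∑ i ∈ Finset.range m, v i ω) / 2)) ∂P
        ≤ 1 / 2 * ∫ ω, ∑ j ∈ Finset.range m, χ j ω * (1 - Real.exp (-(v j ω) / 2)) ∂P := by
          refine mul_le_mul_of_nonneg_left (integral_mono iV
            (integrable_finsetSum _ fun j _ => i3 j) fun ω => ?_) (by norm_num)
          simp only
          by_cases hω : ω ∈ C m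
          · have hall : ∀ j ∈ Finset.range m, χ j ω = 1 := fun j hj => by
              have : ω ∈ C j := fun i hi => hω i (hi.trans (Finset.mem_range.1 hj).le)
              simp [χ, this]
            have hs : ∑ j ∈ Finset.range m, χ j ω * (1 - Real.exp (-(v j ω) / 2)) =
                ∑ j ∈ Finset.range m, (1 - Real.exp (-(v j ω) / 2)) :=
              Finset.sum_congr rfl fun j hj => by rw [hall j hj, one_mul]
            rw [hs]
            simp only [χ, if_pos hω, one_mul]
            exact one_sub_exp_sum_le _ (fun i => h.nonneg i ω) m
          · simp only [χ, if_neg hω, zero_mul]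
            exact Finset.sum_nonneg fun j _ => mul_nonneg (hχ0 j ω) (by linarith [he1 j ω])
      _ = ∑ j ∈ Finset.range m, 1 / 2 * ∫ ω, χ j ω * (1 - Real.exp (-(v j ω) / 2)) ∂P := by
          rw [integral_finsetSum _ fun j _ => i3 j, Finset.mul_sum]
      _ ≤ ∑ j ∈ Finset.range m, ∫ ω, χ j ω * (Real.cos (M j ω) - Real.cos (M (j + 1) ω)) ∂P :=
          Finset.sum_le_sum fun j _ => hhalf j
      _ = ∫ ω, ∑ j ∈ Finset.range m, χ j ω * (Real.cos (M j ω) - Real.cos (M (j + 1) ω)) ∂P := by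
          rw [integral_finsetSum]
          intro j _
          simp only [mul_sub]
          exact (i1 j j).sub (i1 j (j + 1))
      _ ≤ ∫ ω, (a ^ 2 / 2 + (C m)ᶜ.indicator (fun _ => (2 : ℝ)) ω) ∂P := by
          refine integral_mono (integrable_finsetSum _ fun j _ => ?_)
            ((integrable_const _).add ((integrable_const _).indicator (hCm m).compl)) fun ω => ?_
          · simp only [mul_sub]
            exact (i1 j j).sub (i1 j (j + 1))
          · have hs := sum_stopped_le (fun j => M j ω) (by simp [M]) (fun j => ω ∈ C j)
              (fun j hj i hi => hj i (hi.trans (Nat.le_succ j))) m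
            simp only [χ]
            by_cases hω : ω ∈ C m
            · rw [hs.1 hω, Set.indicator_of_notMem (by simpa using hω), add_zero]
              have h1 := Real.one_sub_sq_div_two_le_cos (x := M m ω)
              have h2 : M m ω ^ 2 ≤ a ^ 2 := by
                rw [← sq_abs]
                exact pow_le_pow_left₀ (abs_nonneg _) (hω m le_rfl) 2
              linarith
            · rw [Set.indicator_of_mem (by exact hω)]
              have := hs.2
              nlinarith [sq_nonneg a]
      _ = a ^ 2 / 2 + 2 * P.real (C m)ᶜ := by
          rw [integral_add (integrable_const _) ((integrable_const _).indicator (hCm m).compl),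
            integral_indicator_const _ (hCm m).compl]
          simp [mul_comm]
  have hset : {ω | ∃ j ≤ m, a < |∑ i ∈ Finset.range j, D i ω|} = (C m)ᶜ := by
    ext ω
    simp only [C, M, Set.mem_ofPred_eq, Set.mem_compl_iff, not_forall, not_le, exists_prop]
  rw [hset]
  have hV0 : ∀ ω, 0 ≤ ∑ i ∈ Finset.range m, v i ω := fun ω =>
    Finset.sum_nonneg fun i _ => h.nonneg i ω
  have hV1 : ∀ ω, Real.exp (-(∑ i ∈ Finset.range m, v i ω) / 2) ≤ 1 := fun ω =>
    Real.exp_le_one_iff.2 (by linarith [hV0 ω])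
  have hVe : Measurable fun ω => 1 - Real.exp (-(∑ i ∈ Finset.range m, v i ω) / 2) :=
    measurable_const.sub (Real.measurable_exp.comp (hVm.neg.div_const 2))
  have hVb : ∀ ω, ‖1 - Real.exp (-(∑ i ∈ Finset.range m, v i ω) / 2)‖ ≤ 1 := fun ω => by
    rw [Real.norm_of_nonneg (by linarith [hV1 ω])]
    linarith [Real.exp_pos (-(∑ i ∈ Finset.range m, v i ω) / 2)]
  -- Doubling `hsum` gives the factor `4`, and dropping the restriction to `C m` costs the
  -- probability of its complement once more.
  calc ∫ ω, (1 - Real.exp (-(∑ i ∈ Finset.range m, v i ω) / 2)) ∂P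
      ≤ ∫ ω, (χ m ω * (1 - Real.exp (-(∑ i ∈ Finset.range m, v i ω) / 2))
          + (C m)ᶜ.indicator (fun _ => (1 : ℝ)) ω) ∂P := by
        refine integral_mono (integrable_of_measurable_of_bound hVe hVb)
          ((integrable_of_measurable_of_bound ((hχm m).mul hVe) (c := 1) fun ω => ?_).add
          ((integrable_const _).indicator (hCm m).compl)) fun ω => ?_
        · rw [Pi.mul_apply, norm_mul, Real.norm_of_nonneg (hχ0 m ω)]
          exact mul_le_one₀ (hχ1 m ω) (norm_nonneg _) (hVb ω)
        · simp only [χ]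
          by_cases hω : ω ∈ C m
          · simp [hω]
          · simp only [if_neg hω, zero_mul, zero_add]
            rw [Set.indicator_of_mem (by exact hω)]
            linarith [Real.exp_pos (-(∑ i ∈ Finset.range m, v i ω) / 2)]
    _ = ∫ ω, χ m ω * (1 - Real.exp (-(∑ i ∈ Finset.range m, v i ω) / 2)) ∂P + P.real (C m)ᶜ := by
        have i4 : Integrable (fun ω => χ m ω *
            (1 - Real.exp (-(∑ i ∈ Finset.range m, v i ω) / 2))) P :=
          integrable_of_measurable_of_bound ((hχm m).mul hVe) (c := 1) fun ω => by
            rw [norm_mul, Real.norm_of_nonneg (hχ0 m ω)]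
            exact mul_le_one₀ (hχ1 m ω) (norm_nonneg _) (hVb ω)
        rw [integral_add i4 ((integrable_const _).indicator (hCm m).compl),
          integral_indicator_const _ (hCm m).compl]
        simp
    _ ≤ _ := by linarith

/-- The exponential martingale, stopped before the conditional variance exceeds `b`. -/
lemma exists_stopped_exp (h : CondGaussian P 𝒢 D v) {b : ℝ} (hb : 0 ≤ b) (m : ℕ) :
    ∃ K : Ω → ℂ, Measurable K ∧ ∫ ω, K ω ∂P = 1 ∧ (∀ ω, ‖K ω‖ ≤ Real.exp (b / 2)) ∧
      ∀ ω, ∑ i ∈ Finset.range m, v i ω ≤ b → K ω =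
        Complex.exp ((∑ i ∈ Finset.range m, D i ω : ℝ) * Complex.I) *
          Real.exp ((∑ i ∈ Finset.range m, v i ω) / 2) := by
  classical
  suffices H : ∃ K : Ω → ℂ, Measurable[𝒢 m] K ∧ ∫ ω, K ω ∂P = 1 ∧
      (∀ ω, ‖K ω‖ ≤ Real.exp (b / 2)) ∧
      ∀ ω, ∑ i ∈ Finset.range m, v i ω ≤ b → K ω =
        Complex.exp ((∑ i ∈ Finset.range m, D i ω : ℝ) * Complex.I) *
          Real.exp ((∑ i ∈ Finset.range m, v i ω) / 2) by
    obtain ⟨K, h1, h2⟩ := H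
    exact ⟨K, h1.mono (h.le m) le_rfl, h2⟩
  induction m with
  | zero =>
    refine ⟨fun _ => 1, measurable_const, by simp, fun ω => ?_, fun ω _ => by simp⟩
    rw [norm_one]; exact Real.one_le_exp (by linarith)
  | succ m ih =>
    obtain ⟨K, hKm, hK1, hKb, hKe⟩ := ih
    -- The variance of the next step is already known at stage `m`, so one can stop just before the
    -- bound `b` is exceeded. On `C` the factor `exp (v m / 2)` compensates the conditional
    -- characteristic function of `D m`, which keeps the mean equal to one.
    let C : Set Ω := {ω | ∑ i ∈ Finset.range (m + 1), v i ω ≤ b}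
    have hCG : MeasurableSet[𝒢 m] C := h.measurable_sum_v m measurableSet_Iic
    have hC := h.le m _ hCG
    have hvm : Measurable[𝒢 m] fun ω => ((Real.exp (v m ω / 2) : ℝ) : ℂ) :=
      Complex.measurable_ofReal.comp (Real.measurable_exp.comp ((h.measurable_v m).div_const 2))
    have hCle : ∀ ω ∈ C, ∑ i ∈ Finset.range m, v i ω ≤ b := fun ω hω => by
      have : ∑ i ∈ Finset.range (m + 1), v i ω ≤ b := hω
      rw [Finset.sum_range_succ] at this
      linarith [h.nonneg m ω]
    let Y : Ω → ℂ := C.indicator fun ω => K ω * (Real.exp (v m ω / 2) : ℝ)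
    have hYm : Measurable[𝒢 m] Y := (hKm.mul hvm).indicator hCG
    have hYb : ∀ ω, ‖Y ω‖ ≤ Real.exp (b / 2) := by
      intro ω
      by_cases hω : ω ∈ C
      · simp only [Y, Set.indicator_of_mem hω]
        rw [hKe ω (hCle ω hω), norm_mul, norm_mul, Complex.norm_exp_ofReal_mul_I, one_mul,
          Complex.norm_real, Complex.norm_real, Real.norm_of_nonneg (Real.exp_pos _).le,
          Real.norm_of_nonneg (Real.exp_pos _).le, ← Real.exp_add]
        have : ∑ i ∈ Finset.range (m + 1), v i ω ≤ b := hω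
        rw [Finset.sum_range_succ] at this
        exact Real.exp_le_exp.2 (by linarith)
      · simp only [Y, Set.indicator_of_notMem hω, norm_zero]
        exact (Real.exp_pos _).le
    have hDm : Measurable[𝒢 (m + 1)] fun ω => Complex.exp (D m ω * Complex.I) :=
      Complex.measurable_exp.comp
        ((Complex.measurable_ofReal.comp (h.measurable_D m)).mul_const _)
    have hmono : 𝒢 m ≤ 𝒢 (m + 1) := h.mono (Nat.le_succ m)
    refine ⟨fun ω => Cᶜ.indicator K ω + Y ω * Complex.exp (D m ω * Complex.I), ?_, ?_, ?_, ?_⟩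
    · exact ((hKm.indicator hCG.compl).mono hmono le_rfl).add
        ((hYm.mono hmono le_rfl).mul hDm)
    · have hc := h.charFun m Y hYm ⟨_, hYb⟩
      have I0 : Integrable K P :=
        integrable_of_measurable_of_bound (hKm.mono (h.le m) le_rfl) hKb
      have I3 : Integrable (fun ω => Y ω * Complex.exp (D m ω * Complex.I)) P :=
        integrable_of_measurable_of_bound
          ((hYm.mono (h.le m) le_rfl).mul (hDm.mono (h.le _) le_rfl)) (c := Real.exp (b / 2))
          fun ω => by
            rw [norm_mul, Complex.norm_exp_ofReal_mul_I, mul_one]; exact hYb ω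
      show ∫ ω, (Cᶜ.indicator K ω + Y ω * Complex.exp (D m ω * Complex.I)) ∂P = 1
      rw [integral_add (I0.indicator hC.compl) I3, hc]
      have : (fun ω => Y ω * (Real.exp (-(v m ω) / 2) : ℝ)) = C.indicator K := by
        ext ω
        by_cases hω : ω ∈ C
        · simp only [Y, Set.indicator_of_mem hω]
          rw [mul_assoc, ← Complex.ofReal_mul, ← Real.exp_add]
          simp [neg_div]
        · simp [Y, Set.indicator_of_notMem hω]
      rw [this, ← hK1, integral_indicator hC, integral_indicator hC.compl, add_comm]
      exact integral_add_compl hC I0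
    · intro ω
      show ‖Cᶜ.indicator K ω + Y ω * Complex.exp (D m ω * Complex.I)‖ ≤ _
      by_cases hω : ω ∈ C
      · rw [Set.indicator_of_notMem (by simpa using hω), zero_add, norm_mul,
          Complex.norm_exp_ofReal_mul_I, mul_one]
        exact hYb ω
      · rw [Set.indicator_of_mem (by exact hω)]
        simp only [Y, Set.indicator_of_notMem hω, zero_mul, add_zero]
        exact hKb ω
    · intro ω hω
      have hω' : ω ∈ C := hω
      show Cᶜ.indicator K ω + Y ω * Complex.exp (D m ω * Complex.I) = _
      rw [Set.indicator_of_notMem (by simpa using hω'), zero_add]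
      simp only [Y, Set.indicator_of_mem hω']
      rw [hKe ω (hCle ω hω'), Finset.sum_range_succ, Finset.sum_range_succ, add_div, Real.exp_add,
        Complex.ofReal_add, add_mul, Complex.exp_add, Complex.ofReal_mul]
      ring

/-- If the total conditional variance is close to a constant `q`, then the sum is close to a
Gaussian with variance `q`. -/
lemma norm_integral_exp_sub_le (h : CondGaussian P 𝒢 D v) {q θ : ℝ} (hq : 0 ≤ q) (hθ0 : 0 ≤ θ)
    (hθ : θ ≤ 1) (m : ℕ) :
    ‖∫ ω, Complex.exp ((∑ i ∈ Finset.range m, D i ω : ℝ) * Complex.I) ∂P - Real.exp (-q / 2)‖ ≤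
      θ + (1 + Real.exp ((q + 1) / 2)) * P.real {ω | θ < |∑ i ∈ Finset.range m, v i ω - q|} := by
  obtain ⟨K, hKm, hK1, hKb, hKe⟩ := h.exists_stopped_exp (b := q + 1) (by linarith) m
  have hMm : Measurable fun ω => Complex.exp ((∑ i ∈ Finset.range m, D i ω : ℝ) * Complex.I) :=
    Complex.measurable_exp.comp ((Complex.measurable_ofReal.comp
      ((h.measurable_sum_D m).mono (h.le m) le_rfl)).mul_const _)
  have I1 : Integrable (fun ω => Complex.exp ((∑ i ∈ Finset.range m, D i ω : ℝ) * Complex.I)) P :=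
    integrable_of_measurable_of_bound hMm (c := 1) fun ω => by rw [Complex.norm_exp_ofReal_mul_I]
  have I2 : Integrable K P := integrable_of_measurable_of_bound hKm hKb
  have e : ((Real.exp (-q / 2) : ℝ) : ℂ) = ∫ ω, K ω * (Real.exp (-q / 2) : ℝ) ∂P := by
    rw [integral_mul_const, hK1, one_mul]
  have hVm : Measurable fun ω => ∑ i ∈ Finset.range m, v i ω :=
    Finset.measurable_fun_sum _ fun i _ => (h.measurable_v i).mono (h.le i) le_rfl
  set B := {ω | θ < |∑ i ∈ Finset.range m, v i ω - q|} with hB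
  have hBm : MeasurableSet B := measurableSet_lt measurable_const (hVm.sub_const q).abs
  rw [e, ← integral_sub I1 (I2.mul_const _)]
  have hexp0 : 0 < Real.exp ((q + 1) / 2) := Real.exp_pos _
  calc _ ≤ ∫ ω, ‖Complex.exp ((∑ i ∈ Finset.range m, D i ω : ℝ) * Complex.I) -
        K ω * (Real.exp (-q / 2) : ℝ)‖ ∂P := norm_integral_le_integral_norm _
    _ ≤ ∫ ω, (θ + B.indicator (fun _ => 1 + Real.exp ((q + 1) / 2)) ω) ∂P := by
        refine integral_mono (I1.sub (I2.mul_const _)).norm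
          ((integrable_const _).add ((integrable_const _).indicator hBm)) fun ω => ?_
        simp only
        by_cases hω : ω ∈ B
        · rw [Set.indicator_of_mem hω]
          have h1 : ‖K ω * (Real.exp (-q / 2) : ℝ)‖ ≤ Real.exp ((q + 1) / 2) := by
            rw [norm_mul, Complex.norm_real, Real.norm_of_nonneg (Real.exp_pos _).le]
            refine (mul_le_of_le_one_right (norm_nonneg _) ?_).trans (hKb ω)
            exact Real.exp_le_one_iff.2 (by linarith)
          have h2 := norm_sub_le (Complex.exp ((∑ i ∈ Finset.range m, D i ω : ℝ) * Complex.I))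
            (K ω * (Real.exp (-q / 2) : ℝ))
          rw [Complex.norm_exp_ofReal_mul_I] at h2
          linarith
        · rw [Set.indicator_of_notMem hω, add_zero]
          have hω' : |∑ i ∈ Finset.range m, v i ω - q| ≤ θ := by
            simpa [hB] using hω
          have hle := abs_le.1 hω'
          rw [hKe ω (by linarith)]
          rw [mul_assoc, ← Complex.ofReal_mul, ← Real.exp_add, ← mul_one_sub, norm_mul,
            Complex.norm_exp_ofReal_mul_I, one_mul, ← Complex.ofReal_one, ← Complex.ofReal_sub,
            Complex.norm_real, norm_sub_rev, Real.norm_eq_abs]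
          have e2 : (∑ i ∈ Finset.range m, v i ω) / 2 + -q / 2
              = (∑ i ∈ Finset.range m, v i ω - q) / 2 := by ring
          rw [e2]
          have h3 : |(∑ i ∈ Finset.range m, v i ω - q) / 2| ≤ θ / 2 := by
            rw [abs_div, abs_two]; linarith
          have := Real.abs_exp_sub_one_le (x := (∑ i ∈ Finset.range m, v i ω - q) / 2)
            (by linarith)
          linarith
    _ = _ := by
        rw [integral_add (integrable_const _) ((integrable_const _).indicator hBm),
          integral_indicator_const _ hBm]
        simp [mul_comm]

end CondGaussian

/-- The data of a process `1_{(s, t] × B} h` with `B ∈ 𝓕 s`. -/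
structure StepTerm {Ω : Type*} [mΩ : MeasurableSpace Ω] {T : ℝ}
    (𝓕 : Filtration (TimeInterval T) mΩ) (H : Type*) where
  s : TimeInterval T
  t : TimeInterval T
  le : s ≤ t
  B : Set Ω
  measurableSet_B : MeasurableSet[𝓕 s] B
  h : H

/-- The points are inserted in increasing order. Repetitions are allowed because degenerate cells
carry neither length nor increments, and indexing by all of `ℕ` makes the grid usable as the time
set of a filtration. -/
lemma exists_monotone_grid {α : Type*} [LinearOrder α] (b : α) (hb : ∀ x, b ≤ x) (G : Finset α) :
    ∃ (m : ℕ) (u : ℕ → α), Monotone u ∧ u 0 = b ∧ ∀ g ∈ G, ∃ j ≤ m, u j = g := by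
  induction G using Finset.induction_on_max with
  | empty => exact ⟨0, fun _ => b, monotone_const, rfl, by simp⟩
  | insert a G ha ih =>
    obtain ⟨m, u, hu, hu0, hG⟩ := ih
    refine ⟨m + 1, fun j => if j ≤ m then min (u j) a else a, ?_, ?_, ?_⟩
    · intro i j hij
      dsimp only
      split_ifs with h1 h2
      · exact min_le_min_right a (hu hij)
      · exact min_le_right _ _
      · omega
      · exact le_rfl
    · simp [hu0, hb]
    · intro g hg
      rcases Finset.mem_insert.1 hg with rfl | hg
      · exact ⟨m + 1, le_rfl, by simp⟩
      · obtain ⟨j, hj, rfl⟩ := hG g hg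
        exact ⟨j, hj.trans (Nat.le_succ m), by simp [hj, (ha _ hg).le]⟩

lemma timeMeasure_Ioc {T : ℝ} {a b : TimeInterval T} :
    timeMeasure T (Set.Ioc a b) = ENNReal.ofReal ((b : ℝ) - a) := by
  rw [timeMeasure, (MeasurableEmbedding.subtype_coe measurableSet_Icc).comap_apply]
  have : (Subtype.val '' Set.Ioc a b : Set ℝ) = Set.Ioc (a : ℝ) b := by
    ext x
    constructor
    · rintro ⟨y, ⟨h1, h2⟩, rfl⟩
      exact ⟨h1, h2⟩
    · rintro ⟨h1, h2⟩
      exact ⟨⟨x, a.2.1.trans h1.le, h2.trans b.2.2⟩, ⟨h1, h2⟩, rfl⟩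
  rw [this, Real.volume_Ioc]

lemma timeMeasure_univ {T : ℝ} : timeMeasure T Set.univ = ENNReal.ofReal T := by
  rw [timeMeasure, (MeasurableEmbedding.subtype_coe measurableSet_Icc).comap_apply,
    Set.image_univ, Subtype.range_coe, Real.volume_Icc, sub_zero]

instance {T : ℝ} : IsFiniteMeasure (timeMeasure T) :=
  ⟨by rw [timeMeasure_univ]; exact ENNReal.ofReal_lt_top⟩

lemma timeMeasure_real_Ioc {T : ℝ} {a b : TimeInterval T} (h : a ≤ b) :
    (timeMeasure T).real (Set.Ioc a b) = (b : ℝ) - a := by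
  rw [Measure.real, timeMeasure_Ioc, ENNReal.toReal_ofReal (sub_nonneg.2 h)]

/-! ### Integrals of scalar step processes. -/

section

variable {Ω : Type*} [mΩ : MeasurableSpace Ω] {P : Measure Ω}
  {T : ℝ} {𝓕 : Filtration (TimeInterval T) mΩ}
  {H : Type*} [NormedAddCommGroup H] [InnerProductSpace ℝ H]
  {W : TimeInterval T → H →L[ℝ] Lp ℝ 2 P}
  {α : Type*} [Fintype α]

/-- The value of a step process. -/
noncomputable def stepValue (τ : α → StepTerm 𝓕 H) (p : TimeInterval T × Ω) : H :=
  ∑ i, (Set.Ioc (τ i).s (τ i).t ×ˢ (τ i).B).indicator (fun _ => (τ i).h) p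

/-- The integral of a step process. -/
noncomputable def stepIntegral (W : TimeInterval T → H →L[ℝ] Lp ℝ 2 P) (τ : α → StepTerm 𝓕 H)
    (t : TimeInterval T) (ω : Ω) : ℝ :=
  ∑ i, (τ i).B.indicator
    (fun ω => W (min (τ i).t t) (τ i).h ω - W (min (τ i).s t) (τ i).h ω) ω

/-- The quadratic variation of the integral of a step process. -/
noncomputable def stepEnergy (τ : α → StepTerm 𝓕 H) (ω : Ω) : ℝ :=
  ∫ t, ‖stepValue τ (t, ω)‖ ^ 2 ∂timeMeasure T

/-- The increment is independent of the past and centred Gaussian with variance `(t - s) * ‖h‖ ^ 2`.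
-/
lemma integral_mul_exp_increment [IsProbabilityMeasure P] (hW : IsCylindricalBrownianMotion P 𝓕 W)
    (h : H) {s t : TimeInterval T} (hst : s ≤ t) {Y : Ω → ℂ} (hY : Measurable[𝓕 s] Y) :
    ∫ ω, Y ω * Complex.exp ((W t h ω - W s h ω : ℝ) * Complex.I) ∂P =
      (∫ ω, Y ω ∂P) * Real.exp (-(((t : ℝ) - s) * ‖h‖ ^ 2) / 2) := by
  have hB := hW.brownian h
  have hind : IndepFun (fun ω => W t h ω - W s h ω) Y P := by
    have := hB.indep s t hst
    exact indep_of_indep_of_le_right this hY.comap_le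
  have hm : AEStronglyMeasurable (fun ω => W t h ω - W s h ω) P :=
    (Lp.aestronglyMeasurable _).sub (Lp.aestronglyMeasurable _)
  have hexp : Measurable fun x : ℝ => Complex.exp (x * Complex.I) :=
    Complex.measurable_exp.comp (Complex.measurable_ofReal.mul_const _)
  have h1 := (hind.comp hexp measurable_id).symm.integral_fun_mul_eq_mul_integral
    (hY.mono (𝓕.le s) le_rfl).aestronglyMeasurable
    (hexp.comp_aemeasurable hm.aemeasurable).aestronglyMeasurable
  simp only [Function.comp_apply, id] at h1
  rw [h1]
  congr 1
  have h2 := hB.gaussian s t hst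
  have h3 : ∫ ω, Complex.exp ((W t h ω - W s h ω : ℝ) * Complex.I) ∂P
      = charFun (gaussianReal 0 (‖h‖₊ ^ 2 * Real.toNNReal ((t : ℝ) - s))) 1 := by
    rw [← h2.map_eq, charFun_apply_real, integral_map h2.aemeasurable
      (by fun_prop)]
    simp
  rw [h3, charFun_gaussianReal]
  simp only [Complex.ofReal_one, one_mul, Complex.ofReal_zero, zero_mul, one_pow, mul_one, zero_sub]
  rw [Complex.ofReal_exp]
  congr 1
  have : ((‖h‖₊ ^ 2 * Real.toNNReal ((t : ℝ) - s) : ℝ≥0) : ℝ) = ‖h‖ ^ 2 * ((t : ℝ) - s) := by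
    rw [NNReal.coe_mul, NNReal.coe_pow, coe_nnnorm, Real.coe_toNNReal _ (sub_nonneg.2 hst)]
  rw [show (((‖h‖₊ ^ 2 * Real.toNNReal ((t : ℝ) - s) : ℝ≥0) : ℂ)) =
    (((‖h‖₊ ^ 2 * Real.toNNReal ((t : ℝ) - s) : ℝ≥0) : ℝ) : ℂ) from rfl, this]
  push_cast
  ring

/-- The indices of the terms which are active between the grid points `a` and `b`. -/
noncomputable def activeTerms (τ : α → StepTerm 𝓕 H) (a b : TimeInterval T) (ω : Ω) : Finset α := by
  classical exact Finset.univ.filter fun i => ((τ i).s ≤ a ∧ b ≤ (τ i).t) ∧ ω ∈ (τ i).B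

lemma mem_activeTerms {τ : α → StepTerm 𝓕 H} {a b : TimeInterval T} {ω : Ω} {i : α} :
    i ∈ activeTerms τ a b ω ↔ ((τ i).s ≤ a ∧ b ≤ (τ i).t) ∧ ω ∈ (τ i).B := by
  classical simp [activeTerms]

/-- A term active between `a` and `b` has started no later than `a`, so its random set belongs to `𝓕
a`: the active terms are known at the left end. -/
lemma measurableSet_activeTerms_eq (τ : α → StepTerm 𝓕 H) (a b : TimeInterval T) (p : Finset α) :
    MeasurableSet[𝓕 a] {ω | activeTerms τ a b ω = p} := by
  have : {ω | activeTerms τ a b ω = p} = ⋂ i, {ω | i ∈ activeTerms τ a b ω ↔ i ∈ p} := by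
    ext ω; simp [Finset.ext_iff]
  rw [this]
  refine MeasurableSet.iInter fun i => ?_
  simp only [mem_activeTerms]
  by_cases h : (τ i).s ≤ a ∧ b ≤ (τ i).t
  · have hB : MeasurableSet[𝓕 a] (τ i).B := 𝓕.mono h.1 _ (τ i).measurableSet_B
    by_cases hp : i ∈ p
    · simpa [h, hp] using hB
    · have e : {ω | ((τ i).s ≤ a ∧ b ≤ (τ i).t) ∧ ω ∈ (τ i).B ↔ i ∈ p} = (τ i).Bᶜ := by
        ext ω; simp [h, hp]
      rw [e]
      exact hB.compl
  · by_cases hp : i ∈ p <;> simp [h, hp]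

lemma sum_patterns {F : Type*} [AddCommMonoid F] {p₀ : Finset α} [DecidableEq (Finset α)]
    (f : Finset α → F) :
    ∑ p : Finset α, (if p₀ = p then f p else 0) = f p₀ := by
  simp

lemma stronglyMeasurable_activeTerms {F : Type*} [NormedAddCommGroup F]
    (τ : α → StepTerm 𝓕 H) {a b c : TimeInterval T} (hac : a ≤ c)
    {f : Finset α → Ω → F} (hf : ∀ p, StronglyMeasurable[𝓕 c] (f p)) :
    StronglyMeasurable[𝓕 c] fun ω => f (activeTerms τ a b ω) ω := by
  classical
  have : (fun ω => f (activeTerms τ a b ω) ω) =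
      fun ω => ∑ p, {ω | activeTerms τ a b ω = p}.indicator (f p) ω := by
    ext ω
    simp only [Set.indicator_apply, Set.mem_ofPred_eq]
    rw [sum_patterns (fun p => f p ω)]
  rw [this]
  exact Finset.stronglyMeasurable_fun_sum _ fun p _ =>
    (hf p).indicator (𝓕.mono hac _ (measurableSet_activeTerms_eq τ a b p))

lemma coe_sum_apply (t : TimeInterval T) (p : Finset α) (h : α → H) :
    (W t (∑ i ∈ p, h i) : Ω → ℝ) =ᵐ[P] fun ω => ∑ i ∈ p, W t (h i) ω := by
  rw [map_sum]
  exact Lp.coeFn_finsetSum p _ |>.trans (ae_of_all _ fun ω => by simp)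

/-- On a grid containing all endpoints, the active terms are constant over each cell and known at
its left end. Given them, the increment is that of `W` in a fixed direction, hence Gaussian, with
variance the length of the cell times the squared norm of that direction; these variances add up to
the energy. -/
lemma exists_condGaussian [IsProbabilityMeasure P] (hW : IsCylindricalBrownianMotion P 𝓕 W)
    (hT : 0 ≤ T) (τ : α → StepTerm 𝓕 H) :
    ∃ (m : ℕ) (u : ℕ → TimeInterval T) (𝒢 : ℕ → MeasurableSpace Ω) (D v : ℕ → Ω → ℝ),
      CondGaussian P 𝒢 D v ∧ (u m : ℝ) = T ∧
      (∀ ω, ∑ i ∈ Finset.range m, v i ω = stepEnergy τ ω) ∧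
      ∀ j, (fun ω => ∑ i ∈ Finset.range j, D i ω) =ᵐ[P] stepIntegral W τ (u j) := by
  classical
  obtain ⟨m, u, hu, hu0, hG⟩ := exists_monotone_grid (⟨0, le_rfl, hT⟩ : TimeInterval T)
    (fun x => x.2.1) (insert ⟨T, hT, le_rfl⟩
      (Finset.univ.image (fun i => (τ i).s) ∪ Finset.univ.image fun i => (τ i).t))
  have hsu : ∀ i, ∃ j ≤ m, u j = (τ i).s := fun i => hG _ (by simp)
  have htu : ∀ i, ∃ j ≤ m, u j = (τ i).t := fun i => hG _ (by simp)
  have hgrid : ∀ g, (∃ j ≤ m, u j = g) → ∀ j, g ≤ u j ∨ u (j + 1) ≤ g := by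
    rintro g ⟨k, -, rfl⟩ j
    rcases Nat.lt_or_ge j k with h | h
    · exact Or.inr (hu h)
    · exact Or.inl (hu h)
  have hum : (u m : ℝ) = T := by
    obtain ⟨j, hj, h⟩ := hG ⟨T, hT, le_rfl⟩ (by simp)
    refine le_antisymm (u m).2.2 ?_
    have : u j ≤ u m := hu hj
    rw [h] at this
    exact this
  -- adapted versions
  let w : TimeInterval T → H → Ω → ℝ := fun t h => ((hW.brownian h).adapted t).mk _
  have hwm : ∀ t h, StronglyMeasurable[𝓕 t] (w t h) := fun t h =>
    ((hW.brownian h).adapted t).stronglyMeasurable_mk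
  have hw : ∀ t h, (W t h : Ω → ℝ) =ᵐ[P] w t h := fun t h =>
    ((hW.brownian h).adapted t).ae_eq_mk
  let η : ℕ → Ω → H := fun j ω => ∑ i ∈ activeTerms τ (u j) (u (j + 1)) ω, (τ i).h
  let D : ℕ → Ω → ℝ := fun j ω => ∑ i ∈ activeTerms τ (u j) (u (j + 1)) ω,
    (w (u (j + 1)) (τ i).h ω - w (u j) (τ i).h ω)
  let v : ℕ → Ω → ℝ := fun j ω => ((u (j + 1) : ℝ) - u j) * ‖η j ω‖ ^ 2
  have hle : ∀ j, u j ≤ u (j + 1) := fun j => hu (Nat.le_succ j)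
  refine ⟨m, u, fun j => 𝓕 (u j), D, v, ⟨fun i j hij => 𝓕.mono (hu hij), fun j => 𝓕.le _, ?_, ?_,
    ?_, ?_⟩, hum, ?_, ?_⟩
  · intro j
    exact (stronglyMeasurable_activeTerms τ (hle j) (f := fun p ω => ∑ i ∈ p,
      (w (u (j + 1)) (τ i).h ω - w (u j) (τ i).h ω)) fun p =>
      Finset.stronglyMeasurable_fun_sum _ fun i _ =>
        (hwm _ _).sub ((hwm _ _).mono (𝓕.mono (hle j)))).measurable
  · intro j
    have := stronglyMeasurable_activeTerms τ (le_refl (u j)) (b := u (j + 1))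
      (f := fun p (_ : Ω) => ((u (j + 1) : ℝ) - u j) * ‖∑ i ∈ p, (τ i).h‖ ^ 2)
      fun p => stronglyMeasurable_const
    exact this.measurable
  · exact fun j ω => mul_nonneg (sub_nonneg.2 (hle j)) (sq_nonneg _)
  · rintro j Y hY ⟨c, hc⟩
    have hYm := hY.mono (𝓕.le (u j)) le_rfl
    let A : Finset α → Set Ω := fun p => {ω | activeTerms τ (u j) (u (j + 1)) ω = p}
    have hA : ∀ p, MeasurableSet[𝓕 (u j)] (A p) := measurableSet_activeTerms_eq τ _ _
    have hYi : ∀ p, Integrable ((A p).indicator Y) P := fun p =>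
      (CondGaussian.integrable_of_measurable_of_bound hYm hc).indicator (𝓕.le _ _ (hA p))
    let X : Finset α → Ω → ℝ := fun p ω =>
      W (u (j + 1)) (∑ i ∈ p, (τ i).h) ω - W (u j) (∑ i ∈ p, (τ i).h) ω
    have hXm : ∀ p, AEStronglyMeasurable (fun ω => Complex.exp (X p ω * Complex.I)) P := fun p =>
      (by fun_prop : Measurable fun x : ℝ => Complex.exp (x * Complex.I)).comp_aemeasurable
        ((Lp.aestronglyMeasurable _).sub (Lp.aestronglyMeasurable _)).aemeasurable
        |>.aestronglyMeasurable
    have hD : ∀ᵐ ω ∂P, ∀ p, ∑ i ∈ p, (w (u (j + 1)) (τ i).h ω - w (u j) (τ i).h ω) = X p ω := by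
      rw [ae_all_iff]
      intro p
      have h1 : ∀ᵐ ω ∂P, ∀ i, W (u (j + 1)) (τ i).h ω = w (u (j + 1)) (τ i).h ω :=
        ae_all_iff.2 fun i => hw _ _
      have h2 : ∀ᵐ ω ∂P, ∀ i, W (u j) (τ i).h ω = w (u j) (τ i).h ω :=
        ae_all_iff.2 fun i => hw _ _
      filter_upwards [h1, h2, coe_sum_apply (W := W) (u j) p (fun i => (τ i).h),
        coe_sum_apply (W := W) (u (j + 1)) p (fun i => (τ i).h)] with ω h1 h2 h3 h4
      simp only [X]
      rw [h3, h4, ← Finset.sum_sub_distrib]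
      exact Finset.sum_congr rfl fun i _ => by rw [h1, h2]
    -- Splitting according to the finitely many possible sets of active terms leaves a deterministic
    -- direction on each event `A p`.
    calc ∫ ω, Y ω * Complex.exp (D j ω * Complex.I) ∂P
        = ∫ ω, ∑ p, (A p).indicator Y ω * Complex.exp (X p ω * Complex.I) ∂P := by
          refine integral_congr_ae ?_
          filter_upwards [hD] with ω hω
          simp only [Set.indicator_apply, A, Set.mem_ofPred_eq, ite_mul, zero_mul]
          rw [sum_patterns (fun p => Y ω * Complex.exp (X p ω * Complex.I)), ← hω]
      _ = ∑ p, ∫ ω, (A p).indicator Y ω * Complex.exp (X p ω * Complex.I) ∂P := by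
          refine integral_finsetSum _ fun p _ => ?_
          refine (hYi p).mul_bdd (c := 1) (hXm p) (ae_of_all _ fun ω => ?_)
          rw [Complex.norm_exp_ofReal_mul_I]
      _ = ∑ p, ∫ ω, (A p).indicator Y ω *
            (Real.exp (-(((u (j + 1) : ℝ) - u j) * ‖∑ i ∈ p, (τ i).h‖ ^ 2) / 2) : ℝ) ∂P := by
          refine Finset.sum_congr rfl fun p _ => ?_
          rw [integral_mul_const]
          exact integral_mul_exp_increment hW _ (hle j) (hY.indicator (hA p))
      _ = ∫ ω, ∑ p, (A p).indicator Y ω *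
            (Real.exp (-(((u (j + 1) : ℝ) - u j) * ‖∑ i ∈ p, (τ i).h‖ ^ 2) / 2) : ℝ) ∂P :=
          (integral_finsetSum _ fun p _ => (hYi p).mul_const _).symm
      _ = ∫ ω, Y ω * Real.exp (-(v j ω) / 2) ∂P := by
          refine integral_congr_ae (ae_of_all _ fun ω => ?_)
          simp only [Set.indicator_apply, A, Set.mem_ofPred_eq, ite_mul, zero_mul]
          rw [sum_patterns (fun p => Y ω *
            ((Real.exp (-(((u (j + 1) : ℝ) - u j) * ‖∑ i ∈ p, (τ i).h‖ ^ 2) / 2) : ℝ) : ℂ))]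
  · intro ω
    have hact : ∀ (j : ℕ) (t : TimeInterval T), t ∈ Set.Ioc (u j) (u (j + 1)) →
        stepValue τ (t, ω) = η j ω := by
      intro j t ht
      simp only [stepValue, η, activeTerms, Finset.sum_filter, Set.indicator_apply, Set.mem_prod,
        Set.mem_Ioc]
      refine Finset.sum_congr rfl fun i _ => ?_
      congr 1
      have h1 : (τ i).s < t ↔ (τ i).s ≤ u j := by
        refine ⟨fun h => ?_, fun h => h.trans_lt ht.1⟩
        rcases hgrid _ (hsu i) j with h' | h'
        · exact h'
        · exact absurd (h.trans_le ht.2) (not_lt.2 h')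
      have h2 : t ≤ (τ i).t ↔ u (j + 1) ≤ (τ i).t := by
        refine ⟨fun h => ?_, fun h => ht.2.trans h⟩
        rcases hgrid _ (htu i) j with h' | h'
        · exact absurd (ht.1.trans_le h) (not_lt.2 h')
        · exact h'
      rw [h1, h2]
    have hval : ∀ t, ‖stepValue τ (t, ω)‖ ^ 2 = ∑ j ∈ Finset.range m,
        (Set.Ioc (u j) (u (j + 1))).indicator (fun _ => ‖η j ω‖ ^ 2) t := by
      intro t
      by_cases h : ∃ j ∈ Finset.range m, t ∈ Set.Ioc (u j) (u (j + 1))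
      · obtain ⟨j, hj, hjt⟩ := h
        rw [Finset.sum_eq_single j, Set.indicator_of_mem hjt, hact j t hjt]
        · intro k _ hkj
          refine Set.indicator_of_notMem (fun hk => ?_) _
          exact Set.disjoint_left.1 (hu.pairwise_disjoint_on_Ioc_succ hkj) hk hjt
        · exact fun h => absurd hj h
      · push Not at h
        rw [Finset.sum_eq_zero fun j hj => Set.indicator_of_notMem (h j hj) _]
        -- If a term were active at `t`, the first grid point not before `t` would be the right end
        -- of a cell containing `t`.
        have hz : stepValue τ (t, ω) = 0 := by
          refine Finset.sum_eq_zero fun i _ => Set.indicator_of_notMem (fun hi => ?_) _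
          have hi1 : t ∈ Set.Ioc (τ i).s (τ i).t := hi.1
          have hex : ∃ j, t ≤ u j := by
            obtain ⟨j, -, hj⟩ := htu i
            exact ⟨j, hj ▸ hi1.2⟩
          have hfind : t ≤ u (Nat.find hex) := Nat.find_spec hex
          have hne : Nat.find hex ≠ 0 := fun h0 => by
            rw [h0, hu0] at hfind
            have h3 : (t : ℝ) ≤ 0 := hfind
            have h4 : ((τ i).s : ℝ) < t := hi1.1
            linarith [(τ i).s.2.1]
          obtain ⟨k, hk⟩ := Nat.exists_eq_succ_of_ne_zero hne
          have hlt : u k < t := not_le.1 (Nat.find_min hex (by omega))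
          have hkm : k < m := by
            obtain ⟨j, hjm, hj⟩ := htu i
            have h5 : Nat.find hex ≤ j := Nat.find_min' hex (hj ▸ hi1.2)
            omega
          exact h k (Finset.mem_range.2 hkm) ⟨hlt, by rw [← Nat.succ_eq_add_one, ← hk]; exact hfind⟩
        rw [hz]; simp
    unfold stepEnergy
    simp only [hval]
    rw [integral_finsetSum _ fun j _ => (integrable_const _).indicator measurableSet_Ioc]
    refine Finset.sum_congr rfl fun j _ => ?_
    rw [integral_indicator_const _ measurableSet_Ioc, timeMeasure_real_Ioc (hle j), smul_eq_mul]
  · intro j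
    induction j with
    | zero =>
      refine ae_of_all _ fun ω => ?_
      have hmin : ∀ x : TimeInterval T, min x (u 0) = u 0 := fun x =>
        min_eq_right (by rw [hu0]; exact x.2.1)
      simp [stepIntegral, hmin]
    | succ j ih =>
      have h1 : ∀ᵐ ω ∂P, ∀ i, W (u (j + 1)) (τ i).h ω = w (u (j + 1)) (τ i).h ω :=
        ae_all_iff.2 fun i => hw _ _
      have h2 : ∀ᵐ ω ∂P, ∀ i, W (u j) (τ i).h ω = w (u j) (τ i).h ω :=
        ae_all_iff.2 fun i => hw _ _
      filter_upwards [ih, h1, h2] with ω ih h1 h2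
      rw [Finset.sum_range_succ, ih]
      simp only [stepIntegral, D, activeTerms, Finset.sum_filter, ← Finset.sum_add_distrib]
      refine Finset.sum_congr rfl fun i _ => ?_
      by_cases hB : ω ∈ (τ i).B
      · simp only [Set.indicator_of_mem hB, hB, and_true]
        rw [← h1, ← h2]
        -- Each endpoint lies weakly to one side of the cell. When a term over on one side of the
        -- cell nevertheless satisfies the weak inequalities defining activity, the cell is
        -- degenerate and contributes zero.
        rcases hgrid _ (hsu i) j with hs | hs
        · rw [min_eq_left hs, min_eq_left (hs.trans (hle j))]
          rcases hgrid _ (htu i) j with ht | ht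
          · rw [min_eq_left ht, min_eq_left (ht.trans (hle j))]
            split_ifs with hc
            · have e : u (j + 1) = u j := le_antisymm (hc.2.trans ht) (hle j)
              rw [e]; ring
            · ring
          · rw [min_eq_right ht, min_eq_right ((hle j).trans ht), if_pos ⟨hs, ht⟩]
            ring
        · have ht : u (j + 1) ≤ (τ i).t := hs.trans (τ i).le
          rw [min_eq_right hs, min_eq_right ((hle j).trans hs), min_eq_right ht,
            min_eq_right ((hle j).trans ht)]
          split_ifs with hc
          · have e : u (j + 1) = u j := le_antisymm (hs.trans hc.1) (hle j)
            rw [e]; ring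
          · ring
      · simp [Set.indicator_of_notMem hB, hB]


/-- If the integral of a step process is small, then so is its quadratic variation. -/
lemma integral_one_sub_exp_stepEnergy_le [IsProbabilityMeasure P]
    (hW : IsCylindricalBrownianMotion P 𝓕 W) (hT : 0 ≤ T) (τ : α → StepTerm 𝓕 H)
    {X : TimeInterval T → Ω → ℝ} (hX : ∀ t, X t =ᵐ[P] stepIntegral W τ t) {a : ℝ} (ha : a ≤ 1)
    {A : Set Ω} (hA : ∀ t, {ω | a < |X t ω|} ⊆ A) :
    ∫ ω, (1 - Real.exp (-(stepEnergy τ ω) / 2)) ∂P ≤ a ^ 2 + 5 * P.real A := by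
  obtain ⟨m, u, 𝒢, D, v, h, -, hv, hD⟩ := exists_condGaussian hW hT τ
  have h1 := h.integral_one_sub_exp_le ha m
  simp only [hv] at h1
  refine h1.trans (add_le_add_right (mul_le_mul_of_nonneg_left ?_ (by norm_num)) _)
  refine ENNReal.toReal_mono (measure_ne_top _ _) (measure_mono_ae ?_)
  filter_upwards [ae_all_iff.2 hD, ae_all_iff.2 fun j => hX (u j)] with ω h1 h2 h3
  obtain ⟨j, -, hj⟩ := h3
  refine hA (u j) ?_
  show a < |X (u j) ω|
  rw [h2, ← h1]
  exact hj

/-- If the quadratic variation of the integral of a step process is close to a constant, then the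
integral is close to a Gaussian variable. -/
lemma norm_integral_exp_stepIntegral_sub_le [IsProbabilityMeasure P]
    (hW : IsCylindricalBrownianMotion P 𝓕 W) (hT : 0 ≤ T) (τ : α → StepTerm 𝓕 H)
    {q θ : ℝ} (hq : 0 ≤ q) (hθ0 : 0 ≤ θ) (hθ : θ ≤ 1) :
    ‖∫ ω, Complex.exp ((stepIntegral W τ ⟨T, hT, le_rfl⟩ ω : ℝ) * Complex.I) ∂P
        - Real.exp (-q / 2)‖ ≤
      θ + (1 + Real.exp ((q + 1) / 2)) * P.real {ω | θ < |stepEnergy τ ω - q|} := by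
  obtain ⟨m, u, 𝒢, D, v, h, hu, hv, hD⟩ := exists_condGaussian hW hT τ
  have h1 := h.norm_integral_exp_sub_le hq hθ0 hθ m
  simp only [hv] at h1
  refine le_trans (le_of_eq ?_) h1
  congr 2
  refine integral_congr_ae ?_
  have hu' : u m = ⟨T, hT, le_rfl⟩ := Subtype.ext hu
  filter_upwards [hD m] with ω hω
  rw [hu'] at hω
  exact congrArg (fun x : ℝ => Complex.exp (x * Complex.I)) hω.symm

lemma measurable_stepEnergy [IsProbabilityMeasure P]
    (hW : IsCylindricalBrownianMotion P 𝓕 W) (hT : 0 ≤ T) (τ : α → StepTerm 𝓕 H) :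
    Measurable (stepEnergy τ) := by
  obtain ⟨m, u, 𝒢, D, v, h, hu, hv, hD⟩ := exists_condGaussian hW hT τ
  have : stepEnergy τ = fun ω => ∑ i ∈ Finset.range m, v i ω := funext fun ω => (hv ω).symm
  rw [this]
  exact Finset.measurable_fun_sum _ fun i _ => (h.measurable_v i).mono (h.le i) le_rfl

/-- The negative of a step term. -/
def StepTerm.neg (τ : StepTerm 𝓕 H) : StepTerm 𝓕 H := { τ with h := -τ.h }

/-- The terms of the difference of two step processes. -/
def subTerms {β : Type*} (τ : α → StepTerm 𝓕 H) (σ : β → StepTerm 𝓕 H) :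
    α ⊕ β → StepTerm 𝓕 H :=
  Sum.elim τ fun i => (σ i).neg

lemma stepValue_subTerms {β : Type*} [Fintype β] (τ : α → StepTerm 𝓕 H) (σ : β → StepTerm 𝓕 H)
    (p : TimeInterval T × Ω) :
    stepValue (subTerms τ σ) p = stepValue τ p - stepValue σ p := by
  simp only [stepValue, subTerms, Fintype.sum_sum_type, Sum.elim_inl, Sum.elim_inr, StepTerm.neg,
    sub_eq_add_neg, ← Finset.sum_neg_distrib]
  congr 1
  refine Finset.sum_congr rfl fun i _ => ?_
  by_cases hp : p ∈ Set.Ioc (σ i).s (σ i).t ×ˢ (σ i).B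
  · rw [Set.indicator_of_mem hp, Set.indicator_of_mem hp]
  · rw [Set.indicator_of_notMem hp, Set.indicator_of_notMem hp, neg_zero]

lemma stepIntegral_subTerms {β : Type*} [Fintype β] (τ : α → StepTerm 𝓕 H)
    (σ : β → StepTerm 𝓕 H) (t : TimeInterval T) :
    stepIntegral W (subTerms τ σ) t =ᵐ[P]
      fun ω => stepIntegral W τ t ω - stepIntegral W σ t ω := by
  have h : ∀ s : TimeInterval T, ∀ᵐ ω ∂P, ∀ i, W s (-(σ i).h) ω = - W s (σ i).h ω := fun s =>
    ae_all_iff.2 fun i => by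
      rw [map_neg]
      exact Lp.coeFn_neg _
  have h1 : ∀ᵐ ω ∂P, ∀ i, W (min (σ i).t t) (-(σ i).h) ω = - W (min (σ i).t t) (σ i).h ω :=
    ae_all_iff.2 fun i => by
      filter_upwards [h (min (σ i).t t)] with ω hω using hω i
  have h2 : ∀ᵐ ω ∂P, ∀ i, W (min (σ i).s t) (-(σ i).h) ω = - W (min (σ i).s t) (σ i).h ω :=
    ae_all_iff.2 fun i => by
      filter_upwards [h (min (σ i).s t)] with ω hω using hω i
  filter_upwards [h1, h2] with ω h1 h2
  simp only [stepIntegral, subTerms, Fintype.sum_sum_type, Sum.elim_inl, Sum.elim_inr,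
    StepTerm.neg, sub_eq_add_neg (∑ _, _), ← Finset.sum_neg_distrib]
  congr 1
  refine Finset.sum_congr rfl fun i _ => ?_
  by_cases hB : ω ∈ (σ i).B
  · rw [Set.indicator_of_mem hB, Set.indicator_of_mem hB, h1, h2]; ring
  · rw [Set.indicator_of_notMem hB, Set.indicator_of_notMem hB, neg_zero]

/-- The integral of a deterministic step process is Gaussian. -/
lemma integral_exp_stepIntegral_of_const [IsProbabilityMeasure P]
    (hW : IsCylindricalBrownianMotion P 𝓕 W) (hT : 0 ≤ T) (τ : α → StepTerm 𝓕 H)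
    {q : ℝ} (hq : ∀ ω, stepEnergy τ ω = q) :
    ∫ ω, Complex.exp ((stepIntegral W τ ⟨T, hT, le_rfl⟩ ω : ℝ) * Complex.I) ∂P
      = Real.exp (-q / 2) := by
  have hq0 : 0 ≤ q := by
    obtain ⟨ω⟩ : Nonempty Ω := nonempty_of_isProbabilityMeasure P
    rw [← hq ω]
    exact integral_nonneg fun t => sq_nonneg _
  have h := norm_integral_exp_stepIntegral_sub_le hW hT τ hq0 le_rfl zero_le_one
  have h2 : {ω | (0 : ℝ) < |stepEnergy τ ω - q|} = ∅ := by
    ext ω; simp [hq]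
  rw [h2] at h
  simp only [measureReal_empty, mul_zero, add_zero] at h
  exact sub_eq_zero.1 (norm_le_zero_iff.1 h)

end

/-- A diagonal Borel–Cantelli argument: at stage `k` the first `k + 1` sequences are required to be
within `2 ^ (-k)` of their limits off a set of measure at most `2 ^ (-k)`, so a single subsequence
serves all indices. -/
lemma exists_seq_tendsto_ae_of_countable {X F : Type*} [MeasurableSpace X] {ν : Measure X}
    [PseudoEMetricSpace F] {f : ℕ → ℕ → X → F} {g : ℕ → X → F}
    (h : ∀ i, TendstoInMeasure ν (f i) atTop (g i)) :
    ∃ ns : ℕ → ℕ, StrictMono ns ∧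
      ∀ᵐ x ∂ν, ∀ i, Tendsto (fun k => f i (ns k) x) atTop (𝓝 (g i x)) := by
  let A : ℕ → ℕ → Set X := fun k n =>
    ⋃ i ∈ Finset.range (k + 1), {x | (2⁻¹ : ℝ≥0∞) ^ k ≤ edist (f i n x) (g i x)}
  have hev : ∀ k, ∀ᶠ n in atTop, ν (A k n) ≤ 2⁻¹ ^ k := by
    intro k
    have hpos : (0 : ℝ≥0∞) < 2⁻¹ ^ k := ENNReal.pow_pos (by simp) k
    have h1 : Tendsto (fun n => ∑ i ∈ Finset.range (k + 1),
        ν {x | (2⁻¹ : ℝ≥0∞) ^ k ≤ edist (f i n x) (g i x)}) atTop (𝓝 0) := by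
      have := tendsto_finsetSum (Finset.range (k + 1)) fun i _ => h i _ hpos
      simpa using this
    filter_upwards [h1.eventually_le_const hpos] with n hn
    exact (measure_biUnion_finset_le _ _).trans hn
  obtain ⟨ns, hns, hA⟩ := extraction_forall_of_eventually hev
  refine ⟨ns, hns, ?_⟩
  have hsum : ∑' k, ν (A k (ns k)) ≠ ∞ := by
    refine ne_top_of_le_ne_top ?_ (ENNReal.tsum_le_tsum hA)
    rw [ENNReal.tsum_geometric]
    simp
  filter_upwards [ae_eventually_notMem hsum] with x hx i
  rw [EMetric.tendsto_nhds]
  intro ε hε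
  have hlim : Tendsto (fun k => (2⁻¹ : ℝ≥0∞) ^ k) atTop (𝓝 0) :=
    ENNReal.tendsto_pow_atTop_nhds_zero_of_lt_one (by simp)
  filter_upwards [hx, hlim.eventually_lt_const hε, eventually_ge_atTop i] with k hk hkε hki
  refine lt_trans ?_ hkε
  by_contra hcon
  refine hk (Set.mem_iUnion₂.2 ⟨i, Finset.mem_range.2 (by omega), ?_⟩)
  exact not_lt.1 hcon

/-- Weak lower semicontinuity of the norm, tested on a dense set. The sequence need not be bounded,
so the test is made along the indices where the norm stays below a level strictly between the lower
limit and `‖y‖`. The resulting bound extends from `D` to the vector `y` by density. -/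
lemma enorm_sq_le_liminf_of_tendsto_inner {H : Type*} [NormedAddCommGroup H]
    [InnerProductSpace ℝ H] {D : Set H} (hD : Dense D) {x : ℕ → H} {y : H}
    (h : ∀ d ∈ D, Tendsto (fun k => inner ℝ (x k) d) atTop (𝓝 (inner ℝ y d))) :
    ‖y‖ₑ ^ 2 ≤ liminf (fun k => ‖x k‖ₑ ^ 2) atTop := by
  by_contra! hlt
  obtain ⟨c, hc1, hc2⟩ := ENNReal.lt_iff_exists_nnreal_btwn.1 hlt
  have hfreq := frequently_lt_of_liminf_lt (by isBoundedDefault) hc1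
  have conv : ∀ z : H, ‖z‖ₑ ^ 2 = ENNReal.ofReal (‖z‖ ^ 2) := fun z => by
    rw [ENNReal.ofReal_pow (norm_nonneg _), ofReal_norm]
  have hcy : Real.sqrt c < ‖y‖ := by
    rw [conv, ← ENNReal.ofReal_coe_nnreal, ENNReal.ofReal_lt_ofReal_iff'] at hc2
    rw [Real.sqrt_lt' ((lt_of_le_of_ne (norm_nonneg _)) ?_)]
    · exact hc2.1
    · intro h0; rw [← h0] at hc2; simp at hc2
  have hfreq' : ∃ᶠ k in atTop, ‖x k‖ ≤ Real.sqrt c := by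
    refine hfreq.mono fun k hk => ?_
    rw [conv, ← ENNReal.ofReal_coe_nnreal] at hk
    exact Real.le_sqrt_of_sq_le (ENNReal.ofReal_lt_ofReal_iff'.1 hk).1.le
  have hin : ∀ d ∈ D, inner ℝ y d ≤ Real.sqrt c * ‖d‖ := by
    intro d hd
    by_contra! hlt
    obtain ⟨k, hk1, hk2⟩ := (hfreq'.and_eventually ((h d hd).eventually_const_lt hlt)).exists
    have := real_inner_le_norm (x k) d
    nlinarith [norm_nonneg d]
  have hcl : IsClosed {d : H | inner ℝ y d ≤ Real.sqrt c * ‖d‖} :=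
    isClosed_le (by fun_prop) (by fun_prop)
  have hy : inner ℝ y y ≤ Real.sqrt c * ‖y‖ := hcl.closure_subset_iff.2 hin (hD y)
  rw [real_inner_self_eq_norm_sq] at hy
  nlinarith [Real.sqrt_nonneg (c : ℝ)]

/-! ### Functionals of elementary processes and the limit of their kernels. -/

section

variable {Ω : Type*} [mΩ : MeasurableSpace Ω] {P : Measure Ω}
  {T : ℝ} {𝓕 : Filtration (TimeInterval T) mΩ}
  {H : Type*} [NormedAddCommGroup H] [InnerProductSpace ℝ H]
  {E : Type*} [NormedAddCommGroup E] [NormedSpace ℝ E]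

/-- The `H`-valued step process obtained by composing an elementary adapted process with a
functional. -/
noncomputable def ElementaryAdapted.terms (Ψ : ElementaryAdapted 𝓕 H E) (x' : E →L[ℝ] ℝ) :
    Fin Ψ.N × Fin Ψ.M → StepTerm 𝓕 H := fun i =>
  { s := Ψ.t i.1.castSucc
    t := Ψ.t i.1.succ
    le := Ψ.strictMono_t.monotone (Fin.castSucc_lt_succ).le
    B := Ψ.A i.2 i.1
    measurableSet_B := Ψ.measurableSet_A i.2 i.1
    h := ∑ k, x' (Ψ.x k i.2 i.1) • Ψ.h k }

lemma ElementaryAdapted.inner_stepValue_terms (Ψ : ElementaryAdapted 𝓕 H E) (x' : E →L[ℝ] ℝ)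
    (p : TimeInterval T × Ω) (h : H) :
    inner ℝ (stepValue (Ψ.terms x') p) h = x' (Ψ.process p h) := by
  simp only [stepValue, ElementaryAdapted.process, Fintype.sum_prod_type, sum_inner,
    FunLike.coe_sum, Finset.sum_apply, map_sum]
  refine Finset.sum_congr rfl fun n _ => Finset.sum_congr rfl fun m _ => ?_
  have e : ((Ψ.terms x' (n, m)).s, (Ψ.terms x' (n, m)).t, (Ψ.terms x' (n, m)).B)
    = (Ψ.t n.castSucc, Ψ.t n.succ, Ψ.A m n) := rfl
  by_cases hp : p ∈ Set.Ioc (Ψ.t n.castSucc) (Ψ.t n.succ) ×ˢ Ψ.A m n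
  · rw [Set.indicator_of_mem hp, Set.indicator_of_mem (by exact hp)]
    simp only [ElementaryAdapted.terms, sum_inner, inner_smul_left, FunLike.coe_sum,
      Finset.sum_apply, map_sum]
    refine Finset.sum_congr rfl fun k _ => ?_
    simp [mul_comm]
  · rw [Set.indicator_of_notMem hp, Set.indicator_of_notMem (by exact hp)]
    simp

lemma ElementaryAdapted.stepIntegral_terms (W : TimeInterval T → H →L[ℝ] Lp ℝ 2 P)
    (Ψ : ElementaryAdapted 𝓕 H E) (x' : E →L[ℝ] ℝ) (t : TimeInterval T) :
    (fun ω => x' (Ψ.integral W t ω)) =ᵐ[P] stepIntegral W (Ψ.terms x') t := by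
  have key : ∀ (r : TimeInterval T) (n : Fin Ψ.N) (m : Fin Ψ.M), ∀ᵐ ω ∂P,
      W r (∑ k, x' (Ψ.x k m n) • Ψ.h k) ω = ∑ k, x' (Ψ.x k m n) * W r (Ψ.h k) ω := by
    intro r n m
    have h1 : ∀ᵐ ω ∂P, ∀ k, (W r (x' (Ψ.x k m n) • Ψ.h k)) ω =
        x' (Ψ.x k m n) * W r (Ψ.h k) ω := ae_all_iff.2 fun k => by
      rw [map_smul]
      exact Lp.coeFn_smul _ _
    filter_upwards [coe_sum_apply (W := W) r Finset.univ (fun k => x' (Ψ.x k m n) • Ψ.h k),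
      h1] with ω h2 h3
    rw [h2]
    exact Finset.sum_congr rfl fun k _ => h3 k
  have h1 := ae_all_iff.2 fun n => ae_all_iff.2 fun m => key (min (Ψ.t n.succ) t) n m
  have h2 := ae_all_iff.2 fun n => ae_all_iff.2 fun m => key (min (Ψ.t n.castSucc) t) n m
  filter_upwards [h1, h2] with ω h1 h2
  simp only [stepIntegral, ElementaryAdapted.integral, Fintype.sum_prod_type, map_sum]
  refine Finset.sum_congr rfl fun n _ => Finset.sum_congr rfl fun m _ => ?_
  by_cases hA : ω ∈ Ψ.A m n
  · rw [Set.indicator_of_mem hA, Set.indicator_of_mem (by exact hA)]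
    simp only [ElementaryAdapted.terms]
    rw [h1, h2, map_sum, ← Finset.sum_sub_distrib]
    refine Finset.sum_congr rfl fun k _ => ?_
    rw [map_smul, smul_eq_mul]; ring
  · rw [Set.indicator_of_notMem hA, Set.indicator_of_notMem (by exact hA), map_zero]

lemma stronglyMeasurable_stepValue {α : Type*} [Fintype α] (τ : α → StepTerm 𝓕 H) :
    StronglyMeasurable (stepValue τ) :=
  Finset.stronglyMeasurable_fun_sum _ fun i _ => stronglyMeasurable_const.indicator
    (measurableSet_Ioc.prod (𝓕.le _ _ (τ i).measurableSet_B))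

lemma memLp_stepValue {α : Type*} [Fintype α] (τ : α → StepTerm 𝓕 H) (ω : Ω) :
    MemLp (fun t => stepValue τ (t, ω)) 2 (timeMeasure T) := by
  refine MemLp.of_bound ((stronglyMeasurable_stepValue τ).comp_measurable
    measurable_prodMk_right).aestronglyMeasurable (∑ i, ‖(τ i).h‖) (ae_of_all _ fun t => ?_)
  refine (norm_sum_le _ _).trans (Finset.sum_le_sum fun i _ => ?_)
  exact norm_indicator_le_norm_self (fun _ => (τ i).h) _

lemma ofReal_stepEnergy {α : Type*} [Fintype α] (τ : α → StepTerm 𝓕 H) (ω : Ω) :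
    ENNReal.ofReal (stepEnergy τ ω) = ∫⁻ t, ‖stepValue τ (t, ω)‖ₑ ^ 2 ∂timeMeasure T := by
  rw [stepEnergy, ofReal_integral_eq_lintegral_ofReal ((memLp_stepValue τ ω).integrable_norm_pow two_ne_zero)
    (ae_of_all _ fun t => sq_nonneg _)]
  refine lintegral_congr fun t => ?_
  rw [ENNReal.ofReal_pow (norm_nonneg _), ofReal_norm]

variable [IsProbabilityMeasure P] {W : TimeInterval T → H →L[ℝ] Lp ℝ 2 P}

/-- From `exp (-v / 2) ≤ 1 / (1 + v / 2)` one gets the lower bound `v / (2 + v)`, which is at least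
a third of `min v 1`. -/
lemma min_le_three_mul_one_sub_exp {v : ℝ} (hv : 0 ≤ v) :
    min v 1 ≤ 3 * (1 - Real.exp (-v / 2)) := by
  have h1 : Real.exp (-v / 2) ≤ 1 / (1 + v / 2) := by
    rw [neg_div, Real.exp_neg, ← one_div]
    refine one_div_le_one_div_of_le (by positivity) ?_
    linarith [Real.add_one_le_exp (v / 2)]
  have h2 : 1 - 1 / (1 + v / 2) = v / (2 + v) := by field_simp; ring
  have h3 : min v 1 ≤ 3 * (v / (2 + v)) := by
    rw [← mul_div_assoc, le_div_iff₀ (by positivity)]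
    rcases le_total v 1 with h | h
    · rw [min_eq_left h]; nlinarith
    · rw [min_eq_right h]; linarith
  linarith

/-- Truncating the energy at `1` expresses smallness in probability, which is all that smallness of
the integral in probability can give. -/
lemma lintegral_min_stepEnergy_le {α : Type*} [Fintype α]
    (hW : IsCylindricalBrownianMotion P 𝓕 W) (hT : 0 ≤ T) (τ : α → StepTerm 𝓕 H)
    {X : TimeInterval T → Ω → ℝ} (hX : ∀ t, X t =ᵐ[P] stepIntegral W τ t) {a : ℝ} (ha : a ≤ 1)
    {A : Set Ω} (hA : ∀ t, {ω | a < |X t ω|} ⊆ A) :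
    ∫⁻ ω, min (∫⁻ t, ‖stepValue τ (t, ω)‖ₑ ^ 2 ∂timeMeasure T) 1 ∂P
      ≤ ENNReal.ofReal (3 * (a ^ 2 + 5 * P.real A)) := by
  have h0 : ∀ ω, 0 ≤ stepEnergy τ ω := fun ω => integral_nonneg fun t => sq_nonneg _
  have hm : Measurable fun ω => 1 - Real.exp (-(stepEnergy τ ω) / 2) :=
    measurable_const.sub (Real.measurable_exp.comp
      ((measurable_stepEnergy hW hT τ).neg.div_const 2))
  have h1 : ∀ ω, 0 ≤ 1 - Real.exp (-(stepEnergy τ ω) / 2) := fun ω =>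
    sub_nonneg.2 (Real.exp_le_one_iff.2 (by linarith [h0 ω]))
  have hi : Integrable (fun ω => 1 - Real.exp (-(stepEnergy τ ω) / 2)) P :=
    CondGaussian.integrable_of_measurable_of_bound hm (c := 1) fun ω => by
      rw [Real.norm_of_nonneg (h1 ω)]
      linarith [Real.exp_pos (-(stepEnergy τ ω) / 2)]
  calc _ ≤ ∫⁻ ω, ENNReal.ofReal (3 * (1 - Real.exp (-(stepEnergy τ ω) / 2))) ∂P := by
        refine lintegral_mono fun ω => ?_
        rw [← ofReal_stepEnergy, ← ENNReal.ofReal_one, ← ENNReal.ofReal_min]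
        exact ENNReal.ofReal_le_ofReal (min_le_three_mul_one_sub_exp (h0 ω))
    _ = ENNReal.ofReal (∫ ω, 3 * (1 - Real.exp (-(stepEnergy τ ω) / 2)) ∂P) :=
        (ofReal_integral_eq_lintegral_ofReal (hi.const_mul 3)
          (ae_of_all _ fun ω => mul_nonneg (by norm_num) (h1 ω))).symm
    _ ≤ _ := by
        rw [integral_const_mul]
        exact ENNReal.ofReal_le_ofReal (mul_le_mul_of_nonneg_left
          (integral_one_sub_exp_stepEnergy_le hW hT τ hX ha hA) (by norm_num))

/-- The vector representing the functional `h ↦ ⟨Φ t h, x'⟩`. -/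
noncomputable def dualKernel [CompleteSpace H] (Φ : TimeInterval T → H →L[ℝ] E)
    (x' : E →L[ℝ] ℝ) (t : TimeInterval T) : H :=
  (InnerProductSpace.toDual ℝ H).symm (x'.comp (Φ t))

lemma inner_dualKernel [CompleteSpace H] (Φ : TimeInterval T → H →L[ℝ] E)
    (x' : E →L[ℝ] ℝ) (t : TimeInterval T) (h : H) :
    inner ℝ (dualKernel Φ x' t) h = x' (Φ t h) := by
  simp [dualKernel, InnerProductSpace.toDual_symm_apply]

lemma countable_of_orthonormal [TopologicalSpace.SeparableSpace H] {κ : Type*} {b : κ → H}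
    (hb : Orthonormal ℝ b) : Countable κ := by
  have : Set.PairwiseDisjoint (Set.univ : Set κ) fun i => Metric.ball (b i) (1 / 2) := by
    intro i _ j _ hij
    refine Metric.ball_disjoint_ball ?_
    have h1 : ‖b i - b j‖ ^ 2 = 2 := by
      rw [@norm_sub_sq_real, hb.1 i, hb.1 j, hb.2 hij]
      norm_num
    rw [dist_eq_norm]
    nlinarith [norm_nonneg (b i - b j)]
  have := this.countable_of_isOpen (fun i _ => Metric.isOpen_ball)
    (fun i _ => ⟨b i, Metric.mem_ball_self (by norm_num)⟩)
  exact Set.countable_univ_iff.1 this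

/-- Weak measurability suffices in a separable space, by expansion in a countable orthonormal basis.
-/
lemma aestronglyMeasurable_of_inner [CompleteSpace H] [TopologicalSpace.SeparableSpace H]
    {X : Type*} [MeasurableSpace X] {ν : Measure X} {f : X → H}
    (hf : ∀ h : H, AEStronglyMeasurable (fun t => inner ℝ (f t) h) ν) :
    AEStronglyMeasurable f ν := by
  obtain ⟨w, b, hb⟩ := exists_hilbertBasis ℝ H
  have hw : Countable w := countable_of_orthonormal b.orthonormal
  refine aestronglyMeasurable_of_tendsto_ae (u := (atTop : Filter (Finset w)))
    (f := fun s t => ∑ i ∈ s, inner ℝ (f t) (b i) • b i) (fun s => ?_)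
    (ae_of_all _ fun t => ?_)
  · exact Finset.aestronglyMeasurable_fun_sum _ fun i _ => (hf (b i)).smul_const _
  · have := b.hasSum_repr (f t)
    simp only [b.repr_apply_apply, HasSum, SummationFilter.unconditional_filter] at this
    simpa only [real_inner_comm] using this

lemma min_liminf_le (u : ℕ → ℝ≥0∞) (c : ℝ≥0∞) :
    min (liminf u atTop) c ≤ liminf (fun k => min (u k) c) atTop := by
  refine le_of_forall_lt fun b hb => ?_
  obtain ⟨b', hb1, hb2⟩ := exists_between hb
  refine lt_of_lt_of_le hb1 (le_liminf_of_le (by isBoundedDefault) ?_)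
  filter_upwards [eventually_lt_of_lt_liminf (hb2.trans_le (min_le_left _ _))
    (by isBoundedDefault)] with k hk
  exact le_min hk.le (hb2.le.trans (min_le_right _ _))

/-- The data exhibiting `ζ` as a stochastic integral of a deterministic function. -/
structure ApproximatesIntegral (W : TimeInterval T → H →L[ℝ] Lp ℝ 2 P)
    (Φ : TimeInterval T → H →L[ℝ] E) (ζ : Ω → C(TimeInterval T, E))
    (Ψ : ℕ → ElementaryAdapted 𝓕 H E) (Z : ℕ → Ω → C(TimeInterval T, E)) : Prop where
  tendsto_process : ∀ (h : H) (x' : E →L[ℝ] ℝ),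
    TendstoInMeasure ((timeMeasure T).prod P)
      (fun n p => x' ((Ψ n).process p h)) atTop (fun p => x' (Φ p.1 h))
  integral_ae_eq : ∀ n t, (fun ω => Z n ω t) =ᵐ[P] (Ψ n).integral W t
  tendsto_integral : TendstoInMeasure P Z atTop ζ

namespace ApproximatesIntegral

variable {Φ : TimeInterval T → H →L[ℝ] E} {ζ : Ω → C(TimeInterval T, E)}
  {Ψ : ℕ → ElementaryAdapted 𝓕 H E} {Z : ℕ → Ω → C(TimeInterval T, E)}

/-- The integrals are Cauchy in measure in the supremum norm. Off a small event, the integral of the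
difference of two of the step processes is thus small at all times, which forces the `L²` distance
of their kernels to be small in probability. -/
lemma exists_lintegral_min_sub_le (h : ApproximatesIntegral W Φ ζ Ψ Z)
    (hW : IsCylindricalBrownianMotion P 𝓕 W) (hT : 0 ≤ T) (x' : E →L[ℝ] ℝ) {δ : ℝ} (hδ : 0 < δ) :
    ∃ N, ∀ n ≥ N, ∀ m ≥ N, ∫⁻ ω, min (∫⁻ t, ‖stepValue ((Ψ n).terms x') (t, ω) -
      stepValue ((Ψ m).terms x') (t, ω)‖ₑ ^ 2 ∂timeMeasure T) 1 ∂P ≤ ENNReal.ofReal δ := by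
  -- In the bound `3 * (a ^ 2 + 5 * P.real A)` both parts are at most `δ / 2`, since `a ^ 2 ≤ δ / 6`
  -- and the probability is at most `2 * (δ / 60)`. The threshold `ε` is chosen so that `(‖x'‖ + 1)
  -- * (2 * ε) = a`.
  set a : ℝ := min 1 (δ / 6) with ha
  have ha0 : 0 < a := lt_min one_pos (by positivity)
  have ha1 : a ≤ 1 := min_le_left _ _
  set ε : ℝ := a / (2 * (‖x'‖ + 1)) with hε
  have hε0 : 0 < ε := by positivity
  have hlim := (tendstoInMeasure_iff_measureReal_dist.1 h.tendsto_integral ε hε0)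
  obtain ⟨N, hN⟩ := eventually_atTop.1 (hlim.eventually_le_const (show 0 < δ / 60 by positivity))
  refine ⟨N, fun n hn m hm => ?_⟩
  have hX : ∀ t, (fun ω => x' (Z n ω t) - x' (Z m ω t)) =ᵐ[P]
      stepIntegral W (subTerms ((Ψ n).terms x') ((Ψ m).terms x')) t := by
    intro t
    filter_upwards [h.integral_ae_eq n t, h.integral_ae_eq m t,
      (Ψ n).stepIntegral_terms W x' t, (Ψ m).stepIntegral_terms W x' t,
      stepIntegral_subTerms (W := W) ((Ψ n).terms x') ((Ψ m).terms x') t] with ω h1 h2 h3 h4 h5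
    rw [h5, ← h3, ← h4, ← h1, ← h2]
  have hA : ∀ t, {ω | a < |x' (Z n ω t) - x' (Z m ω t)|} ⊆
      {ω | ε ≤ dist (Z n ω) (ζ ω)} ∪ {ω | ε ≤ dist (Z m ω) (ζ ω)} := by
    intro t ω hω
    by_contra hcon
    simp only [Set.mem_union, Set.mem_ofPred_eq, not_or, not_le] at hcon
    have h1 : dist (Z n ω t) (Z m ω t) ≤ dist (Z n ω) (Z m ω) := ContinuousMap.dist_apply_le_dist t
    have h2 := dist_triangle_right (Z n ω) (Z m ω) (ζ ω)
    have h3 : |x' (Z n ω t) - x' (Z m ω t)| ≤ ‖x'‖ * dist (Z n ω t) (Z m ω t) := by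
      rw [← map_sub, dist_eq_norm]
      exact x'.le_opNorm _
    have h4 : ‖x'‖ * dist (Z n ω t) (Z m ω t) ≤ (‖x'‖ + 1) * (2 * ε) :=
      mul_le_mul (by linarith) (by linarith) dist_nonneg (by positivity)
    have h5 : (‖x'‖ + 1) * (2 * ε) = a := by rw [hε]; field_simp
    have hω' : a < |x' (Z n ω t) - x' (Z m ω t)| := hω
    linarith
  have key := lintegral_min_stepEnergy_le hW hT _ hX ha1 hA
  simp only [stepValue_subTerms] at key
  refine key.trans (ENNReal.ofReal_le_ofReal ?_)
  have h1 := measureReal_union_le (μ := P) {ω | ε ≤ dist (Z n ω) (ζ ω)}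
    {ω | ε ≤ dist (Z m ω) (ζ ω)}
  have h2 := hN n hn
  have h3 := hN m hm
  have h4 : a ^ 2 ≤ δ / 6 := by
    have : a ≤ δ / 6 := min_le_right _ _
    nlinarith
  linarith

/-- The second index is sent to infinity in the Cauchy bound. The kernels converge only weakly,
along a subsequence and at almost every `(t, ω)`, but lower semicontinuity of the norm and Fatou's
lemma, in `t` and then in `ω`, are enough. -/
lemma exists_lintegral_min_le [CompleteSpace H] [TopologicalSpace.SeparableSpace H]
    (h : ApproximatesIntegral W Φ ζ Ψ Z)
    (hW : IsCylindricalBrownianMotion P 𝓕 W) (hT : 0 ≤ T) (x' : E →L[ℝ] ℝ) {δ : ℝ} (hδ : 0 < δ) :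
    ∃ N, ∀ n ≥ N, ∫⁻ ω, min (∫⁻ t, ‖stepValue ((Ψ n).terms x') (t, ω) -
      dualKernel Φ x' t‖ₑ ^ 2 ∂timeMeasure T) 1 ∂P ≤ ENNReal.ofReal δ := by
  obtain ⟨N, hN⟩ := h.exists_lintegral_min_sub_le hW hT x' hδ
  obtain ⟨ns, hns, hlim⟩ := exists_seq_tendsto_ae_of_countable fun i =>
    h.tendsto_process (TopologicalSpace.denseSeq H i) x'
  refine ⟨N, fun n hn => ?_⟩
  have hlim' : ∀ᵐ ω ∂P, ∀ᵐ t ∂timeMeasure T, ∀ i,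
      Tendsto (fun k => x' ((Ψ (ns k)).process (t, ω) (TopologicalSpace.denseSeq H i))) atTop
        (𝓝 (x' (Φ t (TopologicalSpace.denseSeq H i)))) := by
    have := (Measure.measurePreserving_swap (μ := P) (ν := timeMeasure T)).quasiMeasurePreserving.ae hlim
    exact Measure.ae_ae_of_ae_prod this
  have hmeas : ∀ k, Measurable fun ω => ∫⁻ t, ‖stepValue ((Ψ n).terms x') (t, ω) -
      stepValue ((Ψ (ns k)).terms x') (t, ω)‖ₑ ^ 2 ∂timeMeasure T := by
    intro k
    have : (fun ω => ∫⁻ t, ‖stepValue ((Ψ n).terms x') (t, ω) -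
        stepValue ((Ψ (ns k)).terms x') (t, ω)‖ₑ ^ 2 ∂timeMeasure T) = fun ω =>
        ENNReal.ofReal (stepEnergy (subTerms ((Ψ n).terms x') ((Ψ (ns k)).terms x')) ω) := by
      ext ω
      rw [ofReal_stepEnergy]
      simp only [stepValue_subTerms]
    rw [this]
    exact (measurable_stepEnergy hW hT _).ennreal_ofReal
  calc _ ≤ ∫⁻ ω, liminf (fun k => min (∫⁻ t, ‖stepValue ((Ψ n).terms x') (t, ω) -
        stepValue ((Ψ (ns k)).terms x') (t, ω)‖ₑ ^ 2 ∂timeMeasure T) 1) atTop ∂P := by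
        refine lintegral_mono_ae ?_
        filter_upwards [hlim'] with ω hω
        refine le_trans (min_le_min_right _ ?_) (min_liminf_le _ _)
        refine le_trans (lintegral_mono_ae ?_) (lintegral_liminf_le fun k => ?_)
        · filter_upwards [hω] with t ht
          refine enorm_sq_le_liminf_of_tendsto_inner
            (TopologicalSpace.denseRange_denseSeq H) ?_
          rintro _ ⟨i, rfl⟩
          simp only [inner_sub_left, ElementaryAdapted.inner_stepValue_terms, inner_dualKernel]
          exact tendsto_const_nhds.sub (ht i)
        · have h1 : Measurable fun t => ‖stepValue ((Ψ n).terms x') (t, ω) -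
              stepValue ((Ψ (ns k)).terms x') (t, ω)‖ₑ :=
            (((stronglyMeasurable_stepValue _).comp_measurable measurable_prodMk_right).sub
              ((stronglyMeasurable_stepValue _).comp_measurable measurable_prodMk_right)).enorm
          exact h1.pow_const 2
    _ ≤ liminf (fun k => ∫⁻ ω, min (∫⁻ t, ‖stepValue ((Ψ n).terms x') (t, ω) -
        stepValue ((Ψ (ns k)).terms x') (t, ω)‖ₑ ^ 2 ∂timeMeasure T) 1 ∂P) atTop :=
        lintegral_liminf_le fun k => (hmeas k).min measurable_const
    _ ≤ ENNReal.ofReal δ := by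
        refine liminf_le_of_frequently_le' (Eventually.frequently ?_)
        filter_upwards [eventually_ge_atTop N] with k hk
        exact hN n hn (ns k) (hk.trans (hns.id_le k))

/-- The kernel does not depend on `ω`. The truncated distance has mean at most `1 / 2`, so it is
below `1` at some `ω`, where the kernel is at finite `L²` distance from a bounded step function. -/
lemma memLp_dualKernel [CompleteSpace H] [TopologicalSpace.SeparableSpace H]
    (h : ApproximatesIntegral W Φ ζ Ψ Z)
    (hW : IsCylindricalBrownianMotion P 𝓕 W) (hT : 0 ≤ T)
    (hΦ : ∀ h : H, AEStronglyMeasurable (fun t => Φ t h) (timeMeasure T)) (x' : E →L[ℝ] ℝ) :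
    MemLp (dualKernel Φ x') 2 (timeMeasure T) := by
  have hm : AEStronglyMeasurable (dualKernel Φ x') (timeMeasure T) :=
    aestronglyMeasurable_of_inner fun h => by
      simp only [inner_dualKernel]
      exact x'.continuous.comp_aestronglyMeasurable (hΦ h)
  obtain ⟨N, hN⟩ := h.exists_lintegral_min_le hW hT x' (show (0 : ℝ) < 1 / 2 by norm_num)
  obtain ⟨ω, hω⟩ : ∃ ω, ∫⁻ t, ‖stepValue ((Ψ N).terms x') (t, ω) -
      dualKernel Φ x' t‖ₑ ^ 2 ∂timeMeasure T < 1 := by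
    by_contra! hcon
    have h1 := hN N le_rfl
    simp only [min_eq_right (hcon _), lintegral_one, measure_univ] at h1
    have h2 : ENNReal.ofReal (1 / 2) < 1 := by
      rw [← ENNReal.ofReal_one]; exact (ENNReal.ofReal_lt_ofReal_iff one_pos).2 (by norm_num)
    exact absurd h1 (not_le.2 h2)
  have h1 := memLp_stepValue ((Ψ N).terms x') ω
  have h2 : MemLp (fun t => stepValue ((Ψ N).terms x') (t, ω) - dualKernel Φ x' t) 2
      (timeMeasure T) := by
    refine ⟨h1.1.sub hm, ?_⟩
    rw [eLpNorm_lt_top_iff_lintegral_rpow_enorm_lt_top (by norm_num) (by norm_num)]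
    simpa using hω.trans_le le_top
  have h3 := h1.sub h2
  refine h3.congr_norm hm (ae_of_all _ fun t => ?_)
  simp

end ApproximatesIntegral

end

/-! ### Characteristic functions of stochastic integrals. -/

section

variable {Ω : Type*} [mΩ : MeasurableSpace Ω] {P : Measure Ω}
  {T : ℝ} {𝓕 : Filtration (TimeInterval T) mΩ}
  {H : Type*} [NormedAddCommGroup H] [InnerProductSpace ℝ H]
  {E : Type*} [NormedAddCommGroup E] [NormedSpace ℝ E]

lemma stepValue_sumElim {α β : Type*} [Fintype α] [Fintype β] (τ : α → StepTerm 𝓕 H)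
    (σ : β → StepTerm 𝓕 H) (p : TimeInterval T × Ω) :
    stepValue (Sum.elim τ σ) p = stepValue τ p + stepValue σ p := by
  simp [stepValue, Fintype.sum_sum_type]

lemma stepIntegral_sumElim {α β : Type*} [Fintype α] [Fintype β]
    (W : TimeInterval T → H →L[ℝ] Lp ℝ 2 P) (τ : α → StepTerm 𝓕 H)
    (σ : β → StepTerm 𝓕 H) (t : TimeInterval T) (ω : Ω) :
    stepIntegral W (Sum.elim τ σ) t ω = stepIntegral W τ t ω + stepIntegral W σ t ω := by
  simp [stepIntegral, Fintype.sum_sum_type]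

lemma aestronglyMeasurable_stepIntegral {α : Type*} [Fintype α]
    (W : TimeInterval T → H →L[ℝ] Lp ℝ 2 P) (τ : α → StepTerm 𝓕 H) (t : TimeInterval T) :
    AEStronglyMeasurable (stepIntegral W τ t) P :=
  Finset.aestronglyMeasurable_fun_sum _ fun i _ =>
    ((Lp.aestronglyMeasurable _).sub (Lp.aestronglyMeasurable _)).indicator
      (𝓕.le _ _ (τ i).measurableSet_B)

lemma integral_norm_sq_eq_toReal_eLpNorm {X : Type*} [MeasurableSpace X] {ν : Measure X}
    {f : X → H} (hf : MemLp f 2 ν) : ∫ x, ‖f x‖ ^ 2 ∂ν = (eLpNorm f 2 ν).toReal ^ 2 := by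
  have h1 := ofReal_integral_eq_lintegral_ofReal (hf.integrable_norm_pow two_ne_zero)
    (ae_of_all _ fun t => sq_nonneg _)
  have h2 : eLpNorm f 2 ν ^ 2 = ∫⁻ x, ENNReal.ofReal (‖f x‖ ^ 2) ∂ν := by
    rw [eLpNorm_eq_lintegral_rpow_enorm_toReal (by norm_num) (by norm_num), ← ENNReal.rpow_two,
      ← ENNReal.rpow_mul]
    simp only [ENNReal.toReal_ofNat, one_div]
    rw [inv_mul_cancel₀ (by norm_num), ENNReal.rpow_one]
    refine lintegral_congr fun x => ?_
    rw [ENNReal.rpow_two, ENNReal.ofReal_pow (norm_nonneg _), ofReal_norm]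
  rw [← ENNReal.toReal_pow, h2, ← h1, ENNReal.toReal_ofReal]
  exact integral_nonneg fun t => sq_nonneg _

variable [IsProbabilityMeasure P] {W : TimeInterval T → H →L[ℝ] Lp ℝ 2 P}

lemma tendsto_integral_exp_of_tendstoInMeasure {X : ℕ → Ω → ℝ} {Y : Ω → ℝ}
    (hX : ∀ n, AEStronglyMeasurable (X n) P) (h : TendstoInMeasure P X atTop Y) :
    ∃ ns : ℕ → ℕ, StrictMono ns ∧
      Tendsto (fun k => ∫ ω, Complex.exp (X (ns k) ω * Complex.I) ∂P) atTop
        (𝓝 (∫ ω, Complex.exp (Y ω * Complex.I) ∂P)) := by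
  obtain ⟨ns, hns, hlim⟩ := h.exists_seq_tendsto_ae
  refine ⟨ns, hns, tendsto_integral_of_dominated_convergence (fun _ => 1) (fun k => ?_)
    (integrable_const _) (fun k => ae_of_all _ fun ω => ?_) ?_⟩
  · exact (by fun_prop : Continuous fun x : ℝ => Complex.exp (x * Complex.I)).comp_aestronglyMeasurable
      (hX _)
  · rw [Complex.norm_exp_ofReal_mul_I]
  · filter_upwards [hlim] with ω hω
    exact ((by fun_prop : Continuous fun x : ℝ => Complex.exp (x * Complex.I)).tendsto _).comp hω

namespace ApproximatesIntegral

variable {Φ : TimeInterval T → H →L[ℝ] E} {ζ : Ω → C(TimeInterval T, E)}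
  {Ψ : ℕ → ElementaryAdapted 𝓕 H E} {Z : ℕ → Ω → C(TimeInterval T, E)}

/-- Markov's inequality for the truncated squared distance at the level `min (c ^ 2) 1`. -/
lemma tendsto_measureReal_lintegral [CompleteSpace H] [TopologicalSpace.SeparableSpace H]
    (h : ApproximatesIntegral W Φ ζ Ψ Z)
    (hW : IsCylindricalBrownianMotion P 𝓕 W) (hT : 0 ≤ T)
    (hΦ : ∀ h : H, AEStronglyMeasurable (fun t => Φ t h) (timeMeasure T)) (x' : E →L[ℝ] ℝ)
    {c : ℝ} (hc : 0 < c) :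
    Tendsto (fun n => P.real {ω | c ≤ (eLpNorm (fun t => stepValue ((Ψ n).terms x') (t, ω) -
      dualKernel Φ x' t) 2 (timeMeasure T)).toReal}) atTop (𝓝 0) := by
  have hf := h.memLp_dualKernel hW hT hΦ x'
  obtain ⟨g, hgm, hfg⟩ := hf.1
  set c' : ℝ := min (c ^ 2) 1 with hc'
  have hc'0 : 0 < c' := lt_min (by positivity) one_pos
  rw [Metric.tendsto_atTop]
  intro ε hε
  obtain ⟨N, hN⟩ := h.exists_lintegral_min_le hW hT x' (show 0 < ε * c' / 2 by positivity)
  refine ⟨N, fun n hn => ?_⟩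
  rw [Real.dist_0_eq_abs, abs_of_nonneg measureReal_nonneg]
  have e : ∀ ω, ∫⁻ t, ‖stepValue ((Ψ n).terms x') (t, ω) - dualKernel Φ x' t‖ₑ ^ 2 ∂timeMeasure T
      = ∫⁻ t, ‖stepValue ((Ψ n).terms x') (t, ω) - g t‖ₑ ^ 2 ∂timeMeasure T := fun ω => by
    refine lintegral_congr_ae ?_
    filter_upwards [hfg] with t ht
    rw [ht]
  have hmeas : Measurable fun ω =>
      min (∫⁻ t, ‖stepValue ((Ψ n).terms x') (t, ω) - g t‖ₑ ^ 2 ∂timeMeasure T) 1 := by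
    refine Measurable.min ?_ measurable_const
    refine Measurable.lintegral_prod_left' (f := fun p : TimeInterval T × Ω =>
      ‖stepValue ((Ψ n).terms x') p - g p.1‖ₑ ^ 2) ?_
    exact ((stronglyMeasurable_stepValue _).sub (hgm.comp_measurable measurable_fst)).enorm.pow_const 2
  have h1 := hN n hn
  simp only [e] at h1
  have h2 := mul_meas_ge_le_lintegral (μ := P) hmeas (ENNReal.ofReal c')
  have h3 : P {ω | ENNReal.ofReal c' ≤
      min (∫⁻ t, ‖stepValue ((Ψ n).terms x') (t, ω) - g t‖ₑ ^ 2 ∂timeMeasure T) 1}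
      ≤ ENNReal.ofReal (ε / 2) := by
    have h4 := h2.trans h1
    rw [show ε * c' / 2 = c' * (ε / 2) by ring, ENNReal.ofReal_mul hc'0.le] at h4
    exact (ENNReal.mul_le_mul_iff_right (by simpa using hc'0) ENNReal.ofReal_ne_top).1 h4
  refine lt_of_le_of_lt ?_ (half_lt_self hε)
  refine ENNReal.toReal_le_of_le_ofReal (by positivity) (le_trans (measure_mono fun ω hω => ?_) h3)
  have hω : c ≤ (eLpNorm (fun t => stepValue ((Ψ n).terms x') (t, ω) -
      dualKernel Φ x' t) 2 (timeMeasure T)).toReal := hω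
  have hL : MemLp (fun t => stepValue ((Ψ n).terms x') (t, ω) - dualKernel Φ x' t) 2
    (timeMeasure T) := (memLp_stepValue ((Ψ n).terms x') ω).sub hf
  have h5 := integral_norm_sq_eq_toReal_eLpNorm hL
  have h6 : ∫⁻ t, ‖stepValue ((Ψ n).terms x') (t, ω) - g t‖ₑ ^ 2 ∂timeMeasure T =
      ENNReal.ofReal (∫ t, ‖stepValue ((Ψ n).terms x') (t, ω) - dualKernel Φ x' t‖ ^ 2
        ∂timeMeasure T) := by
    rw [← e, ofReal_integral_eq_lintegral_ofReal (hL.integrable_norm_pow two_ne_zero)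
      (ae_of_all _ fun t => sq_nonneg _)]
    refine lintegral_congr fun t => ?_
    rw [ENNReal.ofReal_pow (norm_nonneg _), ofReal_norm]
  show ENNReal.ofReal c' ≤ _
  rw [h6, h5, ← ENNReal.ofReal_one, ← ENNReal.ofReal_min]
  exact ENNReal.ofReal_le_ofReal (min_le_min_right _ (pow_le_pow_left₀ hc.le hω 2))

/-- The joint characteristic function of a stochastic integral and of a limit of integrals of
deterministic step functions. -/
lemma integral_exp_add [CompleteSpace H] [TopologicalSpace.SeparableSpace H]
    (h : ApproximatesIntegral W Φ ζ Ψ Z)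
    (hW : IsCylindricalBrownianMotion P 𝓕 W) (hT : 0 ≤ T)
    (hΦ : ∀ h : H, AEStronglyMeasurable (fun t => Φ t h) (timeMeasure T)) (x' : E →L[ℝ] ℝ)
    {β : ℕ → Type*} [∀ n, Fintype (β n)] (d : ∀ n, β n → StepTerm 𝓕 H) {D : ℕ → TimeInterval T → H}
    (hD : ∀ n t ω, stepValue (d n) (t, ω) = D n t) {f : TimeInterval T → H}
    (hf : MemLp f 2 (timeMeasure T))
    (hDf : Tendsto (fun n => eLpNorm (fun t => D n t - f t) 2 (timeMeasure T)) atTop (𝓝 0))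
    {γ : Ω → ℝ} (hγ : TendstoInMeasure P (fun n => stepIntegral W (d n) ⟨T, hT, le_rfl⟩) atTop γ) :
    ∫ ω, Complex.exp ((x' (ζ ω ⟨T, hT, le_rfl⟩) + γ ω : ℝ) * Complex.I) ∂P =
      Real.exp (-(∫ t, ‖dualKernel Φ x' t + f t‖ ^ 2 ∂timeMeasure T) / 2) := by
  have hg := h.memLp_dualKernel hW hT hΦ x'
  set top : TimeInterval T := ⟨T, hT, le_rfl⟩ with htop
  set q : ℝ := ∫ t, ‖dualKernel Φ x' t + f t‖ ^ 2 ∂timeMeasure T with hq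
  have hq0 : 0 ≤ q := integral_nonneg fun t => sq_nonneg _
  -- Together the approximating process and the deterministic step function form one adapted step
  -- process. Its energy converges in probability to the constant `q`, which makes its integral
  -- asymptotically Gaussian.
  let X : ℕ → Ω → ℝ := fun n => stepIntegral W (Sum.elim ((Ψ n).terms x') (d n)) top
  have hqN : q = (eLpNorm (fun t => dualKernel Φ x' t + f t) 2 (timeMeasure T)).toReal ^ 2 :=
    integral_norm_sq_eq_toReal_eLpNorm (hg.add hf)
  set a : ℝ := (eLpNorm (fun t => dualKernel Φ x' t + f t) 2 (timeMeasure T)).toReal with ha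
  -- convergence in measure
  have hX : TendstoInMeasure P X atTop fun ω => x' (ζ ω top) + γ ω := by
    rw [tendstoInMeasure_iff_dist]
    intro ε hε
    have h1 := tendstoInMeasure_iff_dist.1 h.tendsto_integral (ε / 2 / (‖x'‖ + 1)) (by positivity)
    have h2 := tendstoInMeasure_iff_dist.1 hγ (ε / 2) (by positivity)
    refine tendsto_of_tendsto_of_tendsto_of_le_of_le tendsto_const_nhds
      (by simpa using h1.add h2) (fun _ => zero_le) fun n => ?_
    refine le_trans (measure_mono_ae ?_) (measure_union_le _ _)
    filter_upwards [h.integral_ae_eq n top, (Ψ n).stepIntegral_terms W x' top] with ω e1 e2 hω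
    have hω : ε ≤ dist (X n ω) (x' (ζ ω top) + γ ω) := hω
    show ω ∈ {ω | ε / 2 / (‖x'‖ + 1) ≤ dist (Z n ω) (ζ ω)} ∪
      {ω | ε / 2 ≤ dist (stepIntegral W (d n) top ω) (γ ω)}
    by_contra hcon
    simp only [Set.mem_union, Set.mem_ofPred_eq, not_or, not_le] at hcon
    have h3 : X n ω = x' (Z n ω top) + stepIntegral W (d n) top ω := by
      simp only [X]
      rw [stepIntegral_sumElim, ← e2, e1]
    have h4 : dist (x' (Z n ω top)) (x' (ζ ω top)) ≤ ε / 2 := by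
      rw [dist_eq_norm, ← map_sub]
      have h5 : ‖Z n ω top - ζ ω top‖ ≤ ε / 2 / (‖x'‖ + 1) := by
        rw [← dist_eq_norm]
        exact (ContinuousMap.dist_apply_le_dist top).trans hcon.1.le
      calc _ ≤ ‖x'‖ * ‖Z n ω top - ζ ω top‖ := x'.le_opNorm _
        _ ≤ (‖x'‖ + 1) * (ε / 2 / (‖x'‖ + 1)) := by gcongr; linarith
        _ = ε / 2 := by field_simp
    have h6 := dist_add_add_le (x' (Z n ω top)) (stepIntegral W (d n) top ω) (x' (ζ ω top)) (γ ω)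
    rw [h3] at hω
    linarith [hcon.2]
  obtain ⟨ns, hns, hlim⟩ := tendsto_integral_exp_of_tendstoInMeasure
    (fun n => aestronglyMeasurable_stepIntegral W _ top) hX
  refine tendsto_nhds_unique hlim (tendsto_iff_norm_sub_tendsto_zero.2 ?_)
  refine Tendsto.comp (g := fun n => ‖∫ ω, Complex.exp (X n ω * Complex.I) ∂P -
    ((Real.exp (-q / 2) : ℝ) : ℂ)‖) ?_ hns.tendsto_atTop
  -- convergence of the energies
  have henergy : ∀ θ > 0, Tendsto (fun n => P.real {ω | θ <
      |stepEnergy (Sum.elim ((Ψ n).terms x') (d n)) ω - q|}) atTop (𝓝 0) := by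
    intro θ hθ
    have hcont : ContinuousAt (fun x : ℝ => x ^ 2) a := by fun_prop
    obtain ⟨ρ, hρ, hρa⟩ := Metric.continuousAt_iff.1 hcont θ hθ
    have h1 := h.tendsto_measureReal_lintegral hW hT hΦ x' (show 0 < ρ / 2 by positivity)
    refine squeeze_zero' (Eventually.of_forall fun _ => measureReal_nonneg) ?_ h1
    have h2 := hDf.eventually_lt_const (show (0 : ℝ≥0∞) < ENNReal.ofReal (ρ / 2) by simpa using hρ)
    filter_upwards [h2] with n hn
    refine measureReal_mono fun ω hω => ?_
    have hω : θ < |stepEnergy (Sum.elim ((Ψ n).terms x') (d n)) ω - q| := hω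
    show ρ / 2 ≤ _
    by_contra! hcon
    set p : TimeInterval T → H := fun t => stepValue ((Ψ n).terms x') (t, ω) with hp
    have hpL : MemLp p 2 (timeMeasure T) := memLp_stepValue ((Ψ n).terms x') ω
    have hDL : MemLp (D n) 2 (timeMeasure T) := by
      have := memLp_stepValue (d n) ω
      simpa only [hD] using this
    have hE : stepEnergy (Sum.elim ((Ψ n).terms x') (d n)) ω
        = (eLpNorm (fun t => p t + D n t) 2 (timeMeasure T)).toReal ^ 2 := by
      have e := integral_norm_sq_eq_toReal_eLpNorm (hpL.add hDL)
      refine Eq.trans ?_ e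
      simp only [stepEnergy, stepValue_sumElim, hD]
      rfl
    set b : ℝ := (eLpNorm (fun t => p t + D n t) 2 (timeMeasure T)).toReal with hb
    have hdist : |b - a| < ρ := by
      have tri : ∀ u v : TimeInterval T → H, MemLp u 2 (timeMeasure T) →
          MemLp v 2 (timeMeasure T) → (eLpNorm u 2 (timeMeasure T)).toReal ≤
          (eLpNorm v 2 (timeMeasure T)).toReal +
          (eLpNorm (fun t => u t - v t) 2 (timeMeasure T)).toReal := by
        intro u v hu hv
        have e : u = v + fun t => u t - v t := by ext t; simp
        have huv : MemLp (fun t => u t - v t) 2 (timeMeasure T) := hu.sub hv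
        rw [← ENNReal.toReal_add hv.eLpNorm_ne_top huv.eLpNorm_ne_top]
        refine ENNReal.toReal_mono (ENNReal.add_ne_top.2
          ⟨hv.eLpNorm_ne_top, (hu.sub hv).eLpNorm_ne_top⟩) ?_
        conv_lhs => rw [e]
        exact eLpNorm_add_le hv.1 (hu.sub hv).1 (by norm_num)
      have h3 : (eLpNorm (fun t => (p t + D n t) - (dualKernel Φ x' t + f t)) 2
          (timeMeasure T)).toReal < ρ := by
        have e : (fun t => (p t + D n t) - (dualKernel Φ x' t + f t)) =
            (fun t => p t - dualKernel Φ x' t) + fun t => D n t - f t := by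
          ext t; simp only [Pi.add_apply]; abel
        have h4 := ENNReal.toReal_mono (ENNReal.add_ne_top.2
          ⟨(hpL.sub hg).eLpNorm_ne_top, (hDL.sub hf).eLpNorm_ne_top⟩)
          (eLpNorm_add_le (hpL.sub hg).1 (hDL.sub hf).1 (by norm_num))
        rw [ENNReal.toReal_add (hpL.sub hg).eLpNorm_ne_top (hDL.sub hf).eLpNorm_ne_top] at h4
        have h5 : (eLpNorm (fun t => D n t - f t) 2 (timeMeasure T)).toReal < ρ / 2 :=
          ENNReal.toReal_lt_of_lt_ofReal hn
        rw [e]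
        refine lt_of_le_of_lt h4 ?_
        have h6 : (eLpNorm (p - dualKernel Φ x') 2 (timeMeasure T)).toReal < ρ / 2 := hcon
        have h7 : (eLpNorm (D n - f) 2 (timeMeasure T)).toReal < ρ / 2 := h5
        linarith
      have h4 := tri _ _ (hpL.add hDL) (hg.add hf)
      have h5 := tri _ _ (hg.add hf) (hpL.add hDL)
      have h6 : eLpNorm (fun t => (dualKernel Φ x' + f) t - (p + D n) t) 2 (timeMeasure T) =
          eLpNorm (fun t => (p + D n) t - (dualKernel Φ x' + f) t) 2 (timeMeasure T) :=
        eLpNorm_sub_comm _ _ _ _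
      rw [h6] at h5
      rw [abs_lt]
      have h3' : (eLpNorm (fun t => (p + D n) t - (dualKernel Φ x' + f) t) 2
        (timeMeasure T)).toReal < ρ := h3
      have hb' : b = (eLpNorm (p + D n) 2 (timeMeasure T)).toReal := rfl
      have ha' : a = (eLpNorm (dualKernel Φ x' + f) 2 (timeMeasure T)).toReal := rfl
      constructor <;> linarith
    have := hρa (x := b) (by rw [Real.dist_eq]; exact hdist)
    rw [Real.dist_eq, ← hE, ← hqN] at this
    linarith
  rw [Metric.tendsto_atTop]
  intro ε hε
  set θ : ℝ := min 1 (ε / 3) with hθ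
  have hθ0 : 0 < θ := lt_min one_pos (by positivity)
  have hlim0 := (henergy θ hθ0).const_mul (1 + Real.exp ((q + 1) / 2))
  rw [mul_zero] at hlim0
  obtain ⟨N, hN⟩ := eventually_atTop.1 (hlim0.eventually_le_const (show 0 < ε / 3 by positivity))
  refine ⟨N, fun n hn => ?_⟩
  rw [Real.dist_0_eq_abs, abs_of_nonneg (norm_nonneg _)]
  have h1 := norm_integral_exp_stepIntegral_sub_le hW hT (Sum.elim ((Ψ n).terms x') (d n)) hq0
    hθ0.le (min_le_left _ _)
  have h2 := hN n hn
  have h3 : θ ≤ ε / 3 := min_le_right _ _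
  exact lt_of_le_of_lt h1 (by linarith)

end ApproximatesIntegral

end

/-- The law of the norm of a random vector is determined by its characteristic function. -/
lemma map_norm_eq_of_integral_exp_eq {Ω : Type*} [MeasurableSpace Ω] {P : Measure Ω}
    [IsProbabilityMeasure P] {Ω' : Type*} [MeasurableSpace Ω'] {P' : Measure Ω'}
    [IsProbabilityMeasure P']
    {E : Type*} [NormedAddCommGroup E] [NormedSpace ℝ E] [CompleteSpace E]
    {X : Ω → E} {Y : Ω' → E} (hX : AEStronglyMeasurable X P) (hY : AEStronglyMeasurable Y P')
    (h : ∀ x' : E →L[ℝ] ℝ, ∫ ω, Complex.exp ((x' (X ω) : ℝ) * Complex.I) ∂P =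
      ∫ ω, Complex.exp ((x' (Y ω) : ℝ) * Complex.I) ∂P') :
    P.map (fun ω => ‖X ω‖) = P'.map (fun ω => ‖Y ω‖) := by
  obtain ⟨X', hX'm, hXX'⟩ := hX
  obtain ⟨Y', hY'm, hYY'⟩ := hY
  let s : Set E := Set.range X' ∪ Set.range Y'
  have hs : TopologicalSpace.IsSeparable s :=
    hX'm.isSeparable_range.union hY'm.isSeparable_range
  -- Both variables take almost all their values in a separable closed subspace, where a Borel law
  -- is determined by its characteristic functional. Hahn–Banach extends the functionals on `F` to
  -- `E`, where the hypothesis applies.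
  let F : Submodule ℝ E := (Submodule.span ℝ s).topologicalClosure
  have hFs : TopologicalSpace.IsSeparable (F : Set E) := by
    rw [Submodule.topologicalClosure_coe]
    exact (TopologicalSpace.IsSeparable.span (R := ℝ) hs).closure
  have hsF : s ⊆ F := Submodule.subset_span.trans (Submodule.le_topologicalClosure _)
  have : CompleteSpace F := (Submodule.isClosed_topologicalClosure _).completeSpace_coe
  have : SecondCountableTopology F := by
    have := hFs.separableSpace
    exact UniformSpace.secondCountable_of_separable F
  letI : MeasurableSpace F := borel F
  have : BorelSpace F := ⟨rfl⟩
  let X₀ : Ω → F := fun ω => ⟨X' ω, hsF (Or.inl ⟨ω, rfl⟩)⟩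
  let Y₀ : Ω' → F := fun ω => ⟨Y' ω, hsF (Or.inr ⟨ω, rfl⟩)⟩
  have hX₀ : Measurable X₀ := by
    refine StronglyMeasurable.measurable ?_
    exact (Embedding.comp_stronglyMeasurable_iff (f := X₀) Topology.IsEmbedding.subtypeVal).1 hX'm
  have hY₀ : Measurable Y₀ := by
    refine StronglyMeasurable.measurable ?_
    exact (Embedding.comp_stronglyMeasurable_iff (f := Y₀) Topology.IsEmbedding.subtypeVal).1 hY'm
  have hlaw : P.map X₀ = P'.map Y₀ := by
    have := Measure.isProbabilityMeasure_map (μ := P) hX₀.aemeasurable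
    have := Measure.isProbabilityMeasure_map (μ := P') hY₀.aemeasurable
    refine Measure.ext_of_charFunDual ?_
    ext L
    obtain ⟨x', hx', -⟩ := exists_extension_norm_eq F L
    have hm : Measurable fun x : F => Complex.exp (L x * Complex.I) := by fun_prop
    rw [charFunDual_apply, charFunDual_apply, integral_map hX₀.aemeasurable
      hm.aestronglyMeasurable, integral_map hY₀.aemeasurable hm.aestronglyMeasurable]
    simp only [← hx']
    refine ((integral_congr_ae ?_).trans (h x')).trans (integral_congr_ae ?_)
    · filter_upwards [hXX'] with ω hω
      rw [hω]
    · filter_upwards [hYY'] with ω hω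
      rw [hω]
  have e1 : P.map (fun ω => ‖X ω‖) = (P.map X₀).map (fun x : F => ‖x‖) := by
    rw [Measure.map_map measurable_norm hX₀]
    refine Measure.map_congr ?_
    filter_upwards [hXX'] with ω hω
    rw [hω]; rfl
  have e2 : P'.map (fun ω => ‖Y ω‖) = (P'.map Y₀).map (fun x : F => ‖x‖) := by
    rw [Measure.map_map measurable_norm hY₀]
    refine Measure.map_congr ?_
    filter_upwards [hYY'] with ω hω
    rw [hω]; rfl
  rw [e1, e2, hlaw]

/-- The points of the uniform partition of `[0, T]` into `n + 1` intervals. -/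
noncomputable def gridPoint {T : ℝ} (hT : 0 ≤ T) (n i : ℕ) : TimeInterval T :=
  Set.projIcc 0 T hT (i * (T / (n + 1)))

/-! ### Averages over uniform partitions of the time interval. -/

section

variable {T : ℝ}

lemma monotone_gridPoint (hT : 0 ≤ T) (n : ℕ) : Monotone (gridPoint hT n) := by
  intro i j hij
  refine Set.monotone_projIcc hT ?_
  have : (i : ℝ) ≤ j := by exact_mod_cast hij
  have : 0 ≤ T / (n + 1) := by positivity
  gcongr

lemma coe_gridPoint (hT : 0 ≤ T) {n i : ℕ} (hi : i ≤ n + 1) :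
    (gridPoint hT n i : ℝ) = i * (T / (n + 1)) := by
  have h : (i : ℝ) * (T / (n + 1)) ∈ Set.Icc 0 T := by
    refine ⟨by positivity, ?_⟩
    have h1 : (i : ℝ) ≤ n + 1 := by exact_mod_cast hi
    calc (i : ℝ) * (T / (n + 1)) ≤ (n + 1) * (T / (n + 1)) := by gcongr
      _ = T := by field_simp
  rw [gridPoint, Set.projIcc_of_mem hT h]

/-- The intervals of the uniform partition. -/
noncomputable def gridCell (hT : 0 ≤ T) (n i : ℕ) : Set (TimeInterval T) :=
  Set.Ioc (gridPoint hT n i) (gridPoint hT n (i + 1))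

lemma measurableSet_gridCell (hT : 0 ≤ T) (n i : ℕ) : MeasurableSet (gridCell hT n i) :=
  measurableSet_Ioc

lemma measureReal_gridCell (hT : 0 ≤ T) {n i : ℕ} (hi : i < n + 1) :
    (timeMeasure T).real (gridCell hT n i) = T / (n + 1) := by
  rw [gridCell, timeMeasure_real_Ioc (monotone_gridPoint hT n (Nat.le_succ i)),
    coe_gridPoint hT hi.le, coe_gridPoint hT hi]
  push_cast; ring

lemma pairwise_disjoint_gridCell (hT : 0 ≤ T) (n : ℕ) :
    Pairwise fun i j => Disjoint (gridCell hT n i) (gridCell hT n j) :=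
  (monotone_gridPoint hT n).pairwise_disjoint_on_Ioc_succ

/-- The half-open cells miss only the time `0`. -/
lemma ae_exists_mem_gridCell (hT : 0 ≤ T) :
    ∀ᵐ t ∂timeMeasure T, ∀ n : ℕ, ∃ i < n + 1, t ∈ gridCell hT n i := by
  have h0 : ∀ᵐ t ∂timeMeasure T, (⟨0, le_rfl, hT⟩ : TimeInterval T) < t := by
    have h1 := timeMeasure_Ioc (a := (⟨0, le_rfl, hT⟩ : TimeInterval T))
      (b := (⟨T, hT, le_rfl⟩ : TimeInterval T))
    rw [ae_iff]
    have h2 : {t : TimeInterval T | ¬ (⟨0, le_rfl, hT⟩ : TimeInterval T) < t} =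
        (Set.Ioc (⟨0, le_rfl, hT⟩ : TimeInterval T) ⟨T, hT, le_rfl⟩)ᶜ := by
      ext t
      simp only [Set.mem_ofPred_eq, Set.mem_compl_iff, Set.mem_Ioc, not_and_or]
      exact ⟨Or.inl, fun h => h.elim id fun h' => absurd t.2.2 h'⟩
    rw [h2, measure_compl measurableSet_Ioc (measure_ne_top _ _), h1, timeMeasure_univ]
    simp
  filter_upwards [h0] with t ht n
  have hex : ∃ j, t ≤ gridPoint hT n j := by
    refine ⟨n + 1, ?_⟩
    show (t : ℝ) ≤ gridPoint hT n (n + 1)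
    rw [coe_gridPoint hT le_rfl]
    have : ((n + 1 : ℕ) : ℝ) * (T / (n + 1)) = T := by push_cast; field_simp
    rw [this]
    exact t.2.2
  classical
  have hfind : t ≤ gridPoint hT n (Nat.find hex) := Nat.find_spec hex
  have hne : Nat.find hex ≠ 0 := fun h0 => by
    rw [h0] at hfind
    have h3 : (t : ℝ) ≤ gridPoint hT n 0 := hfind
    rw [coe_gridPoint hT (Nat.zero_le _)] at h3
    have h4 : (0 : ℝ) < t := ht
    simp at h3
    linarith
  obtain ⟨k, hk⟩ := Nat.exists_eq_succ_of_ne_zero hne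
  have hlt : gridPoint hT n k < t := not_le.1 (Nat.find_min hex (by omega))
  refine ⟨k, ?_, hlt, by rw [← Nat.succ_eq_add_one, ← hk]; exact hfind⟩
  by_contra hkn
  have h5 : (gridPoint hT n (n + 1) : ℝ) ≤ gridPoint hT n k :=
    monotone_gridPoint hT n (not_lt.1 hkn)
  rw [coe_gridPoint hT le_rfl] at h5
  have h6 : ((n + 1 : ℕ) : ℝ) * (T / (n + 1)) = T := by push_cast; field_simp
  have h7 : (gridPoint hT n k : ℝ) < t := hlt
  have h8 : (t : ℝ) ≤ T := t.2.2
  linarith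

/-- The piecewise averages of a function on the uniform partition. -/
noncomputable def gridAverage (hT : 0 ≤ T) (n : ℕ) (c : TimeInterval T → ℝ) (t : TimeInterval T) :
    ℝ :=
  ∑ i ∈ Finset.range (n + 1), (gridCell hT n i).indicator
    (fun _ => (n + 1) / T * ∫ r in gridCell hT n i, c r ∂timeMeasure T) t

/-- The squared `L²`-norm of the piecewise averages. -/
noncomputable def gridEnergy (hT : 0 ≤ T) (n : ℕ) (c : TimeInterval T → ℝ) : ℝ :=
  ∑ i ∈ Finset.range (n + 1), (n + 1) / T * (∫ r in gridCell hT n i, c r ∂timeMeasure T) ^ 2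

lemma gridAverage_eq (hT : 0 ≤ T) {n i : ℕ} (hi : i < n + 1) (c : TimeInterval T → ℝ)
    {t : TimeInterval T} (ht : t ∈ gridCell hT n i) :
    gridAverage hT n c t = (n + 1) / T * ∫ r in gridCell hT n i, c r ∂timeMeasure T := by
  rw [gridAverage, Finset.sum_eq_single i, Set.indicator_of_mem ht]
  · intro j _ hj
    exact Set.indicator_of_notMem
      (Set.disjoint_left.1 (pairwise_disjoint_gridCell hT n hj.symm) ht) _
  · exact fun h => absurd (Finset.mem_range.2 hi) h

lemma gridEnergy_nonneg (hT : 0 ≤ T) (n : ℕ) (c : TimeInterval T → ℝ) : 0 ≤ gridEnergy hT n c :=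
  Finset.sum_nonneg fun i _ => by positivity

lemma measurable_gridAverage (hT : 0 ≤ T) (n : ℕ) (c : TimeInterval T → ℝ) :
    Measurable (gridAverage hT n c) :=
  Finset.measurable_fun_sum _ fun i _ => measurable_const.indicator (measurableSet_gridCell hT n i)

lemma memLp_gridAverage (hT : 0 ≤ T) (n : ℕ) (c : TimeInterval T → ℝ) :
    MemLp (gridAverage hT n c) 2 (timeMeasure T) := by
  refine memLp_finsetSum _ fun i _ => ?_
  exact (memLp_const _).indicator (measurableSet_gridCell hT n i)

lemma gridAverage_sq (hT : 0 < T) (n : ℕ) (c : TimeInterval T → ℝ) (t : TimeInterval T) :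
    gridAverage hT.le n c t ^ 2 = ∑ i ∈ Finset.range (n + 1), (gridCell hT.le n i).indicator
      (fun _ => ((n + 1) / T * ∫ r in gridCell hT.le n i, c r ∂timeMeasure T) ^ 2) t := by
  by_cases h : ∃ i < n + 1, t ∈ gridCell hT.le n i
  · obtain ⟨i, hi, ht⟩ := h
    rw [gridAverage_eq hT.le hi c ht, Finset.sum_eq_single i, Set.indicator_of_mem ht]
    · intro j _ hj
      exact Set.indicator_of_notMem
        (Set.disjoint_left.1 (pairwise_disjoint_gridCell hT.le n hj.symm) ht) _
    · exact fun h => absurd (Finset.mem_range.2 hi) h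
  · push Not at h
    rw [gridAverage, Finset.sum_eq_zero fun i hi =>
      Set.indicator_of_notMem (h i (Finset.mem_range.1 hi)) _,
      Finset.sum_eq_zero fun i hi => Set.indicator_of_notMem (h i (Finset.mem_range.1 hi)) _]
    simp

lemma integral_gridAverage_sq (hT : 0 < T) (n : ℕ) (c : TimeInterval T → ℝ) :
    ∫ t, gridAverage hT.le n c t ^ 2 ∂timeMeasure T = gridEnergy hT.le n c := by
  simp only [gridAverage_sq hT]
  rw [integral_finsetSum _ fun i _ => (integrable_const _).indicator
    (measurableSet_gridCell hT.le n i)]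
  refine Finset.sum_congr rfl fun i hi => ?_
  rw [integral_indicator_const _ (measurableSet_gridCell hT.le n i),
    measureReal_gridCell hT.le (Finset.mem_range.1 hi), smul_eq_mul]
  field_simp

/-- Averaging is an orthogonal projection, so the pairing of `c` with its averages is the energy of
the averages. As these are bounded, integrability of `c` is enough. -/
lemma integral_gridAverage_mul (hT : 0 < T) (n : ℕ) {c : TimeInterval T → ℝ}
    (hc : Integrable c (timeMeasure T)) :
    ∫ t, gridAverage hT.le n c t * c t ∂timeMeasure T = gridEnergy hT.le n c := by
  have e : ∀ t, gridAverage hT.le n c t * c t = ∑ i ∈ Finset.range (n + 1),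
      (gridCell hT.le n i).indicator (fun t =>
        ((n + 1) / T * ∫ r in gridCell hT.le n i, c r ∂timeMeasure T) * c t) t := by
    intro t
    rw [gridAverage, Finset.sum_mul]
    refine Finset.sum_congr rfl fun i _ => ?_
    by_cases ht : t ∈ gridCell hT.le n i
    · rw [Set.indicator_of_mem ht, Set.indicator_of_mem ht]
    · rw [Set.indicator_of_notMem ht, Set.indicator_of_notMem ht, zero_mul]
  simp only [e]
  rw [integral_finsetSum _ fun i _ => (hc.const_mul _).indicator
    (measurableSet_gridCell hT.le n i)]
  refine Finset.sum_congr rfl fun i hi => ?_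
  rw [integral_indicator (measurableSet_gridCell hT.le n i), integral_const_mul]
  ring

lemma integral_sub_gridAverage_sq (hT : 0 < T) (n : ℕ) {c : TimeInterval T → ℝ}
    (hc : MemLp c 2 (timeMeasure T)) :
    ∫ t, (c t - gridAverage hT.le n c t) ^ 2 ∂timeMeasure T =
      ∫ t, c t ^ 2 ∂timeMeasure T - gridEnergy hT.le n c := by
  have hQ := memLp_gridAverage hT.le n c
  have i1 : Integrable (fun t => c t ^ 2) (timeMeasure T) := hc.integrable_sq
  have i2 : Integrable (fun t => gridAverage hT.le n c t ^ 2) (timeMeasure T) := hQ.integrable_sq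
  have i3 : Integrable (fun t => 2 * (gridAverage hT.le n c t * c t)) (timeMeasure T) :=
    (hQ.integrable_mul hc).const_mul 2
  have e : ∀ t, (c t - gridAverage hT.le n c t) ^ 2 =
      c t ^ 2 - 2 * (gridAverage hT.le n c t * c t) + gridAverage hT.le n c t ^ 2 := fun t => by
    ring
  simp only [e]
  have i4 : Integrable (fun t => c t ^ 2 - 2 * (gridAverage hT.le n c t * c t)) (timeMeasure T) :=
    i1.sub i3
  rw [integral_add i4 i2, integral_sub i1 i3, integral_const_mul,
    integral_gridAverage_mul hT n (hc.integrable (by norm_num)), integral_gridAverage_sq hT]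
  ring

lemma gridEnergy_le (hT : 0 < T) (n : ℕ) {c : TimeInterval T → ℝ}
    (hc : MemLp c 2 (timeMeasure T)) :
    gridEnergy hT.le n c ≤ ∫ t, c t ^ 2 ∂timeMeasure T := by
  have := integral_sub_gridAverage_sq hT n hc
  have h2 : 0 ≤ ∫ t, (c t - gridAverage hT.le n c t) ^ 2 ∂timeMeasure T :=
    integral_nonneg fun t => sq_nonneg _
  linarith

lemma map_timeMeasure : (timeMeasure T).map Subtype.val = volume.restrict (Set.Icc 0 T) := by
  rw [timeMeasure, map_comap_subtype_coe measurableSet_Icc]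

/-- Lebesgue's differentiation theorem. The cells containing `t` are not centred at `t`, so the
version with balls of moving centres is used, after extending `c` by zero to the line. -/
lemma ae_tendsto_gridAverage (hT : 0 < T) {c : TimeInterval T → ℝ}
    (hc : Integrable c (timeMeasure T)) :
    ∀ᵐ t ∂timeMeasure T, Tendsto (fun n => gridAverage hT.le n c t) atTop (𝓝 (c t)) := by
  classical
  have hemb : MeasurableEmbedding (Subtype.val : TimeInterval T → ℝ) :=
    MeasurableEmbedding.subtype_coe measurableSet_Icc
  let c' : ℝ → ℝ := fun x => if h : x ∈ Set.Icc 0 T then c ⟨x, h⟩ else 0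
  have hcc : ∀ t : TimeInterval T, c' t = c t := fun t => dif_pos t.2
  have hc' : Integrable c' := by
    rw [← integrableOn_iff_integrable_of_support_subset (s := Set.Icc (0 : ℝ) T), IntegrableOn,
      ← map_timeMeasure, hemb.integrable_map_iff]
    · exact hc.congr (ae_of_all _ fun t => (hcc t).symm)
    · intro x hx
      by_contra h
      exact hx (dif_neg h)
  have h1 := IsUnifLocDoublingMeasure.ae_tendsto_average (volume : Measure ℝ)
    hc'.locallyIntegrable 1
  have h2 : ∀ᵐ t : TimeInterval T ∂timeMeasure T, ∀ (w : ℕ → ℝ) (δ : ℕ → ℝ), Tendsto δ atTop (𝓝[>] 0) →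
      (∀ᶠ j in atTop, (t : ℝ) ∈ Metric.closedBall (w j) (1 * δ j)) →
      Tendsto (fun j => ⨍ y in Metric.closedBall (w j) (δ j), c' y) atTop (𝓝 (c' t)) := by
    have h3 := ae_restrict_of_ae (s := Set.Icc 0 T) h1
    rw [← map_timeMeasure, hemb.ae_map_iff] at h3
    filter_upwards [h3] with t ht w δ h4 h5
    exact ht w δ h4 h5
  filter_upwards [h2, ae_exists_mem_gridCell hT.le] with t ht hcell
  choose i hi hti using hcell
  -- The closed cell is the ball about its midpoint with half the mesh as radius.
  have h3 := ht (fun n => (i n + 1 / 2 : ℝ) * (T / (n + 1))) (fun n => T / (n + 1) / 2) ?_ ?_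
  · rw [hcc] at h3
    refine h3.congr fun n => ?_
    have hpos : 0 < T / (n + 1) := by positivity
    have ebal : Metric.closedBall ((i n + 1 / 2 : ℝ) * (T / (n + 1))) (T / (n + 1) / 2) =
        Set.Icc (gridPoint hT.le n (i n) : ℝ) (gridPoint hT.le n (i n + 1)) := by
      rw [Real.closedBall_eq_Icc, coe_gridPoint hT.le (hi n).le, coe_gridPoint hT.le (hi n)]
      congr 1 <;> push_cast <;> ring
    have epre : gridCell hT.le n (i n) = Subtype.val ⁻¹'
        Set.Ioc (gridPoint hT.le n (i n) : ℝ) (gridPoint hT.le n (i n + 1)) := rfl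
    rw [gridAverage_eq hT.le (hi n) c (hti n), ebal, setAverage_eq, integral_Icc_eq_integral_Ioc,
      Real.volume_real_Icc_of_le (monotone_gridPoint hT.le n (Nat.le_succ _)),
      coe_gridPoint hT.le (hi n).le, coe_gridPoint hT.le (hi n), smul_eq_mul]
    have eint : ∫ r in gridCell hT.le n (i n), c r ∂timeMeasure T = ∫ y in
        Set.Ioc (gridPoint hT.le n (i n) : ℝ) (gridPoint hT.le n (i n + 1)), c' y := by
      rw [epre]
      have h4 := hemb.setIntegral_map (μ := timeMeasure T) c'
        (Set.Ioc (gridPoint hT.le n (i n) : ℝ) (gridPoint hT.le n (i n + 1)))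
      simp only [hcc] at h4
      rw [← h4, map_timeMeasure, Measure.restrict_restrict measurableSet_Ioc]
      congr 2
      refine Set.inter_eq_left.2 fun x hx => ⟨?_, ?_⟩
      · exact (gridPoint hT.le n (i n)).2.1.trans hx.1.le
      · exact hx.2.trans (gridPoint hT.le n (i n + 1)).2.2
    rw [eint, coe_gridPoint hT.le (hi n).le, coe_gridPoint hT.le (hi n)]
    congr 1
    have : ((i n + 1 : ℕ) : ℝ) * (T / (n + 1)) - (i n) * (T / (n + 1)) = T / (n + 1) := by
      push_cast; ring
    rw [this, inv_div]
  · rw [tendsto_nhdsWithin_iff]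
    refine ⟨?_, Eventually.of_forall fun n => by
      show 0 < T / (n + 1) / 2
      positivity⟩
    have h4 : Tendsto (fun n : ℕ => T / 2 * (1 / ((n : ℝ) + 1))) atTop (𝓝 (T / 2 * 0)) :=
      tendsto_one_div_add_atTop_nhds_zero_nat.const_mul _
    rw [mul_zero] at h4
    refine h4.congr fun n => ?_
    field_simp
  · refine Eventually.of_forall fun n => ?_
    rw [Metric.mem_closedBall, one_mul, Real.dist_eq, abs_le]
    have h5 : (gridPoint hT.le n (i n) : ℝ) < t := (hti n).1
    have h6 : (t : ℝ) ≤ gridPoint hT.le n (i n + 1) := (hti n).2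
    rw [coe_gridPoint hT.le (hi n).le] at h5
    rw [coe_gridPoint hT.le (hi n)] at h6
    push_cast at h6
    constructor <;> nlinarith

lemma lintegral_enorm_gridAverage_sq (hT : 0 < T) (n : ℕ) (c : TimeInterval T → ℝ) :
    ∫⁻ t, ‖gridAverage hT.le n c t‖ₑ ^ 2 ∂timeMeasure T
      = ENNReal.ofReal (gridEnergy hT.le n c) := by
  rw [← integral_gridAverage_sq hT, ofReal_integral_eq_lintegral_ofReal
    (memLp_gridAverage hT.le n c).integrable_sq (ae_of_all _ fun t => sq_nonneg _)]
  refine lintegral_congr fun t => ?_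
  rw [← sq_abs, ENNReal.ofReal_pow (abs_nonneg _), ← Real.norm_eq_abs, ofReal_norm]

/-- Fatou's lemma. Only integrability of `c` is assumed and the left side may be infinite: in the
lower bound, square integrability of the kernel is part of the conclusion. -/
lemma lintegral_enorm_sq_le_liminf (hT : 0 < T) {c : TimeInterval T → ℝ}
    (hc : Integrable c (timeMeasure T)) :
    ∫⁻ t, ‖c t‖ₑ ^ 2 ∂timeMeasure T
      ≤ liminf (fun n => ENNReal.ofReal (gridEnergy hT.le n c)) atTop := by
  simp only [← lintegral_enorm_gridAverage_sq hT]
  refine le_trans (lintegral_mono_ae ?_) (lintegral_liminf_le fun n =>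
    (measurable_gridAverage hT.le n c).enorm.pow_const 2)
  filter_upwards [ae_tendsto_gridAverage hT hc] with t ht
  have : Tendsto (fun n => ‖gridAverage hT.le n c t‖ₑ ^ 2) atTop (𝓝 (‖c t‖ₑ ^ 2)) :=
    ((ENNReal.continuous_pow 2).comp continuous_enorm).continuousAt.tendsto.comp ht
  exact this.liminf_eq.ge

/-- Fatou's lemma bounds the lower limit, and contractivity of the projection bounds the upper
limit. -/
lemma tendsto_gridEnergy (hT : 0 < T) {c : TimeInterval T → ℝ} (hc : MemLp c 2 (timeMeasure T)) :
    Tendsto (fun n => gridEnergy hT.le n c) atTop (𝓝 (∫ t, c t ^ 2 ∂timeMeasure T)) := by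
  have h0 : 0 ≤ ∫ t, c t ^ 2 ∂timeMeasure T := integral_nonneg fun t => sq_nonneg _
  have e : ∫⁻ t, ‖c t‖ₑ ^ 2 ∂timeMeasure T = ENNReal.ofReal (∫ t, c t ^ 2 ∂timeMeasure T) := by
    rw [ofReal_integral_eq_lintegral_ofReal hc.integrable_sq (ae_of_all _ fun t => sq_nonneg _)]
    refine lintegral_congr fun t => ?_
    rw [← sq_abs, ENNReal.ofReal_pow (abs_nonneg _), ← Real.norm_eq_abs, ofReal_norm]
  have h1 := lintegral_enorm_sq_le_liminf hT (hc.integrable (by norm_num))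
  rw [e] at h1
  have h2 : Tendsto (fun n => ENNReal.ofReal (gridEnergy hT.le n c)) atTop
      (𝓝 (ENNReal.ofReal (∫ t, c t ^ 2 ∂timeMeasure T))) := by
    refine tendsto_of_le_liminf_of_limsup_le h1 ?_
    refine limsup_le_of_le (by isBoundedDefault) (Eventually.of_forall fun n => ?_)
    exact ENNReal.ofReal_le_ofReal (gridEnergy_le hT n hc)
  have h3 := (ENNReal.tendsto_toReal ENNReal.ofReal_ne_top).comp h2
  rw [ENNReal.toReal_ofReal h0] at h3
  refine h3.congr fun n => ?_
  simp [ENNReal.toReal_ofReal (gridEnergy_nonneg hT.le n c)]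

lemma tendsto_integral_sub_gridAverage_sq (hT : 0 < T) {c : TimeInterval T → ℝ}
    (hc : MemLp c 2 (timeMeasure T)) :
    Tendsto (fun n => ∫ t, (c t - gridAverage hT.le n c t) ^ 2 ∂timeMeasure T) atTop (𝓝 0) := by
  simp only [integral_sub_gridAverage_sq hT _ hc]
  have := (tendsto_gridEnergy hT hc).const_sub (∫ t, c t ^ 2 ∂timeMeasure T)
  rwa [sub_self] at this

end

/-! ### Wiener integrals of deterministic functions. -/

section

variable {Ω : Type*} [mΩ : MeasurableSpace Ω] {P : Measure Ω}
  {T : ℝ} {𝓕 : Filtration (TimeInterval T) mΩ}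
  {H : Type*} [NormedAddCommGroup H] [InnerProductSpace ℝ H]
  {W : TimeInterval T → H →L[ℝ] Lp ℝ 2 P}

/-- A scalar multiple of a step term. -/
def StepTerm.smul (a : ℝ) (τ : StepTerm 𝓕 H) : StepTerm 𝓕 H := { τ with h := a • τ.h }

lemma stepValue_smul {α : Type*} [Fintype α] (a : ℝ) (τ : α → StepTerm 𝓕 H)
    (p : TimeInterval T × Ω) :
    stepValue (fun i => (τ i).smul a) p = a • stepValue τ p := by
  simp only [stepValue, Finset.smul_sum, StepTerm.smul]
  refine Finset.sum_congr rfl fun i _ => ?_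
  by_cases hp : p ∈ Set.Ioc (τ i).s (τ i).t ×ˢ (τ i).B
  · rw [Set.indicator_of_mem hp, Set.indicator_of_mem hp]
  · rw [Set.indicator_of_notMem hp, Set.indicator_of_notMem hp, smul_zero]

lemma stepIntegral_smul {α : Type*} [Fintype α] (a : ℝ) (τ : α → StepTerm 𝓕 H)
    (t : TimeInterval T) :
    stepIntegral W (fun i => (τ i).smul a) t =ᵐ[P] fun ω => a * stepIntegral W τ t ω := by
  have h : ∀ (s : TimeInterval T) (y : H), ∀ᵐ ω ∂P, W s (a • y) ω = a * W s y ω := fun s y => by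
    rw [map_smul]
    exact Lp.coeFn_smul _ _
  have h1 := ae_all_iff.2 fun i => h (min (τ i).t t) (τ i).h
  have h2 := ae_all_iff.2 fun i => h (min (τ i).s t) (τ i).h
  filter_upwards [h1, h2] with ω h1 h2
  simp only [stepIntegral, Finset.mul_sum, StepTerm.smul]
  refine Finset.sum_congr rfl fun i _ => ?_
  by_cases hB : ω ∈ (τ i).B
  · rw [Set.indicator_of_mem hB, Set.indicator_of_mem hB, h1, h2]; ring
  · rw [Set.indicator_of_notMem hB, Set.indicator_of_notMem hB, mul_zero]

variable [IsProbabilityMeasure P]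

lemma hasLaw_gaussianReal_of_integral_exp {X : Ω → ℝ} (hX : AEStronglyMeasurable X P) {q : ℝ}
    (hq : 0 ≤ q) (h : ∀ a : ℝ, ∫ ω, Complex.exp ((a * X ω : ℝ) * Complex.I) ∂P =
      Real.exp (-(a ^ 2 * q) / 2)) :
    HasLaw X (gaussianReal 0 q.toNNReal) P := by
  refine ⟨hX.aemeasurable, ?_⟩
  have := Measure.isProbabilityMeasure_map (μ := P) hX.aemeasurable
  refine Measure.ext_of_charFun ?_
  ext a
  rw [charFun_gaussianReal, charFun_apply_real, integral_map hX.aemeasurable (by fun_prop)]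
  have := h a
  simp only [Complex.ofReal_mul] at this
  rw [this, Complex.ofReal_exp]
  congr 1
  rw [show ((q.toNNReal : ℝ≥0) : ℂ) = ((q.toNNReal : ℝ) : ℂ) from rfl, Real.coe_toNNReal q hq]
  push_cast
  ring

/-- The integral of a deterministic step function is Gaussian. -/
lemma hasLaw_stepIntegral_of_const {α : Type*} [Fintype α]
    (hW : IsCylindricalBrownianMotion P 𝓕 W) (hT : 0 ≤ T) (τ : α → StepTerm 𝓕 H)
    {D : TimeInterval T → H} (hD : ∀ t ω, stepValue τ (t, ω) = D t) :
    HasLaw (stepIntegral W τ ⟨T, hT, le_rfl⟩)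
      (gaussianReal 0 (∫ t, ‖D t‖ ^ 2 ∂timeMeasure T).toNNReal) P := by
  refine hasLaw_gaussianReal_of_integral_exp (aestronglyMeasurable_stepIntegral W τ _)
    (integral_nonneg fun t => sq_nonneg _) fun a => ?_
  have h := integral_exp_stepIntegral_of_const hW hT (fun i => (τ i).smul a)
    (q := a ^ 2 * ∫ t, ‖D t‖ ^ 2 ∂timeMeasure T) fun ω => by
      simp only [stepEnergy, stepValue_smul, hD, norm_smul, mul_pow, Real.norm_eq_abs, sq_abs]
      rw [integral_const_mul]
  rw [← h]
  refine integral_congr_ae ?_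
  filter_upwards [stepIntegral_smul (W := W) a τ ⟨T, hT, le_rfl⟩] with ω hω
  exact congrArg (fun x : ℝ => Complex.exp (x * Complex.I)) hω.symm

lemma memLp_stepValue_of_const {α : Type*} [Fintype α] (τ : α → StepTerm 𝓕 H)
    {D : TimeInterval T → H} (hD : ∀ t (ω : Ω), stepValue τ (t, ω) = D t) [Nonempty Ω] :
    MemLp D 2 (timeMeasure T) := by
  obtain ⟨ω⟩ := ‹Nonempty Ω›
  have := memLp_stepValue τ ω
  simpa only [hD] using this

/-- The isometry is read off from the variance of the Gaussian law of the integral. -/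
lemma eLpNorm_stepIntegral_of_const {α : Type*} [Fintype α]
    (hW : IsCylindricalBrownianMotion P 𝓕 W) (hT : 0 ≤ T) (τ : α → StepTerm 𝓕 H)
    {D : TimeInterval T → H} (hD : ∀ t ω, stepValue τ (t, ω) = D t) :
    MemLp (stepIntegral W τ ⟨T, hT, le_rfl⟩) 2 P ∧
    eLpNorm (stepIntegral W τ ⟨T, hT, le_rfl⟩) 2 P = eLpNorm D 2 (timeMeasure T) := by
  have : Nonempty Ω := nonempty_of_isProbabilityMeasure P
  have hlaw := hasLaw_stepIntegral_of_const hW hT τ hD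
  have hDL := memLp_stepValue_of_const τ hD
  set q := ∫ t, ‖D t‖ ^ 2 ∂timeMeasure T with hq
  have hq0 : 0 ≤ q := integral_nonneg fun t => sq_nonneg _
  have hid : MemLp id 2 (gaussianReal 0 q.toNNReal) := memLp_id_gaussianReal 2
  have e : eLpNorm (stepIntegral W τ ⟨T, hT, le_rfl⟩) 2 P
      = eLpNorm id 2 (gaussianReal 0 q.toNNReal) := by
    rw [← hlaw.map_eq, eLpNorm_map_measure aestronglyMeasurable_id hlaw.aemeasurable]
    rfl
  refine ⟨⟨aestronglyMeasurable_stepIntegral W τ _, e ▸ hid.2⟩, ?_⟩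
  rw [e, ← ENNReal.toReal_eq_toReal_iff' hid.eLpNorm_ne_top hDL.eLpNorm_ne_top,
    ← sq_eq_sq₀ ENNReal.toReal_nonneg ENNReal.toReal_nonneg,
    ← integral_norm_sq_eq_toReal_eLpNorm hDL, ← integral_norm_sq_eq_toReal_eLpNorm hid]
  have hv := variance_id_gaussianReal (μ := 0) (v := q.toNNReal)
  rw [variance_eq_integral aemeasurable_id] at hv
  simp only [id, integral_id_gaussianReal, sub_zero] at hv
  simp only [id, Real.norm_eq_abs, sq_abs]
  rw [hv, Real.coe_toNNReal q hq0]

/-- `γ` is the Wiener integral of the square integrable function `f`, as a limit of integrals of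
deterministic step functions. -/
def IsWienerIntegral (𝓕 : Filtration (TimeInterval T) mΩ) (W : TimeInterval T → H →L[ℝ] Lp ℝ 2 P)
    (hT : 0 ≤ T) (f : TimeInterval T → H) (γ : Ω → ℝ) : Prop :=
  MemLp f 2 (timeMeasure T) ∧
  ∃ (β : ℕ → Type) (_ : ∀ n, Fintype (β n)) (d : ∀ n, β n → StepTerm 𝓕 H)
    (D : ℕ → TimeInterval T → H), (∀ n t ω, stepValue (d n) (t, ω) = D n t) ∧
    Tendsto (fun n => eLpNorm (fun t => D n t - f t) 2 (timeMeasure T)) atTop (𝓝 0) ∧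
    TendstoInMeasure P (fun n => stepIntegral W (d n) ⟨T, hT, le_rfl⟩) atTop γ

lemma tendstoInMeasure_add {X Y : ℕ → Ω → ℝ} {x y : Ω → ℝ} (hX : TendstoInMeasure P X atTop x)
    (hY : TendstoInMeasure P Y atTop y) :
    TendstoInMeasure P (fun n ω => X n ω + Y n ω) atTop fun ω => x ω + y ω := by
  rw [tendstoInMeasure_iff_dist] at *
  intro ε hε
  refine tendsto_of_tendsto_of_tendsto_of_le_of_le tendsto_const_nhds
    (by simpa using (hX (ε / 2) (half_pos hε)).add (hY (ε / 2) (half_pos hε)))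
    (fun _ => zero_le) fun n => ?_
  refine le_trans (measure_mono fun ω hω => ?_) (measure_union_le _ _)
  have hω : ε ≤ dist (X n ω + Y n ω) (x ω + y ω) := hω
  show ω ∈ {ω | ε / 2 ≤ dist (X n ω) (x ω)} ∪ {ω | ε / 2 ≤ dist (Y n ω) (y ω)}
  by_contra hcon
  simp only [Set.mem_union, Set.mem_ofPred_eq, not_or, not_le] at hcon
  linarith [dist_add_add_le (X n ω) (Y n ω) (x ω) (y ω), hcon.1, hcon.2]

lemma tendstoInMeasure_const_mul {X : ℕ → Ω → ℝ} {x : Ω → ℝ} (a : ℝ)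
    (hX : TendstoInMeasure P X atTop x) :
    TendstoInMeasure P (fun n ω => a * X n ω) atTop fun ω => a * x ω := by
  rw [tendstoInMeasure_iff_dist] at *
  intro ε hε
  refine tendsto_of_tendsto_of_tendsto_of_le_of_le tendsto_const_nhds
    (hX (ε / (|a| + 1)) (by positivity)) (fun _ => zero_le) fun n => measure_mono fun ω hω => ?_
  have hω : ε ≤ dist (a * X n ω) (a * x ω) := hω
  show ε / (|a| + 1) ≤ dist (X n ω) (x ω)
  rw [div_le_iff₀ (by positivity)]
  rw [Real.dist_eq, ← mul_sub, abs_mul, ← Real.dist_eq] at hω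
  nlinarith [dist_nonneg (x := X n ω) (y := x ω)]

namespace IsWienerIntegral

variable {hT : 0 ≤ T} {f g : TimeInterval T → H} {γ δ : Ω → ℝ}

lemma zero : IsWienerIntegral 𝓕 W hT (fun _ => (0 : H)) fun _ => 0 := by
  refine ⟨MemLp.zero', fun _ => Empty, fun _ => inferInstance, fun _ i => i.elim, fun _ _ => 0,
    fun n t ω => by simp [stepValue], by simp, ?_⟩
  refine tendstoInMeasure_iff_dist.2 fun ε hε => ?_
  simp [stepIntegral, not_le.2 hε]

lemma add (h : IsWienerIntegral 𝓕 W hT f γ) (h' : IsWienerIntegral 𝓕 W hT g δ) :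
    IsWienerIntegral 𝓕 W hT (fun t => f t + g t) fun ω => γ ω + δ ω := by
  have : Nonempty Ω := nonempty_of_isProbabilityMeasure P
  obtain ⟨hf, β, hβ, d, D, hD, hDf, hγ⟩ := h
  obtain ⟨hg, β', hβ', d', D', hD', hDg, hδ⟩ := h'
  refine ⟨hf.add hg, fun n => β n ⊕ β' n, fun n => inferInstance, fun n => Sum.elim (d n) (d' n),
    fun n t => D n t + D' n t, fun n t ω => by rw [stepValue_sumElim, hD, hD'], ?_, ?_⟩
  · refine tendsto_of_tendsto_of_tendsto_of_le_of_le tendsto_const_nhds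
      (by simpa using hDf.add hDg) (fun _ => zero_le) fun n => ?_
    have e : (fun t => D n t + D' n t - (f t + g t)) =
        (fun t => D n t - f t) + fun t => D' n t - g t := by
      ext t; simp only [Pi.add_apply]; abel
    rw [e]
    exact eLpNorm_add_le ((memLp_stepValue_of_const (d n) (hD n)).1.sub hf.1)
      ((memLp_stepValue_of_const (d' n) (hD' n)).1.sub hg.1) (by norm_num)
  · refine (tendstoInMeasure_add hγ hδ).congr_left fun n => ae_of_all _ fun ω => ?_
    rw [stepIntegral_sumElim]

lemma const_smul (h : IsWienerIntegral 𝓕 W hT f γ) (a : ℝ) :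
    IsWienerIntegral 𝓕 W hT (fun t => a • f t) fun ω => a * γ ω := by
  obtain ⟨hf, β, hβ, d, D, hD, hDf, hγ⟩ := h
  refine ⟨hf.const_smul a, β, hβ, fun n i => (d n i).smul a, fun n t => a • D n t,
    fun n t ω => by rw [stepValue_smul, hD], ?_, ?_⟩
  · have e : ∀ n, eLpNorm (fun t => a • D n t - a • f t) 2 (timeMeasure T) =
        ‖a‖ₑ * eLpNorm (fun t => D n t - f t) 2 (timeMeasure T) := fun n => by
      rw [← eLpNorm_const_smul]
      congr 1
      ext t
      simp [smul_sub]
    simp only [e]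
    have := ENNReal.Tendsto.const_mul (a := ‖a‖ₑ) hDf (Or.inr enorm_ne_top)
    rwa [mul_zero] at this
  · exact (tendstoInMeasure_const_mul a hγ).congr_left fun n => (stepIntegral_smul a (d n) _).symm

lemma sum {κ : Type*} (s : Finset κ) {f : κ → TimeInterval T → H} {γ : κ → Ω → ℝ}
    (h : ∀ i ∈ s, IsWienerIntegral 𝓕 W hT (f i) (γ i)) :
    IsWienerIntegral 𝓕 W hT (fun t => ∑ i ∈ s, f i t) fun ω => ∑ i ∈ s, γ i ω := by
  classical
  induction s using Finset.induction_on with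
  | empty => simpa using zero
  | insert a s ha ih =>
    simp only [Finset.sum_insert ha]
    exact (h a (Finset.mem_insert_self a s)).add (ih fun i hi => h i (Finset.mem_insert_of_mem hi))

end IsWienerIntegral

/-- The step terms of a piecewise average times a vector. -/
noncomputable def gridTerms (𝓕 : Filtration (TimeInterval T) mΩ) (hT : 0 ≤ T) (n : ℕ)
    (c : TimeInterval T → ℝ) (h : H) (i : Fin (n + 1)) : StepTerm 𝓕 H :=
  { s := gridPoint hT n i
    t := gridPoint hT n (i + 1)
    le := monotone_gridPoint hT n (Nat.le_succ i)
    B := Set.univ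
    measurableSet_B := MeasurableSet.univ
    h := ((n + 1) / T * ∫ r in gridCell hT n i, c r ∂timeMeasure T) • h }

lemma stepValue_gridTerms (hT : 0 ≤ T) (n : ℕ) (c : TimeInterval T → ℝ) (h : H)
    (t : TimeInterval T) (ω : Ω) :
    stepValue (gridTerms 𝓕 hT n c h) (t, ω) = gridAverage hT n c t • h := by
  rw [gridAverage, Finset.sum_smul, ← Fin.sum_univ_eq_sum_range (fun i =>
    (gridCell hT n i).indicator (fun _ => (n + 1) / T * ∫ r in gridCell hT n i, c r ∂timeMeasure T)
      t • h), stepValue]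
  refine Finset.sum_congr rfl fun i _ => ?_
  by_cases ht : t ∈ gridCell hT n i
  · rw [Set.indicator_of_mem ht, Set.indicator_of_mem (by exact ⟨ht, Set.mem_univ _⟩)]
    rfl
  · rw [Set.indicator_of_notMem ht, Set.indicator_of_notMem (by exact fun h' => ht h'.1), zero_smul]

/-- Square integrable functions with values in a line have a Wiener integral. -/
lemma exists_isWienerIntegral (hW : IsCylindricalBrownianMotion P 𝓕 W) (hT : 0 < T)
    {c : TimeInterval T → ℝ} (hc : MemLp c 2 (timeMeasure T)) (h : H) :
    ∃ γ : Ω → ℝ, Measurable γ ∧ IsWienerIntegral 𝓕 W hT.le (fun t => c t • h) γ := by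
  have : Nonempty Ω := nonempty_of_isProbabilityMeasure P
  have hD : ∀ n t (ω : Ω), stepValue (gridTerms 𝓕 hT.le n c h) (t, ω) = gridAverage hT.le n c t • h :=
    fun n t ω => stepValue_gridTerms hT.le n c h t ω
  have hcsm : MemLp (fun t => c t • h) 2 (timeMeasure T) := by
    refine (hc.norm.mul_const ‖h‖).of_le (hc.1.smul_const h) (ae_of_all _ fun t => ?_)
    simp [norm_smul]
  have hlim : Tendsto (fun n => eLpNorm (fun t => gridAverage hT.le n c t • h - c t • h) 2
      (timeMeasure T)) atTop (𝓝 0) := by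
    have e : ∀ n, eLpNorm (fun t => gridAverage hT.le n c t • h - c t • h) 2 (timeMeasure T) =
        ENNReal.ofReal (√(∫ t, (c t - gridAverage hT.le n c t) ^ 2 ∂timeMeasure T) * ‖h‖) := by
      intro n
      have hL : MemLp (fun t => gridAverage hT.le n c t • h - c t • h) 2 (timeMeasure T) :=
        (memLp_stepValue_of_const _ (hD n)).sub hcsm
      rw [← ENNReal.ofReal_toReal hL.eLpNorm_ne_top]
      congr 1
      rw [← Real.sqrt_sq (ENNReal.toReal_nonneg (a := eLpNorm _ 2 _)),
        ← integral_norm_sq_eq_toReal_eLpNorm hL]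
      have e2 : ∀ t, ‖gridAverage hT.le n c t • h - c t • h‖ ^ 2 =
          (c t - gridAverage hT.le n c t) ^ 2 * ‖h‖ ^ 2 := fun t => by
        rw [← sub_smul, norm_smul, mul_pow, Real.norm_eq_abs, sq_abs]; ring
      simp only [e2]
      rw [integral_mul_const, Real.sqrt_mul (integral_nonneg fun t => sq_nonneg _),
        Real.sqrt_sq (norm_nonneg _)]
    simp only [e]
    rw [← ENNReal.ofReal_zero]
    refine ENNReal.tendsto_ofReal ?_
    have := ((Real.continuous_sqrt.tendsto _).comp
      (tendsto_integral_sub_gridAverage_sq hT hc)).mul_const ‖h‖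
    simpa using this
  let X : ℕ → Ω → ℝ := fun n => stepIntegral W (gridTerms 𝓕 hT.le n c h) ⟨T, hT.le, le_rfl⟩
  have hX : ∀ n, MemLp (X n) 2 P := fun n => (eLpNorm_stepIntegral_of_const hW hT.le _ (hD n)).1
  -- The isometry, applied to the difference of two step functions, makes the integrals Cauchy in
  -- `L²`.
  have hXX : ∀ n m, eLpNorm (X n - X m) 2 P ≤
      eLpNorm (fun t => gridAverage hT.le n c t • h - c t • h) 2 (timeMeasure T) +
      eLpNorm (fun t => gridAverage hT.le m c t • h - c t • h) 2 (timeMeasure T) := by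
    intro n m
    have h1 := (eLpNorm_stepIntegral_of_const hW hT.le (subTerms (gridTerms 𝓕 hT.le n c h)
      (gridTerms 𝓕 hT.le m c h))
      (D := fun t => gridAverage hT.le n c t • h - gridAverage hT.le m c t • h)
      fun t ω => by rw [stepValue_subTerms, hD, hD]).2
    have h2 : eLpNorm (X n - X m) 2 P = eLpNorm (stepIntegral W (subTerms (gridTerms 𝓕 hT.le n c h)
      (gridTerms 𝓕 hT.le m c h)) ⟨T, hT.le, le_rfl⟩) 2 P :=
      eLpNorm_congr_ae (stepIntegral_subTerms _ _ _).symm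
    rw [h2, h1]
    have e : (fun t => gridAverage hT.le n c t • h - gridAverage hT.le m c t • h) =
        (fun t => gridAverage hT.le n c t • h - c t • h) -
          fun t => gridAverage hT.le m c t • h - c t • h := by
      ext t; simp
    rw [e]
    exact eLpNorm_sub_le ((memLp_stepValue_of_const _ (hD n)).1.sub hcsm.1)
      ((memLp_stepValue_of_const _ (hD m)).1.sub hcsm.1) (by norm_num)
  have hcau : CauchySeq fun n => (hX n).toLp (X n) := by
    rw [EMetric.cauchySeq_iff]
    intro ε hε
    obtain ⟨N, hN⟩ := eventually_atTop.1 (hlim.eventually_lt_const (ENNReal.half_pos hε.ne'))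
    refine ⟨N, fun n hn m hm => ?_⟩
    rw [Lp.edist_toLp_toLp]
    refine (hXX n m).trans_lt ?_
    exact (ENNReal.add_lt_add (hN n hn) (hN m hm)).trans_le (ENNReal.add_halves ε).le
  obtain ⟨γ, hγ⟩ := cauchySeq_tendsto_of_complete hcau
  have hγm := tendstoInMeasure_of_tendsto_Lp hγ
  refine ⟨(Lp.aestronglyMeasurable γ).mk _, (Lp.aestronglyMeasurable γ).stronglyMeasurable_mk.measurable,
    hcsm, fun n => Fin (n + 1), fun n => inferInstance, fun n => gridTerms 𝓕 hT.le n c h,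
    fun n t => gridAverage hT.le n c t • h, hD, hlim, ?_⟩
  exact (hγm.congr_left fun n => (hX n).coeFn_toLp).congr_right (Lp.aestronglyMeasurable γ).ae_eq_mk

end

/-! ### Functionals of functions whose square function lies in the space. -/

namespace IsFunctionSpace

variable {S : Type*} [MeasurableSpace S] {μ : Measure S}
  {E : Type*} [NormedAddCommGroup E] [NormedSpace ℝ E] {ι : E →ₗ[ℝ] (S →ₘ[μ] ℝ)}
  {𝕋 : Type*} [MeasurableSpace 𝕋] {ρ : Measure 𝕋}

/-- The `L²`-norm of a functional of an `E`-valued function is controlled by the norm of a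
square function. -/
lemma lintegral_dual_sq_le [SigmaFinite μ] [IsFiniteMeasure ρ] [CompleteSpace E]
    (hι : IsFunctionSpace μ ι) {F : 𝕋 → E} (hF : AEStronglyMeasurable F ρ) {f : 𝕋 × S → ℝ}
    (hf : StronglyMeasurable f) (hFf : ∀ᵐ t ∂ρ, ∀ᵐ s ∂μ, ι (F t) s = f (t, s)) {y : E}
    (hy : ∀ᵐ s ∂μ, ∫⁻ t, ‖f (t, s)‖ₑ ^ 2 ∂ρ ≤ ‖ι y s‖ₑ ^ 2) (x' : E →L[ℝ] ℝ) :
    ∫⁻ t, ‖x' (F t)‖ₑ ^ 2 ∂ρ ≤ (‖x'‖ₑ * ‖y‖ₑ) ^ 2 := by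
  obtain ⟨F', hF', hFF'⟩ := hF
  have hFf' : ∀ᵐ t ∂ρ, ∀ᵐ s ∂μ, ι (F' t) s = f (t, s) := by
    filter_upwards [hFf, hFF'] with t h1 h2
    rwa [← h2]
  have e0 : ∫⁻ t, ‖x' (F t)‖ₑ ^ 2 ∂ρ = ∫⁻ t, ‖x' (F' t)‖ₑ ^ 2 ∂ρ := by
    refine lintegral_congr_ae ?_
    filter_upwards [hFF'] with t ht
    rw [ht]
  rw [e0]
  -- Truncation makes `θ k` bounded and `θ k • F'` integrable, so the norm `N` of `θ k` is finite
  -- and can be cancelled at the end.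
  let A : ℕ → Set 𝕋 := fun k => {t | ‖F' t‖ ≤ k}
  have hA : ∀ k, MeasurableSet (A k) := fun k =>
    (hF'.norm.measurable) measurableSet_Iic
  let θ : ℕ → 𝕋 → ℝ := fun k => (A k).indicator fun t => x' (F' t)
  have hθm : ∀ k, StronglyMeasurable (θ k) := fun k =>
    (x'.continuous.comp_stronglyMeasurable hF').indicator (hA k)
  have hθb : ∀ k t, ‖θ k t‖ ≤ ‖x'‖ * k := by
    intro k t
    by_cases ht : t ∈ A k
    · simp only [θ, Set.indicator_of_mem ht]
      exact (x'.le_opNorm _).trans (mul_le_mul_of_nonneg_left ht (norm_nonneg _))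
    · simp only [θ, Set.indicator_of_notMem ht, norm_zero]
      positivity
  have hθL : ∀ k, MemLp (θ k) 2 ρ := fun k =>
    MemLp.of_bound (hθm k).aestronglyMeasurable _ (ae_of_all _ (hθb k))
  -- the truncated estimate
  have key : ∀ k, ∫⁻ t, ‖θ k t‖ₑ ^ 2 ∂ρ ≤ (‖x'‖ₑ * ‖y‖ₑ) ^ 2 := by
    intro k
    have hGi : Integrable (fun t => θ k t • F' t) ρ := by
      refine Integrable.of_bound ((hθm k).smul hF').aestronglyMeasurable (‖x'‖ * k * k)
        (ae_of_all _ fun t => ?_)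
      rw [norm_smul]
      by_cases ht : t ∈ A k
      · exact mul_le_mul (hθb k t) ht (norm_nonneg _) (by positivity)
      · simp only [θ, Set.indicator_of_notMem ht, norm_zero, zero_mul]
        positivity
    have hcoe := hι.coe_integral hGi
      (f := fun p => θ k p.1 * f p) (((hθm k).comp_measurable measurable_fst).mul hf) (by
        filter_upwards [hFf'] with t ht
        filter_upwards [ht, coe_smul ι (θ k t) (F' t)] with s h1 h2
        rw [h2, h1])
    set N : ℝ := (eLpNorm (θ k) 2 ρ).toReal with hN
    have hNe : (∫⁻ t, ‖θ k t‖ₑ ^ (2 : ℝ) ∂ρ) ^ (1 / 2 : ℝ) = ENNReal.ofReal N := by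
      rw [hN, ENNReal.ofReal_toReal (hθL k).eLpNorm_ne_top,
        eLpNorm_eq_lintegral_rpow_enorm_toReal (by norm_num) (by norm_num)]
      simp
    -- Cauchy–Schwarz in `t` at fixed `s`. The integral of `θ k • F'` then has norm at most `N *
    -- ‖y‖`, and applying `x'` to it returns `N ^ 2`.
    have hint : ∀ᵐ s ∂μ, |ι (∫ t, θ k t • F' t ∂ρ) s| ≤ N * |ι y s| := by
      filter_upwards [hcoe, hy] with s h1 h2
      rw [h1.2, ← Real.norm_eq_abs, ← Real.norm_eq_abs, ← ENNReal.ofReal_le_ofReal_iff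
        (mul_nonneg ENNReal.toReal_nonneg (norm_nonneg _)), ENNReal.ofReal_mul
        ENNReal.toReal_nonneg, ofReal_norm, ofReal_norm]
      calc ‖∫ t, θ k t * f (t, s) ∂ρ‖ₑ ≤ ∫⁻ t, ‖θ k t * f (t, s)‖ₑ ∂ρ :=
            enorm_integral_le_lintegral_enorm _
        _ = ∫⁻ t, ((fun t => ‖θ k t‖ₑ) * fun t => ‖f (t, s)‖ₑ) t ∂ρ := by
            simp only [enorm_mul, Pi.mul_apply]
        _ ≤ (∫⁻ t, ‖θ k t‖ₑ ^ (2 : ℝ) ∂ρ) ^ (1 / 2 : ℝ) *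
            (∫⁻ t, ‖f (t, s)‖ₑ ^ (2 : ℝ) ∂ρ) ^ (1 / 2 : ℝ) :=
            ENNReal.lintegral_mul_le_Lp_mul_Lq ρ (Real.HolderConjugate.two_two)
              (hθm k).enorm.aemeasurable
              (hf.comp_measurable measurable_prodMk_right).enorm.aemeasurable
        _ ≤ ENNReal.ofReal N * ‖ι y s‖ₑ := by
            rw [hNe]
            refine mul_le_mul_right ?_ _
            simp only [ENNReal.rpow_two]
            calc _ ≤ (‖ι y s‖ₑ ^ 2) ^ (1 / 2 : ℝ) := ENNReal.rpow_le_rpow h2 (by norm_num)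
              _ = ‖ι y s‖ₑ := by
                rw [← ENNReal.rpow_two, ← ENNReal.rpow_mul]
                norm_num
    have hnorm := hι.norm_le_const_mul ENNReal.toReal_nonneg hint
    have hx : x' (∫ t, θ k t • F' t ∂ρ) = ∫ t, ‖θ k t‖ ^ 2 ∂ρ := by
      rw [← x'.integral_comp_comm hGi]
      refine integral_congr_ae (ae_of_all _ fun t => ?_)
      simp only [map_smul, smul_eq_mul]
      by_cases ht : t ∈ A k
      · simp only [θ, Set.indicator_of_mem ht]
        rw [Real.norm_eq_abs, sq_abs, sq]
      · simp [θ, Set.indicator_of_notMem ht]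
    have hN2 : ∫ t, ‖θ k t‖ ^ 2 ∂ρ = N ^ 2 := integral_norm_sq_eq_toReal_eLpNorm (hθL k)
    have h3 : N ^ 2 ≤ ‖x'‖ * (N * ‖y‖) := by
      rw [← hN2, ← hx]
      refine (le_abs_self _).trans ((x'.le_opNorm _).trans ?_)
      exact mul_le_mul_of_nonneg_left hnorm (norm_nonneg _)
    have hN0 : 0 ≤ N := ENNReal.toReal_nonneg
    have h4 : N ≤ ‖x'‖ * ‖y‖ := by
      rcases hN0.eq_or_lt with h0 | h0
      · rw [← h0]; positivity
      · nlinarith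
    calc ∫⁻ t, ‖θ k t‖ₑ ^ 2 ∂ρ = ENNReal.ofReal (∫ t, ‖θ k t‖ ^ 2 ∂ρ) := by
          rw [ofReal_integral_eq_lintegral_ofReal ((hθL k).integrable_norm_pow two_ne_zero)
            (ae_of_all _ fun t => sq_nonneg _)]
          refine lintegral_congr fun t => ?_
          rw [ENNReal.ofReal_pow (norm_nonneg _), ofReal_norm]
      _ ≤ ENNReal.ofReal ((‖x'‖ * ‖y‖) ^ 2) := by
          rw [hN2]
          exact ENNReal.ofReal_le_ofReal (pow_le_pow_left₀ hN0 h4 2)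
      _ = _ := by
          rw [ENNReal.ofReal_pow (by positivity), ENNReal.ofReal_mul (norm_nonneg _), ofReal_norm,
            ofReal_norm]
  calc ∫⁻ t, ‖x' (F' t)‖ₑ ^ 2 ∂ρ ≤ ∫⁻ t, liminf (fun k => ‖θ k t‖ₑ ^ 2) atTop ∂ρ := by
        refine lintegral_mono fun t => ?_
        obtain ⟨K, hK⟩ := exists_nat_ge ‖F' t‖
        refine le_liminf_of_le (by isBoundedDefault) ?_
        filter_upwards [eventually_ge_atTop K] with k hk
        have ht : t ∈ A k := hK.trans (by exact_mod_cast hk)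
        simp only [θ, Set.indicator_of_mem ht, le_refl]
    _ ≤ liminf (fun k => ∫⁻ t, ‖θ k t‖ₑ ^ 2 ∂ρ) atTop :=
        lintegral_liminf_le fun k => (hθm k).enorm.pow_const 2
    _ ≤ _ := liminf_le_of_frequently_le' (Eventually.of_forall key).frequently

end IsFunctionSpace

/-! ### Projections onto finitely many coordinates and their time averages. -/

section

variable {T : ℝ} {H : Type*} [NormedAddCommGroup H] [InnerProductSpace ℝ H]

/-- The piecewise averages of the coordinates with indices in a finite set. -/
noncomputable def gridProjection {κ : Type*} (hT : 0 ≤ T) (n : ℕ) (F : Finset κ) (b : κ → H)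
    (u : TimeInterval T → H) (t : TimeInterval T) : H :=
  ∑ k ∈ F, gridAverage hT n (fun r => inner ℝ (u r) (b k)) t • b k

lemma memLp_inner {u : TimeInterval T → H} (hu : MemLp u 2 (timeMeasure T)) (h : H) :
    MemLp (fun t => inner ℝ (u t) h) 2 (timeMeasure T) := by
  refine (hu.norm.mul_const ‖h‖).of_le (hu.1.inner aestronglyMeasurable_const)
    (ae_of_all _ fun t => ?_)
  rw [norm_mul, norm_norm, norm_norm]
  exact norm_inner_le_norm _ _

lemma memLp_gridProjection {κ : Type*} (hT : 0 ≤ T) (n : ℕ) (F : Finset κ) (b : κ → H)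
    (u : TimeInterval T → H) : MemLp (gridProjection hT n F b u) 2 (timeMeasure T) := by
  refine memLp_finsetSum _ fun k _ => ?_
  refine ((memLp_gridAverage hT n (fun r => inner ℝ (u r) (b k))).norm.mul_const ‖b k‖).of_le
    ((measurable_gridAverage hT n _).aestronglyMeasurable.smul_const _) (ae_of_all _ fun t => ?_)
  simp [norm_smul]

lemma norm_sub_sum_smul_sq {κ : Type*} {b : κ → H} (hb : Orthonormal ℝ b) (F : Finset κ)
    (a : κ → ℝ) (x : H) :
    ‖x - ∑ k ∈ F, a k • b k‖ ^ 2 =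
      ‖x‖ ^ 2 - 2 * ∑ k ∈ F, a k * inner ℝ x (b k) + ∑ k ∈ F, a k ^ 2 := by
  rw [norm_sub_sq_real, inner_sum, ← real_inner_self_eq_norm_sq (∑ k ∈ F, a k • b k),
    hb.inner_sum]
  simp only [inner_smul_right, conj_trivial, sq]

/-- Pythagoras: restricting to orthonormal coordinates and averaging in time combine into an
orthogonal projection of `L²`. -/
lemma integral_norm_sub_gridProjection_sq {κ : Type*} (hT : 0 < T) (n : ℕ) (F : Finset κ)
    {b : κ → H} (hb : Orthonormal ℝ b) {u : TimeInterval T → H} (hu : MemLp u 2 (timeMeasure T)) :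
    ∫ t, ‖u t - gridProjection hT.le n F b u t‖ ^ 2 ∂timeMeasure T =
      ∫ t, ‖u t‖ ^ 2 ∂timeMeasure T -
        ∑ k ∈ F, gridEnergy hT.le n (fun r => inner ℝ (u r) (b k)) := by
  have i1 : Integrable (fun t => ‖u t‖ ^ 2) (timeMeasure T) := hu.integrable_norm_pow two_ne_zero
  have i2 : ∀ k ∈ F, Integrable (fun t => gridAverage hT.le n (fun r => inner ℝ (u r) (b k)) t *
      inner ℝ (u t) (b k)) (timeMeasure T) := fun k _ =>
    (memLp_gridAverage hT.le n _).integrable_mul (memLp_inner hu (b k))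
  have i3 : ∀ k ∈ F, Integrable (fun t =>
      gridAverage hT.le n (fun r => inner ℝ (u r) (b k)) t ^ 2) (timeMeasure T) := fun k _ =>
    (memLp_gridAverage hT.le n _).integrable_sq
  have i2' := integrable_finsetSum F i2
  have i3' := integrable_finsetSum F i3
  have i4 : Integrable (fun t => ‖u t‖ ^ 2 - 2 * ∑ k ∈ F,
      gridAverage hT.le n (fun r => inner ℝ (u r) (b k)) t * inner ℝ (u t) (b k))
      (timeMeasure T) := i1.sub (i2'.const_mul 2)
  simp only [gridProjection, norm_sub_sum_smul_sq hb]
  rw [integral_add i4 i3', integral_sub i1 (i2'.const_mul 2), integral_const_mul,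
    integral_finsetSum _ i2, integral_finsetSum _ i3]
  simp only [integral_gridAverage_sq hT]
  rw [Finset.sum_congr rfl fun k _ => integral_gridAverage_mul hT n
    ((memLp_inner hu (b k)).integrable (by norm_num))]
  ring

lemma sum_gridEnergy_le {κ : Type*} (hT : 0 < T) (n : ℕ) (F : Finset κ)
    {b : κ → H} (hb : Orthonormal ℝ b) {u : TimeInterval T → H} (hu : MemLp u 2 (timeMeasure T)) :
    ∑ k ∈ F, gridEnergy hT.le n (fun r => inner ℝ (u r) (b k)) ≤
      ∫ t, ‖u t‖ ^ 2 ∂timeMeasure T := by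
  have h1 := integral_norm_sub_gridProjection_sq hT n F hb hu
  have h2 : 0 ≤ ∫ t, ‖u t - gridProjection hT.le n F b u t‖ ^ 2 ∂timeMeasure T :=
    integral_nonneg fun t => sq_nonneg _
  linarith

/-- Along finite sets exhausting an orthonormal basis, the projections converge. -/
lemma tendsto_integral_norm_sub_gridProjection_sq {κ : Type*} [Countable κ] (hT : 0 < T)
    (b : HilbertBasis κ ℝ H)
    {F : ℕ → Finset κ} (hF : Tendsto F atTop atTop) {u : TimeInterval T → H}
    (hu : MemLp u 2 (timeMeasure T)) :
    Tendsto (fun n => ∫ t, ‖u t - gridProjection hT.le n (F n) b u t‖ ^ 2 ∂timeMeasure T) atTop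
      (𝓝 0) := by
  simp only [integral_norm_sub_gridProjection_sq hT _ _ b.orthonormal hu]
  set q := ∫ t, ‖u t‖ ^ 2 ∂timeMeasure T with hq
  -- Parseval
  have hpars : Tendsto (fun G : Finset κ => ∑ k ∈ G, ∫ t, inner ℝ (u t) (b k) ^ 2 ∂timeMeasure T)
      atTop (𝓝 q) := by
    have h1 : Tendsto (fun G : Finset κ => ∫ t, ∑ k ∈ G, inner ℝ (u t) (b k) ^ 2 ∂timeMeasure T)
        atTop (𝓝 q) := by
      refine tendsto_integral_filter_of_dominated_convergence (fun t => ‖u t‖ ^ 2)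
        (Eventually.of_forall fun G => ?_) (Eventually.of_forall fun G => ae_of_all _ fun t => ?_)
        (hu.integrable_norm_pow two_ne_zero) (ae_of_all _ fun t => ?_)
      · exact Finset.aestronglyMeasurable_fun_sum _ fun k _ => (memLp_inner hu (b k)).1.pow 2
      · rw [Real.norm_of_nonneg (Finset.sum_nonneg fun k _ => sq_nonneg _)]
        have h2 := norm_sub_sum_smul_sq b.orthonormal G (fun k => inner ℝ (u t) (b k)) (u t)
        simp only [← sq] at h2
        have h3 := sq_nonneg ‖u t - ∑ k ∈ G, inner ℝ (u t) (b k) • b k‖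
        linarith
      · have h2 := b.hasSum_inner_mul_inner (u t) (u t)
        rw [real_inner_self_eq_norm_sq] at h2
        simp only [HasSum, SummationFilter.unconditional_filter] at h2
        refine h2.congr fun G => Finset.sum_congr rfl fun k _ => ?_
        rw [real_inner_comm (u t) (b k), sq]
    refine h1.congr fun G => ?_
    exact integral_finsetSum _ fun k _ => (memLp_inner hu (b k)).integrable_sq
  -- The energies never exceed `q`. For a level below `q`, Parseval gives a finite set `G` of
  -- coordinates that reaches it; for large `n` the set `G` lies in `F n` and its time averages
  -- still exceed the level. This treats the two limits jointly.
  have hlim : Tendsto (fun n => ∑ k ∈ F n, gridEnergy hT.le n (fun r => inner ℝ (u r) (b k)))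
      atTop (𝓝 q) := by
    rw [tendsto_order]
    refine ⟨fun a ha => ?_, fun a ha => Eventually.of_forall fun n =>
      (sum_gridEnergy_le hT n (F n) b.orthonormal hu).trans_lt ha⟩
    obtain ⟨G, hG⟩ := (hpars.eventually_const_lt ha).exists
    have h1 : Tendsto (fun n => ∑ k ∈ G, gridEnergy hT.le n (fun r => inner ℝ (u r) (b k))) atTop
        (𝓝 (∑ k ∈ G, ∫ t, inner ℝ (u t) (b k) ^ 2 ∂timeMeasure T)) :=
      tendsto_finsetSum _ fun k _ => tendsto_gridEnergy hT (memLp_inner hu (b k))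
    filter_upwards [h1.eventually_const_lt hG, hF.eventually_ge_atTop G] with n h2 h3
    exact h2.trans_le (Finset.sum_le_sum_of_subset_of_nonneg h3 fun k _ _ =>
      gridEnergy_nonneg hT.le n _)
  have := hlim.const_sub q
  rwa [sub_self] at this

end

/-- Random continuous functions whose values are random variables are random variables. -/
lemma aestronglyMeasurable_continuousMap {Ω : Type*} [MeasurableSpace Ω] {P : Measure Ω}
    {K : Type*} [TopologicalSpace K] [CompactSpace K] [TopologicalSpace.MetrizableSpace K]
    {B : Ω → C(K, ℝ)} (hB : ∀ t, AEMeasurable (fun ω => B ω t) P) : AEStronglyMeasurable B P := by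
  classical
  rcases isEmpty_or_nonempty K with hK | hK
  · have : B = fun _ => 0 := by ext ω t; exact (IsEmpty.false t).elim
    rw [this]
    exact aestronglyMeasurable_const
  letI := TopologicalSpace.metrizableSpaceMetric K
  let q : ℕ → K := TopologicalSpace.denseSeq K
  -- Off the null set `N` the paths agree with measurable versions at all points of a dense
  -- sequence. Replacing the path by zero on `N` makes these evaluations measurable everywhere.
  let N : Set Ω := toMeasurable P {ω | ¬ ∀ i, B ω (q i) = (hB (q i)).mk _ ω}
  have hN : P N = 0 := by
    rw [measure_toMeasurable]
    exact ae_all_iff.2 fun i => (hB (q i)).ae_eq_mk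
  let B' : Ω → C(K, ℝ) := fun ω => if ω ∈ N then 0 else B ω
  have hBB' : B =ᵐ[P] B' := by
    have : ∀ᵐ ω ∂P, ω ∉ N := by rw [ae_iff]; simpa using hN
    filter_upwards [this] with ω hω
    simp [B', hω]
  have hB'm : ∀ i, Measurable fun ω => B' ω (q i) := by
    intro i
    have : (fun ω => B' ω (q i)) = fun ω => if ω ∈ N then 0 else (hB (q i)).mk _ ω := by
      ext ω
      by_cases h : ω ∈ N
      · simp [B', h]
      · have h1 : ω ∉ {ω | ¬ ∀ i, B ω (q i) = (hB (q i)).mk _ ω} := fun h' =>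
          h (subset_toMeasurable _ _ h')
        have h2 : ∀ i, B ω (q i) = (hB (q i)).mk _ ω := by simpa using h1
        simp only [B', if_neg h]
        exact h2 i
    rw [this]
    exact Measurable.ite (measurableSet_toMeasurable _ _) measurable_const (hB (q i)).measurable_mk
  letI : MeasurableSpace C(K, ℝ) := borel _
  have : BorelSpace C(K, ℝ) := ⟨rfl⟩
  have hmeas : Measurable B' := by
    -- The space `C(K, ℝ)` is separable, so its Borel sets are generated by balls, and the distance
    -- to a fixed function is determined by the values along the dense sequence.
    have hbasis : TopologicalSpace.IsTopologicalBasis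
        {U : Set C(K, ℝ) | ∃ f r, U = Metric.ball f r} := by
      refine TopologicalSpace.isTopologicalBasis_of_isOpen_of_nhds ?_ ?_
      · rintro _ ⟨f, r, rfl⟩; exact Metric.isOpen_ball
      · intro f U hf hU
        obtain ⟨r, hr, h⟩ := Metric.isOpen_iff.1 hU f hf
        exact ⟨_, ⟨f, r, rfl⟩, Metric.mem_ball_self hr, h⟩
    have hborel := hbasis.borel_eq_generateFrom
    show @Measurable _ _ _ (borel C(K, ℝ)) B'
    rw [hborel]
    refine measurable_generateFrom ?_
    rintro _ ⟨f, r, rfl⟩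
    have hd : Measurable fun ω => dist (B' ω) f := by
      refine measurable_of_Iic fun c => ?_
      rcases lt_or_ge c 0 with hc | hc
      · convert MeasurableSet.empty
        ext ω
        simp only [Set.mem_preimage, Set.mem_Iic, Set.mem_empty_iff_false, iff_false, not_le]
        exact hc.trans_le dist_nonneg
      · have : (fun ω => dist (B' ω) f) ⁻¹' Set.Iic c = ⋂ i, {ω | |B' ω (q i) - f (q i)| ≤ c} := by
          ext ω
          simp only [Set.mem_preimage, Set.mem_Iic, Set.mem_iInter, Set.mem_ofPred_eq]
          rw [ContinuousMap.dist_le hc]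
          refine ⟨fun h i => h (q i), fun h => ?_⟩
          have hcl : IsClosed {x : K | dist (B' ω x) (f x) ≤ c} :=
            isClosed_le (by fun_prop) continuous_const
          have hsub : closure (Set.range q) ⊆ {x : K | dist (B' ω x) (f x) ≤ c} := by
            refine hcl.closure_subset_iff.2 ?_
            rintro _ ⟨i, rfl⟩
            exact h i
          intro x
          exact hsub (TopologicalSpace.denseRange_denseSeq K x)
        rw [this]
        refine MeasurableSet.iInter fun i => ?_
        exact ((hB'm i).sub_const _).abs measurableSet_Iic
    exact hd measurableSet_Iio
  exact ⟨B', hmeas.stronglyMeasurable, hBB'⟩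

/-! ### Vector-valued integrals: martingale property and maximal inequality. -/

section

variable {Ω : Type*} [mΩ : MeasurableSpace Ω] {P : Measure Ω} [IsProbabilityMeasure P]
  {T : ℝ} {𝓕 : Filtration (TimeInterval T) mΩ}
  {H : Type*} [NormedAddCommGroup H] [InnerProductSpace ℝ H]
  {W : TimeInterval T → H →L[ℝ] Lp ℝ 2 P}
  {E : Type*} [NormedAddCommGroup E] [NormedSpace ℝ E]
  {α : Type*} [Fintype α]

lemma integrable_brownian (t : TimeInterval T) (h : H) : Integrable (W t h) P :=
  (Lp.memLp (W t h)).integrable (by norm_num)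

/-- Capped at `r`, the increment either vanishes or is a Brownian increment after time `u`, hence
centred and independent of `A`. -/
lemma setIntegral_increment_eq_zero (hW : IsCylindricalBrownianMotion P 𝓕 W) (h : H)
    {u u' : TimeInterval T} (huu : u ≤ u') (r : TimeInterval T) {A : Set Ω}
    (hA : MeasurableSet[𝓕 u] A) :
    ∫ ω in A, (W (min r u') h ω - W (min r u) h ω) ∂P = 0 := by
  rcases le_total r u with hr | hr
  · rw [min_eq_left hr, min_eq_left (hr.trans huu)]
    simp
  · rw [min_eq_right hr]
    have hle : u ≤ min r u' := le_min hr huu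
    have hB := hW.brownian h
    set Δ : Ω → ℝ := fun ω => W (min r u') h ω - W u h ω with hΔ
    have hΔi : Integrable Δ P := (integrable_brownian _ _).sub (integrable_brownian _ _)
    have hY : Measurable[𝓕 u] (A.indicator fun _ => (1 : ℝ)) := measurable_const.indicator hA
    have hind : IndepFun Δ (A.indicator fun _ => (1 : ℝ)) P :=
      indep_of_indep_of_le_right (hB.indep u _ hle) hY.comap_le
    have h1 := hind.integral_fun_mul_eq_mul_integral hΔi.aestronglyMeasurable
      (hY.mono (𝓕.le u) le_rfl).aestronglyMeasurable
    have h2 : ∫ ω, Δ ω ∂P = 0 := by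
      have hlaw := hB.gaussian u _ hle
      have h3 := integral_map (μ := P) hlaw.aemeasurable
        (f := fun x : ℝ => x) measurable_id.aestronglyMeasurable
      rw [hlaw.map_eq] at h3
      have h4 := integral_id_gaussianReal (μ := 0)
        (v := ‖h‖₊ ^ 2 * Real.toNNReal (((min r u' : TimeInterval T) : ℝ) - (u : ℝ)))
      rw [h4] at h3
      exact h3.symm
    rw [← integral_indicator (𝓕.le u A hA)]
    have e : A.indicator Δ = fun ω => Δ ω * A.indicator (fun _ => (1 : ℝ)) ω := by
      ext ω
      by_cases hω : ω ∈ A <;> simp [hω]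
    rw [e, h1, h2, zero_mul]

/-- The `E`-valued integral of a deterministic step function. -/
noncomputable def vecIntegral (W : TimeInterval T → H →L[ℝ] Lp ℝ 2 P) (τ : α → StepTerm 𝓕 H)
    (x : α → E) (t : TimeInterval T) (ω : Ω) : E :=
  ∑ i, (W (min (τ i).t t) (τ i).h ω - W (min (τ i).s t) (τ i).h ω) • x i

lemma integrable_vecIntegral (τ : α → StepTerm 𝓕 H) (x : α → E) (t : TimeInterval T) :
    Integrable (vecIntegral W τ x t) P :=
  integrable_finsetSum _ fun i _ =>
    ((integrable_brownian _ _).sub (integrable_brownian _ _)).smul_const _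

lemma setIntegral_vecIntegral_eq [CompleteSpace E] (hW : IsCylindricalBrownianMotion P 𝓕 W)
    (τ : α → StepTerm 𝓕 H) (x : α → E) {u u' : TimeInterval T} (huu : u ≤ u') {A : Set Ω}
    (hA : MeasurableSet[𝓕 u] A) :
    ∫ ω in A, vecIntegral W τ x u ω ∂P = ∫ ω in A, vecIntegral W τ x u' ω ∂P := by
  have hint : ∀ (r s : TimeInterval T) (h : H), Integrable (fun ω => W r h ω - W s h ω)
      (P.restrict A) := fun r s h =>
    ((integrable_brownian _ _).sub (integrable_brownian _ _)).restrict
  unfold vecIntegral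
  rw [integral_finsetSum _ fun _ _ => (hint _ _ _).smul_const _,
    integral_finsetSum _ fun _ _ => (hint _ _ _).smul_const _]
  refine Finset.sum_congr rfl fun i _ => ?_
  rw [integral_smul_const, integral_smul_const]
  congr 1
  have h1 := setIntegral_increment_eq_zero hW (τ i).h huu (τ i).t hA
  have h2 := setIntegral_increment_eq_zero hW (τ i).h huu (τ i).s hA
  rw [integral_sub (integrable_brownian _ _).restrict (integrable_brownian _ _).restrict] at h1 h2
  rw [integral_sub (integrable_brownian _ _).restrict (integrable_brownian _ _).restrict,
    integral_sub (integrable_brownian _ _).restrict (integrable_brownian _ _).restrict]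
  linarith

lemma aestronglyMeasurable_vecIntegral (hW : IsCylindricalBrownianMotion P 𝓕 W)
    (τ : α → StepTerm 𝓕 H) (x : α → E) (t : TimeInterval T) :
    AEStronglyMeasurable[𝓕 t] (vecIntegral W τ x t) P := by
  have h : ∀ (r : TimeInterval T) (h : H), AEStronglyMeasurable[𝓕 t] (W (min r t) h) P :=
    fun r h => ((hW.brownian h).adapted (min r t)).mono (𝓕.mono (min_le_right r t))
  refine ⟨fun ω => ∑ i, ((h (τ i).t (τ i).h).mk _ ω - (h (τ i).s (τ i).h).mk _ ω) • x i,
    Finset.stronglyMeasurable_fun_sum _ fun i _ =>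
      ((h _ _).stronglyMeasurable_mk.sub (h _ _).stronglyMeasurable_mk).smul_const _, ?_⟩
  filter_upwards [ae_all_iff.2 fun i => (h (τ i).t (τ i).h).ae_eq_mk,
    ae_all_iff.2 fun i => (h (τ i).s (τ i).h).ae_eq_mk] with ω h1 h2
  simp only [vecIntegral, h1, h2]

/-- A maximal inequality for integrals of deterministic step functions. -/
lemma mul_measure_lt_norm_le [CompleteSpace E] (hW : IsCylindricalBrownianMotion P 𝓕 W)
    (hT : 0 ≤ T) (τ : α → StepTerm 𝓕 H) (x : α → E) {Z : Ω → C(TimeInterval T, E)}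
    (hZ : ∀ t, (fun ω => Z ω t) =ᵐ[P] vecIntegral W τ x t) (c : ℝ≥0) :
    c * P {ω | (c : ℝ) < ‖Z ω‖} ≤ ∫⁻ ω, ‖vecIntegral W τ x ⟨T, hT, le_rfl⟩ ω‖ₑ ∂P := by
  classical
  have : Nonempty (TimeInterval T) := ⟨⟨T, hT, le_rfl⟩⟩
  -- By continuity the supremum over all times is one over a dense sequence, and the events
  -- involving its first points increase to the full one. For each of them Doob's inequality is
  -- applied to the norms of the martingale on a finite grid ending at `T`.
  let q : ℕ → TimeInterval T := TopologicalSpace.denseSeq (TimeInterval T)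
  let A : ℕ → Set Ω := fun J => {ω | ∃ i ≤ J, (c : ℝ) < ‖Z ω (q i)‖}
  have hAm : Monotone A := fun J J' hJ ω hω => by
    obtain ⟨i, hi, h⟩ := hω
    exact ⟨i, hi.trans hJ, h⟩
  have hU : {ω | (c : ℝ) < ‖Z ω‖} ⊆ ⋃ J, A J := by
    intro ω hω
    by_contra hcon
    simp only [Set.mem_iUnion, not_exists, A, Set.mem_ofPred_eq, not_and, not_lt] at hcon
    have h1 : ‖Z ω‖ ≤ c := by
      refine (ContinuousMap.norm_le _ c.coe_nonneg).2 ?_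
      have hcl : IsClosed {t : TimeInterval T | ‖Z ω t‖ ≤ c} :=
        isClosed_le (by fun_prop) continuous_const
      have hsub : closure (Set.range q) ⊆ {t | ‖Z ω t‖ ≤ c} := by
        refine hcl.closure_subset_iff.2 ?_
        rintro _ ⟨i, rfl⟩
        exact hcon i i le_rfl
      exact fun t => hsub (TopologicalSpace.denseRange_denseSeq _ t)
    exact absurd hω (not_lt.2 h1)
  refine (mul_le_mul_right (measure_mono hU) _).trans ?_
  rw [hAm.measure_iUnion, ENNReal.mul_iSup]
  refine iSup_le fun J => ?_
  -- a finite grid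
  obtain ⟨m, u, hu, -, hG⟩ := exists_monotone_grid (⟨0, le_rfl, hT⟩ : TimeInterval T)
    (fun x => x.2.1) (insert ⟨T, hT, le_rfl⟩ ((Finset.range (J + 1)).image q))
  have hum : u m = ⟨T, hT, le_rfl⟩ := by
    obtain ⟨j, hj, h⟩ := hG ⟨T, hT, le_rfl⟩ (by simp)
    refine le_antisymm (u m).2.2 ?_
    rw [← h]
    exact hu hj
  let 𝒢 : Filtration ℕ mΩ := ⟨fun j => 𝓕 (u j), fun i j hij => 𝓕.mono (hu hij), fun j => 𝓕.le _⟩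
  let M : ℕ → Ω → E := fun j => (aestronglyMeasurable_vecIntegral hW τ x (u j)).mk _
  have hM : ∀ j, vecIntegral W τ x (u j) =ᵐ[P] M j := fun j =>
    (aestronglyMeasurable_vecIntegral hW τ x (u j)).ae_eq_mk
  have hMm : ∀ j, StronglyMeasurable[𝓕 (u j)] (M j) := fun j =>
    (aestronglyMeasurable_vecIntegral hW τ x (u j)).stronglyMeasurable_mk
  have hMi : ∀ j, Integrable (M j) P := fun j => (integrable_vecIntegral τ x (u j)).congr (hM j)
  have hsub : Submartingale (fun j ω => ‖M j ω‖) 𝒢 P := by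
    refine ⟨fun j => (hMm j).norm, fun i j hij => ?_, fun j => (hMi j).norm⟩
    have h1 : M i =ᵐ[P] P[M j | 𝓕 (u i)] := by
      refine ae_eq_condExp_of_forall_setIntegral_eq (𝓕.le (u i)) (hMi j)
        (fun s _ _ => (hMi i).integrableOn) (fun s hs _ => ?_)
        (hMm i).aestronglyMeasurable
      rw [← setIntegral_congr_ae (𝓕.le _ s hs) ((hM i).mono fun ω h _ => h),
        ← setIntegral_congr_ae (𝓕.le _ s hs) ((hM j).mono fun ω h _ => h)]
      exact setIntegral_vecIntegral_eq hW τ x (hu hij) hs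
    filter_upwards [h1, norm_condExp_le (μ := P) (m := 𝓕 (u i)) (M j)] with ω h2 h3
    rw [h2]
    exact h3
  have hmax := maximal_ineq hsub (fun j ω => norm_nonneg _) (ε := c) m
  calc c * P (A J) ≤ c * P {ω | (c : ℝ) ≤ (Finset.range (m + 1)).sup' Finset.nonempty_range_add_one
        fun k => ‖M k ω‖} := by
        refine mul_le_mul_right (measure_mono_ae ?_) _
        filter_upwards [ae_all_iff.2 hM, ae_all_iff.2 fun j => hZ (u j)] with ω h1 h2 hω
        obtain ⟨i, hi, hlt⟩ := hω
        obtain ⟨j, hj, hji⟩ := hG (q i) (Finset.mem_insert_of_mem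
          (Finset.mem_image_of_mem q (Finset.mem_range.2 (by omega))))
        show (c : ℝ) ≤ _
        refine hlt.le.trans (le_trans (le_of_eq ?_) (Finset.le_sup' (fun k => ‖M k ω‖)
          (Finset.mem_range.2 (Nat.lt_succ_of_le hj))))
        rw [← hji, h2, h1]
    _ ≤ _ := hmax
    _ ≤ ENNReal.ofReal (∫ ω, ‖M m ω‖ ∂P) :=
        ENNReal.ofReal_le_ofReal (setIntegral_le_integral (hMi m).norm
          (ae_of_all _ fun ω => norm_nonneg _))
    _ = ∫⁻ ω, ‖vecIntegral W τ x ⟨T, hT, le_rfl⟩ ω‖ₑ ∂P := by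
        rw [ofReal_integral_norm_eq_lintegral_enorm (hMi m)]
        refine lintegral_congr_ae ?_
        filter_upwards [hM m] with ω h
        rw [← h, hum]

/-- Integrals of deterministic step functions have continuous versions. -/
lemma exists_continuous_vecIntegral (hW : IsCylindricalBrownianMotion P 𝓕 W)
    (τ : α → StepTerm 𝓕 H) (x : α → E) :
    ∃ Z : Ω → C(TimeInterval T, E), AEStronglyMeasurable Z P ∧
      ∀ t, (fun ω => Z ω t) =ᵐ[P] vecIntegral W τ x t := by
  choose B hB using fun h => (hW.brownian h).continuous
  have hBm : ∀ h, AEStronglyMeasurable (B h) P := fun h =>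
    aestronglyMeasurable_continuousMap fun t =>
      (Lp.aestronglyMeasurable (W t h)).aemeasurable.congr (hB h t).symm
  let L : TimeInterval T → E → C(TimeInterval T, ℝ) → C(TimeInterval T, E) := fun r y f =>
    ⟨fun t => f (min r t) • y, by fun_prop⟩
  have hL : ∀ r y, Continuous (L r y) := by
    intro r y
    have hlip : LipschitzWith ‖y‖₊ (L r y) := by
      refine LipschitzWith.of_dist_le_mul fun f g => ?_
      rw [ContinuousMap.dist_le (by positivity)]
      intro t
      show dist (f (min r t) • y) (g (min r t) • y) ≤ _
      rw [dist_eq_norm, ← sub_smul, norm_smul, mul_comm, ← dist_eq_norm, coe_nnnorm]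
      exact mul_le_mul_of_nonneg_left (ContinuousMap.dist_apply_le_dist _) (norm_nonneg _)
    exact hlip.continuous
  refine ⟨fun ω => ∑ i, (L (τ i).t (x i) (B (τ i).h ω) - L (τ i).s (x i) (B (τ i).h ω)), ?_, ?_⟩
  · exact Finset.aestronglyMeasurable_fun_sum _ fun i _ =>
      ((hL _ _).comp_aestronglyMeasurable (hBm _)).sub
        ((hL _ _).comp_aestronglyMeasurable (hBm _))
  · intro t
    have h1 := ae_all_iff.2 fun i => hB (τ i).h (min (τ i).t t)
    have h2 := ae_all_iff.2 fun i => hB (τ i).h (min (τ i).s t)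
    filter_upwards [h1, h2] with ω h1 h2
    simp only [vecIntegral, ContinuousMap.coe_sum, Finset.sum_apply, ContinuousMap.coe_sub,
      Pi.sub_apply]
    refine Finset.sum_congr rfl fun i _ => ?_
    rw [← h1, ← h2, sub_smul]
    rfl

end

/-! ### Second moments of deterministic vector-valued integrals. -/

section

variable {S : Type*} [MeasurableSpace S] {μ : Measure S}
  {E : Type*} [NormedAddCommGroup E] [NormedSpace ℝ E] {ι : E →ₗ[ℝ] (S →ₘ[μ] ℝ)}
  {Ω : Type*} [mΩ : MeasurableSpace Ω] {P : Measure Ω} [IsProbabilityMeasure P]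
  {T : ℝ} {𝓕 : Filtration (TimeInterval T) mΩ}
  {H : Type*} [NormedAddCommGroup H] [InnerProductSpace ℝ H]
  {W : TimeInterval T → H →L[ℝ] Lp ℝ 2 P}
  {α : Type*} [Fintype α]

/-- The `H`-valued step function with coefficients `a`. -/
noncomputable def coefStep (τ : α → StepTerm 𝓕 H) (a : α → ℝ) (r : TimeInterval T) : H :=
  ∑ i, (Set.Ioc (τ i).s (τ i).t).indicator (fun _ => a i • (τ i).h) r

lemma stronglyMeasurable_coefStep (τ : α → StepTerm 𝓕 H) :
    StronglyMeasurable fun p : TimeInterval T × (α → ℝ) => coefStep τ p.2 p.1 := by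
  refine Finset.stronglyMeasurable_fun_sum _ fun i _ => ?_
  have h1 : StronglyMeasurable fun p : TimeInterval T × (α → ℝ) => p.2 i • (τ i).h :=
    (((measurable_pi_apply i).comp measurable_snd).stronglyMeasurable).smul_const _
  have h2 := h1.indicator (s := Prod.fst ⁻¹' Set.Ioc (τ i).s (τ i).t)
    (measurable_fst measurableSet_Ioc)
  exact h2

/-- The second moment of the `E`-valued integral of a deterministic step function is controlled
by its square function. -/
lemma lintegral_vecIntegral_sq_le (hι : IsFunctionSpace μ ι) {R : ℕ} {C κ : ℝ}
    (hC : 0 < C) (hQ : HasLowerEstimate ι (2 * R) C) (hR : 1 ≤ R) (hκ : 1 ≤ κ)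
    (hκv : ∀ (v : ℝ≥0) (l : ℕ),
      2 * (8 ^ l) ^ (2 * R) * (gaussianReal 0 v).real {z | κ * 2 ^ l * √v < |z|} ≤ 1)
    (hW : IsCylindricalBrownianMotion P 𝓕 W) (hT : 0 ≤ T) (τ : α → StepTerm 𝓕 H)
    (hτ : ∀ i, (τ i).B = Set.univ) (x : α → E) {y : E}
    (hy : ∀ᵐ s ∂μ, ∫ r, ‖coefStep τ (fun i => ι (x i) s) r‖ ^ 2 ∂timeMeasure T ≤ ι y s ^ 2) :
    ∫⁻ ω, ‖vecIntegral W τ x ⟨T, hT, le_rfl⟩ ω‖ₑ ^ 2 ∂P ≤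
      (ENNReal.ofReal (κ * (2 + 12 * C)) * ‖y‖ₑ) ^ 2 := by
  let va : (α → ℝ) → ℝ := fun a => ∫ r, ‖coefStep τ a r‖ ^ 2 ∂timeMeasure T
  have hva0 : ∀ a, 0 ≤ va a := fun a => integral_nonneg fun r => sq_nonneg _
  have hvam : StronglyMeasurable va :=
    StronglyMeasurable.integral_prod_left' (f := fun p : TimeInterval T × (α → ℝ) =>
      ‖coefStep τ p.2 p.1‖ ^ 2) ((stronglyMeasurable_coefStep τ).norm.pow 2)
  have hxm : AEMeasurable (fun s i => ι (x i) s) μ :=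
    aemeasurable_pi_lambda _ fun i => (IsFunctionSpace.aestronglyMeasurable_coe ι (x i)).aemeasurable
  -- The Gaussian estimate needs the variance exactly, so the square function of the step function
  -- is itself realised as an element `g` below `y`.
  obtain ⟨g, hg, hgy⟩ := hι.exists_of_abs_le (y := y)
    (f := fun s => √(va fun i => ι (x i) s))
    (Real.continuous_sqrt.comp_aestronglyMeasurable
      (hvam.measurable.comp_aemeasurable hxm).aestronglyMeasurable) (by
      filter_upwards [hy] with s hs
      rw [abs_of_nonneg (Real.sqrt_nonneg _), ← Real.sqrt_sq_eq_abs]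
      exact Real.sqrt_le_sqrt hs)
  let top : TimeInterval T := ⟨T, hT, le_rfl⟩
  have hγ0 : ∀ i, AEStronglyMeasurable
      (fun ω => W (min (τ i).t top) (τ i).h ω - W (min (τ i).s top) (τ i).h ω) P := fun i =>
    (Lp.aestronglyMeasurable _).sub (Lp.aestronglyMeasurable _)
  let γ : Ω → α → ℝ := fun ω i => (hγ0 i).mk _ ω
  have hγ : Measurable γ := measurable_pi_lambda _ fun i =>
    (hγ0 i).stronglyMeasurable_mk.measurable
  have hγe : ∀ᵐ ω ∂P, ∀ i,
      W (min (τ i).t top) (τ i).h ω - W (min (τ i).s top) (τ i).h ω = γ ω i :=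
    ae_all_iff.2 fun i => (hγ0 i).ae_eq_mk
  have hlaw : ∀ a : α → ℝ, HasLaw (fun ω => ∑ i, γ ω i * a i)
      (gaussianReal 0 (va a).toNNReal) P := by
    intro a
    have hD : ∀ r ω, stepValue (fun i => (τ i).smul (a i)) (r, ω) = coefStep τ a r := by
      intro r ω
      refine Finset.sum_congr rfl fun i _ => ?_
      by_cases hr : r ∈ Set.Ioc (τ i).s (τ i).t
      · rw [Set.indicator_of_mem hr, Set.indicator_of_mem]
        · rfl
        · exact ⟨hr, by rw [show ((τ i).smul (a i)).B = (τ i).B from rfl, hτ]; exact Set.mem_univ _⟩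
      · rw [Set.indicator_of_notMem hr, Set.indicator_of_notMem]
        exact fun h => hr h.1
    have h1 := hasLaw_stepIntegral_of_const hW hT (fun i => (τ i).smul (a i)) hD
    refine h1.congr ?_
    have hs : ∀ (r : TimeInterval T) i, ∀ᵐ ω ∂P, W r (a i • (τ i).h) ω = a i * W r (τ i).h ω :=
      fun r i => by
        rw [map_smul]
        exact Lp.coeFn_smul _ _
    filter_upwards [hγe, ae_all_iff.2 fun i => hs (min (τ i).t top) i,
      ae_all_iff.2 fun i => hs (min (τ i).s top) i] with ω h2 h3 h4
    refine Finset.sum_congr rfl fun i _ => ?_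
    rw [Set.indicator_of_mem]
    · show γ ω i * a i = W (min (τ i).t top) (a i • (τ i).h) ω -
        W (min (τ i).s top) (a i • (τ i).h) ω
      rw [h3, h4, ← h2]; ring
    · rw [show ((τ i).smul (a i)).B = (τ i).B from rfl, hτ]; exact Set.mem_univ _
  have key := hι.lintegral_gaussian_sum_le hC hQ hR hκ hκv hγ hlaw (x := x) (g := g) (by
    filter_upwards [hg] with s hs
    rw [hs, Real.sq_sqrt (hva0 _), Real.coe_toNNReal _ (hva0 _)])
  have e : ∫⁻ ω, ‖vecIntegral W τ x ⟨T, hT, le_rfl⟩ ω‖ₑ ^ 2 ∂P =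
      ∫⁻ ω, ‖∑ k, γ ω k • x k‖ₑ ^ 2 ∂P := by
    refine lintegral_congr_ae ?_
    filter_upwards [hγe] with ω h
    simp only [vecIntegral, ← h]
    rfl
  rw [e]
  refine key.trans (pow_le_pow_left₀ zero_le ?_ 2)
  refine mul_le_mul_right ?_ _
  rw [enorm_le_iff_norm_le]
  exact hgy

end

/-! ### Deterministic elementary processes on the uniform grid. -/

section

variable {E : Type*} [NormedAddCommGroup E] [NormedSpace ℝ E]
  {Ω : Type*} [mΩ : MeasurableSpace Ω] {P : Measure Ω}
  {T : ℝ} 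
  {H : Type*} [NormedAddCommGroup H] [InnerProductSpace ℝ H]
  {κ : Type*}

lemma strictMono_gridPoint (hT : 0 < T) (n : ℕ) :
    StrictMono fun i : Fin (n + 2) => gridPoint hT.le n i := by
  intro i j hij
  show (gridPoint hT.le n i : ℝ) < gridPoint hT.le n j
  rw [coe_gridPoint hT.le (Nat.lt_succ_iff.1 i.2), coe_gridPoint hT.le (Nat.lt_succ_iff.1 j.2)]
  have h1 : (i : ℝ) < j := by exact_mod_cast hij
  have : 0 < T / (n + 1) := by positivity
  exact mul_lt_mul_of_pos_right h1 this

/-- A deterministic elementary process on the uniform grid. -/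
noncomputable def gridElementary (𝓕 : Filtration (TimeInterval T) mΩ) (hT : 0 < T) (n : ℕ)
    (F : Finset κ) {b : κ → H} (hb : Orthonormal ℝ b) (x : κ → ℕ → E) : ElementaryAdapted 𝓕 H E where
  N := n + 1
  M := 1
  K := F.card
  t := fun i => gridPoint hT.le n i
  strictMono_t := strictMono_gridPoint hT n
  A := fun _ _ => Set.univ
  measurableSet_A := fun _ _ => MeasurableSet.univ
  disjoint_A := fun _ i j hij => absurd (Subsingleton.elim i j) hij
  h := fun k => b (F.equivFin.symm k)
  orthonormal_h := hb.comp _ (Subtype.val_injective.comp F.equivFin.symm.injective)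
  x := fun k _ i => x (F.equivFin.symm k) i

/-- The terms of a deterministic elementary process on the uniform grid. -/
noncomputable def gridVecTerms (𝓕 : Filtration (TimeInterval T) mΩ) (hT : 0 ≤ T) (n : ℕ)
    (F : Finset κ) (b : κ → H) (p : Fin (n + 1) × F) : StepTerm 𝓕 H where
  s := gridPoint hT n p.1
  t := gridPoint hT n (p.1 + 1)
  le := monotone_gridPoint hT n (Nat.le_succ p.1)
  B := Set.univ
  measurableSet_B := MeasurableSet.univ
  h := b p.2

lemma integral_gridElementary (𝓕 : Filtration (TimeInterval T) mΩ) (hT : 0 < T) (n : ℕ)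
    (F : Finset κ) {b : κ → H} (hb : Orthonormal ℝ b) (x : κ → ℕ → E)
    (W : TimeInterval T → H →L[ℝ] Lp ℝ 2 P) (t : TimeInterval T) (ω : Ω) :
    (gridElementary 𝓕 hT n F hb x).integral W t ω =
      vecIntegral W (gridVecTerms 𝓕 hT.le n F b) (fun p => x p.2 p.1) t ω := by
  rw [vecIntegral, Fintype.sum_prod_type, ElementaryAdapted.integral]
  refine Finset.sum_congr rfl fun i _ => ?_
  rw [← Equiv.sum_comp F.equivFin.symm]
  refine (Fin.sum_univ_one _).trans ?_
  rw [Set.indicator_of_mem (by exact Set.mem_univ _)]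
  rfl

lemma process_gridElementary (𝓕 : Filtration (TimeInterval T) mΩ) (hT : 0 < T) (n : ℕ)
    (F : Finset κ) {b : κ → H} (hb : Orthonormal ℝ b) (x : κ → ℕ → E)
    (t : TimeInterval T) (ω : Ω) (h : H) :
    (gridElementary 𝓕 hT n F hb x).process (t, ω) h =
      ∑ i ∈ Finset.range (n + 1), (gridCell hT.le n i).indicator (fun _ => (1 : ℝ)) t •
        ∑ k ∈ F, inner ℝ (b k) h • x k i := by
  rw [← Fin.sum_univ_eq_sum_range (fun i => (gridCell hT.le n i).indicator (fun _ => (1 : ℝ)) t •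
    ∑ k ∈ F, inner ℝ (b k) h • x k i), ElementaryAdapted.process, FunLike.coe_sum,
    Finset.sum_apply]
  refine Finset.sum_congr rfl fun i _ => ?_
  rw [show (∑ m : Fin (gridElementary 𝓕 hT n F hb x).M,
    (Set.Ioc ((gridElementary 𝓕 hT n F hb x).t i.castSucc) ((gridElementary 𝓕 hT n F hb x).t i.succ)
      ×ˢ (gridElementary 𝓕 hT n F hb x).A m i).indicator (fun _ =>
      ∑ k : Fin (gridElementary 𝓕 hT n F hb x).K,
        (innerSL ℝ ((gridElementary 𝓕 hT n F hb x).h k)).smulRight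
          ((gridElementary 𝓕 hT n F hb x).x k m i)) (t, ω)) =
    (gridCell hT.le n i ×ˢ (Set.univ : Set Ω)).indicator (fun _ => ∑ k : Fin F.card,
      (innerSL ℝ (b (F.equivFin.symm k))).smulRight (x (F.equivFin.symm k) i)) (t, ω) from
    Fin.sum_univ_one _]
  by_cases ht : t ∈ gridCell hT.le n i
  · rw [Set.indicator_of_mem ht, Set.indicator_of_mem (by exact ⟨ht, Set.mem_univ _⟩), one_smul,
      ← Finset.sum_coe_sort F, ← Equiv.sum_comp F.equivFin.symm, FunLike.coe_sum, Finset.sum_apply]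
    rfl
  · rw [Set.indicator_of_notMem ht, Set.indicator_of_notMem (by exact fun h' => ht h'.1), zero_smul]
    rfl

/-- The square function of a grid process whose coefficients represent averages. -/
lemma coefStep_gridVecTerms (𝓕 : Filtration (TimeInterval T) mΩ) (hT : 0 ≤ T) (n : ℕ)
    (F : Finset κ) (b : κ → H) (u : TimeInterval T → H) {a : Fin (n + 1) × F → ℝ}
    (ha : ∀ p : Fin (n + 1) × F, a p = (n + 1) / T *
      ∫ r in gridCell hT n p.1, inner ℝ (u r) (b p.2) ∂timeMeasure T) (t : TimeInterval T) :
    coefStep (gridVecTerms 𝓕 hT n F b) a t = gridProjection hT n F b u t := by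
  rw [coefStep, Fintype.sum_prod_type_right, gridProjection, ← Finset.sum_coe_sort F]
  refine Finset.sum_congr rfl fun k _ => ?_
  rw [gridAverage, ← Fin.sum_univ_eq_sum_range (fun i => (gridCell hT n i).indicator
    (fun _ => (n + 1) / T * ∫ r in gridCell hT n i, inner ℝ (u r) (b k) ∂timeMeasure T) t),
    Finset.sum_smul]
  refine Finset.sum_congr rfl fun i _ => ?_
  show (gridCell hT n i).indicator (fun _ => a (i, k) • b k) t = _
  by_cases ht : t ∈ gridCell hT n i
  · rw [Set.indicator_of_mem ht, Set.indicator_of_mem ht, ha]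
  · rw [Set.indicator_of_notMem ht, Set.indicator_of_notMem ht, zero_smul]

end

/-! ### Approximation of kernels by kernels of step functions. -/

section

variable {S : Type*} [MeasurableSpace S] {μ : Measure S}
  {T : ℝ} {H : Type*} [NormedAddCommGroup H] [InnerProductSpace ℝ H]
  {κ : Type*} {φ : TimeInterval T × S → H}

lemma stronglyMeasurable_setIntegral_inner (hφ : StronglyMeasurable φ) (A : Set (TimeInterval T))
    (h : H) : StronglyMeasurable fun s => ∫ r in A, inner ℝ (φ (r, s)) h ∂timeMeasure T :=
  StronglyMeasurable.integral_prod_left' (f := fun p : TimeInterval T × S => inner ℝ (φ p) h)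
    (hφ.inner stronglyMeasurable_const)

lemma stronglyMeasurable_gridProjection (hφ : StronglyMeasurable φ) (hT : 0 ≤ T) (n : ℕ)
    (F : Finset κ) (b : κ → H) :
    StronglyMeasurable fun p : TimeInterval T × S =>
      gridProjection hT n F b (fun r => φ (r, p.2)) p.1 := by
  refine Finset.stronglyMeasurable_fun_sum _ fun k _ => StronglyMeasurable.smul_const ?_ _
  refine Finset.stronglyMeasurable_fun_sum _ fun i _ => ?_
  have h1 : StronglyMeasurable fun p : TimeInterval T × S => (n + 1) / T *
      ∫ r in gridCell hT n i, inner ℝ (φ (r, p.2)) (b k) ∂timeMeasure T :=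
    ((stronglyMeasurable_setIntegral_inner hφ (gridCell hT n i) (b k)).comp_measurable
      measurable_snd).const_mul _
  exact h1.indicator (s := Prod.fst ⁻¹' gridCell hT n i)
    (measurable_fst (measurableSet_gridCell hT n i))

variable {E : Type*} [NormedAddCommGroup E] [NormedSpace ℝ E] {ι : E →ₗ[ℝ] (S →ₘ[μ] ℝ)}

lemma ae_memLp_of_lintegral_eq (hφ : StronglyMeasurable φ) {g : E}
    (hg : ∀ᵐ s ∂μ, ∫⁻ t, ‖φ (t, s)‖ₑ ^ 2 ∂timeMeasure T = ‖ι g s‖ₑ ^ 2) :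
    ∀ᵐ s ∂μ, MemLp (fun t => φ (t, s)) 2 (timeMeasure T) ∧
      ∫ t, ‖φ (t, s)‖ ^ 2 ∂timeMeasure T = ι g s ^ 2 := by
  filter_upwards [hg] with s hs
  have hm : StronglyMeasurable fun t => φ (t, s) := hφ.comp_measurable measurable_prodMk_right
  have h1 : MemLp (fun t => φ (t, s)) 2 (timeMeasure T) := by
    refine ⟨hm.aestronglyMeasurable, ?_⟩
    rw [eLpNorm_lt_top_iff_lintegral_rpow_enorm_lt_top (by norm_num) (by norm_num)]
    simp only [ENNReal.toReal_ofNat, ENNReal.rpow_ofNat, hs]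
    exact ENNReal.pow_lt_top enorm_lt_top
  refine ⟨h1, ?_⟩
  rw [integral_eq_lintegral_of_nonneg_ae (ae_of_all _ fun t => sq_nonneg _)
    (hm.norm.pow 2).aestronglyMeasurable]
  have e : ∀ t, ENNReal.ofReal (‖φ (t, s)‖ ^ 2) = ‖φ (t, s)‖ₑ ^ 2 := fun t => by
    rw [ENNReal.ofReal_pow (norm_nonneg _), ofReal_norm]
  simp only [e, hs]
  rw [ENNReal.toReal_pow, toReal_enorm, Real.norm_eq_abs, sq_abs]

/-- Approximation of the kernel of an operator valued function by kernels of step functions. -/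
lemma exists_grid_approximation [CompleteSpace E] [Countable κ] (hι : IsFunctionSpace μ ι)
    {Q : ℕ} {C : ℝ} (hQ : HasLowerEstimate ι Q C) (hT : 0 < T) (b : HilbertBasis κ ℝ H)
    {F : ℕ → Finset κ} (hF : Tendsto F atTop atTop) (hφ : StronglyMeasurable φ) {g : E}
    (hg : ∀ᵐ s ∂μ, ∫⁻ t, ‖φ (t, s)‖ₑ ^ 2 ∂timeMeasure T = ‖ι g s‖ₑ ^ 2) :
    ∃ (x : ℕ → κ → ℕ → E) (y : ℕ → E),
      (∀ n k i, i < n + 1 → ∀ᵐ s ∂μ, ι (x n k i) s =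
        (n + 1) / T * ∫ r in gridCell hT.le n i, inner ℝ (φ (r, s)) (b k) ∂timeMeasure T) ∧
      (∀ n, ∀ᵐ s ∂μ, ι (y n) s ^ 2 = ∫ t, ‖φ (t, s) -
        gridProjection hT.le n (F n) b (fun r => φ (r, s)) t‖ ^ 2 ∂timeMeasure T) ∧
      Tendsto y atTop (𝓝 0) := by
  have hL := ae_memLp_of_lintegral_eq hφ hg
  have hx : ∀ (n : ℕ) (k : κ) (i : ℕ), ∃ x : E, i < n + 1 → ∀ᵐ s ∂μ, ι x s =
      (n + 1) / T * ∫ r in gridCell hT.le n i, inner ℝ (φ (r, s)) (b k) ∂timeMeasure T := by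
    intro n k i
    by_cases hi : i < n + 1
    swap
    · exact ⟨0, fun h => absurd h hi⟩
    have h0 : 0 < ((n : ℝ) + 1) / T := by positivity
    -- The energy of a single coordinate is at most `ι g s ^ 2`, so `(n + 1) / T` times the squared
    -- integral over one cell is too. The coefficient is therefore at most `√((n + 1) / T) * |ι g
    -- s|`, which places it in the ideal.
    obtain ⟨x, hx, -⟩ := hι.exists_of_abs_le_const_mul (c := √((n + 1) / T)) (y := g)
      (Real.sqrt_nonneg _)
      ((stronglyMeasurable_setIntegral_inner hφ (gridCell hT.le n i) (b k)).const_mul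
        ((n + 1) / T)).aestronglyMeasurable (by
        filter_upwards [hL] with s ⟨h1, h2⟩
        have h3 := sum_gridEnergy_le hT n {k} b.orthonormal h1
        rw [Finset.sum_singleton, h2] at h3
        have h4 : (n + 1) / T * (∫ r in gridCell hT.le n i, inner ℝ (φ (r, s)) (b k)
            ∂timeMeasure T) ^ 2 ≤ ι g s ^ 2 :=
          le_trans (Finset.single_le_sum (f := fun i => (n + 1) / T * (∫ r in gridCell hT.le n i,
            inner ℝ (φ (r, s)) (b k) ∂timeMeasure T) ^ 2) (fun i _ => by positivity)
            (Finset.mem_range.2 hi)) h3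
        refine abs_le_of_sq_le_sq' ?_ (by positivity) |> abs_le.2
        rw [mul_pow, mul_pow, Real.sq_sqrt h0.le, sq_abs, sq, mul_assoc]
        exact mul_le_mul_of_nonneg_left h4 h0.le)
    exact ⟨x, fun _ => hx⟩
  choose x hx using hx
  have hres : ∀ n, ∀ᵐ s ∂μ, ∫ t, ‖φ (t, s) -
      gridProjection hT.le n (F n) b (fun r => φ (r, s)) t‖ ^ 2 ∂timeMeasure T ≤ ι g s ^ 2 := by
    intro n
    filter_upwards [hL] with s ⟨h1, h2⟩
    rw [integral_norm_sub_gridProjection_sq hT n _ b.orthonormal h1, h2]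
    exact sub_le_self _ (Finset.sum_nonneg fun k _ => gridEnergy_nonneg _ _ _)
  have hres0 : ∀ n s, 0 ≤ ∫ t, ‖φ (t, s) -
      gridProjection hT.le n (F n) b (fun r => φ (r, s)) t‖ ^ 2 ∂timeMeasure T := fun n s =>
    integral_nonneg fun t => sq_nonneg _
  have hle : ∀ n, ∀ᵐ s ∂μ, |√(∫ t, ‖φ (t, s) -
      gridProjection hT.le n (F n) b (fun r => φ (r, s)) t‖ ^ 2 ∂timeMeasure T)| ≤ |ι g s| := by
    intro n
    filter_upwards [hres n] with s hs
    rw [abs_of_nonneg (Real.sqrt_nonneg _), ← Real.sqrt_sq_eq_abs]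
    exact Real.sqrt_le_sqrt hs
  have hy : ∀ n, ∃ y : E, ∀ᵐ s ∂μ, ι y s = √(∫ t, ‖φ (t, s) -
      gridProjection hT.le n (F n) b (fun r => φ (r, s)) t‖ ^ 2 ∂timeMeasure T) := by
    intro n
    obtain ⟨y, hy, -⟩ := hι.exists_of_abs_le (y := g) (Real.continuous_sqrt.comp_stronglyMeasurable
      (StronglyMeasurable.integral_prod_left' (μ := timeMeasure T)
        (f := fun p : TimeInterval T × S => ‖φ p -
          gridProjection hT.le n (F n) b (fun r => φ (r, p.2)) p.1‖ ^ 2)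
        ((hφ.sub (stronglyMeasurable_gridProjection hφ hT.le n (F n) b)).norm.pow
          2))).aestronglyMeasurable (hle n)
    exact ⟨y, hy⟩
  choose y hy using hy
  refine ⟨x, y, hx, fun n => ?_, ?_⟩
  · filter_upwards [hy n] with s hs
    rw [hs, Real.sq_sqrt (hres0 n s)]
  -- The residual square functions are dominated by `g` and tend to zero at almost every `s`; order
  -- continuity of the norm turns this into norm convergence.
  · refine hι.tendsto_zero_of_dominated hQ (g := g) (fun n => ?_) ?_
    · filter_upwards [hy n, hle n] with s h1 h2
      rwa [h1]
    · filter_upwards [ae_all_iff.2 hy, hL] with s h1 h2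
      simp only [h1]
      have := (tendsto_integral_norm_sub_gridProjection_sq hT b hF h2.1).sqrt
      rwa [Real.sqrt_zero] at this

end

/-- A sequence of random variables which is Cauchy in probability has an almost surely convergent
subsequence. -/
lemma exists_subseq_tendsto_ae {Ω V : Type*} [MeasurableSpace Ω] {P : Measure Ω}
    [NormedAddCommGroup V] [CompleteSpace V] {Z : ℕ → Ω → V}
    (hZ : ∀ n, AEStronglyMeasurable (Z n) P) {a : ℕ → ℝ} (ha : Tendsto a atTop (𝓝 0))
    (h : ∀ n m (c : ℝ≥0), c * P {ω | (c : ℝ) < ‖Z n ω - Z m ω‖} ≤ ENNReal.ofReal (a n + a m)) :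
    ∃ (ns : ℕ → ℕ) (ζ : Ω → V), StrictMono ns ∧ StronglyMeasurable ζ ∧
      ∀ᵐ ω ∂P, Tendsto (fun k => Z (ns k) ω) atTop (𝓝 (ζ ω)) := by
  -- With `a (ns k) ≤ 4 ^ (-k)` and the threshold `2 ^ (-k)`, consecutive differences exceed the
  -- threshold with probability at most `2 * 2 ^ (-k)`, which is summable.
  obtain ⟨ns, hns, hans⟩ := extraction_forall_of_eventually (P := fun k n => a n ≤ (1 / 4 : ℝ) ^ k)
    fun k => (ha.eventually_lt_const (by positivity)).mono fun _ => le_of_lt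
  have hA : ∀ k, P {ω | (((1 / 2) ^ k : ℝ≥0) : ℝ) < ‖Z (ns k) ω - Z (ns (k + 1)) ω‖} ≤
      ENNReal.ofReal (2 * (1 / 2) ^ k) := by
    intro k
    have h1 := h (ns k) (ns (k + 1)) ((1 / 2) ^ k)
    have h2 : a (ns k) + a (ns (k + 1)) ≤ (1 / 2) ^ k * (2 * (1 / 2) ^ k) := by
      have h3 := hans k
      have h4 := hans (k + 1)
      have e : ((1 : ℝ) / 4) ^ k = (1 / 2) ^ k * (1 / 2) ^ k := by rw [← mul_pow]; norm_num
      have h5 : (0 : ℝ) ≤ (1 / 4) ^ k := by positivity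
      rw [pow_succ] at h4
      nlinarith
    have h3 := h1.trans (ENNReal.ofReal_le_ofReal h2)
    rw [ENNReal.ofReal_mul (by positivity)] at h3
    have e : ENNReal.ofReal ((1 / 2) ^ k) = (((1 / 2) ^ k : ℝ≥0) : ℝ≥0∞) := by
      rw [ENNReal.ofReal]
      congr 1
      ext
      rw [Real.coe_toNNReal _ (by positivity)]
      simp
    rw [e] at h3
    exact (ENNReal.mul_le_mul_iff_right (by simp) ENNReal.coe_ne_top).1 h3
  have hsum : ∑' k, P {ω | (((1 / 2) ^ k : ℝ≥0) : ℝ) < ‖Z (ns k) ω - Z (ns (k + 1)) ω‖} ≠ ∞ :=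
    ne_top_of_le_ne_top
      ((summable_geometric_of_lt_one (by norm_num) (by norm_num)).mul_left 2).tsum_ofReal_ne_top
      (ENNReal.tsum_le_tsum hA)
  have hlim : ∀ᵐ ω ∂P, ∃ z, Tendsto (fun k => Z (ns k) ω) atTop (𝓝 z) := by
    filter_upwards [ae_eventually_notMem hsum] with ω hω
    refine cauchySeq_tendsto_of_complete (cauchySeq_of_summable_dist ?_)
    refine Summable.of_norm_bounded_eventually_nat (g := fun k => (1 / 2 : ℝ) ^ k)
      (summable_geometric_of_lt_one (by norm_num) (by norm_num)) ?_
    filter_upwards [hω] with k hk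
    rw [Real.norm_of_nonneg dist_nonneg, dist_eq_norm]
    have := not_lt.1 hk
    simpa using this
  obtain ⟨ζ, hζ, hlim'⟩ := exists_stronglyMeasurable_limit_of_tendsto_ae (fun k => hZ (ns k)) hlim
  exact ⟨ns, ζ, hns, hζ, hlim'⟩

/-! ### Comparison of step functions approximating a common kernel. -/

section

variable {S : Type*} [MeasurableSpace S] {μ : Measure S}
  {E : Type*} [NormedAddCommGroup E] [NormedSpace ℝ E] {ι : E →ₗ[ℝ] (S →ₘ[μ] ℝ)}
  {Ω : Type*} [mΩ : MeasurableSpace Ω] {P : Measure Ω}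
  {T : ℝ} {𝓕 : Filtration (TimeInterval T) mΩ}
  {H : Type*} [NormedAddCommGroup H] [InnerProductSpace ℝ H]
  {W : TimeInterval T → H →L[ℝ] Lp ℝ 2 P}
  {α β : Type*} [Fintype α] [Fintype β]

lemma vecIntegral_sumElim_neg (τ : α → StepTerm 𝓕 H) (σ : β → StepTerm 𝓕 H) (x : α → E) (z : β → E)
    (t : TimeInterval T) (ω : Ω) :
    vecIntegral W (Sum.elim τ σ) (Sum.elim x fun i => -z i) t ω =
      vecIntegral W τ x t ω - vecIntegral W σ z t ω := by
  simp [vecIntegral, Fintype.sum_sum_type, sub_eq_add_neg]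

lemma coefStep_sumElim_neg (τ : α → StepTerm 𝓕 H) (σ : β → StepTerm 𝓕 H) (a : α → ℝ) (b : β → ℝ)
    (t : TimeInterval T) :
    coefStep (Sum.elim τ σ) (Sum.elim a fun i => -b i) t = coefStep τ a t - coefStep σ b t := by
  have e : ∀ i, (Set.Ioc (σ i).s (σ i).t).indicator (fun _ => (-b i) • (σ i).h) t =
      -(Set.Ioc (σ i).s (σ i).t).indicator (fun _ => b i • (σ i).h) t := fun i => by
    by_cases h : t ∈ Set.Ioc (σ i).s (σ i).t
    · rw [Set.indicator_of_mem h, Set.indicator_of_mem h, neg_smul]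
    · rw [Set.indicator_of_notMem h, Set.indicator_of_notMem h, neg_zero]
  rw [coefStep, coefStep, coefStep, Fintype.sum_sum_type, sub_eq_add_neg, ← Finset.sum_neg_distrib]
  simp only [Sum.elim_inl, Sum.elim_inr, e]

lemma memLp_coefStep (τ : α → StepTerm 𝓕 H) (a : α → ℝ) :
    MemLp (coefStep τ a) 2 (timeMeasure T) :=
  memLp_finsetSum _ fun _ _ => (memLp_const _).indicator measurableSet_Ioc

lemma integral_norm_sub_sq_le {X V : Type*} [MeasurableSpace X] {ν : Measure X}
    [NormedAddCommGroup V] {u f g : X → V} (hu : MemLp u 2 ν)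
    (hf : MemLp f 2 ν) (hg : MemLp g 2 ν) :
    ∫ t, ‖f t - g t‖ ^ 2 ∂ν ≤ 2 * (∫ t, ‖u t - f t‖ ^ 2 ∂ν + ∫ t, ‖u t - g t‖ ^ 2 ∂ν) := by
  have i1 : Integrable (fun t => ‖u t - f t‖ ^ 2) ν := (hu.sub hf).integrable_norm_pow two_ne_zero
  have i2 : Integrable (fun t => ‖u t - g t‖ ^ 2) ν := (hu.sub hg).integrable_norm_pow two_ne_zero
  have i3 : Integrable (fun t => ‖f t - g t‖ ^ 2) ν := (hf.sub hg).integrable_norm_pow two_ne_zero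
  rw [← integral_add i1 i2, ← integral_const_mul]
  refine integral_mono i3 ((i1.add i2).const_mul 2) fun t => ?_
  have h1 : ‖f t - g t‖ ≤ ‖u t - f t‖ + ‖u t - g t‖ := by
    rw [show f t - g t = (u t - g t) - (u t - f t) by abel, add_comm]
    exact norm_sub_le _ _
  show ‖f t - g t‖ ^ 2 ≤ 2 * (‖u t - f t‖ ^ 2 + ‖u t - g t‖ ^ 2)
  nlinarith [norm_nonneg (f t - g t), sq_nonneg (‖u t - f t‖ - ‖u t - g t‖)]

/-- The distance of the integrals of two step functions is controlled by their distances to a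
common kernel. -/
lemma lintegral_vecIntegral_sub_sq_le [IsProbabilityMeasure P] (hι : IsFunctionSpace μ ι) {R : ℕ}
    {C κ : ℝ} (hC : 0 < C) (hQ : HasLowerEstimate ι (2 * R) C) (hR : 1 ≤ R) (hκ : 1 ≤ κ)
    (hκv : ∀ (v : ℝ≥0) (l : ℕ),
      2 * (8 ^ l) ^ (2 * R) * (gaussianReal 0 v).real {z | κ * 2 ^ l * √v < |z|} ≤ 1)
    (hW : IsCylindricalBrownianMotion P 𝓕 W) (hT : 0 ≤ T)
    {φ : TimeInterval T × S → H} (hφ : ∀ᵐ s ∂μ, MemLp (fun t => φ (t, s)) 2 (timeMeasure T))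
    {τ : α → StepTerm 𝓕 H} (hτ : ∀ i, (τ i).B = Set.univ) {x : α → E} {y : E}
    (hy : ∀ᵐ s ∂μ, ι y s ^ 2 =
      ∫ r, ‖φ (r, s) - coefStep τ (fun i => ι (x i) s) r‖ ^ 2 ∂timeMeasure T)
    {σ : β → StepTerm 𝓕 H} (hσ : ∀ i, (σ i).B = Set.univ) {z : β → E} {w : E}
    (hw : ∀ᵐ s ∂μ, ι w s ^ 2 =
      ∫ r, ‖φ (r, s) - coefStep σ (fun i => ι (z i) s) r‖ ^ 2 ∂timeMeasure T) :
    ∫⁻ ω, ‖vecIntegral W τ x ⟨T, hT, le_rfl⟩ ω - vecIntegral W σ z ⟨T, hT, le_rfl⟩ ω‖ₑ ^ 2 ∂P ≤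
      ENNReal.ofReal (κ * (2 + 12 * C) * (2 * (‖y‖ + ‖w‖))) ^ 2 := by
  simp only [← vecIntegral_sumElim_neg]
  -- The squared distance of two step kernels is at most twice the sum of their squared distances to
  -- `φ`, so `2 * (|y| + |w|)` dominates the square function of the difference.
  refine (lintegral_vecIntegral_sq_le hι hC hQ hR hκ hκv hW hT _ (by
    rintro (i | i)
    · exact hτ i
    · exact hσ i) _ (y := (2 : ℝ) • (hι.absE y + hι.absE w)) ?_).trans ?_
  · have hneg : ∀ i, ∀ᵐ s ∂μ, ι (-z i) s = -ι (z i) s := fun i => by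
      filter_upwards [IsFunctionSpace.coe_smul ι (-1) (z i)] with s hs
      rw [← neg_one_smul ℝ, hs, neg_one_mul]
    filter_upwards [hφ, hy, hw, ae_all_iff.2 hneg, hι.coe_absE y, hι.coe_absE w,
      IsFunctionSpace.coe_smul ι 2 (hι.absE y + hι.absE w),
      IsFunctionSpace.coe_add ι (hι.absE y) (hι.absE w)] with s h1 h2 h3 h4 h5 h6 h7 h8
    have e : (fun i => ι ((Sum.elim x fun i => -z i : α ⊕ β → E) i) s) =
        Sum.elim (fun i => ι (x i) s) fun i => -ι (z i) s := by
      funext i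
      rcases i with i | i
      · rfl
      · exact h4 i
    rw [e]
    simp only [coefStep_sumElim_neg]
    refine (integral_norm_sub_sq_le h1 (memLp_coefStep _ _) (memLp_coefStep _ _)).trans ?_
    rw [← h2, ← h3, h7, h8, h5, h6, ← sq_abs (ι y s), ← sq_abs (ι w s)]
    nlinarith [abs_nonneg (ι y s), abs_nonneg (ι w s), mul_nonneg (abs_nonneg (ι y s))
      (abs_nonneg (ι w s))]
  · refine pow_le_pow_left₀ zero_le ?_ 2
    rw [ENNReal.ofReal_mul (p := κ * (2 + 12 * C)) (by positivity), ← ofReal_norm]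
    refine mul_le_mul_right (ENNReal.ofReal_le_ofReal ?_) _
    rw [norm_smul, Real.norm_of_nonneg zero_le_two]
    refine mul_le_mul_of_nonneg_left ((norm_add_le _ _).trans ?_) zero_le_two
    rw [hι.norm_absE, hι.norm_absE]

end

lemma lintegral_enorm_le_of_sq_le {Ω V : Type*} [MeasurableSpace Ω] {P : Measure Ω}
    [IsProbabilityMeasure P] [NormedAddCommGroup V] {f : Ω → V} (hf : AEStronglyMeasurable f P)
    {c : ℝ≥0∞} (h : ∫⁻ ω, ‖f ω‖ₑ ^ 2 ∂P ≤ c ^ 2) : ∫⁻ ω, ‖f ω‖ₑ ∂P ≤ c := by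
  have h1 := eLpNorm_le_eLpNorm_of_exponent_le (p := 1) (q := 2) (by norm_num) hf
  rw [eLpNorm_one_eq_lintegral_enorm, eLpNorm_eq_lintegral_rpow_enorm_toReal (by norm_num)
    (by norm_num)] at h1
  simp only [ENNReal.toReal_ofNat, ENNReal.rpow_ofNat] at h1
  refine h1.trans ?_
  rw [one_div, ENNReal.rpow_inv_le_iff zero_lt_two, ENNReal.rpow_ofNat]
  exact h

lemma tendstoInMeasure_comp_fst {X Y V : Type*} [MeasurableSpace X] [MeasurableSpace Y]
    {ν : Measure X} {P : Measure Y} [IsProbabilityMeasure P] [SFinite ν] [EDist V]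
    {f : ℕ → X → V} {g : X → V}
    (h : TendstoInMeasure ν f atTop g) :
    TendstoInMeasure (ν.prod P) (fun n p => f n p.1) atTop fun p => g p.1 := by
  intro ε hε
  refine (h ε hε).congr fun n => ?_
  have : {p : X × Y | ε ≤ edist (f n p.1) (g p.1)} =
      {x | ε ≤ edist (f n x) (g x)} ×ˢ (Set.univ : Set Y) := by
    ext p; simp
  rw [this, Measure.prod_prod, measure_univ, mul_one]

section

variable {S : Type*} [MeasurableSpace S] {μ : Measure S}
  {E : Type*} [NormedAddCommGroup E] [NormedSpace ℝ E] {ι : E →ₗ[ℝ] (S →ₘ[μ] ℝ)}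
  {T : ℝ} {H : Type*} [NormedAddCommGroup H] [InnerProductSpace ℝ H] {κ : Type*}

/-- Weak convergence of operator valued step functions follows from the convergence of their
kernels. -/
lemma tendstoInMeasure_dual_of_grid [SigmaFinite μ] [CompleteSpace E] (hι : IsFunctionSpace μ ι)
    (hT : 0 < T) {b : κ → H} {F : ℕ → Finset κ}
    {Φ : TimeInterval T → H →L[ℝ] E}
    (hΦ : ∀ h : H, AEStronglyMeasurable (fun t => Φ t h) (timeMeasure T))
    {φ : TimeInterval T × S → H} (hφ : StronglyMeasurable φ)
    (hΦφ : ∀ h : H, ∀ᵐ t ∂timeMeasure T, ∀ᵐ s ∂μ, ι (Φ t h) s = inner ℝ (φ (t, s)) h)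
    (hφ2 : ∀ᵐ s ∂μ, MemLp (fun t => φ (t, s)) 2 (timeMeasure T)) {x : ℕ → κ → ℕ → E}
    (hx : ∀ n k i, i < n + 1 → ∀ᵐ s ∂μ, ι (x n k i) s =
        (n + 1) / T * ∫ r in gridCell hT.le n i, inner ℝ (φ (r, s)) (b k) ∂timeMeasure T)
    {y : ℕ → E} (hy : ∀ n, ∀ᵐ s ∂μ, ι (y n) s ^ 2 = ∫ t, ‖φ (t, s) -
        gridProjection hT.le n (F n) b (fun r => φ (r, s)) t‖ ^ 2 ∂timeMeasure T)
    (hy0 : Tendsto y atTop (𝓝 0)) (h : H) (x' : E →L[ℝ] ℝ) :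
    TendstoInMeasure (timeMeasure T) (fun n t => x' (∑ i ∈ Finset.range (n + 1),
      (gridCell hT.le n i).indicator (fun _ => (1 : ℝ)) t • ∑ k ∈ F n, inner ℝ (b k) h • x n k i))
      atTop fun t => x' (Φ t h) := by
  set G : ℕ → TimeInterval T → E := fun n t => ∑ i ∈ Finset.range (n + 1),
      (gridCell hT.le n i).indicator (fun _ => (1 : ℝ)) t • ∑ k ∈ F n, inner ℝ (b k) h • x n k i
    with hG
  have hGm : ∀ n, AEStronglyMeasurable (G n) (timeMeasure T) := fun n =>
    Finset.aestronglyMeasurable_fun_sum _ fun i _ =>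
      ((stronglyMeasurable_const.indicator
        (measurableSet_gridCell hT.le n i)).smul_const _).aestronglyMeasurable
  have hGφ : ∀ n, ∀ᵐ t ∂timeMeasure T, ∀ᵐ s ∂μ, ι (G n t - Φ t h) s =
      inner ℝ (gridProjection hT.le n (F n) b (fun r => φ (r, s)) t - φ (t, s)) h := by
    intro n
    filter_upwards [hΦφ h] with t ht
    have h1 : ∀ᵐ s ∂μ, ∀ i ∈ Finset.range (n + 1), ∀ k ∈ F n, ι (x n k i) s = (n + 1) / T *
        ∫ r in gridCell hT.le n i, inner ℝ (φ (r, s)) (b k) ∂timeMeasure T :=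
      ((Finset.range (n + 1)).finite_toSet.eventually_all (l := ae μ)).2 fun i hi =>
        ((F n).finite_toSet.eventually_all (l := ae μ)).2 fun k _ =>
          hx n k i (Finset.mem_range.1 hi)
    have h2 : ∀ᵐ s ∂μ, ∀ i ∈ Finset.range (n + 1), ι (∑ k ∈ F n, inner ℝ (b k) h • x n k i) s =
        ∑ k ∈ F n, inner ℝ (b k) h * ι (x n k i) s :=
      ((Finset.range (n + 1)).finite_toSet.eventually_all (l := ae μ)).2 fun i _ =>
        IsFunctionSpace.coe_sum_smul ι _ _ _
    filter_upwards [ht, h1, h2, IsFunctionSpace.coe_sub ι (G n t) (Φ t h),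
      IsFunctionSpace.coe_sum_smul ι (Finset.range (n + 1))
        (fun i => (gridCell hT.le n i).indicator (fun _ => (1 : ℝ)) t)
        (fun i => ∑ k ∈ F n, inner ℝ (b k) h • x n k i)] with s h3 h4 h5 h6 h7
    rw [h6, h3, inner_sub_left]
    congr 1
    rw [hG]
    simp only
    rw [h7, gridProjection, sum_inner, Finset.sum_congr rfl fun i hi => by
      rw [h5 i hi, Finset.mul_sum], Finset.sum_comm]
    refine Finset.sum_congr rfl fun k hk => ?_
    rw [inner_smul_left, conj_trivial, gridAverage, Finset.sum_mul]
    refine Finset.sum_congr rfl fun i hi => ?_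
    rw [h4 i hi k hk]
    by_cases ht : t ∈ gridCell hT.le n i
    · rw [Set.indicator_of_mem ht, Set.indicator_of_mem ht]; ring
    · rw [Set.indicator_of_notMem ht, Set.indicator_of_notMem ht]; ring
  -- Pairing the residual kernel with `h` gives a square function at most `‖h‖ * |ι (y n) s|`, which
  -- controls the `L²` norm of any functional of the residual.
  have hest : ∀ n, ∫⁻ t, ‖x' (G n t - Φ t h)‖ₑ ^ 2 ∂timeMeasure T ≤
      (‖x'‖ₑ * ‖‖h‖ • y n‖ₑ) ^ 2 := by
    intro n
    refine hι.lintegral_dual_sq_le ((hGm n).sub (hΦ h)) (f := fun p =>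
      inner ℝ (gridProjection hT.le n (F n) b (fun r => φ (r, p.2)) p.1 - φ p) h)
      (((stronglyMeasurable_gridProjection hφ hT.le n (F n) b).sub hφ).inner
        stronglyMeasurable_const) (hGφ n) ?_ x'
    filter_upwards [hφ2, hy n, IsFunctionSpace.coe_smul ι ‖h‖ (y n)] with s h1 h2 h3
    have i1 : Integrable (fun t => ‖φ (t, s) -
        gridProjection hT.le n (F n) b (fun r => φ (r, s)) t‖ ^ 2) (timeMeasure T) :=
      (h1.sub (memLp_gridProjection hT.le n (F n) b _)).integrable_norm_pow two_ne_zero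
    have e1 : ∫⁻ t, ‖φ (t, s) - gridProjection hT.le n (F n) b (fun r => φ (r, s)) t‖ₑ ^ 2
        ∂timeMeasure T = ‖ι (y n) s‖ₑ ^ 2 := by
      rw [← ofReal_norm (ι (y n) s), ← ENNReal.ofReal_pow (norm_nonneg _), Real.norm_eq_abs, sq_abs,
        h2, ofReal_integral_eq_lintegral_ofReal i1 (ae_of_all _ fun t => sq_nonneg _)]
      refine lintegral_congr fun t => ?_
      rw [ENNReal.ofReal_pow (norm_nonneg _), ofReal_norm]
    rw [h3, enorm_mul, mul_pow, ← e1, enorm_norm, ← lintegral_const_mul' _ _ (by simp)]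
    refine lintegral_mono fun t => ?_
    rw [← mul_pow]
    refine pow_le_pow_left₀ zero_le ?_ 2
    rw [← ofReal_norm, ← ofReal_norm, ← ofReal_norm, ← ENNReal.ofReal_mul (norm_nonneg _)]
    refine ENNReal.ofReal_le_ofReal ((norm_inner_le_norm _ _).trans (le_of_eq ?_))
    rw [norm_sub_rev, mul_comm]
  refine tendstoInMeasure_of_tendsto_eLpNorm (p := 2) (by norm_num)
    (fun n => x'.continuous.comp_aestronglyMeasurable (hGm n))
    (x'.continuous.comp_aestronglyMeasurable (hΦ h)) ?_
  have hlim : Tendsto (fun n => ‖x'‖ₑ * ‖‖h‖ • y n‖ₑ) atTop (𝓝 0) := by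
    have h1 : Tendsto (fun n => ‖‖h‖ • y n‖ₑ) atTop (𝓝 0) := by
      have := (hy0.const_smul ‖h‖).enorm
      simpa using this
    have := ENNReal.Tendsto.const_mul h1 (a := ‖x'‖ₑ) (Or.inr (by simp))
    simpa using this
  refine tendsto_of_tendsto_of_tendsto_of_le_of_le tendsto_const_nhds hlim (fun _ => zero_le)
    fun n => ?_
  rw [eLpNorm_eq_lintegral_rpow_enorm_toReal (by norm_num) (by norm_num)]
  simp only [ENNReal.toReal_ofNat, ENNReal.rpow_ofNat]
  rw [one_div, ENNReal.rpow_inv_le_iff zero_lt_two, ENNReal.rpow_ofNat]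
  refine le_trans (le_of_eq (lintegral_congr fun t => ?_)) (hest n)
  rw [map_sub]
  rfl

end

/-! ### Existence of the stochastic integral. -/

section

variable {S : Type*} [MeasurableSpace S] {μ : Measure S}
  {E : Type*} [NormedAddCommGroup E] [NormedSpace ℝ E] {ι : E →ₗ[ℝ] (S →ₘ[μ] ℝ)}
  {Ω : Type*} [mΩ : MeasurableSpace Ω] {P : Measure Ω} [IsProbabilityMeasure P]
  {T : ℝ} {𝓕 : Filtration (TimeInterval T) mΩ}
  {H : Type*} [NormedAddCommGroup H] [InnerProductSpace ℝ H]
  {W : TimeInterval T → H →L[ℝ] Lp ℝ 2 P}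

/-- The projections are contractions. -/
lemma integral_norm_gridProjection_sq_le {κ : Type*} (hT : 0 < T) (n : ℕ) (F : Finset κ)
    {b : κ → H} (hb : Orthonormal ℝ b) {u : TimeInterval T → H} (hu : MemLp u 2 (timeMeasure T)) :
    ∫ t, ‖gridProjection hT.le n F b u t‖ ^ 2 ∂timeMeasure T ≤ ∫ t, ‖u t‖ ^ 2 ∂timeMeasure T := by
  have e : ∀ t, ‖gridProjection hT.le n F b u t‖ ^ 2 =
      ∑ k ∈ F, gridAverage hT.le n (fun r => inner ℝ (u r) (b k)) t ^ 2 := fun t => by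
    rw [gridProjection, ← real_inner_self_eq_norm_sq, hb.inner_sum]
    simp only [conj_trivial, sq]
  simp only [e]
  rw [integral_finsetSum _ fun k _ => (memLp_gridAverage hT.le n _).integrable_sq]
  rw [Finset.sum_congr rfl fun k _ => integral_gridAverage_sq hT n fun r => inner ℝ (u r) (b k)]
  exact sum_gridEnergy_le hT n F hb hu

/-- An operator valued function is stochastically integrable if the square function of its kernel
belongs to `E`, and the second moment of the integral is controlled by the square function. -/
theorem exists_isStochasticIntegral [SigmaFinite μ] [CompleteSpace E] [CompleteSpace H]
    [TopologicalSpace.SeparableSpace H] (hι : IsFunctionSpace μ ι) {R : ℕ}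
    {C κ : ℝ} (hC : 0 < C) (hQ : HasLowerEstimate ι (2 * R) C) (hR : 1 ≤ R) (hκ : 1 ≤ κ)
    (hκv : ∀ (v : ℝ≥0) (l : ℕ),
      2 * (8 ^ l) ^ (2 * R) * (gaussianReal 0 v).real {z | κ * 2 ^ l * √v < |z|} ≤ 1)
    (hW : IsCylindricalBrownianMotion P 𝓕 W) (hT : 0 < T)
    {Φ : TimeInterval T → H →L[ℝ] E}
    (hΦ : ∀ h : H, AEStronglyMeasurable (fun t => Φ t h) (timeMeasure T))
    {φ : TimeInterval T × S → H} (hφ : StronglyMeasurable φ)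
    (hΦφ : ∀ h : H, ∀ᵐ t ∂timeMeasure T, ∀ᵐ s ∂μ, ι (Φ t h) s = inner ℝ (φ (t, s)) h) {g : E}
    (hg : ∀ᵐ s ∂μ, ∫⁻ t, ‖φ (t, s)‖ₑ ^ 2 ∂timeMeasure T = ‖ι g s‖ₑ ^ 2) :
    ∃ ζ : Ω → C(TimeInterval T, E), IsStochasticIntegral P 𝓕 W (fun p => Φ p.1) ζ ∧
      ∫⁻ ω, ‖ζ ω ⟨T, hT.le, le_rfl⟩‖ₑ ^ 2 ∂P ≤
        (ENNReal.ofReal (κ * (2 + 12 * C)) * ‖g‖ₑ) ^ 2 := by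
  obtain ⟨w, b, -⟩ := exists_hilbertBasis ℝ H
  have : Countable w := countable_of_orthonormal b.orthonormal
  obtain ⟨F, hF⟩ := exists_seq_tendsto (atTop : Filter (Finset w))
  obtain ⟨x, y, hx, hy, hy0⟩ := exists_grid_approximation hι hQ hT b hF hφ hg
  have hL := ae_memLp_of_lintegral_eq hφ hg
  let top : TimeInterval T := ⟨T, hT.le, le_rfl⟩
  let τ : ∀ n, Fin (n + 1) × F n → StepTerm 𝓕 H := fun n => gridVecTerms 𝓕 hT.le n (F n) b
  have hτ : ∀ n i, (τ n i).B = Set.univ := fun n i => rfl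
  let X : ∀ n, Fin (n + 1) × F n → E := fun n p => x n p.2 p.1
  have hcoef : ∀ n, ∀ᵐ s ∂μ, ∀ t, coefStep (τ n) (fun i => ι (X n i) s) t =
      gridProjection hT.le n (F n) b (fun r => φ (r, s)) t := by
    intro n
    filter_upwards [ae_all_iff.2 fun p : Fin (n + 1) × F n => hx n p.2 p.1 p.1.2] with s hs t
    exact coefStep_gridVecTerms 𝓕 hT.le n (F n) b (fun r => φ (r, s)) hs t
  have hy' : ∀ n, ∀ᵐ s ∂μ, ι (y n) s ^ 2 =
      ∫ r, ‖φ (r, s) - coefStep (τ n) (fun i => ι (X n i) s) r‖ ^ 2 ∂timeMeasure T := by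
    intro n
    filter_upwards [hcoef n, hy n] with s h1 h2
    simp only [h1, h2]
  choose Z hZm hZ using fun n => exists_continuous_vecIntegral hW (τ n) (X n)
  have hint : ∀ n t, AEStronglyMeasurable (vecIntegral W (τ n) (X n) t) P := fun n t =>
    (integrable_vecIntegral (τ n) (X n) t).1
  -- The difference of two approximating integrals is the integral of one step function, with the
  -- second family of coefficients negated, so the maximal inequality applies to it.
  have hdiff : ∀ n m (c : ℝ≥0), c * P {ω | (c : ℝ) < ‖Z n ω - Z m ω‖} ≤
      ENNReal.ofReal (κ * (2 + 12 * C) * (2 * ‖y n‖) + κ * (2 + 12 * C) * (2 * ‖y m‖)) := by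
    intro n m c
    have h1 := mul_measure_lt_norm_le hW hT.le (Sum.elim (τ n) (τ m))
      (Sum.elim (X n) fun i => -X m i) (Z := fun ω => Z n ω - Z m ω) (fun t => by
        filter_upwards [hZ n t, hZ m t] with ω h1 h2
        rw [vecIntegral_sumElim_neg, ContinuousMap.sub_apply, h1, h2]) c
    refine h1.trans ?_
    simp only [vecIntegral_sumElim_neg]
    refine lintegral_enorm_le_of_sq_le ((hint n top).sub (hint m top)) ?_
    have h2 := lintegral_vecIntegral_sub_sq_le hι hC hQ hR hκ hκv hW hT.le
      (hL.mono fun s hs => hs.1) (hτ n) (hy' n) (hτ m) (hy' m)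
    refine h2.trans (le_of_eq ?_)
    congr 2
    ring
  obtain ⟨ns, ζ, hns, hζ, hlim⟩ := exists_subseq_tendsto_ae hZm
    (a := fun n => κ * (2 + 12 * C) * (2 * ‖y n‖)) (by
      have := (hy0.norm.const_mul 2).const_mul (κ * (2 + 12 * C))
      simpa using this) hdiff
  refine ⟨ζ, ⟨hζ.aestronglyMeasurable, fun k => gridElementary 𝓕 hT (ns k) (F (ns k))
    b.orthonormal (x (ns k)), fun k => Z (ns k), fun h x' => ?_, fun k t => ?_, ?_⟩, ?_⟩
  · have h1 := tendstoInMeasure_comp_fst (P := P) (tendstoInMeasure_dual_of_grid hι hT hΦ hφ hΦφ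
      (hL.mono fun s hs => hs.1) hx hy hy0 h x')
    intro ε hε
    refine ((h1 ε hε).comp hns.tendsto_atTop).congr fun k => ?_
    simp only [Function.comp_apply]
    congr 1
    ext p
    rw [Set.mem_ofPred_eq, Set.mem_ofPred_eq, ← process_gridElementary 𝓕 hT _ _ b.orthonormal]
  · filter_upwards [hZ (ns k) t] with ω h1
    rw [h1, integral_gridElementary]
  · exact tendstoInMeasure_of_tendsto_ae (fun k => hZm (ns k)) hlim
  -- Projections contract, so `g` dominates the square function of every approximation; the common
  -- bound passes to the limit by Fatou's lemma.
  · have hbound : ∀ n, ∫⁻ ω, ‖Z n ω top‖ₑ ^ 2 ∂P ≤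
        (ENNReal.ofReal (κ * (2 + 12 * C)) * ‖g‖ₑ) ^ 2 := by
      intro n
      rw [lintegral_congr_ae (g := fun ω => ‖vecIntegral W (τ n) (X n) top ω‖ₑ ^ 2) (by
        filter_upwards [hZ n top] with ω h1
        rw [h1])]
      refine lintegral_vecIntegral_sq_le hι hC hQ hR hκ hκv hW hT.le _ (hτ n) _ ?_
      filter_upwards [hcoef n, hL] with s h1 h2
      simp only [h1]
      rw [← h2.2]
      exact integral_norm_gridProjection_sq_le hT n (F n) b.orthonormal h2.1
    refine le_trans (lintegral_mono_ae ?_) ((lintegral_liminf_le' (u := atTop) fun k => ?_).trans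
      (liminf_le_of_frequently_le' (Eventually.of_forall fun k => hbound (ns k)).frequently))
    · filter_upwards [hlim] with ω h1
      have h2 : Tendsto (fun k => Z (ns k) ω top) atTop (𝓝 (ζ ω top)) :=
        ((continuous_eval_const (F := C(TimeInterval T, E)) top).tendsto _).comp h1
      exact ((((ENNReal.continuous_pow 2).comp continuous_enorm).tendsto _).comp h2).liminf_eq.ge
    · exact (((continuous_eval_const (F := C(TimeInterval T, E)) top).comp_aestronglyMeasurable
        (hZm (ns k))).enorm).pow_const 2

end

/-- The square is expanded; the `e p` are pairwise orthogonal in `L²` with squared norms `w p`,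
which are allowed to vanish. -/
lemma integral_norm_add_sum_smul_sq {X V α : Type*} [MeasurableSpace X] {ν : Measure X}
    [NormedAddCommGroup V] [InnerProductSpace ℝ V] [Fintype α] [DecidableEq α] {u : X → V}
    (hu : MemLp u 2 ν) {e : α → X → V} (he : ∀ p, MemLp (e p) 2 ν) {w : α → ℝ}
    (hw : ∀ p q, ∫ t, inner ℝ (e p t) (e q t) ∂ν = if p = q then w p else 0) (a : α → ℝ) :
    ∫ t, ‖u t + ∑ p, a p • e p t‖ ^ 2 ∂ν =
      ∫ t, ‖u t‖ ^ 2 ∂ν + 2 * ∑ p, a p * ∫ t, inner ℝ (u t) (e p t) ∂ν + ∑ p, a p ^ 2 * w p := by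
  have hi : ∀ {f g : X → V}, MemLp f 2 ν → MemLp g 2 ν →
      Integrable (fun t => inner ℝ (f t) (g t)) ν := fun {f g} hf hg => by
    refine (hf.norm.integrable_mul hg.norm).mono' (hf.1.inner hg.1)
      (ae_of_all _ fun t => norm_inner_le_norm _ _)
  have pt : ∀ t, ‖u t + ∑ p, a p • e p t‖ ^ 2 = ‖u t‖ ^ 2 + 2 * ∑ p, a p * inner ℝ (u t) (e p t) +
      ∑ p, ∑ q, a p * a q * inner ℝ (e p t) (e q t) := by
    intro t
    rw [norm_add_sq_real, inner_sum, ← real_inner_self_eq_norm_sq (∑ p, a p • e p t), sum_inner]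
    congr 1
    · simp only [inner_smul_right]
    · refine Finset.sum_congr rfl fun p _ => ?_
      rw [inner_sum]
      refine Finset.sum_congr rfl fun q _ => ?_
      rw [inner_smul_left, inner_smul_right, conj_trivial, mul_assoc]
  have i1 : Integrable (fun t => ‖u t‖ ^ 2) ν := hu.integrable_norm_pow two_ne_zero
  have i2 : ∀ p ∈ Finset.univ, Integrable (fun t => a p * inner ℝ (u t) (e p t)) ν :=
    fun p _ => (hi hu (he p)).const_mul _
  have i3 : ∀ p ∈ Finset.univ, ∀ q ∈ Finset.univ,
      Integrable (fun t => a p * a q * inner ℝ (e p t) (e q t)) ν :=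
    fun p _ q _ => (hi (he p) (he q)).const_mul _
  have i2' : Integrable (fun t => 2 * ∑ p, a p * inner ℝ (u t) (e p t)) ν :=
    (integrable_finsetSum _ i2).const_mul 2
  have i12 : Integrable (fun t => ‖u t‖ ^ 2 + 2 * ∑ p, a p * inner ℝ (u t) (e p t)) ν := i1.add i2'
  have i3' : ∀ p ∈ Finset.univ, Integrable (fun t => ∑ q, a p * a q * inner ℝ (e p t) (e q t)) ν :=
    fun p hp => integrable_finsetSum _ (i3 p hp)
  simp only [pt]
  rw [integral_add i12 (integrable_finsetSum _ i3'), integral_add i1 i2', integral_const_mul,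
    integral_finsetSum _ i2, integral_finsetSum _ i3']
  simp only [integral_const_mul]
  congr 1
  refine Finset.sum_congr rfl fun p hp => ?_
  rw [integral_finsetSum _ (i3 p hp)]
  simp only [integral_const_mul, hw, mul_ite, mul_zero]
  rw [Finset.sum_ite_eq, if_pos (Finset.mem_univ _)]
  ring

/-! ### The law of the integral and the reflection argument. -/

section

variable {E : Type*} [NormedAddCommGroup E] [NormedSpace ℝ E]
  {Ω : Type*} [mΩ : MeasurableSpace Ω] {P : Measure Ω} [IsProbabilityMeasure P]
  {T : ℝ} {𝓕 : Filtration (TimeInterval T) mΩ}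
  {H : Type*} [NormedAddCommGroup H] [InnerProductSpace ℝ H] [CompleteSpace H]
  [TopologicalSpace.SeparableSpace H]
  {W : TimeInterval T → H →L[ℝ] Lp ℝ 2 P}
  {Φ : TimeInterval T → H →L[ℝ] E} {ζ ζ' : Ω → C(TimeInterval T, E)}
  {Ψ Ψ' : ℕ → ElementaryAdapted 𝓕 H E} {Z Z' : ℕ → Ω → C(TimeInterval T, E)}

namespace ApproximatesIntegral

/-- The joint characteristic function of a stochastic integral and a Wiener integral. -/
lemma integral_exp_add_of_isWienerIntegral (h : ApproximatesIntegral W Φ ζ Ψ Z)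
    (hW : IsCylindricalBrownianMotion P 𝓕 W) (hT : 0 ≤ T)
    (hΦ : ∀ h : H, AEStronglyMeasurable (fun t => Φ t h) (timeMeasure T)) (x' : E →L[ℝ] ℝ)
    {f : TimeInterval T → H} {γ : Ω → ℝ} (hγ : IsWienerIntegral 𝓕 W hT f γ) :
    ∫ ω, Complex.exp ((x' (ζ ω ⟨T, hT, le_rfl⟩) + γ ω : ℝ) * Complex.I) ∂P =
      Real.exp (-(∫ t, ‖dualKernel Φ x' t + f t‖ ^ 2 ∂timeMeasure T) / 2) := by
  obtain ⟨hf, β, hβ, d, D, hD, hDf, hγ⟩ := hγ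
  exact h.integral_exp_add hW hT hΦ x' d hD hf hDf hγ

lemma integral_exp (h : ApproximatesIntegral W Φ ζ Ψ Z)
    (hW : IsCylindricalBrownianMotion P 𝓕 W) (hT : 0 ≤ T)
    (hΦ : ∀ h : H, AEStronglyMeasurable (fun t => Φ t h) (timeMeasure T)) (x' : E →L[ℝ] ℝ) :
    ∫ ω, Complex.exp ((x' (ζ ω ⟨T, hT, le_rfl⟩) : ℝ) * Complex.I) ∂P =
      Real.exp (-(∫ t, ‖dualKernel Φ x' t‖ ^ 2 ∂timeMeasure T) / 2) := by
  have := h.integral_exp_add_of_isWienerIntegral hW hT hΦ x' IsWienerIntegral.zero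
  simpa using this

/-- All stochastic integrals of the same function have the same second moment. -/
lemma lintegral_enorm_sq_eq [CompleteSpace E] (h : ApproximatesIntegral W Φ ζ Ψ Z)
    (h' : ApproximatesIntegral W Φ ζ' Ψ' Z')
    (hW : IsCylindricalBrownianMotion P 𝓕 W) (hT : 0 ≤ T)
    (hΦ : ∀ h : H, AEStronglyMeasurable (fun t => Φ t h) (timeMeasure T))
    (hζ : AEStronglyMeasurable ζ P) (hζ' : AEStronglyMeasurable ζ' P) :
    ∫⁻ ω, ‖ζ ω ⟨T, hT, le_rfl⟩‖ₑ ^ 2 ∂P = ∫⁻ ω, ‖ζ' ω ⟨T, hT, le_rfl⟩‖ₑ ^ 2 ∂P := by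
  set top : TimeInterval T := ⟨T, hT, le_rfl⟩
  have m1 := (continuous_eval_const (F := C(TimeInterval T, E)) top).comp_aestronglyMeasurable hζ
  have m2 := (continuous_eval_const (F := C(TimeInterval T, E)) top).comp_aestronglyMeasurable hζ'
  -- The characteristic functionals depend on `Φ` alone. Equality in law at time `T` suffices here;
  -- almost sure uniqueness of the integral is not required.
  have key := map_norm_eq_of_integral_exp_eq m1 m2 fun x' => by
    rw [h.integral_exp hW hT hΦ x', h'.integral_exp hW hT hΦ x']
  have e : ∀ (f : Ω → C(TimeInterval T, E)), AEStronglyMeasurable (fun ω => f ω top) P →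
      ∫⁻ ω, ‖f ω top‖ₑ ^ 2 ∂P = ∫⁻ z, ‖z‖ₑ ^ 2 ∂(P.map fun ω => ‖f ω top‖) := fun f hf => by
    rw [lintegral_map' (by fun_prop) hf.norm.aemeasurable]
    simp only [enorm_norm]
  rw [e ζ m1, e ζ' m2, key]

/-- A quantile of the norm of a stochastic integral controls the square functions of its
finite-dimensional projections. -/
lemma norm_le_of_projection {S : Type*} [MeasurableSpace S] {μ : Measure S}
    {ι : E →ₗ[ℝ] (S →ₘ[μ] ℝ)} (hι : IsFunctionSpace μ ι) [CompleteSpace E]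
    {δ : ℝ} (hδ : 0 < δ)
    (hδv : ∀ v : ℝ≥0, v ≠ 0 → (gaussianReal 0 v).real {z | |z| < δ * √v} ≤ 1 / 4)
    (h : ApproximatesIntegral W Φ ζ Ψ Z)
    (hW : IsCylindricalBrownianMotion P 𝓕 W) (hT : 0 < T)
    (hΦ : ∀ h : H, AEStronglyMeasurable (fun t => Φ t h) (timeMeasure T))
    (hζ : AEStronglyMeasurable ζ P) {α : Type*} [Fintype α] [DecidableEq α]
    {A : α → Set (TimeInterval T)} (hA : ∀ p, MeasurableSet (A p)) {k : α → H} {w : α → ℝ}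
    (hw0 : ∀ p, 0 ≤ w p)
    (hw : ∀ p q, ∫ t, inner ℝ ((A p).indicator (fun _ => (1 : ℝ)) t • k p)
      ((A q).indicator (fun _ => (1 : ℝ)) t • k q) ∂timeMeasure T = if p = q then w p else 0)
    {x : α → E} (hx : ∀ p (x' : E →L[ℝ] ℝ), x' (x p) = ∫ t, inner ℝ (dualKernel Φ x' t)
      ((A p).indicator (fun _ => (1 : ℝ)) t • k p) ∂timeMeasure T)
    {g : E} (hg : ∀ᵐ s ∂μ, ι g s ^ 2 = ∑ p, (w p)⁻¹ * ι (x p) s ^ 2) {r : ℝ} (hr : 0 < r)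
    (hP : P.real {ω | r < ‖ζ ω ⟨T, hT.le, le_rfl⟩‖} ≤ 1 / 16) :
    ‖g‖ ≤ 16 / (3 * δ) * r := by
  set top : TimeInterval T := ⟨T, hT.le, le_rfl⟩
  let e : α → TimeInterval T → H := fun p t => (A p).indicator (fun _ => (1 : ℝ)) t • k p
  have hind : ∀ p, MemLp ((A p).indicator fun _ => (1 : ℝ)) 2 (timeMeasure T) := fun p =>
    (memLp_const 1).indicator (hA p)
  choose γ hγm hγ using fun p => exists_isWienerIntegral hW hT (hind p) (k p)
  have he : ∀ p, MemLp (e p) 2 (timeMeasure T) := fun p => (hγ p).1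
  have hγa : ∀ a : α → ℝ, IsWienerIntegral 𝓕 W hT.le (fun t => ∑ p, a p • e p t)
      fun ω => ∑ p, a p * γ p ω := fun a =>
    IsWienerIntegral.sum _ fun p _ => (hγ p).const_smul (a p)
  -- The normalized coordinates of the projection onto the span of the `e p`. Where `w p = 0` the
  -- inverse is zero by convention, so the term drops out.
  let G : Ω → α → ℝ := fun ω p => (w p)⁻¹ * γ p ω
  have hG : Measurable G := measurable_pi_lambda _ fun p => (hγm p).const_mul _
  have hv0 : ∀ a : α → ℝ, 0 ≤ ∑ p, (w p)⁻¹ * a p ^ 2 := fun a =>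
    Finset.sum_nonneg fun p _ => mul_nonneg (inv_nonneg.2 (hw0 p)) (sq_nonneg _)
  have hww : ∀ p, (w p)⁻¹ ^ 2 * w p = (w p)⁻¹ := fun p => by
    rcases eq_or_ne (w p) 0 with h0 | h0
    · simp [h0]
    · field_simp
  have hlaw : ∀ a : α → ℝ, HasLaw (fun ω => ∑ p, G ω p * a p)
      (gaussianReal 0 (∑ p, (w p)⁻¹ * a p ^ 2).toNNReal) P := by
    intro a
    refine hasLaw_gaussianReal_of_integral_exp (Measurable.aestronglyMeasurable (by fun_prop))
      (hv0 a) fun c => ?_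
    have h1 := h.integral_exp_add_of_isWienerIntegral hW hT.le hΦ 0
      (hγa fun p => c * (w p)⁻¹ * a p)
    have h2 : ∀ t, dualKernel Φ (0 : E →L[ℝ] ℝ) t = 0 := fun t => by
      rw [dualKernel, ContinuousLinearMap.zero_comp, map_zero]
    rw [integral_norm_add_sum_smul_sq (by rw [show dualKernel Φ (0 : E →L[ℝ] ℝ) = fun _ => 0 from funext h2]; exact MemLp.zero') he hw] at h1
    simp only [h2, inner_zero_left, integral_zero, norm_zero, zero_apply,
      zero_add, mul_zero, Finset.sum_const_zero, zero_pow two_ne_zero] at h1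
    convert h1 using 4
    · rw [Finset.mul_sum]
      congr 2
      refine Finset.sum_congr rfl fun p _ => ?_
      ring
    · rw [Finset.mul_sum]
      congr 1
      refine Finset.sum_congr rfl fun p _ => ?_
      linear_combination -(c ^ 2 * a p ^ 2) * hww p
  -- `Y` is the projection of the integral `X` onto the Wiener integrals `γ p`, and `2Y - X` is its
  -- reflection. The reflection has the law of `X`, and `Y` is the mean of the two, so `‖Y‖` exceeds
  -- `r` with at most twice the probability that `‖X‖` does.
  let X : Ω → E := fun ω => ζ ω top
  let Y : Ω → E := fun ω => ∑ p, G ω p • x p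
  have hX : AEStronglyMeasurable X P :=
    (continuous_eval_const (F := C(TimeInterval T, E)) top).comp_aestronglyMeasurable hζ
  have hY : AEStronglyMeasurable Y P := Finset.aestronglyMeasurable_fun_sum _ fun p _ =>
    (((measurable_pi_apply p).comp hG).aestronglyMeasurable).smul_const _
  have hR : AEStronglyMeasurable (fun ω => (2 : ℝ) • Y ω - X ω) P := (hY.const_smul (2 : ℝ)).sub hX
  have hsym : P.map (fun ω => ‖(2 : ℝ) • Y ω - X ω‖) = P.map fun ω => ‖X ω‖ := by
    refine map_norm_eq_of_integral_exp_eq hR hX fun x' => ?_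
    rw [h.integral_exp hW hT.le hΦ x']
    have h1 := h.integral_exp_add_of_isWienerIntegral hW hT.le hΦ (-x')
      (hγa fun p => 2 * (w p)⁻¹ * x' (x p))
    have h2 : ∀ t, dualKernel Φ (-x') t = -dualKernel Φ x' t := fun t => by
      rw [dualKernel, dualKernel, ← map_neg]
      rfl
    have h3 : MemLp (dualKernel Φ (-x')) 2 (timeMeasure T) :=
      h.memLp_dualKernel hW hT.le hΦ (-x')
    rw [integral_norm_add_sum_smul_sq h3 he hw] at h1
    have h4 : ∀ p, ∫ t, inner ℝ (dualKernel Φ (-x') t) (e p t) ∂timeMeasure T = -x' (x p) :=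
      fun p => by
        rw [hx]
        simp only [h2, inner_neg_left, integral_neg]
        rfl
    simp only [h4] at h1
    simp only [h2, norm_neg] at h1
    -- The mixed terms cancel the squares: a reflection preserves the `L²` norm of the kernel.
    have h5 : ∀ q : ℝ, q + 2 * ∑ p, 2 * (w p)⁻¹ * x' (x p) * -x' (x p) +
        ∑ p, (2 * (w p)⁻¹ * x' (x p)) ^ 2 * w p = q := by
      intro q
      rw [add_assoc, Finset.mul_sum, ← Finset.sum_add_distrib, Finset.sum_eq_zero, add_zero]
      intro p _
      linear_combination 4 * x' (x p) ^ 2 * hww p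
    rw [h5] at h1
    rw [← h1]
    refine integral_congr_ae (ae_of_all _ fun ω => ?_)
    simp only [Y, G, X, map_sub, map_smul, map_sum, smul_eq_mul, neg_apply]
    congr 3
    rw [Finset.mul_sum, sub_eq_neg_add]
    congr 1
    refine Finset.sum_congr rfl fun p _ => ?_
    ring
  refine hι.norm_le_of_gaussian_sum hδ hδv hG hlaw (x := x) (g := g) ?_ hr ?_
  · filter_upwards [hg] with s hs
    rw [hs, Real.coe_toNNReal _ (hv0 _)]
  · have h1 : P.real {ω | r < ‖(2 : ℝ) • Y ω - X ω‖} = P.real {ω | r < ‖X ω‖} := by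
      have h2 := congrArg (fun ν : Measure ℝ => ν.real (Set.Ioi r)) hsym
      simp only [measureReal_def] at h2 ⊢
      rw [Measure.map_apply_of_aemeasurable hR.norm.aemeasurable measurableSet_Ioi,
        Measure.map_apply_of_aemeasurable hX.norm.aemeasurable measurableSet_Ioi] at h2
      exact h2
    have h2 : {ω | r < ‖Y ω‖} ⊆ {ω | r < ‖(2 : ℝ) • Y ω - X ω‖} ∪ {ω | r < ‖X ω‖} := by
      intro ω hω
      by_contra hcon
      rw [Set.mem_union, not_or] at hcon
      have h3 : ‖(2 : ℝ) • Y ω - X ω‖ ≤ r := not_lt.1 (by exact hcon.1)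
      have h4 : ‖X ω‖ ≤ r := not_lt.1 (by exact hcon.2)
      have h5 : ‖(2 : ℝ) • Y ω‖ ≤ ‖(2 : ℝ) • Y ω - X ω‖ + ‖X ω‖ := by
        simpa using norm_add_le ((2 : ℝ) • Y ω - X ω) (X ω)
      rw [norm_smul, Real.norm_of_nonneg zero_le_two] at h5
      have h6 : r < ‖Y ω‖ := hω
      linarith
    have h3 := (measureReal_mono (μ := P) h2).trans (measureReal_union_le _ _)
    rw [h1] at h3
    have h4 : P.real {ω | r < ‖X ω‖} ≤ 1 / 16 := hP
    linarith

end ApproximatesIntegral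

end

/-- Fatou's lemma for the counting measure. -/
lemma sum_liminf_le {κ : Type*} (F : Finset κ) (f : ℕ → κ → ℝ≥0∞) :
    ∑ k ∈ F, liminf (fun n => f n k) atTop ≤ liminf (fun n => ∑ k ∈ F, f n k) atTop := by
  letI : MeasurableSpace F := ⊤
  have e : ∀ g : κ → ℝ≥0∞, ∑ k ∈ F, g k = ∫⁻ k : F, g k ∂Measure.count := fun g => by
    rw [lintegral_count, tsum_fintype, Finset.sum_coe_sort F]
  simp only [e]
  exact lintegral_liminf_le fun n => measurable_from_top

lemma sqrt_sum_sq_le_sum {α : Type*} (s : Finset α) {c : α → ℝ} (hc : ∀ i ∈ s, 0 ≤ c i) :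
    √(∑ i ∈ s, c i ^ 2) ≤ ∑ i ∈ s, c i :=
  Real.sqrt_le_iff.2 ⟨Finset.sum_nonneg hc, Finset.sum_sq_le_sq_sum_of_nonneg hc⟩

/-! ### From projected square functions to the square function of the kernel. -/

section

variable {S : Type*} [MeasurableSpace S] {μ : Measure S}
  {E : Type*} [NormedAddCommGroup E] [NormedSpace ℝ E] {ι : E →ₗ[ℝ] (S →ₘ[μ] ℝ)}
  {Ω : Type*} [mΩ : MeasurableSpace Ω] {P : Measure Ω} [IsProbabilityMeasure P]
  {T : ℝ} {𝓕 : Filtration (TimeInterval T) mΩ}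
  {H : Type*} [NormedAddCommGroup H] [InnerProductSpace ℝ H] [CompleteSpace H]
  [TopologicalSpace.SeparableSpace H]
  {W : TimeInterval T → H →L[ℝ] Lp ℝ 2 P}
  {Φ : TimeInterval T → H →L[ℝ] E} {ζ : Ω → C(TimeInterval T, E)}
  {Ψ : ℕ → ElementaryAdapted 𝓕 H E} {Z : ℕ → Ω → C(TimeInterval T, E)}
  {φ : TimeInterval T × S → H} {κ : Type*}

namespace ApproximatesIntegral

/-- A quantile of the norm of a stochastic integral controls the square functions of the averages
of its coordinates over a partition. -/
lemma exists_sum_gridEnergy_le [SigmaFinite μ] [CompleteSpace E] (hι : IsFunctionSpace μ ι)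
    {δ : ℝ} (hδ : 0 < δ)
    (hδv : ∀ v : ℝ≥0, v ≠ 0 → (gaussianReal 0 v).real {z | |z| < δ * √v} ≤ 1 / 4)
    (h : ApproximatesIntegral W Φ ζ Ψ Z)
    (hW : IsCylindricalBrownianMotion P 𝓕 W) (hT : 0 < T)
    (hΦ : ∀ h : H, AEStronglyMeasurable (fun t => Φ t h) (timeMeasure T))
    (hφ : StronglyMeasurable φ)
    (hΦφ : ∀ h : H, ∀ᵐ t ∂timeMeasure T, ∀ᵐ s ∂μ, ι (Φ t h) s = inner ℝ (φ (t, s)) h)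
    (hζ : AEStronglyMeasurable ζ P) {b : κ → H} (hb : Orthonormal ℝ b) (F : Finset κ)
    {A : Set (TimeInterval T)} (hA : MeasurableSet A)
    (hAi : ∀ k ∈ F, IntegrableOn (fun t => Φ t (b k)) A (timeMeasure T)) {r : ℝ} (hr : 0 < r)
    (hP : P.real {ω | r < ‖ζ ω ⟨T, hT.le, le_rfl⟩‖} ≤ 1 / 16) (n : ℕ) :
    ∃ g : E, ‖g‖ ≤ 16 / (3 * δ) * r ∧ ∀ᵐ s ∂μ, ∑ k ∈ F, gridEnergy hT.le n
      (A.indicator fun t => inner ℝ (φ (t, s)) (b k)) ≤ ι g s ^ 2 := by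
  classical
  -- The cells are cut down to `A`, where the coordinates of `Φ` are integrable. The indicator of `B
  -- p` times the corresponding basis vector gives an orthogonal family whose squared norms are the
  -- measures of the cut cells.
  let B : Fin (n + 1) × F → Set (TimeInterval T) := fun p => gridCell hT.le n p.1 ∩ A
  have hB : ∀ p, MeasurableSet (B p) := fun p => (measurableSet_gridCell hT.le n p.1).inter hA
  let w : Fin (n + 1) × F → ℝ := fun p => (timeMeasure T).real (B p)
  let x : Fin (n + 1) × F → E := fun p => ∫ t in B p, Φ t (b p.2) ∂timeMeasure T
  have hBi : ∀ p : Fin (n + 1) × F, IntegrableOn (fun t => Φ t (b p.2)) (B p) (timeMeasure T) :=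
    fun p => (hAi p.2 p.2.2).mono_set Set.inter_subset_right
  have hw : ∀ p q : Fin (n + 1) × F, ∫ t, inner ℝ ((B p).indicator (fun _ => (1 : ℝ)) t • b p.2)
      ((B q).indicator (fun _ => (1 : ℝ)) t • b q.2) ∂timeMeasure T =
        if p = q then w p else 0 := by
    intro p q
    split_ifs with hpq
    · subst hpq
      rw [integral_congr_ae (g := (B p).indicator fun _ => (1 : ℝ)) (ae_of_all _ fun t => ?_),
        integral_indicator_const _ (hB p), smul_eq_mul, mul_one]
      simp only [inner_smul_left, inner_smul_right, conj_trivial, real_inner_self_eq_norm_sq,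
        hb.1]
      by_cases ht : t ∈ B p
      · simp [Set.indicator_of_mem ht]
      · simp [Set.indicator_of_notMem ht]
    · refine integral_eq_zero_of_ae (ae_of_all _ fun t => ?_)
      simp only [inner_smul_left, inner_smul_right, conj_trivial, Pi.zero_apply]
      by_cases h2 : (p.2 : κ) = q.2
      · have h1 : (p.1 : ℕ) ≠ q.1 := fun h1 => hpq (Prod.ext (Fin.ext h1) (Subtype.ext h2))
        by_cases ht : t ∈ B p
        · rw [Set.indicator_of_notMem (s := B q) fun h' => Set.disjoint_left.1
            (pairwise_disjoint_gridCell hT.le n h1) ht.1 h'.1]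
          simp
        · rw [Set.indicator_of_notMem ht]
          simp
      · rw [hb.2 h2]
        simp
  have hx : ∀ (p : Fin (n + 1) × F) (x' : E →L[ℝ] ℝ), x' (x p) = ∫ t, inner ℝ (dualKernel Φ x' t)
      ((B p).indicator (fun _ => (1 : ℝ)) t • b p.2) ∂timeMeasure T := by
    intro p x'
    rw [← ContinuousLinearMap.integral_comp_comm x' (hBi p), ← integral_indicator (hB p)]
    refine integral_congr_ae (ae_of_all _ fun t => ?_)
    simp only [inner_smul_right, inner_dualKernel]
    by_cases ht : t ∈ B p
    · rw [Set.indicator_of_mem ht, Set.indicator_of_mem ht, one_mul]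
    · rw [Set.indicator_of_notMem ht, Set.indicator_of_notMem ht, zero_mul]
  have hw0 : ∀ p, 0 ≤ w p := fun p => measureReal_nonneg
  have hsum0 : ∀ s, 0 ≤ ∑ p, (w p)⁻¹ * ι (x p) s ^ 2 := fun s =>
    Finset.sum_nonneg fun p _ => mul_nonneg (inv_nonneg.2 (hw0 p)) (sq_nonneg _)
  obtain ⟨g, hg, -⟩ := hι.exists_of_abs_le_sum Finset.univ (c := fun p => √(w p)⁻¹) (y := x)
    (fun p _ => Real.sqrt_nonneg _) (f := fun s => √(∑ p, (w p)⁻¹ * ι (x p) s ^ 2))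
    (Real.continuous_sqrt.comp_aestronglyMeasurable
      (Finset.aestronglyMeasurable_fun_sum _ fun p _ =>
        ((IsFunctionSpace.aestronglyMeasurable_coe ι (x p)).pow 2).const_mul _))
    (ae_of_all _ fun s => by
      have e : ∀ p, (w p)⁻¹ * ι (x p) s ^ 2 = (√(w p)⁻¹ * |ι (x p) s|) ^ 2 := fun p => by
        rw [mul_pow, Real.sq_sqrt (inv_nonneg.2 (hw0 p)), sq_abs]
      rw [abs_of_nonneg (Real.sqrt_nonneg _)]
      simp only [e]
      exact sqrt_sum_sq_le_sum _ fun p _ => by positivity)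
  have hg2 : ∀ᵐ s ∂μ, ι g s ^ 2 = ∑ p, (w p)⁻¹ * ι (x p) s ^ 2 := by
    filter_upwards [hg] with s hs
    rw [hs, Real.sq_sqrt (hsum0 s)]
  refine ⟨g, h.norm_le_of_projection hι hδ hδv hW hT hΦ hζ hB hw0 hw hx hg2 hr hP, ?_⟩
  have hxs : ∀ p : Fin (n + 1) × F, ∀ᵐ s ∂μ, ι (x p) s =
      ∫ t in B p, inner ℝ (φ (t, s)) (b p.2) ∂timeMeasure T := fun p =>
    (hι.coe_integral (hBi p) (f := fun q => inner ℝ (φ q) (b p.2))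
      (hφ.inner stronglyMeasurable_const)
      (ae_restrict_of_ae (hΦφ (b p.2)))).mono fun s hs => hs.2
  filter_upwards [hg2, ae_all_iff.2 hxs] with s h1 h2
  rw [h1, Fintype.sum_prod_type_right, ← Finset.sum_coe_sort F]
  refine Finset.sum_le_sum fun k _ => ?_
  rw [gridEnergy, ← Fin.sum_univ_eq_sum_range (fun i => ((n : ℝ) + 1) / T * (∫ r in
    gridCell hT.le n i, A.indicator (fun t => inner ℝ (φ (t, s)) (b k)) r ∂timeMeasure T) ^ 2)]
  refine Finset.sum_le_sum fun i _ => ?_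
  rw [setIntegral_indicator hA, h2]
  -- A cut cell of measure zero contributes nothing to either side. Otherwise its measure is at most
  -- the mesh `T / (n + 1)`, so its inverse is at least `(n + 1) / T`.
  rcases (hw0 (i, k)).eq_or_lt with h0 | h0
  · have h3 : timeMeasure T (gridCell hT.le n i ∩ A) = 0 :=
      (measureReal_eq_zero_iff (measure_ne_top _ _)).1 h0.symm
    rw [setIntegral_measure_zero _ h3]
    simp [← h0]
  · refine mul_le_mul_of_nonneg_right ?_ (sq_nonneg _)
    rw [← inv_div]
    refine inv_anti₀ h0 ?_
    rw [← measureReal_gridCell hT.le i.2]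
    exact measureReal_mono Set.inter_subset_left

/-- Refining the partition: Fatou's lemma in time bounds each coordinate by the lower limit of its
energies, and Fatou's lemma in `E` keeps the norm bound. Integrability on `A` at almost every `s` is
all that the differentiation of averages needs. -/
lemma extNorm_sum_lintegral_le [SigmaFinite μ] [CompleteSpace E] (hι : IsFunctionSpace μ ι)
    {Q : ℕ} {C : ℝ} (hQ : HasLowerEstimate ι Q C) {δ : ℝ} (hδ : 0 < δ)
    (hδv : ∀ v : ℝ≥0, v ≠ 0 → (gaussianReal 0 v).real {z | |z| < δ * √v} ≤ 1 / 4)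
    (h : ApproximatesIntegral W Φ ζ Ψ Z)
    (hW : IsCylindricalBrownianMotion P 𝓕 W) (hT : 0 < T)
    (hΦ : ∀ h : H, AEStronglyMeasurable (fun t => Φ t h) (timeMeasure T))
    (hφ : StronglyMeasurable φ)
    (hΦφ : ∀ h : H, ∀ᵐ t ∂timeMeasure T, ∀ᵐ s ∂μ, ι (Φ t h) s = inner ℝ (φ (t, s)) h)
    (hζ : AEStronglyMeasurable ζ P) {b : κ → H} (hb : Orthonormal ℝ b) (F : Finset κ)
    {A : Set (TimeInterval T)} (hA : MeasurableSet A)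
    (hAi : ∀ k ∈ F, IntegrableOn (fun t => Φ t (b k)) A (timeMeasure T)) {r : ℝ} (hr : 0 < r)
    (hP : P.real {ω | r < ‖ζ ω ⟨T, hT.le, le_rfl⟩‖} ≤ 1 / 16) :
    extNorm ι (fun s => (∑ k ∈ F, ∫⁻ t in A, ‖(inner ℝ (φ (t, s)) (b k) : ℝ)‖ₑ ^ 2
      ∂timeMeasure T) ^ (1 / 2 : ℝ)) ≤ ENNReal.ofReal (16 / (3 * δ) * r) := by
  choose g hg1 hg2 using h.exists_sum_gridEnergy_le hι hδ hδv hW hT hΦ hφ hΦφ hζ hb F hA hAi hr hP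
  have hm : ∀ k, Measurable fun s => ∫⁻ t in A, ‖(inner ℝ (φ (t, s)) (b k) : ℝ)‖ₑ ^ 2
      ∂timeMeasure T := fun k => by
    have h1 : StronglyMeasurable fun p : TimeInterval T × S => (inner ℝ (φ p) (b k) : ℝ) :=
      hφ.inner stronglyMeasurable_const
    exact Measurable.lintegral_prod_left' (f := fun p : TimeInterval T × S =>
      ‖(inner ℝ (φ p) (b k) : ℝ)‖ₑ ^ 2) (h1.measurable.enorm.pow_const 2)
  refine hι.extNorm_le_of_le_liminf hQ (G := g) (fun n => ?_)
    ((Finset.measurable_fun_sum F fun k _ => hm k).pow_const _).aemeasurable ?_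
  · rw [← ofReal_norm]
    exact ENNReal.ofReal_le_ofReal (hg1 n)
  have hint : ∀ᵐ s ∂μ, ∀ k ∈ F, Integrable (A.indicator fun t => inner ℝ (φ (t, s)) (b k))
      (timeMeasure T) :=
    (F.finite_toSet.eventually_all (l := ae μ)).2 fun k hk =>
      (hι.coe_integral (hAi k hk) (f := fun q => inner ℝ (φ q) (b k))
        (hφ.inner stronglyMeasurable_const) (ae_restrict_of_ae (hΦφ (b k)))).mono fun s hs =>
          (integrable_indicator_iff hA).2 hs.1
  filter_upwards [hint, ae_all_iff.2 hg2] with s h1 h2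
  have h3 : ∀ k ∈ F, ∫⁻ t in A, ‖(inner ℝ (φ (t, s)) (b k) : ℝ)‖ₑ ^ 2 ∂timeMeasure T ≤
      liminf (fun n => ENNReal.ofReal (gridEnergy hT.le n
        (A.indicator fun t => inner ℝ (φ (t, s)) (b k)))) atTop := by
    intro k hk
    refine le_trans (le_of_eq ?_) (lintegral_enorm_sq_le_liminf hT (h1 k hk))
    rw [← lintegral_indicator hA]
    refine lintegral_congr fun t => ?_
    by_cases ht : t ∈ A
    · rw [Set.indicator_of_mem ht, Set.indicator_of_mem ht]
    · rw [Set.indicator_of_notMem ht, Set.indicator_of_notMem ht]; simp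
  have h4 := (Finset.sum_le_sum h3).trans (sum_liminf_le F _)
  have h5 : liminf (fun n => ∑ k ∈ F, ENNReal.ofReal (gridEnergy hT.le n
      (A.indicator fun t => inner ℝ (φ (t, s)) (b k)))) atTop ≤
      liminf (fun n => ‖ι (g n) s‖ₑ ^ (2 : ℝ)) atTop := by
    refine liminf_le_liminf (Eventually.of_forall fun n => ?_)
    rw [← ENNReal.ofReal_sum_of_nonneg fun k _ => gridEnergy_nonneg _ _ _, ENNReal.rpow_ofNat,
      ← ofReal_norm, ← ENNReal.ofReal_pow (norm_nonneg _), Real.norm_eq_abs, sq_abs]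
    exact ENNReal.ofReal_le_ofReal (h2 n)
  -- Squaring is an order isomorphism of `[0, ∞]` and therefore commutes with lower limits.
  have h6 := (ENNReal.orderIsoRpow 2 zero_lt_two).liminf_apply
    (u := fun n => ‖ι (g n) s‖ₑ) (f := atTop)
  simp only [ENNReal.orderIsoRpow_apply] at h6
  rw [one_div, ENNReal.rpow_inv_le_iff zero_lt_two, h6]
  exact h4.trans h5

/-- A quantile of the norm of a stochastic integral controls the square function of the kernel. -/
theorem extNorm_squareFunction_le [SigmaFinite μ] [CompleteSpace E] (hι : IsFunctionSpace μ ι)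
    {Q : ℕ} {C : ℝ} (hQ : HasLowerEstimate ι Q C) {δ : ℝ} (hδ : 0 < δ)
    (hδv : ∀ v : ℝ≥0, v ≠ 0 → (gaussianReal 0 v).real {z | |z| < δ * √v} ≤ 1 / 4)
    (h : ApproximatesIntegral W Φ ζ Ψ Z)
    (hW : IsCylindricalBrownianMotion P 𝓕 W) (hT : 0 < T)
    (hΦ : ∀ h : H, AEStronglyMeasurable (fun t => Φ t h) (timeMeasure T))
    (hφ : StronglyMeasurable φ)
    (hΦφ : ∀ h : H, ∀ᵐ t ∂timeMeasure T, ∀ᵐ s ∂μ, ι (Φ t h) s = inner ℝ (φ (t, s)) h)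
    (hζ : AEStronglyMeasurable ζ P) {r : ℝ} (hr : 0 < r)
    (hP : P.real {ω | r < ‖ζ ω ⟨T, hT.le, le_rfl⟩‖} ≤ 1 / 16) :
    extNorm ι (squareFunction φ) ≤ ENNReal.ofReal (16 / (3 * δ) * r) := by
  obtain ⟨w, b, -⟩ := exists_hilbertBasis ℝ H
  have : Countable w := countable_of_orthonormal b.orthonormal
  obtain ⟨F, hF⟩ := exists_seq_tendsto (atTop : Filter (Finset w))
  -- The times at which the coordinates used so far are bounded by `K`. The basis vectors being unit
  -- vectors, almost every `t` belongs to `A K` once `K ≥ ‖Φ t‖`, however many coordinates `F K`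
  -- contains.
  let A : ℕ → Set (TimeInterval T) := fun K => ⋂ k ∈ F K, {t | ‖(hΦ (b k)).mk _ t‖ ≤ K}
  have hA : ∀ K, MeasurableSet (A K) := fun K => (F K).measurableSet_biInter fun k _ =>
    measurableSet_le (hΦ (b k)).stronglyMeasurable_mk.norm.measurable measurable_const
  have hAi : ∀ K, ∀ k ∈ F K, IntegrableOn (fun t => Φ t (b k)) (A K) (timeMeasure T) := by
    intro K k hk
    refine Integrable.mono' (integrable_const (K : ℝ)) (hΦ (b k)).restrict ?_
    rw [ae_restrict_iff' (hA K)]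
    filter_upwards [(hΦ (b k)).ae_eq_mk] with t ht htA
    rw [ht]
    exact Set.mem_iInter₂.1 htA k hk
  have hAt : ∀ᵐ t ∂timeMeasure T, ∀ᶠ K in atTop, t ∈ A K := by
    filter_upwards [ae_all_iff.2 fun k => (hΦ (b k)).ae_eq_mk] with t ht
    filter_upwards [eventually_ge_atTop ⌈‖Φ t‖⌉₊] with K hK
    refine Set.mem_iInter₂.2 fun k _ => ?_
    show ‖(hΦ (b k)).mk _ t‖ ≤ K
    rw [← ht k]
    calc ‖Φ t (b k)‖ ≤ ‖Φ t‖ * ‖b k‖ := (Φ t).le_opNorm _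
      _ = ‖Φ t‖ := by rw [b.orthonormal.1, mul_one]
      _ ≤ K := (Nat.le_ceil _).trans (by exact_mod_cast hK)
  let f : ℕ → S → ℝ≥0∞ := fun K s => (∑ k ∈ F K, ∫⁻ t in A K,
    ‖(inner ℝ (φ (t, s)) (b k) : ℝ)‖ₑ ^ 2 ∂timeMeasure T) ^ (1 / 2 : ℝ)
  have hf : ∀ K, extNorm ι (f K) ≤ ENNReal.ofReal (16 / (3 * δ) * r) := fun K =>
    h.extNorm_sum_lintegral_le hι hQ hδ hδv hW hT hΦ hφ hΦφ hζ b.orthonormal (F K) (hA K) (hAi K)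
      hr hP
  choose G hG using fun K => IsFunctionSpace.exists_of_extNorm_lt_top
    ((hf K).trans_lt ENNReal.ofReal_lt_top)
  refine hι.extNorm_le_of_le_liminf hQ (G := G) (fun K => ?_) ?_ ?_
  · rw [← hι.extNorm_eq (hG K)]
    exact hf K
  · exact ((Measurable.lintegral_prod_left' (f := fun p : TimeInterval T × S => ‖φ p‖ₑ ^ 2)
      (hφ.enorm.pow_const 2)).pow_const _).aemeasurable
  filter_upwards [ae_all_iff.2 hG] with s hs
  simp only [← hs]
  have h1 : ∀ t, (∀ᶠ K in atTop, t ∈ A K) → Tendsto (fun K => (A K).indicator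
      (fun t => ∑ k ∈ F K, ‖(inner ℝ (φ (t, s)) (b k) : ℝ)‖ₑ ^ 2) t) atTop
      (𝓝 (‖φ (t, s)‖ₑ ^ 2)) := by
    intro t ht
    have h2 : HasSum (fun k => ‖inner ℝ (φ (t, s)) (b k)‖ ^ 2) (‖φ (t, s)‖ ^ 2) := by
      have := b.hasSum_inner_mul_inner (φ (t, s)) (φ (t, s))
      rw [real_inner_self_eq_norm_sq] at this
      refine this.congr_fun fun k => ?_
      rw [real_inner_comm (φ (t, s)) (b k), Real.norm_eq_abs, sq_abs, sq]
    have h3 : Tendsto (fun K => ENNReal.ofReal (∑ k ∈ F K, ‖inner ℝ (φ (t, s)) (b k)‖ ^ 2)) atTop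
        (𝓝 (ENNReal.ofReal (‖φ (t, s)‖ ^ 2))) := ENNReal.tendsto_ofReal (h2.comp hF)
    rw [ENNReal.ofReal_pow (norm_nonneg _), ofReal_norm] at h3
    refine h3.congr' ?_
    filter_upwards [ht] with K hK
    rw [Set.indicator_of_mem hK, ENNReal.ofReal_sum_of_nonneg fun k _ => by positivity]
    refine Finset.sum_congr rfl fun k _ => ?_
    rw [ENNReal.ofReal_pow (norm_nonneg _), ofReal_norm]
  have hmk : ∀ k, Measurable fun t => ‖(inner ℝ (φ (t, s)) (b k) : ℝ)‖ₑ ^ 2 := fun k =>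
    (((hφ.comp_measurable measurable_prodMk_right).inner
      stronglyMeasurable_const).enorm.pow_const 2)
  have h4 : ∫⁻ t, ‖φ (t, s)‖ₑ ^ 2 ∂timeMeasure T ≤ liminf (fun K => (f K s) ^ (2 : ℝ)) atTop := by
    calc ∫⁻ t, ‖φ (t, s)‖ₑ ^ 2 ∂timeMeasure T
        ≤ ∫⁻ t, liminf (fun K => (A K).indicator
          (fun t => ∑ k ∈ F K, ‖(inner ℝ (φ (t, s)) (b k) : ℝ)‖ₑ ^ 2) t) atTop ∂timeMeasure T := by
          refine lintegral_mono_ae ?_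
          filter_upwards [hAt] with t ht
          exact (h1 t ht).liminf_eq.ge
      _ ≤ liminf (fun K => ∫⁻ t, (A K).indicator
          (fun t => ∑ k ∈ F K, ‖(inner ℝ (φ (t, s)) (b k) : ℝ)‖ₑ ^ 2) t ∂timeMeasure T) atTop :=
          lintegral_liminf_le fun K =>
            (Finset.measurable_fun_sum _ fun k _ => hmk k).indicator (hA K)
      _ = liminf (fun K => (f K s) ^ (2 : ℝ)) atTop := by
          congr 1
          funext K
          rw [lintegral_indicator (hA K), lintegral_finsetSum _ fun k _ => hmk k, ← ENNReal.rpow_mul]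
          norm_num
  have h6 := (ENNReal.orderIsoRpow 2 zero_lt_two).liminf_apply
    (u := fun n => f n s) (f := atTop)
  simp only [ENNReal.orderIsoRpow_apply] at h6
  rw [squareFunction, one_div, ENNReal.rpow_inv_le_iff zero_lt_two, h6]
  exact h4

end ApproximatesIntegral

end

/-! ### Quantiles of the norm of a random vector. -/

section

variable {Ω : Type*} [MeasurableSpace Ω] {P : Measure Ω} [IsProbabilityMeasure P]
  {V : Type*} [NormedAddCommGroup V] {X : Ω → V}

lemma exists_measureReal_lt_norm_le (hX : AEStronglyMeasurable X P) {ε : ℝ} (hε : 0 < ε) :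
    ∃ r : ℝ, 0 < r ∧ P.real {ω | r < ‖X ω‖} ≤ ε := by
  have h1 : Tendsto (fun n : ℕ => P {ω | (n : ℝ) < ‖X ω‖}) atTop
      (𝓝 (P (⋂ n : ℕ, {ω | (n : ℝ) < ‖X ω‖}))) :=
    tendsto_measure_iInter_atTop
      (fun n => nullMeasurableSet_lt aemeasurable_const hX.norm.aemeasurable)
      (fun m n hmn ω hω => lt_of_le_of_lt (Nat.cast_le.2 hmn) (show (n : ℝ) < ‖X ω‖ from hω))
      ⟨0, measure_ne_top _ _⟩
  have h2 : (⋂ n : ℕ, {ω | (n : ℝ) < ‖X ω‖}) = ∅ := by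
    refine Set.eq_empty_of_forall_notMem fun ω hω => ?_
    obtain ⟨n, hn⟩ := exists_nat_ge ‖X ω‖
    have h3 : (n : ℝ) < ‖X ω‖ := Set.mem_iInter.1 hω n
    exact absurd hn (not_le.2 h3)
  rw [h2, measure_empty] at h1
  obtain ⟨n, hn, hn1⟩ := ((h1.eventually (gt_mem_nhds (ENNReal.ofReal_pos.2 hε))).and
    (eventually_ge_atTop 1)).exists
  exact ⟨n, by exact_mod_cast hn1, ENNReal.toReal_le_of_le_ofReal hε.le hn.le⟩

lemma measureReal_lt_norm_le_of_lintegral_sq (hX : AEStronglyMeasurable X P) {m r : ℝ} (hr : 0 < r)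
    (hm : ∫⁻ ω, ‖X ω‖ₑ ^ 2 ∂P ≤ ENNReal.ofReal (m ^ 2)) (hmr : 16 * m ^ 2 ≤ r ^ 2) :
    P.real {ω | r < ‖X ω‖} ≤ 1 / 16 := by
  have h1 : ENNReal.ofReal (r ^ 2) * P {ω | r < ‖X ω‖} ≤ ENNReal.ofReal (m ^ 2) := by
    refine le_trans ?_ ((mul_meas_ge_le_lintegral₀ (hX.enorm.pow_const 2) (ENNReal.ofReal (r ^ 2))).trans hm)
    refine mul_le_mul_right (measure_mono fun ω hω => ?_) _
    have h2 : r < ‖X ω‖ := hω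
    show ENNReal.ofReal (r ^ 2) ≤ ‖X ω‖ₑ ^ 2
    rw [ENNReal.ofReal_pow hr.le, ← ofReal_norm]
    exact pow_le_pow_left₀ zero_le (ENNReal.ofReal_le_ofReal h2.le) 2
  rw [← ofReal_measureReal, ← ENNReal.ofReal_mul (by positivity),
    ENNReal.ofReal_le_ofReal_iff (by positivity)] at h1
  have h3 : 0 < r ^ 2 := by positivity
  have h4 : r ^ 2 * P.real {ω | r < ‖X ω‖} ≤ r ^ 2 * (1 / 16) := by linarith
  exact le_of_mul_le_mul_left h4 h3

end

/-! ### Integrability criterion and two-sided estimate. -/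

section

variable {S : Type*} [MeasurableSpace S] {μ : Measure S} [SigmaFinite μ]
  {E : Type*} [NormedAddCommGroup E] [NormedSpace ℝ E] [CompleteSpace E]
  {ι : E →ₗ[ℝ] (S →ₘ[μ] ℝ)}
  {Ω : Type*} [mΩ : MeasurableSpace Ω] {P : Measure Ω} [IsProbabilityMeasure P]
  {T : ℝ} {𝓕 : Filtration (TimeInterval T) mΩ}
  {H : Type*} [NormedAddCommGroup H] [InnerProductSpace ℝ H] [CompleteSpace H]
  [TopologicalSpace.SeparableSpace H]
  {W : TimeInterval T → H →L[ℝ] Lp ℝ 2 P} {Φ : TimeInterval T → H →L[ℝ] E}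
  {ζ : Ω → C(TimeInterval T, E)} {φ : TimeInterval T × S → H}

/-- No moment of the integral is known to be finite here, but every random variable stays below some
level with probability at least `15 / 16`, and the lower bound asks for nothing more. -/
lemma IsStochasticIntegral.extNorm_squareFunction_lt_top (hι : IsFunctionSpace μ ι)
    {Q : ℕ} {C : ℝ} (hQ : HasLowerEstimate ι Q C)
    (h : IsStochasticIntegral P 𝓕 W (fun p => Φ p.1) ζ)
    (hW : IsCylindricalBrownianMotion P 𝓕 W) (hT : 0 < T)
    (hΦ : ∀ h : H, AEStronglyMeasurable (fun t => Φ t h) (timeMeasure T))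
    (hφ : StronglyMeasurable φ)
    (hΦφ : ∀ h : H, ∀ᵐ t ∂timeMeasure T, ∀ᵐ s ∂μ, ι (Φ t h) s = inner ℝ (φ (t, s)) h) :
    extNorm ι (squareFunction φ) < ∞ := by
  obtain ⟨hζ, Ψ, Z, h1, h2, h3⟩ := h
  obtain ⟨δ, hδ, hδv⟩ := exists_gaussianReal_smallBall
  obtain ⟨r, hr, hP⟩ := exists_measureReal_lt_norm_le (ε := 1 / 16)
    ((continuous_eval_const (F := C(TimeInterval T, E))
      (⟨T, hT.le, le_rfl⟩ : TimeInterval T)).comp_aestronglyMeasurable hζ) (by norm_num)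
  exact ((ApproximatesIntegral.mk h1 h2 h3).extNorm_squareFunction_le hι hQ hδ hδv hW hT hΦ hφ hΦφ
    hζ hr hP).trans_lt ENNReal.ofReal_lt_top

/-- Chebyshev's inequality allows the radius `4 * m`, with `m` the root mean square of the norm,
whence the constant `64 = 16 * 4`. The added `ε` keeps the radius positive when `m = 0`. -/
lemma IsStochasticIntegral.extNorm_squareFunction_le (hι : IsFunctionSpace μ ι)
    {Q : ℕ} {C : ℝ} (hQ : HasLowerEstimate ι Q C) {δ : ℝ} (hδ : 0 < δ)
    (hδv : ∀ v : ℝ≥0, v ≠ 0 → (gaussianReal 0 v).real {z | |z| < δ * √v} ≤ 1 / 4)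
    (h : IsStochasticIntegral P 𝓕 W (fun p => Φ p.1) ζ)
    (hW : IsCylindricalBrownianMotion P 𝓕 W) (hT : 0 < T)
    (hΦ : ∀ h : H, AEStronglyMeasurable (fun t => Φ t h) (timeMeasure T))
    (hφ : StronglyMeasurable φ)
    (hΦφ : ∀ h : H, ∀ᵐ t ∂timeMeasure T, ∀ᵐ s ∂μ, ι (Φ t h) s = inner ℝ (φ (t, s)) h) :
    extNorm ι (squareFunction φ) ≤ ENNReal.ofReal (64 / (3 * δ)) *
      (∫⁻ ω, ‖ζ ω ⟨T, hT.le, le_rfl⟩‖ₑ ^ 2 ∂P) ^ (1 / 2 : ℝ) := by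
  obtain ⟨hζ, Ψ, Z, h1, h2, h3⟩ := h
  have hc : 0 < 64 / (3 * δ) := by positivity
  rcases eq_or_ne ((∫⁻ ω, ‖ζ ω ⟨T, hT.le, le_rfl⟩‖ₑ ^ 2 ∂P) ^ (1 / 2 : ℝ)) ∞ with hM | hM
  · rw [hM, ENNReal.mul_top (ENNReal.ofReal_pos.2 hc).ne']
    exact le_top
  obtain ⟨m, hm0, hm⟩ : ∃ m : ℝ, 0 ≤ m ∧ (∫⁻ ω, ‖ζ ω ⟨T, hT.le, le_rfl⟩‖ₑ ^ 2 ∂P) ^ (1 / 2 : ℝ) =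
      ENNReal.ofReal m := ⟨_, ENNReal.toReal_nonneg, (ENNReal.ofReal_toReal hM).symm⟩
  have hm2 : ∫⁻ ω, ‖ζ ω ⟨T, hT.le, le_rfl⟩‖ₑ ^ 2 ∂P ≤ ENNReal.ofReal (m ^ 2) := by
    rw [ENNReal.ofReal_pow hm0, ← hm, ← ENNReal.rpow_ofNat, ← ENNReal.rpow_mul]
    norm_num
  rw [hm, ← ENNReal.ofReal_mul hc.le]
  have key : ∀ ε : ℝ, 0 < ε → extNorm ι (squareFunction φ) ≤
      ENNReal.ofReal (16 / (3 * δ) * (4 * m + ε)) := fun ε hε =>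
    (ApproximatesIntegral.mk h1 h2 h3).extNorm_squareFunction_le hι hQ hδ hδv hW hT hΦ hφ hΦφ
      hζ (by positivity) (measureReal_lt_norm_le_of_lintegral_sq
        ((continuous_eval_const (F := C(TimeInterval T, E))
          (⟨T, hT.le, le_rfl⟩ : TimeInterval T)).comp_aestronglyMeasurable hζ) (by positivity) hm2
        (by nlinarith [mul_nonneg hm0 hε.le]))
  have hlim : Tendsto (fun ε : ℝ => ENNReal.ofReal (16 / (3 * δ) * (4 * m + ε))) (𝓝[>] 0)
      (𝓝 (ENNReal.ofReal (16 / (3 * δ) * (4 * m + 0)))) :=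
    (ENNReal.continuous_ofReal.comp (by fun_prop : Continuous fun ε : ℝ =>
      16 / (3 * δ) * (4 * m + ε))).continuousAt.tendsto.mono_left nhdsWithin_le_nhds
  have := ge_of_tendsto hlim (eventually_nhdsWithin_of_forall key)
  rwa [add_zero, show 16 / (3 * δ) * (4 * m) = 64 / (3 * δ) * m by ring] at this

lemma ae_squareFunction_eq_of_ae_eq {φ' : TimeInterval T × S → H}
    (h : φ =ᵐ[(timeMeasure T).prod μ] φ') :
    ∀ᵐ s ∂μ, squareFunction φ s = squareFunction φ' s := by
  have h1 := (Measure.measurePreserving_swap (μ := μ)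
    (ν := timeMeasure T)).quasiMeasurePreserving.ae h
  filter_upwards [Measure.ae_ae_of_ae_prod h1] with s hs
  rw [squareFunction, squareFunction]
  congr 1
  refine lintegral_congr_ae ?_
  filter_upwards [hs] with t ht
  have : φ (t, s) = φ' (t, s) := ht
  rw [this]

end

theorem mainTheorem8
    {S : Type*} [MeasurableSpace S] (μ : Measure S) [SigmaFinite μ]
    {E : Type*} [NormedAddCommGroup E] [NormedSpace ℝ E] [CompleteSpace E]
    (ι : E →ₗ[ℝ] (S →ₘ[μ] ℝ)) (hι : IsFunctionSpace μ ι) (hE : HasFiniteCotype E) :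
    ∃ C : ℝ≥0, 0 < C ∧
      ∀ (T : ℝ) (hT : 0 < T)
        (H : Type*) [NormedAddCommGroup H] [InnerProductSpace ℝ H] [CompleteSpace H]
        [TopologicalSpace.SeparableSpace H]
        (Ω : Type*) [mΩ : MeasurableSpace Ω] (P : Measure Ω) [IsProbabilityMeasure P]
        (𝓕 : Filtration (TimeInterval T) mΩ)
        (W : TimeInterval T → H →L[ℝ] Lp ℝ 2 P) (_ : IsCylindricalBrownianMotion P 𝓕 W)
        (Φ : TimeInterval T → H →L[ℝ] E)
        (_ : ∀ h : H, AEStronglyMeasurable (fun t => Φ t h) (timeMeasure T))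
        (φ : TimeInterval T × S → H)
        (_ : AEStronglyMeasurable φ ((timeMeasure T).prod μ))
        (_ : ∀ (h : H) (t : TimeInterval T),
          ∀ᵐ s ∂μ, (ι (Φ t h)) s = inner ℝ (φ (t, s)) h),
        (IsStochasticallyIntegrable P 𝓕 W (fun p => Φ p.1) ↔
          extNorm ι (squareFunction φ) < ∞) ∧
        ∀ ζ : Ω → C(TimeInterval T, E), IsStochasticIntegral P 𝓕 W (fun p => Φ p.1) ζ →
          (∫⁻ ω, ‖ζ ω ⟨T, hT.le, le_rfl⟩‖ₑ ^ 2 ∂P) ^ (1 / 2 : ℝ)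
              ≤ C * extNorm ι (squareFunction φ) ∧
          extNorm ι (squareFunction φ)
              ≤ C * (∫⁻ ω, ‖ζ ω ⟨T, hT.le, le_rfl⟩‖ₑ ^ 2 ∂P) ^ (1 / 2 : ℝ) := by
  obtain ⟨R, C, hR, hC, hQ⟩ := hι.exists_lowerEstimate hE
  obtain ⟨κ, hκ, hκv⟩ := exists_gaussianReal_tail R hR
  obtain ⟨δ, hδ, hδv⟩ := exists_gaussianReal_smallBall
  have hK : 0 < κ * (2 + 12 * C) := by positivity
  have hc : 0 < 64 / (3 * δ) := by positivity
  -- The constants of the two inequalities are added. Both come from the lower estimate of `E` and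
  -- from real Gaussian variables, and are fixed before `T`, `H` and `W` appear.
  refine ⟨(κ * (2 + 12 * C)).toNNReal + (64 / (3 * δ)).toNNReal,
    add_pos_of_pos_of_nonneg (Real.toNNReal_pos.2 hK) zero_le, ?_⟩
  intro T hT H _ _ _ _ Ω mΩ P _ 𝓕 W hW Φ hΦ φ hφ hΦφ
  -- Passing to a strongly measurable kernel preserves the representation of `Φ` only at almost
  -- every `t`, which is the form in which the preceding results assume it.
  obtain ⟨φ', hφ', hφφ'⟩ := hφ
  have hΦφ' : ∀ h : H, ∀ᵐ t ∂timeMeasure T, ∀ᵐ s ∂μ, ι (Φ t h) s = inner ℝ (φ' (t, s)) h := by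
    intro h
    filter_upwards [Measure.ae_ae_of_ae_prod hφφ'] with t ht
    filter_upwards [ht, hΦφ h t] with s h1 h2
    rw [h2, h1]
  rw [IsFunctionSpace.extNorm_congr (ι := ι) (ae_squareFunction_eq_of_ae_eq hφφ')]
  have hsq : ∀ g : E, (∀ᵐ s ∂μ, squareFunction φ' s = ‖ι g s‖ₑ) →
      ∀ᵐ s ∂μ, ∫⁻ t, ‖φ' (t, s)‖ₑ ^ 2 ∂timeMeasure T = ‖ι g s‖ₑ ^ 2 := fun g hg => by
    filter_upwards [hg] with s hs
    rw [← hs, squareFunction, ← ENNReal.rpow_ofNat, ← ENNReal.rpow_mul]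
    norm_num
  refine ⟨⟨fun ⟨ζ, hζ⟩ => hζ.extNorm_squareFunction_lt_top hι hQ hW hT hΦ hφ' hΦφ',
    fun h => ?_⟩, fun ζ hζ => ⟨?_, ?_⟩⟩
  · obtain ⟨g, hg⟩ := IsFunctionSpace.exists_of_extNorm_lt_top h
    obtain ⟨ζ, hζ, -⟩ := exists_isStochasticIntegral hι hC hQ hR hκ hκv hW hT hΦ hφ' hΦφ' (hsq g hg)
    exact ⟨ζ, hζ⟩
  · obtain ⟨g, hg⟩ := IsFunctionSpace.exists_of_extNorm_lt_top
      (hζ.extNorm_squareFunction_lt_top hι hQ hW hT hΦ hφ' hΦφ')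
    -- The upper bound is available for one constructed integral `ζ₀`; any other integral of `Φ` has
    -- the same second moment at time `T`.
    obtain ⟨ζ₀, ⟨hζ₀, Ψ₀, Z₀, h1, h2, h3⟩, hle⟩ :=
      exists_isStochasticIntegral hι hC hQ hR hκ hκv hW hT hΦ hφ' hΦφ' (hsq g hg)
    obtain ⟨hζm, Ψ, Z, h4, h5, h6⟩ := hζ
    rw [(ApproximatesIntegral.mk h4 h5 h6).lintegral_enorm_sq_eq (.mk h1 h2 h3) hW hT.le hΦ hζm hζ₀,
      hι.extNorm_eq hg, one_div, ENNReal.rpow_inv_le_iff zero_lt_two, ENNReal.rpow_ofNat]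
    refine hle.trans (pow_le_pow_left₀ zero_le (mul_le_mul_left ?_ _) 2)
    rw [ENNReal.coe_add]
    exact le_self_add
  · refine (hζ.extNorm_squareFunction_le hι hQ hδ hδv hW hT hΦ hφ' hΦφ').trans
      (mul_le_mul_left ?_ _)
    rw [ENNReal.coe_add]
    exact le_add_self
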